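/- Let $k$ be a field of characteristic $0$, let $G$ be an affine algebraic group over $k$ with (finitely generated) Hopf algebra of functions $R$, and let $\mathfrak g$ be its Lie algebra, i.e. the Lie algebra of left invariant $k$-derivations of $R$. Let $B$ be a commutative $k$-algebra (concentrated in degree $0$). Let $\mathsf{dgart}(k)$ be the category of local Artinian commutative dg $k$-algebras $(A,\mathfrak m)$ with residue field $k$, i.e. finite dimensional commutative dg algebras in non-positive degrees with an augmentation $A\to k$ whose kernel $\mathfrak m$ is nilpotent (differentials have degree $+1$). For $n\ge 0$ let $\Omega_n=k[t_0,\dots,t_n,dt_0,\dots,dt_n]/(\sum t_i-1,\sum dt_i)$ be the commutative dg algebra of polynomial differential forms on the standard $n$-simplex. For a commutative dg algebra $C$, a $C$-torsor under $G$ is a commutative dg $C$-algebra $x\colon C\to X$ with a coassociative and counital coaction $\mu\colon X\to X\otimes R$ (a morphism of dg algebras with $\mu x=x\otimes 1$) such that $X\otimes_C X\to X\otimes R$, $y\otimes z\mapsto (y\otimes 1)\mu(z)$, is an isomorphism and $x$ is faithfully flat (as a map of rings, forgetting the differentials). The trivial $B$-torsor is $P=B\otimes R$, with the coaction given by the comultiplication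 of $R$. For $A\in\mathsf{dgart}(k)$ let $\mathcal D(A)$ be the following simplicial groupoid. Its objects are the $A\otimes B$-torsors $T$ together with an isomorphism $T\otimes_{A\otimes B}B\cong P$ of $B$-torsors. An $n$-simplex of morphisms $S\to T$ is an isomorphism $\Omega_n\otimes S\cong\Omega_n\otimes T$ of torsors over $\Omega_n\otimes A\otimes B$, compatible with the trivializations over $\Omega_n\otimes B$. Let $F_{triv}\colon\mathsf{dgart}(k)\to\mathsf{sSet}$ be the functor $A\mapsto \mathcal{TN}(\mathcal D(A))$ (base change being made strictly functorial in $A$), where $\mathcal{TN}$ denotes the diagonal of the bisimplicial set obtained by taking the nerve of the groupoid in each simplicial degree. For a dg Lie algebra $\mathfrak h$ over $k$ let $\Sigma_{\mathfrak h}\colon\mathsf{dgart}(k)\to\mathsf{sSet}$ be its nerve, $$\Sigma_{\mathfrak h}(A)_n=\mathrm{MC}(\mathfrak m\otimes\Omega_n\otimes\mathfrak h),\qquad \mathrm{MC}(\mathfrak l)=\{z\in\mathfrak l^1 : dz+\tfrac12[z,z]=0\}.$$ Then the functor $F_{triv}$, which describes the deformations of the trivial $B$-torsor under $G$, is naturally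 equivalent to the nerve $\Sigma_{B\otimes\mathfrak g}$ of the Lie algebra $B\otimes\mathfrak g$ (concentrated in degree $0$): the two functors are connected by a finite chain of natural transformations, in either direction, of functors $\mathsf{dgart}(k)\to\mathsf{sSet}$, each of which is a homotopy equivalence of simplicial sets at every $A$. -/

import Mathlib

open CategoryTheory TensorProduct DirectSum Opposite

universe u

noncomputable section

namespace DG

/-! ### Commutative dg algebras -/

/-- A commutative dg algebra over `k`: a `ℤ`-graded `k`-algebra which is graded commutative,
with a differential of degree `+1` satisfying the graded Leibniz rule. -/
structure CDGA (k : Type u) [Field k] : Type (u + 1) where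
  carrier : Type u
  [ring : Ring carrier]
  [algebra : Algebra k carrier]
  deg : ℤ → Submodule k carrier
  [graded : GradedAlgebra deg]
  d : carrier →ₗ[k] carrier
  d_mem : ∀ (i : ℤ) (x : carrier), x ∈ deg i → d x ∈ deg (i + 1)
  d_d : ∀ x : carrier, d (d x) = 0
  leibniz : ∀ (i : ℤ) (a b : carrier), a ∈ deg i →
    d (a * b) = d a * b + ((-1 : ℤˣ) ^ i) • (a * d b)
  comm : ∀ (i j : ℤ) (a b : carrier), a ∈ deg i → b ∈ deg j →
    a * b = ((-1 : ℤˣ) ^ (i * j)) • (b * a)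

namespace CDGA

variable {k : Type u} [Field k]

instance : CoeSort (CDGA k) (Type u) := ⟨CDGA.carrier⟩

attribute [instance] CDGA.ring CDGA.algebra CDGA.graded

/-- Morphisms of commutative dg algebras. -/
@[ext]
structure Hom (A B : CDGA k) : Type u where
  toAlgHom : A →ₐ[k] B
  map_deg : ∀ (i : ℤ) (x : A), x ∈ A.deg i → toAlgHom x ∈ B.deg i
  map_d : ∀ x : A, toAlgHom (A.d x) = B.d (toAlgHom x)

instance : Category (CDGA k) where
  Hom := Hom
  id A := ⟨AlgHom.id k A, fun _ _ h => h, fun _ => rfl⟩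
  comp f g := ⟨g.toAlgHom.comp f.toAlgHom, fun i x h => g.map_deg i _ (f.map_deg i x h),
    fun x => by simp [f.map_d, g.map_d]⟩

/-- The underlying algebra homomorphism of a morphism. -/
abbrev alg {A B : CDGA k} (f : A ⟶ B) : A →ₐ[k] B := Hom.toAlgHom f

@[ext]
theorem hom_ext {A B : CDGA k} {f g : A ⟶ B} (h : ∀ x : A, alg f x = alg g x) : f = g :=
  Hom.ext (AlgHom.ext h)

@[simp] theorem alg_id (A : CDGA k) (x : A) : alg (𝟙 A) x = x := rfl

@[simp] theorem alg_comp {A B C : CDGA k} (f : A ⟶ B) (g : B ⟶ C) (x : A) :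
    alg (f ≫ g) x = alg g (alg f x) := rfl

/-- An additive statement holds for all elements if it holds for homogeneous ones. -/
theorem hom_induction (A : CDGA k) {p : A → Prop} (zero : p 0)
    (add : ∀ x y, p x → p y → p (x + y)) (mem : ∀ (i : ℤ) (x : A), x ∈ A.deg i → p x) (x : A) :
    p x :=
  Decomposition.inductionOn A.deg zero (fun {i} m => mem i m m.2) add x

/-- The sign involution `c ↦ (-1)^{|c|} c` of a graded module. -/
def signMap {M : Type u} [AddCommGroup M] [Module k M] (deg : ℤ → Submodule k M)
    [Decomposition deg] : M →ₗ[k] M :=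
  DirectSum.toModule k ℤ M (fun i => ((((-1 : ℤˣ) ^ i : ℤˣ) : ℤ) : k) • (deg i).subtype) ∘ₗ
    (decomposeLinearEquiv deg).toLinearMap

theorem signMap_apply {M : Type u} [AddCommGroup M] [Module k M] (deg : ℤ → Submodule k M)
    [Decomposition deg] {i : ℤ} {x : M} (hx : x ∈ deg i) :
    signMap deg x = ((-1 : ℤˣ) ^ i) • x := by
  simp only [signMap, LinearMap.comp_apply, LinearEquiv.coe_coe, decomposeLinearEquiv_apply,
    decompose_of_mem deg hx]
  rw [← DirectSum.lof_eq_of k, DirectSum.toModule_lof]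
  simp [Units.smul_def, Int.cast_smul_eq_zsmul]

/-! ### Algebras concentrated in degree zero -/

/-- The grading of a module concentrated in degree zero. -/
def degZero {M : Type u} [AddCommGroup M] [Module k M] (i : ℤ) : Submodule k M :=
  if i = 0 then ⊤ else ⊥

theorem mem_degZero {M : Type u} [AddCommGroup M] [Module k M] (i : ℤ) (x : M) :
    x ∈ (degZero i : Submodule k M) ↔ (i = 0 ∨ x = 0) := by
  unfold degZero; split_ifs with h <;> simp [h]

instance {M : Type u} [AddCommGroup M] [Module k M] :
    Decomposition (degZero : ℤ → Submodule k M) :=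
  Decomposition.ofLinearMap _
    (DirectSum.lof k ℤ (fun i => ((degZero i : Submodule k M) : Type u)) 0 ∘ₗ
      LinearMap.codRestrict (degZero 0) LinearMap.id (fun x => by simp [mem_degZero]))
    (by ext x; simp)
    (by
      ext i x
      rcases (mem_degZero i (x : M)).1 x.2 with h | h
      · subst h
        simp only [LinearMap.comp_apply, DirectSum.lof_eq_of, DirectSum.coeLinearMap_of,
          LinearMap.id_apply]
        rfl
      · have : x = 0 := Subtype.ext h
        subst this; simp)

instance {B : Type u} [CommRing B] [Algebra k B] :
    GradedAlgebra (degZero : ℤ → Submodule k B) where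
  one_mem := by simp [mem_degZero]
  mul_mem i j a b ha hb := by
    rw [mem_degZero] at *
    rcases ha with rfl | rfl
    · rcases hb with rfl | rfl <;> simp
    · simp

/-- A commutative `k`-algebra as a dg algebra concentrated in degree zero. -/
abbrev ofComm (B : Type u) [CommRing B] [Algebra k B] : CDGA k where
  carrier := B
  deg := degZero
  d := 0
  d_mem i x _ := by simp
  d_d x := rfl
  leibniz i a b _ := by simp
  comm i j a b ha hb := by
    rw [mem_degZero] at *
    rcases ha with rfl | rfl
    · simp [mul_comm]
    · simp

/-- An algebra homomorphism from `B` to the closed elements of degree zero of `A` is the same as a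
morphism of dg algebras from `B`, concentrated in degree zero, to `A`. -/
def ofCommHom {B : Type u} [CommRing B] [Algebra k B] {A : CDGA k} (f : B →ₐ[k] A)
    (hdeg : ∀ b, f b ∈ A.deg 0) (hd : ∀ b, A.d (f b) = 0) : ofComm B ⟶ A :=
  Hom.mk (A := ofComm B) f
    (fun i x h => by
      rcases (mem_degZero (k := k) (M := B) i x).1 h with h | h
      · subst h; exact hdeg x
      · have h0 : f x = 0 := (congrArg f h).trans (map_zero f)
        exact h0 ▸ zero_mem _)
    (fun x => (map_zero f).trans (hd x).symm)

/-- A morphism of commutative algebras, as a morphism of dg algebras. -/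
def ofCommMap {B C : Type u} [CommRing B] [Algebra k B] [CommRing C] [Algebra k C]
    (f : B →ₐ[k] C) : (ofComm B : CDGA k) ⟶ ofComm C :=
  ofCommHom (A := ofComm C) f (fun _ => (mem_degZero (k := k) (M := C) 0 _).2 (Or.inl rfl))
    (fun _ => rfl)

theorem d_one (A : CDGA k) : A.d 1 = 0 := by
  have := A.leibniz 0 1 1 (SetLike.one_mem_graded A.deg)
  simpa using this

/-- The structure morphism `k ⟶ A`. -/
def unitMap (A : CDGA k) : (ofComm k : CDGA k) ⟶ A :=
  ofCommHom (Algebra.ofId k A) (fun b => SetLike.algebraMap_mem_graded A.deg b)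
    (fun b => by
      change A.d (algebraMap k A b) = 0
      rw [Algebra.algebraMap_eq_smul_one, map_smul, d_one, smul_zero])

theorem unitMap_comp {A B : CDGA k} (f : A ⟶ B) : unitMap A ≫ f = unitMap B :=
  hom_ext fun c => (alg f).commutes c

end CDGA

/-! ### Tensor products -/

namespace CDGA

variable {k : Type u} [Field k]

/-! ### Tensor products -/

theorem sign_congr {x y : ℤ} (c : ℤ) (h : x = y + (c + c)) : (-1 : ℤˣ) ^ x = (-1) ^ y := by
  rw [h, zpow_add, (Even.add_self c).neg_one_zpow, mul_one]

theorem mul_units_smul {R : Type u} [Ring R] (s : ℤˣ) (x y : R) :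
    x * (s • y) = s • (x * y) := by
  rcases Int.units_eq_one_or s with rfl | rfl <;> simp [Units.smul_def]

section tensor

variable (A B : CDGA k)

/-- The underlying space of the tensor product `A ⊗ B`, with the multiplication
`(a ⊗ b) (a' ⊗ b') = (-1)^{|b| |a'|} a a' ⊗ b b'`. -/
abbrev Tens : Type u := A.deg ᵍ⊗[k] B.deg

variable {A B} in
/-- The pure tensor `a ⊗ b`. -/
def tmul (a : A) (b : B) : Tens A B := GradedTensorProduct.tmul k a b

/-- `tmul` as a bilinear map. -/
def tmulₗ : A →ₗ[k] B →ₗ[k] Tens A B :=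
  (TensorProduct.mk k A B).compr₂ (GradedTensorProduct.of k A.deg B.deg).toLinearMap

@[simp] theorem tmulₗ_apply (a : A) (b : B) : tmulₗ A B a b = tmul a b := rfl

theorem tmul_mul_tmul {i j : ℤ} (a a' : A) (b b' : B) (hb : b ∈ B.deg i) (ha : a' ∈ A.deg j) :
    tmul a b * tmul a' b' = ((-1 : ℤˣ) ^ (i * j)) • tmul (a * a') (b * b') :=
  GradedTensorProduct.tmul_coe_mul_coe_tmul A.deg B.deg a ⟨b, hb⟩ ⟨a', ha⟩ b'

/-- Linear maps out of the tensor product. -/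
def tensLift {M : Type u} [AddCommGroup M] [Module k M] (f : A →ₗ[k] B →ₗ[k] M) :
    Tens A B →ₗ[k] M :=
  TensorProduct.lift f ∘ₗ (GradedTensorProduct.of k A.deg B.deg).symm.toLinearMap

@[simp] theorem tensLift_tmul {M : Type u} [AddCommGroup M] [Module k M]
    (f : A →ₗ[k] B →ₗ[k] M) (a : A) (b : B) : tensLift A B f (tmul a b) = f a b := rfl

variable {A B} in
theorem tens_ext {M : Type u} [AddCommGroup M] [Module k M] {f g : Tens A B →ₗ[k] M}
    (h : ∀ a b, f (tmul a b) = g (tmul a b)) : f = g :=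
  GradedTensorProduct.hom_ext _ _ (TensorProduct.ext' h)

/-- Elements of degree `n` of `A ⊗ B`: sums of `a ⊗ b` with `|a| + |b| = n`. -/
def tensDeg (n : ℤ) : Submodule k (Tens A B) :=
  Submodule.span k {z | ∃ (i j : ℤ) (a : A) (b : B),
    a ∈ A.deg i ∧ b ∈ B.deg j ∧ i + j = n ∧ z = tmul a b}

variable {A B} in
theorem tmul_mem {i j n : ℤ} {a : A} {b : B} (ha : a ∈ A.deg i) (hb : b ∈ B.deg j)
    (h : i + j = n) : tmul a b ∈ tensDeg A B n :=
  Submodule.subset_span ⟨i, j, a, b, ha, hb, h, rfl⟩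

variable {A B} in
theorem tens_induction {p : Tens A B → Prop} (zero : p 0) (add : ∀ x y, p x → p y → p (x + y))
    (mem : ∀ (i j : ℤ) (a : A) (b : B), a ∈ A.deg i → b ∈ B.deg j → p (tmul a b))
    (x : Tens A B) : p x := by
  refine TensorProduct.induction_on (motive := p) x zero ?_ add
  intro a b
  change p (tmul a b)
  refine A.hom_induction (p := fun a => p (tmul a b)) ?_ ?_ ?_ a
  · simpa [← tmulₗ_apply] using zero
  · intro x y hx hy; simpa [← tmulₗ_apply] using add _ _ hx hy
  · intro i a ha
    refine B.hom_induction (p := fun b => p (tmul a b)) ?_ ?_ ?_ b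
    · simpa only [← tmulₗ_apply, map_zero] using zero
    · intro x y hx hy; simpa only [← tmulₗ_apply, map_add] using add _ _ hx hy
    · intro j b hb; exact mem i j a b ha hb

variable {A B} in
theorem tensDeg_induction {n : ℤ} {p : Tens A B → Prop} (zero : p 0)
    (add : ∀ x y, p x → p y → p (x + y)) 
    (mem : ∀ (i j : ℤ) (a : A) (b : B), a ∈ A.deg i → b ∈ B.deg j → i + j = n → p (tmul a b))
    (x : Tens A B) (hx : x ∈ tensDeg A B n) : p x := by
  refine Submodule.closure_induction (p := fun x _ => p x) zero (fun x y _ _ => add x y) ?_ hx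
  rintro r z ⟨i, j, a, b, ha, hb, h, rfl⟩
  simpa [← tmulₗ_apply] using mem i j (r • a) b (Submodule.smul_mem _ _ ha) hb h

/-- The decomposition map of `A ⊗ B`. -/
def tensDecomp : Tens A B →ₗ[k] ⨁ n, tensDeg A B n :=
  tensLift A B <|
    LinearMap.compl₁₂
      (DirectSum.toModule k ℤ _ fun i => LinearMap.flip <| DirectSum.toModule k ℤ _ fun j =>
        LinearMap.mk₂ k (fun (b : B.deg j) (a : A.deg i) =>
          DirectSum.lof k ℤ (fun n => tensDeg A B n) (i + j)
            ⟨tmul a b, tmul_mem a.2 b.2 rfl⟩)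
          (fun b b' a => by
            rw [← map_add]; congr 1; apply Subtype.ext; simp [← tmulₗ_apply])
          (fun c b a => by
            rw [← map_smul]; congr 1; apply Subtype.ext; simp [← tmulₗ_apply])
          (fun b a a' => by
            rw [← map_add]; congr 1; apply Subtype.ext; simp [← tmulₗ_apply])
          (fun c b a => by
            rw [← map_smul]; congr 1))
      (decomposeLinearEquiv A.deg).toLinearMap (decomposeLinearEquiv B.deg).toLinearMap

theorem tensDecomp_tmul {i j : ℤ} {a : A} {b : B} (ha : a ∈ A.deg i) (hb : b ∈ B.deg j) :
    tensDecomp A B (tmul a b) =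
      DirectSum.lof k ℤ (fun n => tensDeg A B n) (i + j) ⟨tmul a b, tmul_mem ha hb rfl⟩ := by
  simp only [tensDecomp, tensLift_tmul, LinearMap.compl₁₂_apply, LinearEquiv.coe_coe,
    decomposeLinearEquiv_apply, decompose_of_mem _ ha, decompose_of_mem _ hb]
  rw [← DirectSum.lof_eq_of k, ← DirectSum.lof_eq_of k, DirectSum.toModule_lof,
    LinearMap.flip_apply, DirectSum.toModule_lof]
  rfl

instance : Decomposition (tensDeg A B) :=
  Decomposition.ofLinearMap _ (tensDecomp A B)
    (by
      refine LinearMap.ext fun x => ?_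
      refine tens_induction (p := fun x => (DirectSum.coeLinearMap (tensDeg A B) ∘ₗ tensDecomp A B) x =
        LinearMap.id x) ?_ ?_ ?_ x
      · simp
      · intro x y hx hy; rw [map_add, map_add, hx, hy]
      · intro i j a b ha hb
        rw [LinearMap.comp_apply, tensDecomp_tmul A B ha hb, DirectSum.coeLinearMap_lof]; rfl)
    (by
      ext n x : 2
      obtain ⟨x, hx⟩ := x
      simp only [LinearMap.comp_apply, DirectSum.coeLinearMap_lof, LinearMap.id_apply]
      refine Submodule.closure_induction (p := fun x hx => tensDecomp A B x =
        DirectSum.lof k ℤ (fun n => tensDeg A B n) n ⟨x, hx⟩) ?_ ?_ ?_ hx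
      · rw [map_zero]; exact (map_zero _).symm
      · intro x y hx hy h h'; rw [map_add, h, h', ← map_add]; rfl
      · rintro r z ⟨i, j, a, b, ha, hb, rfl, rfl⟩
        rw [map_smul, tensDecomp_tmul A B ha hb, ← map_smul]; rfl)

instance : GradedAlgebra (tensDeg A B) where
  one_mem := tmul_mem (SetLike.one_mem_graded A.deg) (SetLike.one_mem_graded B.deg) (by simp)
  mul_mem m n x y hx hy := by
    refine tensDeg_induction (p := fun x => x * y ∈ _) ?_ ?_ ?_ x hx
    · rw [zero_mul]; exact zero_mem _
    · intro x x' h h'; rw [add_mul]; exact add_mem h h'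
    · intro i j a b ha hb h
      refine tensDeg_induction (p := fun y => tmul a b * y ∈ _) ?_ ?_ ?_ y hy
      · rw [mul_zero]; exact zero_mem _
      · intro x x' h h'; rw [mul_add]; exact add_mem h h'
      · intro i' j' a' b' ha' hb' h'
        rw [tmul_mul_tmul A B a a' b b' hb ha', Units.smul_def]
        exact zsmul_mem (tmul_mem (SetLike.mul_mem_graded ha ha') (SetLike.mul_mem_graded hb hb')
          (by omega)) _

/-- The differential `d (a ⊗ b) = d a ⊗ b + (-1)^{|a|} a ⊗ d b`. -/
def tensD : Tens A B →ₗ[k] Tens A B :=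
  tensLift A B ((tmulₗ A B).compl₁₂ A.d LinearMap.id +
    (tmulₗ A B).compl₁₂ (signMap A.deg) B.d)

theorem tensD_tmul {i : ℤ} (a : A) (b : B) (ha : a ∈ A.deg i) :
    tensD A B (tmul a b) = tmul (A.d a) b + ((-1 : ℤˣ) ^ i) • tmul a (B.d b) := by
  simp only [tensD, tensLift_tmul, LinearMap.add_apply, LinearMap.compl₁₂_apply,
    signMap_apply A.deg ha, LinearMap.id_apply, tmulₗ_apply]
  congr 1

/-- The tensor product of commutative dg algebras, with the usual signs. -/
abbrev tensor : CDGA k where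
  carrier := Tens A B
  deg := tensDeg A B
  d := tensD A B
  d_mem n x hx := by
    refine tensDeg_induction (p := fun x => tensD A B x ∈ _) ?_ ?_ ?_ x hx
    · simp
    · intro x y hx hy; rw [map_add]; exact add_mem hx hy
    · intro i j a b ha hb h
      rw [tensD_tmul A B a b ha, Units.smul_def]
      exact add_mem (tmul_mem (A.d_mem i a ha) hb (by omega))
        (zsmul_mem (tmul_mem ha (B.d_mem j b hb) (by omega)) _)
  d_d x := by
    refine tens_induction (p := fun x => tensD A B (tensD A B x) = 0) ?_ ?_ ?_ x
    · simp
    · intro x y hx hy; rw [map_add, map_add, hx, hy, add_zero]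
    · intro i j a b ha hb
      rw [tensD_tmul A B a b ha, map_add, Units.smul_def, map_zsmul, tensD_tmul A B a _ ha,
        tensD_tmul A B _ b (A.d_mem i a ha), A.d_d, B.d_d, zpow_add]
      have h1 : tmul (0 : A) b = 0 := by simp [← tmulₗ_apply]
      have h2 : tmul a (0 : B) = 0 := by simp [← tmulₗ_apply]
      rw [h1, h2]
      simp [Units.smul_def]
  leibniz n x y hx := by
    refine tensDeg_induction (p := fun x => tensD A B (x * y) = tensD A B x * y +
      ((-1 : ℤˣ) ^ n) • (x * tensD A B y)) ?_ ?_ ?_ x hx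
    · simp
    · intro x x' h h'
      rw [add_mul, map_add, h, h', map_add, add_mul, add_mul, smul_add]; abel
    · intro i j a b ha hb h
      refine tens_induction (p := fun y => tensD A B (tmul a b * y) = tensD A B (tmul a b) * y +
        ((-1 : ℤˣ) ^ n) • (tmul a b * tensD A B y)) ?_ ?_ ?_ y
      · simp
      · intro x x' h h'
        rw [mul_add, map_add, h, h', map_add, mul_add, mul_add, smul_add]; abel
      · intro i' j' a' b' ha' hb'
        rw [tmul_mul_tmul A B a a' b b' hb ha', tensD_tmul A B a b ha, tensD_tmul A B a' b' ha',
          Units.smul_def, map_zsmul,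
          tensD_tmul A B (a * a') (b * b') (SetLike.mul_mem_graded ha ha'),
          A.leibniz i a a' ha, B.leibniz j b b' hb, add_mul, mul_add, smul_mul_assoc,
          mul_units_smul,
          tmul_mul_tmul A B (A.d a) a' b b' hb ha', 
          tmul_mul_tmul A B a a' (B.d b) b' (B.d_mem j b hb) ha', 
          tmul_mul_tmul A B a (A.d a') b b' hb (A.d_mem i' a' ha'), 
          tmul_mul_tmul A B a a' b (B.d b') hb ha']
        have e1 : ∀ (s : ℤˣ) (x y : A) (b : B), tmul (x + s • y) b = tmul x b + s • tmul y b := by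
          intro s x y b
          simp only [Units.smul_def, ← tmulₗ_apply, map_add, map_zsmul]; rfl
        have e2 : ∀ (s : ℤˣ) (x y : B) (a : A), tmul a (x + s • y) = tmul a x + s • tmul a y := by
          intro s x y b
          simp only [Units.smul_def, ← tmulₗ_apply, map_add, map_zsmul]
        rw [e1, e2, ← Units.smul_def]
        simp only [smul_add, smul_smul, ← h]
        simp only [← zpow_add]
        rw [sign_congr (x := i + (j + 1) * i') (y := j * i' + (i + i')) 0 (by ring),
          sign_congr (x := i + j + j * (i' + 1)) (y := j * i' + i) j (by ring),
          sign_congr (x := i + j + (i' + j * i')) (y := j * i' + (i + i' + j)) 0 (by ring)]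
        abel
  comm m n x y hx hy := by
    refine tensDeg_induction (p := fun x => x * y = _ • (y * x)) ?_ ?_ ?_ x hx
    · simp
    · intro x x' h h'
      rw [add_mul, h, h', mul_add, smul_add]
    · intro i j a b ha hb h
      refine tensDeg_induction (p := fun y => _ * y = _ • (y * _)) ?_ ?_ ?_ y hy
      · simp
      · intro x x' h h'
        rw [mul_add, h, h', add_mul, smul_add]
      · intro i' j' a' b' ha' hb' h'
        rw [tmul_mul_tmul A B a a' b b' hb ha', tmul_mul_tmul A B a' a b' b hb' ha,
          A.comm i i' a a' ha ha', B.comm j j' b b' hb hb']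
        have e : ∀ (s t : ℤˣ) (x : A) (y : B), tmul (s • x) (t • y) = (s * t) • tmul x y := by
          intro s t x y
          simp only [Units.smul_def, ← tmulₗ_apply, map_zsmul, LinearMap.smul_apply, mul_smul]
          exact smul_comm _ _ _
        rw [e, smul_smul, smul_smul, ← h, ← h']
        simp only [← zpow_add]
        rw [sign_congr (x := (i + j) * (i' + j') + j' * i)
          (y := j * i' + (i * i' + j * j')) (i * j') (by ring)]
end tensor

end CDGA

namespace CDGA

variable {k : Type u} [Field k]

section tensorMaps

theorem tmul_mul_tmul_one (A B : CDGA k) (a : A) (b : B) :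
    (tmul a 1 * tmul 1 b : Tens A B) = tmul a b :=
  GradedTensorProduct.tmul_one_mul_one_tmul A.deg B.deg a b

/-- The morphism `A ⟶ A ⊗ B`, `a ↦ a ⊗ 1`. -/
def inl (A B : CDGA k) : A ⟶ tensor A B :=
  Hom.mk (B := tensor A B) (GradedTensorProduct.includeLeft A.deg B.deg)
    (fun i _ h => tmul_mem h (SetLike.one_mem_graded B.deg) (add_zero i))
    (fun x => by
      change tmul (A.d x) 1 = tensD A B (tmul x 1)
      refine A.hom_induction (p := fun x => tmul (A.d x) 1 = tensD A B (tmul x 1)) ?_ ?_ ?_ x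
      · simp [← tmulₗ_apply]
      · intro x y hx hy
        simp only [← tmulₗ_apply, map_add, LinearMap.add_apply] at hx hy ⊢
        rw [hx, hy]
      · intro i a ha
        rw [tensD_tmul A B a 1 ha, d_one]
        simp [← tmulₗ_apply])

/-- The morphism `B ⟶ A ⊗ B`, `b ↦ 1 ⊗ b`. -/
def inr (A B : CDGA k) : B ⟶ tensor A B :=
  Hom.mk (B := tensor A B) (GradedTensorProduct.includeRight A.deg B.deg)
    (fun i _ h => tmul_mem (SetLike.one_mem_graded A.deg) h (zero_add i))
    (fun x => by
      change tmul 1 (B.d x) = tensD A B (tmul 1 x)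
      rw [tensD_tmul A B 1 x (SetLike.one_mem_graded A.deg), d_one]
      simp [← tmulₗ_apply])

@[simp] theorem alg_inl (A B : CDGA k) (a : A) : alg (inl A B) a = (tmul a 1 : Tens A B) := rfl

@[simp] theorem alg_inr (A B : CDGA k) (b : B) : alg (inr A B) b = (tmul 1 b : Tens A B) := rfl

/-- The tensor product is the coproduct of commutative dg algebras: the morphism
`a ⊗ b ↦ f a * g b`. -/
def tlift {A B C : CDGA k} (f : A ⟶ C) (g : B ⟶ C) : tensor A B ⟶ C :=
  Hom.mk (A := tensor A B)
    (GradedTensorProduct.lift A.deg B.deg (alg f) (alg g) (fun i j a b => by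
      rw [mul_comm j i]
      exact C.comm i j _ _ (Hom.map_deg f i _ a.2) (Hom.map_deg g j _ b.2)))
    (fun n x hx => by
      refine tensDeg_induction (p := fun x =>
        GradedTensorProduct.lift A.deg B.deg (alg f) (alg g) _ x ∈ C.deg n) ?_ ?_ ?_ x hx
      · rw [map_zero]; exact zero_mem _
      · intro x y hx hy; rw [map_add]; exact add_mem hx hy
      · intro i j a b ha hb h
        subst h
        exact SetLike.mul_mem_graded (Hom.map_deg f i _ ha) (Hom.map_deg g j _ hb))
    (fun x => by
      refine tens_induction (p := fun x =>
        GradedTensorProduct.lift A.deg B.deg (alg f) (alg g) _ (tensD A B x) =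
          C.d (GradedTensorProduct.lift A.deg B.deg (alg f) (alg g) _ x)) ?_ ?_ ?_ x
      · simp
      · intro x y hx hy; simp only [map_add, hx, hy]
      · intro i j a b ha hb
        rw [tensD_tmul A B a b ha, Units.smul_def, map_add, map_zsmul]
        change alg f (A.d a) * alg g b + _ • (alg f a * alg g (B.d b)) =
          C.d (alg f a * alg g b)
        rw [C.leibniz i _ _ (Hom.map_deg f i _ ha), Hom.map_d f, Hom.map_d g, Units.smul_def])

@[simp] theorem alg_tlift {A B C : CDGA k} (f : A ⟶ C) (g : B ⟶ C) (a : A) (b : B) :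
    alg (tlift f g) (tmul a b : Tens A B) = alg f a * alg g b := rfl

theorem tensor_hom_ext {A B C : CDGA k} {f g : tensor A B ⟶ C}
    (hl : inl A B ≫ f = inl A B ≫ g) (hr : inr A B ≫ f = inr A B ≫ g) : f = g := by
  refine Hom.ext (GradedTensorProduct.algHom_ext A.deg B.deg ?_ ?_)
  · exact congrArg Hom.toAlgHom hl
  · exact congrArg Hom.toAlgHom hr

@[simp]
theorem inl_tlift {A B C : CDGA k} (f : A ⟶ C) (g : B ⟶ C) : inl A B ≫ tlift f g = f := by
  ext x
  rw [alg_comp, alg_inl, alg_tlift, map_one, mul_one]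

@[simp]
theorem inr_tlift {A B C : CDGA k} (f : A ⟶ C) (g : B ⟶ C) : inr A B ≫ tlift f g = g := by
  ext x
  rw [alg_comp, alg_inr, alg_tlift, map_one, one_mul]

@[simp]
theorem inl_tlift_assoc {A B C D : CDGA k} (f : A ⟶ C) (g : B ⟶ C) (h : C ⟶ D) :
    inl A B ≫ tlift f g ≫ h = f ≫ h := by rw [← Category.assoc, inl_tlift]

@[simp]
theorem inr_tlift_assoc {A B C D : CDGA k} (f : A ⟶ C) (g : B ⟶ C) (h : C ⟶ D) :
    inr A B ≫ tlift f g ≫ h = g ≫ h := by rw [← Category.assoc, inr_tlift]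

/-- The tensor product of two morphisms. -/
def tmap {A B A' B' : CDGA k} (f : A ⟶ A') (g : B ⟶ B') : tensor A B ⟶ tensor A' B' :=
  tlift (f ≫ inl A' B') (g ≫ inr A' B')

@[simp] theorem alg_tmap {A B A' B' : CDGA k} (f : A ⟶ A') (g : B ⟶ B') (a : A) (b : B) :
    alg (tmap f g) (tmul a b : Tens A B) = (tmul (alg f a) (alg g b) : Tens A' B') := by
  rw [tmap, alg_tlift, alg_comp, alg_comp, alg_inl, alg_inr]
  exact tmul_mul_tmul_one A' B' _ _

@[simp] theorem inl_tmap {A B A' B' : CDGA k} (f : A ⟶ A') (g : B ⟶ B') :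
    inl A B ≫ tmap f g = f ≫ inl A' B' := inl_tlift _ _

@[simp] theorem inr_tmap {A B A' B' : CDGA k} (f : A ⟶ A') (g : B ⟶ B') :
    inr A B ≫ tmap f g = g ≫ inr A' B' := inr_tlift _ _

@[simp] theorem tmap_id (A B : CDGA k) : tmap (𝟙 A) (𝟙 B) = 𝟙 (tensor A B) :=
  tensor_hom_ext (by rw [inl_tmap, Category.id_comp, Category.comp_id])
    (by rw [inr_tmap, Category.id_comp, Category.comp_id])

theorem tmap_comp {A B A' B' A'' B'' : CDGA k} (f : A ⟶ A') (g : B ⟶ B') (f' : A' ⟶ A'')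
    (g' : B' ⟶ B'') : tmap (f ≫ f') (g ≫ g') = tmap f g ≫ tmap f' g' :=
  tensor_hom_ext
    (by rw [inl_tmap, ← Category.assoc, inl_tmap, Category.assoc, Category.assoc, inl_tmap])
    (by rw [inr_tmap, ← Category.assoc, inr_tmap, Category.assoc, Category.assoc, inr_tmap])

/-- The associativity isomorphism `(A ⊗ B) ⊗ C ⟶ A ⊗ (B ⊗ C)`. -/
def assoc (A B C : CDGA k) : tensor (tensor A B) C ⟶ tensor A (tensor B C) :=
  tlift (tlift (inl _ _) (inl B C ≫ inr _ _)) (inr B C ≫ inr _ _)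

/-- The inverse of the associativity isomorphism. -/
def assocInv (A B C : CDGA k) : tensor A (tensor B C) ⟶ tensor (tensor A B) C :=
  tlift (inl A B ≫ inl _ _) (tlift (inr A B ≫ inl _ _) (inr _ _))

@[simp] theorem alg_assoc {A B C : CDGA k} (a : A) (b : B) (c : C) :
    alg (assoc A B C) (tmul (tmul a b : Tens A B) c : Tens (tensor A B) C) =
      (tmul a (tmul b c : Tens B C) : Tens A (tensor B C)) := by
  rw [assoc, alg_tlift, alg_tlift, alg_comp, alg_comp, alg_inl, alg_inl, alg_inr, alg_inr,
    alg_inr, mul_assoc]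
  have h : (tmul 1 (tmul b 1 : Tens B C) * tmul 1 (tmul 1 c : Tens B C) : Tens A (tensor B C)) =
      tmul 1 (tmul b c : Tens B C) := by
    rw [← tmul_mul_tmul_one B C b c]
    exact (map_mul (alg (inr A (tensor B C))) _ _).symm
  exact (congrArg (tmul a 1 * ·) h).trans (tmul_mul_tmul_one A (tensor B C) a _)

theorem tmap_assoc {A B C A' B' C' : CDGA k} (f : A ⟶ A') (g : B ⟶ B') (h : C ⟶ C') :
    tmap (tmap f g) h ≫ assoc A' B' C' = assoc A B C ≫ tmap f (tmap g h) := by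
  refine tensor_hom_ext (tensor_hom_ext ?_ ?_) ?_ <;> simp [assoc, tmap]

theorem tmap_eq_comp {A B A' B' : CDGA k} (f : A ⟶ A') (g : B ⟶ B') :
    tmap f g = tmap f (𝟙 B) ≫ tmap (𝟙 A') g := by
  rw [← tmap_comp, Category.comp_id, Category.id_comp]

theorem tmap_eq_comp' {A B A' B' : CDGA k} (f : A ⟶ A') (g : B ⟶ B') :
    tmap f g = tmap (𝟙 A) g ≫ tmap f (𝟙 B') := by
  rw [← tmap_comp, Category.comp_id, Category.id_comp]

end tensorMaps

end CDGA

/-! ### Polynomial differential forms on simplices -/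

section forms

variable (k : Type u) [Field k]

/-- The defining relations of `Ω_n = k[t_0, …, t_n, dt_0, …, dt_n] / (∑ t_i - 1, ∑ dt_i)`: the
generators `t_i = ι (inl i)` have degree `0`, the generators `dt_i = ι (inr i)` have degree `1`,
and they commute in the graded sense. (When `2` is invertible, `dt_i * dt_i = 0` follows from
`dt_dt i i`.) -/
inductive FormsRel (n : ℕ) : FreeAlgebra k (Fin (n + 1) ⊕ Fin (n + 1)) →
    FreeAlgebra k (Fin (n + 1) ⊕ Fin (n + 1)) → Prop
  | t_t (i j : Fin (n + 1)) : FormsRel n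
      (FreeAlgebra.ι k (Sum.inl i) * FreeAlgebra.ι k (Sum.inl j))
      (FreeAlgebra.ι k (Sum.inl j) * FreeAlgebra.ι k (Sum.inl i))
  | t_dt (i j : Fin (n + 1)) : FormsRel n
      (FreeAlgebra.ι k (Sum.inl i) * FreeAlgebra.ι k (Sum.inr j))
      (FreeAlgebra.ι k (Sum.inr j) * FreeAlgebra.ι k (Sum.inl i))
  | dt_dt (i j : Fin (n + 1)) : FormsRel n
      (FreeAlgebra.ι k (Sum.inr i) * FreeAlgebra.ι k (Sum.inr j))
      (-(FreeAlgebra.ι k (Sum.inr j) * FreeAlgebra.ι k (Sum.inr i)))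
  | sum_t : FormsRel n (∑ i, FreeAlgebra.ι k (Sum.inl i)) 1
  | sum_dt : FormsRel n (∑ i, FreeAlgebra.ι k (Sum.inr i)) 0

/-- The algebra of polynomial differential forms on the standard `n`-simplex. -/
def Forms (n : ℕ) : Type u := RingQuot (FormsRel k n)

namespace Forms

instance (n : ℕ) : Ring (Forms k n) := inferInstanceAs (Ring (RingQuot (FormsRel k n)))

instance (n : ℕ) : Algebra k (Forms k n) :=
  inferInstanceAs (Algebra k (RingQuot (FormsRel k n)))

/-- The barycentric coordinate `t_i`. -/
def t {n : ℕ} (i : Fin (n + 1)) : Forms k n :=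
  RingQuot.mkAlgHom k (FormsRel k n) (FreeAlgebra.ι k (Sum.inl i))

/-- The differential `dt_i` of the barycentric coordinate `t_i`. -/
def dt {n : ℕ} (i : Fin (n + 1)) : Forms k n :=
  RingQuot.mkAlgHom k (FormsRel k n) (FreeAlgebra.ι k (Sum.inr i))

variable {n : ℕ}

theorem t_t (i j : Fin (n + 1)) : t k i * t k j = t k j * t k i := by
  have := RingQuot.mkAlgHom_rel k (FormsRel.t_t (k := k) i j)
  rwa [map_mul, map_mul] at this

theorem t_dt (i j : Fin (n + 1)) : t k i * dt k j = dt k j * t k i := by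
  have := RingQuot.mkAlgHom_rel k (FormsRel.t_dt (k := k) i j)
  rwa [map_mul, map_mul] at this

theorem dt_dt (i j : Fin (n + 1)) : dt k i * dt k j = -(dt k j * dt k i) := by
  have := RingQuot.mkAlgHom_rel k (FormsRel.dt_dt (k := k) i j)
  rwa [map_mul, map_neg, map_mul] at this

theorem sum_t : ∑ i : Fin (n + 1), t k i = 1 := by
  have := RingQuot.mkAlgHom_rel k (FormsRel.sum_t (k := k) (n := n))
  rwa [map_sum, map_one] at this

theorem sum_dt : ∑ i : Fin (n + 1), dt k i = 0 := by
  have := RingQuot.mkAlgHom_rel k (FormsRel.sum_dt (k := k) (n := n))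
  rwa [map_sum, map_zero] at this

variable {k} in
/-- The universal property of the algebra of forms. -/
def lift {A : Type u} [Ring A] [Algebra k A] (x y : Fin (n + 1) → A)
    (hxx : ∀ i j, x i * x j = x j * x i) (hxy : ∀ i j, x i * y j = y j * x i)
    (hyy : ∀ i j, y i * y j = -(y j * y i)) (hx : ∑ i, x i = 1) (hy : ∑ i, y i = 0) :
    Forms k n →ₐ[k] A :=
  RingQuot.liftAlgHom k ⟨FreeAlgebra.lift k (Sum.elim x y), by
    rintro _ _ (⟨i, j⟩ | ⟨i, j⟩ | ⟨i, j⟩ | _ | _)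
    · simpa using hxx i j
    · simpa using hxy i j
    · simpa using hyy i j
    · simpa using hx
    · simpa using hy⟩

section lift

variable {A : Type u} [Ring A] [Algebra k A] (x y : Fin (n + 1) → A)
    (hxx : ∀ i j, x i * x j = x j * x i) (hxy : ∀ i j, x i * y j = y j * x i)
    (hyy : ∀ i j, y i * y j = -(y j * y i)) (hx : ∑ i, x i = 1) (hy : ∑ i, y i = 0)

@[simp] theorem lift_t (i : Fin (n + 1)) : lift x y hxx hxy hyy hx hy (t k i) = x i := by
  exact (RingQuot.liftAlgHom_mkAlgHom_apply k _ _ _).trans (by simp)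

@[simp] theorem lift_dt (i : Fin (n + 1)) : lift x y hxx hxy hyy hx hy (dt k i) = y i := by
  exact (RingQuot.liftAlgHom_mkAlgHom_apply k _ _ _).trans (by simp)

end lift

variable {k} in
theorem induction {p : Forms k n → Prop} (algebraMap : ∀ c, p (algebraMap k _ c))
    (t : ∀ i, p (t k i)) (dt : ∀ i, p (dt k i)) (mul : ∀ x y, p x → p y → p (x * y))
    (add : ∀ x y, p x → p y → p (x + y)) (x : Forms k n) : p x := by
  obtain ⟨y, rfl⟩ := RingQuot.mkAlgHom_surjective k (FormsRel k n) x
  refine FreeAlgebra.induction k _ (motive := fun y => p (RingQuot.mkAlgHom k _ y)) ?_ ?_ ?_ ?_ y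
  · intro c; rw [AlgHom.commutes]; exact algebraMap c
  · rintro (i | i)
    · exact t i
    · exact dt i
  · intro a b ha hb; rw [map_mul]; exact mul _ _ ha hb
  · intro a b ha hb; rw [map_add]; exact add _ _ ha hb

/-- The algebra map which multiplies a form of degree `i` by `z ^ i` for a formal variable `z`. -/
def weight : Forms k n →ₐ[k] AddMonoidAlgebra (Forms k n) ℤ :=
  lift (fun i => AddMonoidAlgebra.single 0 (t k i)) (fun i => AddMonoidAlgebra.single 1 (dt k i))
    (fun i j => by simp only [AddMonoidAlgebra.single_mul_single, t_t k i j])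
    (fun i j => by simp only [AddMonoidAlgebra.single_mul_single, t_dt k i j, add_comm])
    (fun i j => by
      simp only [AddMonoidAlgebra.single_mul_single, dt_dt k i j]
      simp)
    (by
      rw [AddMonoidAlgebra.one_def, ← sum_t]
      exact (map_sum (AddMonoidAlgebra.singleAddHom 0) _ _).symm)
    (by
      have := (map_sum (AddMonoidAlgebra.singleAddHom (R := Forms k n) (1 : ℤ)) (dt k) Finset.univ).symm
      rw [sum_dt, map_zero] at this
      exact this)

/-- The forms of degree `i`. -/
def deg (i : ℤ) : Submodule k (Forms k n) :=
  LinearMap.eqLocus (weight k).toLinearMap (AddMonoidAlgebra.lsingle i)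

variable {k}

theorem mem_deg {i : ℤ} {x : Forms k n} :
    x ∈ deg k i ↔ weight k x = AddMonoidAlgebra.single i x := Iff.rfl

theorem t_mem (i : Fin (n + 1)) : t k i ∈ deg k 0 := by simp [mem_deg, weight]

theorem dt_mem (i : Fin (n + 1)) : dt k i ∈ deg k 1 := by simp [mem_deg, weight]

instance : SetLike.GradedMonoid (deg k (n := n)) where
  one_mem := by rw [mem_deg, map_one, AddMonoidAlgebra.one_def]
  mul_mem i j a b ha hb := by
    rw [mem_deg] at *
    rw [map_mul, ha, hb, AddMonoidAlgebra.single_mul_single]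

theorem sup_eq_top (N : ℤ → Submodule k (Forms k n)) (h1 : 1 ∈ N 0)
    (hm : ∀ i j x y, x ∈ N i → y ∈ N j → x * y ∈ N (i + j)) (ht : ∀ i, t k i ∈ N 0)
    (hd : ∀ i, dt k i ∈ N 1) : ⨆ i, N i = ⊤ := by
  rw [eq_top_iff]
  rintro x -
  refine induction (p := fun x => x ∈ ⨆ i, N i) ?_ ?_ ?_ ?_ ?_ x
  · intro c
    rw [Algebra.algebraMap_eq_smul_one]
    exact Submodule.smul_mem _ _ (Submodule.mem_iSup_of_mem 0 h1)
  · exact fun i => Submodule.mem_iSup_of_mem 0 (ht i)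
  · exact fun i => Submodule.mem_iSup_of_mem 1 (hd i)
  · intro x y hx hy
    refine Submodule.iSup_induction N (motive := fun x => x * y ∈ ⨆ i, N i) hx ?_ ?_ ?_
    · intro i x hx
      refine Submodule.iSup_induction N (motive := fun y => x * y ∈ ⨆ i, N i) hy ?_ ?_ ?_
      · intro j y hy; exact Submodule.mem_iSup_of_mem _ (hm i j x y hx hy)
      · rw [mul_zero]; exact zero_mem _
      · intro y y' h h'; rw [mul_add]; exact add_mem h h'
    · rw [zero_mul]; exact zero_mem _
    · intro y y' h h'; rw [add_mul]; exact add_mem h h'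
  · exact fun x y hx hy => add_mem hx hy

theorem isInternal : DirectSum.IsInternal (deg k (n := n)) := by
  rw [DirectSum.isInternal_submodule_iff_iSupIndep_and_iSup_eq_top]
  refine ⟨?_, sup_eq_top _ (SetLike.one_mem_graded _)
    (fun i j x y hx hy => SetLike.mul_mem_graded hx hy) t_mem dt_mem⟩
  intro i
  rw [Submodule.disjoint_def]
  intro x hx hx'
  let c : Forms k n →ₗ[k] Forms k n :=
    Finsupp.lapply i ∘ₗ (AddMonoidAlgebra.coeffLinearEquiv k).toLinearMap ∘ₗ (weight k).toLinearMap
  have hle : (⨆ j, ⨆ (_ : j ≠ i), deg k (n := n) j) ≤ LinearMap.ker c := by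
    refine iSup_le fun j => iSup_le fun hj => fun y hy => ?_
    rw [mem_deg] at hy
    have : c y = (Finsupp.single j y) i := by
      simp only [c, LinearMap.comp_apply, AlgHom.toLinearMap_apply, hy]; rfl
    rw [LinearMap.mem_ker, this, Finsupp.single_eq_of_ne hj.symm]
  have h0 := hle hx'
  rw [mem_deg] at hx
  have : c x = (Finsupp.single i x) i := by
    simp only [c, LinearMap.comp_apply, AlgHom.toLinearMap_apply, hx]; rfl
  rwa [LinearMap.mem_ker, this, Finsupp.single_eq_same] at h0

instance : Decomposition (deg k (n := n)) := isInternal.chooseDecomposition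

instance : GradedAlgebra (deg k (n := n)) where

theorem deg_le (N : ℤ → Submodule k (Forms k n)) (hN : ∀ i, N i ≤ deg k i) (h1 : 1 ∈ N 0)
    (hm : ∀ i j x y, x ∈ N i → y ∈ N j → x * y ∈ N (i + j)) (ht : ∀ i, t k i ∈ N 0)
    (hd : ∀ i, dt k i ∈ N 1) (i : ℤ) : deg k i ≤ N i := by
  intro x hx
  have key : ∀ y : Forms k n, ((decompose (deg k) y i : Forms k n)) ∈ N i := by
    intro y
    have hy : y ∈ ⨆ i, N i := by rw [sup_eq_top N h1 hm ht hd]; trivial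
    refine Submodule.iSup_induction N
      (motive := fun y => ((decompose (deg k) y i : Forms k n)) ∈ N i) hy ?_ ?_ ?_
    · intro j y hy
      by_cases h : j = i
      · subst h; rwa [decompose_of_mem_same _ (hN _ hy)]
      · rw [decompose_of_mem_ne _ (hN _ hy) h]; exact zero_mem _
    · simp
    · intro y y' h h'; rw [decompose_add]; exact add_mem h h'
  have := key x
  rwa [decompose_of_mem_same _ hx] at this

theorem mat_ext {S : Type u} {M N : Matrix (Fin 2) (Fin 2) S} (h00 : M 0 0 = N 0 0)
    (h01 : M 0 1 = N 0 1) (h10 : M 1 0 = N 1 0) (h11 : M 1 1 = N 1 1) : M = N := by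
  ext a b
  fin_cases a <;> fin_cases b <;> assumption

/-- The algebra map `ω ↦ !![(-1)^{|ω|} ω, dω; 0, ω]`, which encodes the de Rham differential as
a graded derivation with `d t_i = dt_i` and `d dt_i = 0`. -/
def dMatrix (k : Type u) [Field k] {n : ℕ} :
    Forms k n →ₐ[k] Matrix (Fin 2) (Fin 2) (Forms k n) :=
  lift (fun i => !![t k i, dt k i; 0, t k i]) (fun i => !![-dt k i, 0; 0, dt k i])
    (fun i j => by
      have h1 := t_t k i j
      have h2 := t_dt k i j
      have h3 := t_dt k j i
      refine mat_ext ?_ ?_ ?_ ?_ <;> simp [Matrix.mul_apply, h1, h2, h3, add_comm])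
    (fun i j => by
      have h2 := t_dt k i j
      have h3 := dt_dt k i j
      refine mat_ext ?_ ?_ ?_ ?_ <;> simp [Matrix.mul_apply, h2, h3])
    (fun i j => by
      have h3 := dt_dt k i j
      refine mat_ext ?_ ?_ ?_ ?_ <;> simp [Matrix.mul_apply, h3])
    (by
      refine mat_ext ?_ ?_ ?_ ?_ <;> simp [Matrix.sum_apply, sum_t, sum_dt])
    (by
      refine mat_ext ?_ ?_ ?_ ?_ <;> simp [Matrix.sum_apply, sum_dt])

/-- The de Rham differential. -/
def d (k : Type u) [Field k] {n : ℕ} : Forms k n →ₗ[k] Forms k n where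
  toFun x := dMatrix k x 0 1
  map_add' x y := by simp
  map_smul' c x := by simp

@[simp] theorem d_t (i : Fin (n + 1)) : d k (t k i) = dt k i := by simp [d, dMatrix]

@[simp] theorem d_dt (i : Fin (n + 1)) : d k (dt k i) = 0 := by simp [d, dMatrix]

theorem sign_smul_mul {R : Type u} [Ring R] (i j : ℤ) (x y : R) :
    ((-1 : ℤˣ) ^ i • x) * ((-1 : ℤˣ) ^ j • y) = (-1 : ℤˣ) ^ (i + j) • (x * y) := by
  rw [zpow_add]
  rcases Int.units_eq_one_or ((-1 : ℤˣ) ^ i) with h | h <;>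
    rcases Int.units_eq_one_or ((-1 : ℤˣ) ^ j) with h' | h' <;> simp [h, h', Units.smul_def]

theorem dMatrix_apply {i : ℤ} {x : Forms k n} (hx : x ∈ deg k i) :
    dMatrix k x = !![(-1 : ℤˣ) ^ i • x, d k x; 0, x] := by
  let N : ℤ → Submodule k (Forms k n) := fun i =>
    { carrier := {x | x ∈ deg k i ∧ dMatrix k x = !![(-1 : ℤˣ) ^ i • x, d k x; 0, x]}
      add_mem' := by
        rintro x y ⟨h1, h2⟩ ⟨h3, h4⟩
        refine ⟨add_mem h1 h3, ?_⟩
        rw [map_add, h2, h4]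
        refine mat_ext ?_ ?_ ?_ ?_ <;> simp
      zero_mem' := by
        refine ⟨zero_mem _, ?_⟩
        refine mat_ext ?_ ?_ ?_ ?_ <;> simp
      smul_mem' := by
        rintro c x ⟨h1, h2⟩
        refine ⟨Submodule.smul_mem _ _ h1, ?_⟩
        rw [map_smul, h2]
        refine mat_ext ?_ ?_ ?_ ?_ <;> simp [Units.smul_def] }
  refine (deg_le N (fun i x h => h.1) ?_ ?_ ?_ ?_ i hx).2
  · refine ⟨SetLike.one_mem_graded _, ?_⟩
    refine mat_ext ?_ ?_ ?_ ?_ <;> simp [d]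
  · rintro i j x y ⟨h1, h2⟩ ⟨h3, h4⟩
    refine ⟨SetLike.mul_mem_graded h1 h3, ?_⟩
    have : d k (x * y) = (dMatrix k x * dMatrix k y) 0 1 := by simp [d]
    rw [map_mul, this, h2, h4]
    refine mat_ext ?_ ?_ ?_ ?_ <;> simp [Matrix.mul_apply, sign_smul_mul]
  · intro l
    refine ⟨t_mem l, ?_⟩
    refine mat_ext ?_ ?_ ?_ ?_ <;> simp [dMatrix]
  · intro l
    refine ⟨dt_mem l, ?_⟩
    refine mat_ext ?_ ?_ ?_ ?_ <;> simp [dMatrix, Units.smul_def]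

theorem d_mul {i : ℤ} {a : Forms k n} (b : Forms k n) (ha : a ∈ deg k i) :
    d k (a * b) = d k a * b + ((-1 : ℤˣ) ^ i) • (a * d k b) := by
  have h1 : d k (a * b) = (dMatrix k a * dMatrix k b) 0 1 := by simp [d]
  have h2 : dMatrix k b 1 1 = b := by
    refine Decomposition.inductionOn (deg k) (motive := fun b => dMatrix k b 1 1 = b)
      (by simp) (fun {i} m => ?_) (fun x y h h' => ?_) b
    · rw [dMatrix_apply m.2]; simp
    · rw [map_add, Matrix.add_apply, h, h']
  rw [h1, dMatrix_apply ha, Matrix.mul_apply, Fin.sum_univ_two, h2]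
  simp [Units.smul_def, add_comm, d, mul_assoc]

theorem d_mem {i : ℤ} {x : Forms k n} (hx : x ∈ deg k i) : d k x ∈ deg k (i + 1) := by
  let N : ℤ → Submodule k (Forms k n) := fun i => deg k i ⊓ (deg k (i + 1)).comap (d k)
  refine (deg_le N (fun i x h => h.1) ?_ ?_ ?_ ?_ i hx).2
  · refine ⟨SetLike.one_mem_graded _, ?_⟩
    have : d k (1 : Forms k n) = 0 := by simp [d]
    simp [this]
  · rintro i j x y ⟨h1, h2⟩ ⟨h3, h4⟩
    refine ⟨SetLike.mul_mem_graded h1 h3, ?_⟩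
    change d k (x * y) ∈ deg k (i + j + 1)
    rw [d_mul y h1, Units.smul_def]
    have e1 := SetLike.mul_mem_graded (show d k x ∈ deg k (i + 1) from h2) h3
    have e2 := SetLike.mul_mem_graded h1 (show d k y ∈ deg k (j + 1) from h4)
    rw [show i + 1 + j = i + j + 1 by ring] at e1
    rw [← add_assoc] at e2
    exact add_mem e1 (zsmul_mem e2 _)
  · exact fun l => ⟨t_mem l, by simpa using dt_mem l⟩
  · exact fun l => ⟨dt_mem l, by simp⟩

theorem d_d (x : Forms k n) : d k (d k x) = 0 := by
  let N : ℤ → Submodule k (Forms k n) := fun i => deg k i ⊓ LinearMap.ker (d k ∘ₗ d k)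
  refine Decomposition.inductionOn (deg k) (motive := fun x => d k (d k x) = 0)
    (by simp) (fun {i} m => ?_) (fun x y h h' => ?_) x
  · refine (deg_le N (fun i x h => h.1) ?_ ?_ ?_ ?_ i m.2).2
    · refine ⟨SetLike.one_mem_graded _, ?_⟩
      have : d k (1 : Forms k n) = 0 := by simp [d]
      simp [this]
    · rintro i j x y ⟨h1, h2⟩ ⟨h3, h4⟩
      refine ⟨SetLike.mul_mem_graded h1 h3, ?_⟩
      replace h2 : d k (d k x) = 0 := h2
      replace h4 : d k (d k y) = 0 := h4
      change d k (d k (x * y)) = 0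
      rw [d_mul y h1, Units.smul_def, map_add, map_zsmul, d_mul y (d_mem h1), d_mul _ h1, h2, h4,
        zpow_add]
      simp [Units.smul_def]
    · exact fun l => ⟨t_mem l, by simp⟩
    · exact fun l => ⟨dt_mem l, by simp⟩
  · rw [map_add, map_add, h, h', add_zero]

theorem sign_comm_mul {i j : ℤ} {a b : Forms k n} (ha : a ∈ deg k i) (hb : b ∈ deg k j) :
    a * b = ((-1 : ℤˣ) ^ (i * j)) • (b * a) := by
  let Z (j : ℤ) (b : Forms k n) : ℤ → Submodule k (Forms k n) := fun i =>
    { carrier := {a | a ∈ deg k i ∧ a * b = ((-1 : ℤˣ) ^ (i * j)) • (b * a)}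
      add_mem' := by
        rintro x y ⟨h1, h2⟩ ⟨h3, h4⟩
        exact ⟨add_mem h1 h3, by rw [add_mul, h2, h4, mul_add, smul_add]⟩
      zero_mem' := ⟨zero_mem _, by simp⟩
      smul_mem' := by
        rintro c x ⟨h1, h2⟩
        exact ⟨Submodule.smul_mem _ _ h1, by
          rw [smul_mul_assoc, h2, mul_smul_comm, Units.smul_def, Units.smul_def, smul_comm]⟩ }
  have hZ (j : ℤ) (b : Forms k n) (ht : ∀ l, t k l ∈ Z j b 0) (hd : ∀ l, dt k l ∈ Z j b 1)
      (i : ℤ) (a : Forms k n) (ha : a ∈ deg k i) : a ∈ Z j b i := by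
    refine deg_le (Z j b) (fun i x h => h.1) ?_ ?_ ht hd i ha
    · exact ⟨SetLike.one_mem_graded _, by simp⟩
    · rintro i i' x y ⟨h1, h2⟩ ⟨h3, h4⟩
      refine ⟨SetLike.mul_mem_graded h1 h3, ?_⟩
      rw [mul_assoc, h4, CDGA.mul_units_smul, ← mul_assoc, h2, smul_mul_assoc, smul_smul, mul_assoc,
        ← zpow_add, add_mul, add_comm]
  have ht (l : Fin (n + 1)) (i : ℤ) (a : Forms k n) (ha : a ∈ deg k i) : a * t k l = t k l * a := by
    have := (hZ 0 (t k l) (fun l' => ⟨t_mem l', by simpa using t_t k l' l⟩)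
      (fun l' => ⟨dt_mem l', by simpa using (t_dt k l l').symm⟩) i a ha).2
    simpa using this
  have hd (l : Fin (n + 1)) (i : ℤ) (a : Forms k n) (ha : a ∈ deg k i) :
      a * dt k l = ((-1 : ℤˣ) ^ i) • (dt k l * a) := by
    have := (hZ 1 (dt k l) (fun l' => ⟨t_mem l', by simpa using t_dt k l' l⟩)
      (fun l' => ⟨dt_mem l', by simpa [Units.smul_def] using (dt_dt k l' l)⟩) i a ha).2
    simpa using this
  refine (hZ j b (fun l => ⟨t_mem l, ?_⟩) (fun l => ⟨dt_mem l, ?_⟩) i a ha).2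
  · simpa using (ht l j b hb).symm
  · rw [hd l j b hb, smul_smul, one_mul, ← mul_zpow]; simp

end Forms

open Forms in
/-- The commutative dg algebra `Ω_n` of polynomial differential forms on the `n`-simplex. -/
abbrev Omega (n : ℕ) : CDGA k where
  carrier := Forms k n
  deg := deg k
  d := d k
  d_mem _ _ hx := d_mem hx
  d_d := d_d
  leibniz _ _ b ha := d_mul b ha
  comm _ _ _ _ ha hb := sign_comm_mul ha hb

open Forms in
/-- The pullback of forms along the map of simplices given by a map of vertices:
`t_i ↦ ∑_{θ j = i} t_j`. -/
def Forms.pullback {m n : ℕ} (θ : Fin (m + 1) → Fin (n + 1)) : Forms k n →ₐ[k] Forms k m :=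
  lift (fun i => ∑ j with θ j = i, t k j) (fun i => ∑ j with θ j = i, dt k j)
      (fun i i' => by
        rw [Finset.sum_mul_sum, Finset.sum_mul_sum, Finset.sum_comm]
        simp only [t_t k])
      (fun i i' => by
        rw [Finset.sum_mul_sum, Finset.sum_mul_sum, Finset.sum_comm]
        simp only [t_dt k])
      (fun i i' => by
        rw [Finset.sum_mul_sum, Finset.sum_mul_sum, Finset.sum_comm]
        rw [← Finset.sum_neg_distrib]
        refine Finset.sum_congr rfl fun a _ => ?_
        rw [← Finset.sum_neg_distrib]
        refine Finset.sum_congr rfl fun b _ => dt_dt k _ _)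
      (by rw [Finset.sum_fiberwise, sum_t])
      (by rw [Finset.sum_fiberwise, sum_dt])

theorem Forms.pullback_t {m n : ℕ} (θ : Fin (m + 1) → Fin (n + 1)) (i : Fin (n + 1)) :
    pullback k θ (t k i) = ∑ j with θ j = i, t k j := by simp [pullback]

theorem Forms.pullback_dt {m n : ℕ} (θ : Fin (m + 1) → Fin (n + 1)) (i : Fin (n + 1)) :
    pullback k θ (dt k i) = ∑ j with θ j = i, dt k j := by simp [pullback]

open Forms in
/-- `Forms.pullback` as a morphism of dg algebras. -/
def omegaMap {m n : ℕ} (θ : Fin (m + 1) → Fin (n + 1)) : Omega k n ⟶ Omega k m :=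
  let f := pullback k θ
  have hdeg (i : ℤ) (x : Forms k n) (hx : x ∈ deg k i) : f x ∈ deg k i := by
    let N : ℤ → Submodule k (Forms k n) := fun i => deg k i ⊓ (deg k i).comap f.toLinearMap
    refine (deg_le N (fun i x h => h.1) ?_ ?_ ?_ ?_ i hx).2
    · exact ⟨SetLike.one_mem_graded _, by simpa using SetLike.one_mem_graded _⟩
    · rintro i j x y ⟨h1, h2⟩ ⟨h3, h4⟩
      refine ⟨SetLike.mul_mem_graded h1 h3, ?_⟩
      change f (x * y) ∈ deg k (i + j)
      rw [map_mul]
      exact SetLike.mul_mem_graded (show f x ∈ deg k i from h2) (show f y ∈ deg k j from h4)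
    · exact fun l => ⟨t_mem l, by simpa [f, pullback_t] using sum_mem fun j _ => t_mem j⟩
    · exact fun l => ⟨dt_mem l, by simpa [f, pullback_dt] using sum_mem fun j _ => dt_mem j⟩
  CDGA.Hom.mk (A := Omega k n) (B := Omega k m) f hdeg (fun x => by
    change f (d k x) = d k (f x)
    refine Decomposition.inductionOn (deg k) (motive := fun x => f (d k x) = d k (f x))
      (by simp) (fun {i} y => ?_) (fun x y h h' => by simp [h, h']) x
    let N : ℤ → Submodule k (Forms k n) := fun i =>
      deg k i ⊓ LinearMap.eqLocus (f.toLinearMap ∘ₗ d k) (d k ∘ₗ f.toLinearMap)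
    refine (deg_le N (fun i x h => h.1) ?_ ?_ ?_ ?_ i y.2).2
    · refine ⟨SetLike.one_mem_graded _, ?_⟩
      have h (n : ℕ) : d k (1 : Forms k n) = 0 := by simp [d]
      simp [h]
    · rintro i j x y ⟨h1, h2⟩ ⟨h3, h4⟩
      refine ⟨SetLike.mul_mem_graded h1 h3, ?_⟩
      replace h2 : f (d k x) = d k (f x) := h2
      replace h4 : f (d k y) = d k (f y) := h4
      change f (d k (x * y)) = d k (f (x * y))
      rw [d_mul y h1, map_mul, d_mul _ (hdeg i x h1), Units.smul_def, map_add, map_zsmul, map_mul,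
        map_mul, h2, h4, Units.smul_def]
    · exact fun l => ⟨t_mem l, by simp [f, pullback_t, pullback_dt]⟩
    · exact fun l => ⟨dt_mem l, by simp [f, pullback_dt]⟩)

end forms

section simplicialForms

variable (k : Type u) [Field k]

/-- Two morphisms out of `Ω_n` agree if they agree on the barycentric coordinates. -/
theorem omega_hom_ext {n : ℕ} {A : CDGA k} {f g : Omega k n ⟶ A}
    (h : ∀ i, CDGA.alg f (Forms.t k i) = CDGA.alg g (Forms.t k i)) : f = g := by
  ext x
  refine Forms.induction (p := fun x => CDGA.alg f x = CDGA.alg g x) ?_ h ?_ ?_ ?_ x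
  · intro c
    exact ((CDGA.alg f).commutes c).trans ((CDGA.alg g).commutes c).symm
  · intro i
    rw [← Forms.d_t]
    exact (CDGA.Hom.map_d f _).trans ((congrArg A.d (h i)).trans (CDGA.Hom.map_d g _).symm)
  · intro x y hx hy
    exact (map_mul (CDGA.alg f) x y).trans
      ((congrArg₂ (· * ·) hx hy).trans (map_mul (CDGA.alg g) x y).symm)
  · intro x y hx hy
    exact (map_add (CDGA.alg f) x y).trans
      ((congrArg₂ (· + ·) hx hy).trans (map_add (CDGA.alg g) x y).symm)

theorem omegaMap_t {m n : ℕ} (θ : Fin (m + 1) → Fin (n + 1)) (i : Fin (n + 1)) :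
    CDGA.alg (omegaMap k θ) (Forms.t k i) = ∑ j with θ j = i, Forms.t k j :=
  Forms.pullback_t k θ i

/-- The simplicial commutative dg algebra `[n] ↦ Ω_n`. -/
def omega : SimplexCategoryᵒᵖ ⥤ CDGA k where
  obj n := Omega k n.unop.len
  map θ := omegaMap k θ.unop.toOrderHom
  map_id n := by
    apply omega_hom_ext
    intro i
    refine (omegaMap_t k _ i).trans ?_
    change _ = Forms.t k i
    rw [Finset.sum_filter]
    simp
  map_comp {l m n} θ θ' := by
    apply omega_hom_ext
    intro i
    refine (omegaMap_t k _ i).trans ?_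
    refine Eq.symm (((congrArg (CDGA.alg (omegaMap k θ'.unop.toOrderHom))
      (omegaMap_t k θ.unop.toOrderHom i)).trans (map_sum _ _ _)).trans ?_)
    refine (Finset.sum_congr rfl fun j _ => omegaMap_t k θ'.unop.toOrderHom j).trans ?_
    change ∑ j with θ.unop.toOrderHom j = i, ∑ l with θ'.unop.toOrderHom l = j, Forms.t k l =
      ∑ l with θ.unop.toOrderHom (θ'.unop.toOrderHom l) = i, Forms.t k l
    simp_rw [Finset.sum_filter (fun l => θ'.unop.toOrderHom l = _)]
    rw [Finset.sum_comm]
    simp only [Finset.sum_ite_eq, Finset.mem_filter, Finset.mem_univ, true_and]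
    rw [Finset.sum_filter]

end simplicialForms

namespace CDGA

variable {k : Type u} [Field k]

section

variable {C C' X X' : CDGA k}

/-- For a commutative square of commutative dg algebras given by `φ : C ⟶ C'`, `x : C ⟶ X`,
`x' : C' ⟶ X'` and `f : X ⟶ X'`, the assertion that the induced map `C' ⊗_C X ⟶ X'`,
`c' ⊗ y ↦ x' c' * f y`, is an isomorphism. Here `C' ⊗_C X` is the quotient of `C' ⊗_k X` by the
subspace spanned by the elements `c' φ(c) ⊗ y - c' ⊗ x(c) y`. -/
def IsTensorSquare (φ : C ⟶ C') (x : C ⟶ X) (x' : C' ⟶ X') (f : X ⟶ X') : Prop :=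
  Function.Surjective
      (TensorProduct.lift ((LinearMap.mul k X').compl₁₂ (alg x').toLinearMap (alg f).toLinearMap)) ∧
    LinearMap.ker
      (TensorProduct.lift ((LinearMap.mul k X').compl₁₂ (alg x').toLinearMap (alg f).toLinearMap)) =
      Submodule.span k {z : C' ⊗[k] X | ∃ (c' : C') (c : C) (y : X),
        z = (c' * alg φ c) ⊗ₜ y - c' ⊗ₜ (alg x c * y)}

/-- For a right `C`-module `M` and `f : C ⟶ X`, the kernel of `M ⊗_ℤ X → M ⊗_C X`. -/
def balanced (f : C ⟶ X) (M : Type u) [AddCommGroup M] [Module Cᵐᵒᵖ M] :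
    AddSubgroup (M ⊗[ℤ] X) :=
  AddSubgroup.closure {z | ∃ (m : M) (c : C) (y : X),
    z = (MulOpposite.op c • m) ⊗ₜ y - m ⊗ₜ (alg f c * y)}

/-- `f : C ⟶ X` is faithfully flat: the functor `M ↦ M ⊗_C X` on right `C`-modules preserves
injections and kills no nonzero module. The differentials play no role. -/
def FaithfullyFlat (f : C ⟶ X) : Prop :=
  (∀ (M N : Type u) [AddCommGroup M] [AddCommGroup N] [Module Cᵐᵒᵖ M] [Module Cᵐᵒᵖ N]
    (g : M →ₗ[Cᵐᵒᵖ] N), Function.Injective g →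
      ∀ z : M ⊗[ℤ] X, (g.toAddMonoidHom.toIntLinearMap.rTensor X) z ∈ balanced f N →
        z ∈ balanced f M) ∧
  (∀ (M : Type u) [AddCommGroup M] [Module Cᵐᵒᵖ M], balanced f M = ⊤ → Subsingleton M)

end

end CDGA

/-! ### Artinian dg algebras -/

/-- A local artinian dg algebra with residue field `k`: a finite dimensional commutative dg algebra
concentrated in nonpositive degrees, with an augmentation `A ⟶ k` whose kernel consists of
nilpotent elements. -/
structure DGArt (k : Type u) [Field k] : Type (u + 1) where
  toCDGA : CDGA k
  nonpos : ∀ i : ℤ, 0 < i → toCDGA.deg i = ⊥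
  finite : Module.Finite k toCDGA
  aug : toCDGA ⟶ CDGA.ofComm k
  nilpotent : ∀ a : toCDGA, CDGA.alg aug a = 0 → IsNilpotent a

namespace DGArt

open CDGA

variable {k : Type u} [Field k]

instance : Category (DGArt k) where
  Hom A B := A.toCDGA ⟶ B.toCDGA
  id A := 𝟙 A.toCDGA
  comp {A B C} f g := CategoryStruct.comp (X := A.toCDGA) (Y := B.toCDGA) (Z := C.toCDGA) f g

/-- The underlying morphism of commutative dg algebras. -/
def hom {A B : DGArt k} (f : A ⟶ B) : A.toCDGA ⟶ B.toCDGA := f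

theorem hom_id (A : DGArt k) : hom (𝟙 A) = 𝟙 A.toCDGA := rfl

theorem hom_comp {A B C : DGArt k} (f : A ⟶ B) (g : B ⟶ C) : hom (f ≫ g) = hom f ≫ hom g := rfl

/-- Morphisms automatically respect the augmentations. -/
theorem map_aug {A B : DGArt k} (f : A ⟶ B) : hom f ≫ B.aug = A.aug := by
  have key (g : A.toCDGA ⟶ B.toCDGA) : g ≫ B.aug = A.aug := by
    ext a
    let c : k := alg A.aug a
    have h1 : alg A.aug (a - algebraMap k A.toCDGA c) = 0 := by
      rw [map_sub, AlgHom.commutes]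
      exact sub_self c
    have h2 : alg B.aug (alg g (a - algebraMap k A.toCDGA c)) = 0 :=
      IsNilpotent.eq_zero (R := k) (((A.nilpotent _ h1).map (alg g)).map (alg B.aug))
    rw [map_sub, map_sub, AlgHom.commutes, AlgHom.commutes, sub_eq_zero] at h2
    exact h2
  exact key f

/-- The morphism `A ⊗ B ⟶ B` induced by the augmentation of `A`. -/
def augBase (A : DGArt k) (B : CDGA k) : CDGA.tensor A.toCDGA B ⟶ B :=
  CDGA.tlift (A.aug ≫ CDGA.unitMap B) (𝟙 B)

end DGArt

/-! ### Torsors -/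

section torsors

open CDGA

variable {k : Type u} [Field k] (R : Type u) [CommRing R] [HopfAlgebra k R]

/-- The isomorphism from the usual tensor product `R ⊗ R` to the graded one; there are no signs
since `R` is concentrated in degree zero. -/
def tensAlg : R ⊗[k] R →ₐ[k] tensor (ofComm (k := k) R) (ofComm R) :=
  Algebra.TensorProduct.lift
    (alg (inl (ofComm R) (ofComm R)) : R →ₐ[k] tensor (ofComm (k := k) R) (ofComm R))
    (alg (inr (ofComm R) (ofComm R)) : R →ₐ[k] tensor (ofComm (k := k) R) (ofComm R))
    (fun r s => by
      have h (r : R) : r ∈ (ofComm (k := k) R).deg 0 := (mem_degZero (k := k) 0 r).2 (Or.inl rfl)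
      have := (tensor (ofComm (k := k) R) (ofComm R)).comm 0 0 _ _
        (Hom.map_deg (inl (ofComm R) (ofComm R)) 0 r (h r))
        (Hom.map_deg (inr (ofComm R) (ofComm R)) 0 s (h s))
      rw [mul_zero, zpow_zero, one_smul] at this
      exact this)

theorem tensAlg_tmul (r s : R) :
    tensAlg (k := k) R (r ⊗ₜ s) = (tmul (A := ofComm R) (B := ofComm R) r s) := by
  refine (Algebra.TensorProduct.lift_tmul _ _ _ r s).trans ?_
  exact tmul_mul_tmul_one (ofComm R) (ofComm R) r s

theorem mem_tensAlg (z : tensor (ofComm (k := k) R) (ofComm R)) :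
    z ∈ (tensor (ofComm (k := k) R) (ofComm R)).deg 0 := by
  have h (r : R) : r ∈ (ofComm (k := k) R).deg 0 := (mem_degZero (k := k) 0 r).2 (Or.inl rfl)
  refine tens_induction (p := fun z => z ∈ tensDeg (ofComm (k := k) R) (ofComm R) 0)
    (zero_mem _) (fun _ _ => add_mem) (fun _ _ a b _ _ => tmul_mem (h a) (h b) (add_zero 0)) z

theorem d_tensAlg (z : tensor (ofComm (k := k) R) (ofComm R)) :
    (tensor (ofComm (k := k) R) (ofComm R)).d z = 0 := by
  have h (r : R) : r ∈ (ofComm (k := k) R).deg 0 := (mem_degZero (k := k) 0 r).2 (Or.inl rfl)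
  refine tens_induction (p := fun z => tensD (ofComm (k := k) R) (ofComm R) z = 0)
    (map_zero _) (fun x y hx hy => by rw [map_add, hx, hy, add_zero]) (fun _ _ a b _ _ => ?_) z
  rw [tensD_tmul _ _ a b (h a)]
  have h1 : (ofComm (k := k) R).d a = 0 := rfl
  have h2 : (ofComm (k := k) R).d b = 0 := rfl
  rw [h1, h2]
  simp [← tmulₗ_apply]

/-- The comultiplication `R ⟶ R ⊗ R` as a morphism of dg algebras. -/
def comul : (ofComm R : CDGA k) ⟶ tensor (ofComm R) (ofComm R) :=
  ofCommHom (A := tensor (ofComm R) (ofComm R)) ((tensAlg R).comp (Bialgebra.comulAlgHom k R))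
    (fun _ => mem_tensAlg R _) (fun _ => d_tensAlg R _)

/-- The counit `R ⟶ k` as a morphism of dg algebras. -/
def counit : (ofComm R : CDGA k) ⟶ ofComm k := ofCommMap (Bialgebra.counitAlgHom k R)

/-- A morphism `x : C ⟶ X` of commutative dg algebras together with a coaction `X ⟶ X ⊗ R` of the
Hopf algebra `R`, trivial on `C`: an affine dg scheme over `C` with an action of the group with
algebra of functions `R`. -/
structure CoactAlg (C : CDGA k) : Type (u + 1) where
  X : CDGA k
  x : C ⟶ X
  μ : X ⟶ tensor X (ofComm R)
  base : x ≫ μ = x ≫ inl X (ofComm R)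
  coassoc : μ ≫ tmap μ (𝟙 _) ≫ assoc X (ofComm R) (ofComm R) = μ ≫ tmap (𝟙 X) (comul R)
  counit : μ ≫ tlift (𝟙 X) (DG.counit R ≫ unitMap X) = 𝟙 X

variable {R}

/-- `T` is a torsor over `C`: the map `X ⊗_C X ⟶ X ⊗ R`, `y ⊗ z ↦ (y ⊗ 1) μ(z)` is an
isomorphism, and `C ⟶ X` is faithfully flat. -/
def CoactAlg.IsTorsor {C : CDGA k} (T : CoactAlg R C) : Prop :=
  IsTensorSquare T.x T.x (inl T.X (ofComm R)) T.μ ∧ FaithfullyFlat T.x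

variable (R) in
theorem comul_coassoc : comul (k := k) R ≫ tmap (comul R) (𝟙 _) ≫
    assoc (ofComm R) (ofComm R) (ofComm R) = comul R ≫ tmap (𝟙 _) (comul R) := by
  let Φ : R ⊗[k] (R ⊗[k] R) →ₗ[k] tensor (ofComm (k := k) R) (tensor (ofComm R) (ofComm R)) :=
    TensorProduct.lift ((tmulₗ (ofComm (k := k) R) (tensor (ofComm R) (ofComm R))).compl₁₂
      (LinearMap.id (M := R)) (tensAlg R).toLinearMap)
  have h0 (w : R ⊗[k] R) (s : R) : alg (assoc (ofComm (k := k) R) (ofComm R) (ofComm R))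
      (tmul (A := tensor (ofComm R) (ofComm R)) (B := ofComm R) (tensAlg R w) s) =
      Φ (TensorProduct.assoc k R R R (w ⊗ₜ s)) := by
    induction w with
    | zero => simp [← tmulₗ_apply]
    | add x y hx hy =>
      rw [map_add, TensorProduct.add_tmul, map_add, map_add, ← hx, ← hy, ← map_add]
      simp only [← tmulₗ_apply, map_add, LinearMap.add_apply]
    | tmul a b =>
      rw [tensAlg_tmul, TensorProduct.assoc_tmul]
      refine (alg_assoc _ _ _).trans ?_
      exact congrArg (fun z => tmul (A := ofComm (k := k) R)
        (B := tensor (ofComm (k := k) R) (ofComm R)) a z) (tensAlg_tmul (k := k) R b s).symm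
  have h1 (z : R ⊗[k] R) : alg (tmap (comul (k := k) R) (𝟙 _) ≫
      assoc (ofComm R) (ofComm R) (ofComm R)) (tensAlg R z) =
      Φ (TensorProduct.assoc k R R R ((Coalgebra.comul (R := k) (A := R)).rTensor R z)) := by
    induction z with
    | zero => simp
    | add x y hx hy => simp only [map_add, hx, hy]
    | tmul a b =>
      rw [tensAlg_tmul, LinearMap.rTensor_tmul, ← h0, alg_comp, alg_tmap]
      rfl
  have h2 (z : R ⊗[k] R) : alg (tmap (𝟙 _) (comul (k := k) R)) (tensAlg R z) =
      Φ ((Coalgebra.comul (R := k) (A := R)).lTensor R z) := by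
    induction z with
    | zero => simp
    | add x y hx hy => simp only [map_add, hx, hy]
    | tmul a b =>
      rw [tensAlg_tmul, LinearMap.lTensor_tmul, alg_tmap]
      rfl
  ext r
  refine (h1 (Coalgebra.comul r)).trans (Eq.trans ?_ (h2 (Coalgebra.comul r)).symm)
  rw [Coalgebra.coassoc_apply]

variable (R) in
theorem comul_counit : comul (k := k) R ≫ tlift (𝟙 _) (DG.counit R ≫ unitMap _) = 𝟙 _ := by
  have h1 (z : R ⊗[k] R) : alg (tlift (𝟙 _) (DG.counit (k := k) R ≫ unitMap _)) (tensAlg R z) =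
      TensorProduct.rid k R ((Coalgebra.counit (R := k) (A := R)).lTensor R z) := by
    induction z with
    | zero => simp
    | add x y hx hy => simp only [map_add, hx, hy]
    | tmul a b =>
      rw [tensAlg_tmul, LinearMap.lTensor_tmul, alg_tlift, TensorProduct.rid_tmul, Algebra.smul_def,
        mul_comm]
      rfl
  ext r
  refine (h1 (Coalgebra.comul r)).trans ?_
  rw [Coalgebra.lTensor_counit_comul, TensorProduct.rid_tmul, one_smul]
  rfl

theorem inr_coact (D X : CDGA k) (μ : X ⟶ tensor X (ofComm R)) :
    inr D X ≫ tmap (𝟙 D) μ ≫ assocInv D X (ofComm R) = μ ≫ tmap (inr D X) (𝟙 _) := by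
  rw [← Category.assoc, inr_tmap, Category.assoc]
  congr 1
  refine tensor_hom_ext ?_ ?_ <;> simp [assocInv, tmap]

theorem inl_coact (D X : CDGA k) (μ : X ⟶ tensor X (ofComm R)) :
    inl D X ≫ tmap (𝟙 D) μ ≫ assocInv D X (ofComm R) = inl D X ≫ inl _ _ := by
  simp [assocInv, tmap]

theorem coassoc_tensor (D X : CDGA k) (μ : X ⟶ tensor X (ofComm R))
    (h : μ ≫ tmap μ (𝟙 _) ≫ assoc X (ofComm R) (ofComm R) = μ ≫ tmap (𝟙 X) (comul R)) :
    (tmap (𝟙 D) μ ≫ assocInv D X (ofComm R)) ≫ tmap (tmap (𝟙 D) μ ≫ assocInv D X (ofComm R)) (𝟙 _) ≫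
      assoc (tensor D X) (ofComm R) (ofComm R) =
    (tmap (𝟙 D) μ ≫ assocInv D X (ofComm R)) ≫ tmap (𝟙 (tensor D X)) (comul R) := by
  refine tensor_hom_ext ?_ ?_
  · rw [← Category.assoc, inl_coact, ← Category.assoc (inl D X), inl_coact]
    simp only [Category.assoc]
    rw [← Category.assoc (inl (tensor D X) _), inl_tmap, inl_tmap, Category.assoc]
    rw [← Category.assoc (inl D X) (_ ≫ _), inl_coact]
    simp [assoc]
  · rw [← Category.assoc, inr_coact, ← Category.assoc (inr D X), inr_coact]
    simp only [Category.assoc]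
    rw [← Category.assoc (tmap (inr D X) _), ← tmap_comp, inr_coact]
    have e : tmap (μ ≫ tmap (inr D X) (𝟙 (ofComm R))) (𝟙 (ofComm R)) =
        tmap μ (𝟙 _) ≫ tmap (tmap (inr D X) (𝟙 (ofComm R))) (𝟙 (ofComm R)) := by
      rw [← tmap_comp, Category.id_comp]
    rw [Category.comp_id (𝟙 (ofComm R)), e, Category.assoc, tmap_assoc, tmap_id, ← tmap_eq_comp,
      tmap_eq_comp' (inr D X) (comul R)]
    simp only [← Category.assoc]
    congr 1

theorem counit_tensor (D X : CDGA k) (μ : X ⟶ tensor X (ofComm R))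
    (h : μ ≫ tlift (𝟙 X) (DG.counit R ≫ unitMap X) = 𝟙 X) :
    (tmap (𝟙 D) μ ≫ assocInv D X (ofComm R)) ≫
      tlift (𝟙 (tensor D X)) (DG.counit R ≫ unitMap (tensor D X)) = 𝟙 (tensor D X) := by
  refine tensor_hom_ext ?_ ?_
  · rw [← Category.assoc, inl_coact]
    simp
  · rw [← Category.assoc, inr_coact, Category.assoc, Category.comp_id]
    have e : tmap (inr D X) (𝟙 (ofComm R)) ≫ tlift (𝟙 (tensor D X))
        (DG.counit R ≫ unitMap (tensor D X)) =
        tlift (𝟙 X) (DG.counit R ≫ unitMap X) ≫ inr D X := by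
      refine tensor_hom_ext ?_ ?_
      · simp [tmap]
      · simp only [tmap, inr_tlift_assoc, Category.assoc, Category.id_comp, inr_tlift, unitMap_comp]
    rw [e, ← Category.assoc, h, Category.id_comp]

variable (R) in
/-- The trivial torsor `C ⊗ R` over `C`. -/
def trivialTorsor (C : CDGA k) : CoactAlg R C where
  X := tensor C (ofComm R)
  x := inl C (ofComm R)
  μ := tmap (𝟙 C) (comul R) ≫ assocInv C (ofComm R) (ofComm R)
  base := inl_coact C (ofComm R) (comul R)
  coassoc := coassoc_tensor C (ofComm R) (comul R) (comul_coassoc R)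
  counit := counit_tensor C (ofComm R) (comul R) (comul_counit R)

/-- The base change `D ⊗ X` over `D ⊗ C` of an algebra with coaction over `C`. -/
abbrev CoactAlg.extend (D : CDGA k) {C : CDGA k} (T : CoactAlg R C) : CoactAlg R (tensor D C) where
  X := tensor D T.X
  x := tmap (𝟙 D) T.x
  μ := tmap (𝟙 D) T.μ ≫ assocInv D T.X (ofComm R)
  base := by
    refine tensor_hom_ext ?_ ?_
    · rw [← Category.assoc, inl_tmap, Category.id_comp, inl_coact, ← Category.assoc, inl_tmap,
        Category.id_comp]
    · rw [← Category.assoc, inr_tmap, Category.assoc, inr_coact, ← Category.assoc, T.base,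
        ← Category.assoc, inr_tmap, Category.assoc, Category.assoc, inl_tmap]
  coassoc := coassoc_tensor D T.X T.μ T.coassoc
  counit := counit_tensor D T.X T.μ T.counit

end torsors

/-! ### Deformations of a torsor -/

section deformations

open CDGA

variable {k : Type u} [Field k] {R : Type u} [CommRing R] [HopfAlgebra k R] {B : CDGA k}

/-- A deformation over `A` of a `B`-torsor `P`: an `A ⊗ B`-torsor `T` with a trivialization
`T ⊗_{A ⊗ B} B ≅ P`, which is given by the corresponding equivariant morphism `τ : T ⟶ P` over
`A ⊗ B ⟶ B`. -/
structure Deformation (P : CoactAlg R B) (A : DGArt k) : Type (u + 1) where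
  T : CoactAlg R (tensor A.toCDGA B)
  isTorsor : T.IsTorsor
  τ : T.X ⟶ P.X
  τ_base : T.x ≫ τ = A.augBase B ≫ P.x
  τ_equivariant : T.μ ≫ tmap τ (𝟙 _) = τ ≫ P.μ
  τ_iso : IsTensorSquare (A.augBase B) T.x P.x τ

namespace Deformation

variable {P : CoactAlg R B} {A : DGArt k}

/-- For a commutative dg algebra `W`, an isomorphism `W ⊗ S ≅ W ⊗ T` of torsors over `W ⊗ A ⊗ B`
compatible with the trivializations over `W ⊗ B`. -/
@[ext]
structure Iso (W : CDGA k) (S T : Deformation P A) : Type u where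
  hom : tensor W S.T.X ⟶ tensor W T.T.X
  base : (S.T.extend W).x ≫ hom = (T.T.extend W).x
  equivariant : (S.T.extend W).μ ≫ tmap hom (𝟙 _) = hom ≫ (T.T.extend W).μ
  triv : hom ≫ tmap (𝟙 W) T.τ = tmap (𝟙 W) S.τ
  isIso : IsIso hom

/-- The identity isomorphism. -/
def Iso.refl (W : CDGA k) (S : Deformation P A) : Iso W S S where
  hom := 𝟙 _
  base := Category.comp_id _
  equivariant := by rw [tmap_id, Category.comp_id, Category.id_comp]
  triv := Category.id_comp _
  isIso := inferInstance

/-- Composition of isomorphisms. -/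
def Iso.trans {W : CDGA k} {S T U : Deformation P A} (f : Iso W S T) (g : Iso W T U) :
    Iso W S U where
  hom := f.hom ≫ g.hom
  base := by rw [← Category.assoc, f.base, g.base]
  equivariant := by
    rw [← Category.id_comp (𝟙 (ofComm R)), tmap_comp, ← Category.assoc, f.equivariant,
      Category.assoc, g.equivariant, Category.assoc]
  triv := by rw [Category.assoc, g.triv, f.triv]
  isIso := have := f.isIso; have := g.isIso; inferInstance

end Deformation
end deformations

namespace CDGA

variable {k : Type u} [Field k]

section extension

variable {W W' W'' X Y Z : CDGA k}

/-- The extension of scalars along `w : W ⟶ W'` of a morphism `W ⊗ X ⟶ W ⊗ Y` over `W`. -/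
def extHom (w : W ⟶ W') (f : tensor W X ⟶ tensor W Y) : tensor W' X ⟶ tensor W' Y :=
  tlift (inl W' Y) (inr W X ≫ f ≫ tmap w (𝟙 Y))

@[simp] theorem inl_extHom (w : W ⟶ W') (f : tensor W X ⟶ tensor W Y) :
    inl W' X ≫ extHom w f = inl W' Y := inl_tlift _ _

@[simp] theorem inr_extHom (w : W ⟶ W') (f : tensor W X ⟶ tensor W Y) :
    inr W' X ≫ extHom w f = inr W X ≫ f ≫ tmap w (𝟙 Y) := inr_tlift _ _

theorem tmap_extHom (w : W ⟶ W') (f : tensor W X ⟶ tensor W Y) (h : inl W X ≫ f = inl W Y) :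
    tmap w (𝟙 X) ≫ extHom w f = f ≫ tmap w (𝟙 Y) := by
  refine tensor_hom_ext ?_ ?_
  · rw [← Category.assoc, inl_tmap, Category.assoc, inl_extHom, ← Category.assoc, h, inl_tmap]
  · rw [← Category.assoc, inr_tmap, Category.assoc, inr_extHom, Category.id_comp]

theorem extHom_id (w : W ⟶ W') : extHom w (𝟙 (tensor W X)) = 𝟙 (tensor W' X) := by
  refine tensor_hom_ext ?_ ?_
  · rw [inl_extHom, Category.comp_id]
  · rw [inr_extHom, Category.id_comp, inr_tmap, Category.id_comp, Category.comp_id]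

theorem extHom_comp (w : W ⟶ W') (f : tensor W X ⟶ tensor W Y) (g : tensor W Y ⟶ tensor W Z)
    (hg : inl W Y ≫ g = inl W Z) : extHom w (f ≫ g) = extHom w f ≫ extHom w g := by
  refine tensor_hom_ext ?_ ?_
  · rw [inl_extHom, ← Category.assoc, inl_extHom, inl_extHom]
  · rw [inr_extHom, ← Category.assoc (inr W' X), inr_extHom]
    simp only [Category.assoc]
    rw [tmap_extHom w g hg]

theorem extHom_id' (f : tensor W X ⟶ tensor W Y) (h : inl W X ≫ f = inl W Y) :
    extHom (𝟙 W) f = f := by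
  refine tensor_hom_ext ?_ ?_
  · rw [inl_extHom, h]
  · rw [inr_extHom, tmap_id, Category.comp_id]

theorem extHom_comp' (w : W ⟶ W') (w' : W' ⟶ W'') (f : tensor W X ⟶ tensor W Y) :
    extHom (w ≫ w') f = extHom w' (extHom w f) := by
  refine tensor_hom_ext ?_ ?_
  · rw [inl_extHom, inl_extHom]
  · rw [inr_extHom, inr_extHom, ← Category.assoc (inr W' X), inr_extHom]
    simp only [Category.assoc]
    rw [← tmap_comp, Category.comp_id]

theorem extHom_tmap (w : W ⟶ W') {X' Y' : CDGA k} (f : tensor W X ⟶ tensor W Y)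
    (f' : tensor W X' ⟶ tensor W Y') (p : X ⟶ X') (q : Y ⟶ Y')
    (h : f ≫ tmap (𝟙 W) q = tmap (𝟙 W) p ≫ f') :
    extHom w f ≫ tmap (𝟙 W') q = tmap (𝟙 W') p ≫ extHom w f' := by
  refine tensor_hom_ext ?_ ?_
  · rw [← Category.assoc, inl_extHom, inl_tmap, ← Category.assoc, inl_tmap, Category.id_comp,
      Category.id_comp, inl_extHom]
  · rw [← Category.assoc, inr_extHom, ← Category.assoc (inr W' X), inr_tmap]
    simp only [Category.assoc]
    rw [inr_extHom, ← tmap_eq_comp, tmap_eq_comp', ← Category.assoc f, h, ← Category.assoc p,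
      ← inr_tmap (𝟙 W)]
    simp only [Category.assoc]

end extension

end CDGA

section sections

open CDGA

variable {k : Type u} [Field k] {R : Type u} [CommRing R] [HopfAlgebra k R] {B : CDGA k}

namespace Deformation

variable {P : CoactAlg R B} {A : DGArt k}

theorem extend_coact {C : CDGA k} (T : CoactAlg R C) {W W' : CDGA k} (w : W ⟶ W') :
    (T.extend W).μ ≫ tmap (tmap w (𝟙 T.X)) (𝟙 _) = tmap w (𝟙 T.X) ≫ (T.extend W').μ := by
  refine tensor_hom_ext ?_ ?_
  · rw [← Category.assoc, inl_coact, Category.assoc, inl_tmap, ← Category.assoc, inl_tmap,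
      ← Category.assoc, inl_tmap, Category.assoc, Category.assoc, inl_coact]
  · rw [← Category.assoc, inr_coact, Category.assoc, ← tmap_comp, inr_tmap, ← Category.assoc,
      inr_tmap, Category.id_comp, Category.id_comp, inr_coact]

theorem Iso.inl_hom {W : CDGA k} {S T : Deformation P A} (f : Iso W S T) :
    inl W S.T.X ≫ f.hom = inl W T.T.X := by
  have := congrArg (inl W _ ≫ ·) f.base
  simpa [← Category.assoc] using this

/-- Extension of scalars of isomorphisms along `w : W ⟶ W'`. -/
def Iso.baseChange {W W' : CDGA k} (w : W ⟶ W') {S T : Deformation P A} (f : Iso W S T) :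
    Iso W' S T where
  hom := extHom w f.hom
  base := by
    refine tensor_hom_ext ?_ ?_
    · rw [← Category.assoc, inl_tmap, Category.id_comp, inl_extHom, inl_tmap, Category.id_comp]
    · have := congrArg (fun g => inr W _ ≫ g ≫ tmap w (𝟙 T.T.X)) f.base
      simp only [← Category.assoc, inr_tmap] at this
      simp only [Category.assoc, inr_tmap, Category.id_comp] at this
      rw [← Category.assoc, inr_tmap, Category.assoc, inr_extHom, this, inr_tmap]
  equivariant := by
    refine tensor_hom_ext ?_ ?_
    · rw [← Category.assoc, inl_coact, Category.assoc, inl_tmap, ← Category.assoc, inl_extHom,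
        ← Category.assoc, inl_extHom, inl_coact]
    · have h0 : (S.T.extend W).μ ≫ tmap f.hom (𝟙 _) ≫ tmap (tmap w (𝟙 T.T.X)) (𝟙 _) =
          f.hom ≫ tmap w (𝟙 T.T.X) ≫ (T.T.extend W').μ := by
        rw [← Category.assoc, f.equivariant, Category.assoc, extend_coact]
      have h1 : inr W S.T.X ≫ f.hom ≫ tmap w (𝟙 T.T.X) ≫ (T.T.extend W').μ =
          S.T.μ ≫ tmap (inr W S.T.X) (𝟙 _) ≫ tmap f.hom (𝟙 _) ≫ tmap (tmap w (𝟙 T.T.X)) (𝟙 _) := by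
        rw [← h0, ← Category.assoc, inr_coact, Category.assoc]
      have h2 : inr W' S.T.X ≫ (S.T.extend W').μ ≫ tmap (extHom w f.hom) (𝟙 _) =
          S.T.μ ≫ tmap (inr W' S.T.X) (𝟙 _) ≫ tmap (extHom w f.hom) (𝟙 _) := by
        rw [← Category.assoc, inr_coact, Category.assoc]
      refine h2.trans (Eq.trans ?_ (h1.symm.trans ?_))
      · rw [← tmap_comp, inr_extHom, Category.id_comp, ← tmap_comp, ← tmap_comp,
          Category.id_comp, Category.id_comp]
      · rw [← Category.assoc (inr W' _) (extHom _ _), inr_extHom]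
        simp only [Category.assoc]
  triv := by
    have := extHom_tmap w f.hom (𝟙 _) S.τ T.τ (by rw [f.triv, Category.comp_id])
    rwa [extHom_id, Category.comp_id] at this
  isIso := by
    have := f.isIso
    have h : inl W T.T.X ≫ inv f.hom = inl W S.T.X := by
      rw [IsIso.comp_inv_eq, f.inl_hom]
    refine ⟨extHom w (inv f.hom), ?_, ?_⟩
    · rw [← extHom_comp _ _ _ h, IsIso.hom_inv_id, extHom_id]
    · rw [← extHom_comp _ _ _ f.inl_hom, IsIso.inv_hom_id, extHom_id]

end Deformation

/-- A cartesian section over the category of Artinian dg algebras under `A` of the category of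
deformations of `P`: a deformation over `A` with a compatible choice of all its base changes.
Evaluation at `𝟙 A` is an equivalence from cartesian sections to deformations over `A`. In contrast
to deformations, for which base change is functorial up to canonical isomorphism only, cartesian
sections are strictly functorial in `A`. -/
structure Sec (P : CoactAlg R B) (A : DGArt k) : Type (u + 1) where
  obj : ∀ U : Under A, Deformation P U.right
  map : ∀ {U V : Under A} (_ : U ⟶ V), (obj U).T.X ⟶ (obj V).T.X
  base : ∀ {U V : Under A} (g : U ⟶ V),
    (obj U).T.x ≫ map g = tmap (DGArt.hom g.right) (𝟙 B) ≫ (obj V).T.x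
  equivariant : ∀ {U V : Under A} (g : U ⟶ V),
    (obj U).T.μ ≫ tmap (map g) (𝟙 _) = map g ≫ (obj V).T.μ
  triv : ∀ {U V : Under A} (g : U ⟶ V), map g ≫ (obj V).τ = (obj U).τ
  cartesian : ∀ {U V : Under A} (g : U ⟶ V),
    IsTensorSquare (tmap (DGArt.hom g.right) (𝟙 B)) (obj U).T.x (obj V).T.x (map g)
  map_id : ∀ U : Under A, map (𝟙 U) = 𝟙 _
  map_comp : ∀ {U V V' : Under A} (g : U ⟶ V) (h : V ⟶ V'), map (g ≫ h) = map g ≫ map h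

namespace Sec

variable {P : CoactAlg R B} {A A₁ A₂ : DGArt k}

/-- For a commutative dg algebra `W`, a compatible family of isomorphisms `W ⊗ S ≅ W ⊗ T`. -/
@[ext]
structure Hom (W : CDGA k) (S T : Sec P A) : Type (u + 1) where
  iso : ∀ U : Under A, Deformation.Iso W (S.obj U) (T.obj U)
  natural : ∀ {U V : Under A} (g : U ⟶ V),
    (iso U).hom ≫ tmap (𝟙 W) (T.map g) = tmap (𝟙 W) (S.map g) ≫ (iso V).hom

/-- The groupoid of cartesian sections with morphisms defined over `W`. -/
structure Cart (W : CDGA k) (P : CoactAlg R B) (A : DGArt k) : Type (u + 1) where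
  sec : Sec P A

instance (W : CDGA k) : Category.{u + 1} (Cart W P A) where
  Hom S T := Hom W S.sec T.sec
  id S := ⟨fun U => Deformation.Iso.refl W (S.sec.obj U),
    fun g => (Category.id_comp _).trans (Category.comp_id _).symm⟩
  comp f g := ⟨fun U => (f.iso U).trans (g.iso U), fun {U V} h => by
    change ((f.iso U).hom ≫ (g.iso U).hom) ≫ _ = _ ≫ (f.iso V).hom ≫ (g.iso V).hom
    rw [Category.assoc, g.natural, ← Category.assoc, f.natural, Category.assoc]⟩
  id_comp f := Hom.ext (funext fun U => Deformation.Iso.ext (Category.id_comp _))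
  comp_id f := Hom.ext (funext fun U => Deformation.Iso.ext (Category.comp_id _))
  assoc f g h := Hom.ext (funext fun U => Deformation.Iso.ext (Category.assoc _ _ _))

theorem cart_hom_ext {W : CDGA k} {S T : Cart W P A} {f g : S ⟶ T}
    (h : ∀ U, (Hom.iso f U).hom = (Hom.iso g U).hom) : f = g :=
  Hom.ext (funext fun U => Deformation.Iso.ext (h U))

/-- Extension of scalars along `w : W ⟶ W'`. -/
def extend {W W' : CDGA k} (w : W ⟶ W') (P : CoactAlg R B) (A : DGArt k) :
    Cart W P A ⥤ Cart W' P A where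
  obj S := ⟨S.sec⟩
  map f := ⟨fun U => (Hom.iso f U).baseChange w,
    fun g => extHom_tmap w _ _ _ _ (Hom.natural f g)⟩
  map_id _ := cart_hom_ext fun _ => extHom_id w
  map_comp _ g := cart_hom_ext fun U =>
    extHom_comp w _ _ (Deformation.Iso.inl_hom (Hom.iso g U))

/-- Base change of cartesian sections along `a : A ⟶ A₁`. -/
def pull (a : A ⟶ A₁) (S : Sec P A) : Sec P A₁ where
  obj U := S.obj ((Under.map a).obj U)
  map g := S.map ((Under.map a).map g)
  base g := S.base ((Under.map a).map g)
  equivariant g := S.equivariant ((Under.map a).map g)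
  triv g := S.triv ((Under.map a).map g)
  cartesian g := S.cartesian ((Under.map a).map g)
  map_id U := S.map_id ((Under.map a).obj U)
  map_comp g h := S.map_comp ((Under.map a).map g) ((Under.map a).map h)

theorem pull_id (S : Sec P A) : S.pull (𝟙 A) = S := rfl

theorem pull_comp (a : A ⟶ A₁) (b : A₁ ⟶ A₂) (S : Sec P A) :
    S.pull (a ≫ b) = (S.pull a).pull b := rfl

/-- Base change along `a : A ⟶ A₁`, as a functor. -/
def pullFunctor (W : CDGA k) (P : CoactAlg R B) (a : A ⟶ A₁) : Cart W P A ⥤ Cart W P A₁ where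
  obj S := ⟨S.sec.pull a⟩
  map f := ⟨fun U => Hom.iso f ((Under.map a).obj U),
    fun g => Hom.natural f ((Under.map a).map g)⟩
  map_id _ := rfl
  map_comp _ _ := rfl

/-- The functor assigning to `A` and `W` the groupoid of cartesian sections over `A`, with
morphisms defined over `W`. -/
def functor (P : CoactAlg R B) : DGArt k ⥤ CDGA k ⥤ Cat.{u + 1, u + 1} where
  obj A :=
    { obj := fun W => Cat.of (Cart W P A)
      map := fun w => (extend w P A).toCatHom
      map_id := fun W => by
        refine Cat.Hom.ext (CategoryTheory.Functor.ext (fun _ => rfl) fun S T f => ?_)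
        refine cart_hom_ext fun U => ?_
        refine (extHom_id' _ (Deformation.Iso.inl_hom (Hom.iso f U))).trans ?_
        exact ((Category.id_comp _).trans (Category.comp_id _)).symm
      map_comp := fun w w' => by
        refine Cat.Hom.ext (CategoryTheory.Functor.ext (fun _ => rfl) fun S T f => ?_)
        refine cart_hom_ext fun U => ?_
        refine (extHom_comp' w w' (Hom.iso f U).hom).trans ?_
        exact ((Category.id_comp _).trans (Category.comp_id _)).symm }
  map a :=
    { app := fun W => (pullFunctor W P a).toCatHom
      naturality := fun _ _ _ => rfl }
  map_id _ := rfl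
  map_comp _ _ := rfl

end Sec

/-- The simplicial set `[n] ↦ X_{n,n}` of a bisimplicial set `X`. -/
def diagonal : (SimplexCategoryᵒᵖ ⥤ SSet.{u}) ⥤ SSet.{u} where
  obj X :=
    { obj := fun n => (X.obj n).obj n
      map := fun {m n} f => (X.map f).app m ≫ (X.obj n).map f
      map_id := fun n => by simp
      map_comp := fun f g => by simp }
  map f := { app := fun n => (f.app n).app n }

/-- The simplicial deformation functor of `P`: the diagonal of the nerves of the groupoids of
deformations of `P`, with morphisms defined over `Ω_n`. -/
def deformationFunctor (P : CoactAlg R B) : DGArt k ⥤ SSet.{u + 1} :=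
  Sec.functor P ⋙ (Functor.whiskeringLeft _ _ _).obj (omega k) ⋙
    (Functor.whiskeringRight _ _ _).obj nerveFunctor ⋙ diagonal

end sections

/-! ### Dg Lie algebras and their nerves -/

section dgLie

open CDGA

/-- A dg Lie algebra over `k`. -/
structure DGLie (k : Type u) [Field k] : Type (u + 1) where
  carrier : Type u
  [addCommGroup : AddCommGroup carrier]
  [module : Module k carrier]
  deg : ℤ → Submodule k carrier
  [decomposition : Decomposition deg]
  d : carrier →ₗ[k] carrier
  bracket : carrier →ₗ[k] carrier →ₗ[k] carrier
  d_mem : ∀ (i : ℤ) (x : carrier), x ∈ deg i → d x ∈ deg (i + 1)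
  d_d : ∀ x : carrier, d (d x) = 0
  bracket_mem : ∀ (i j : ℤ) (x y : carrier), x ∈ deg i → y ∈ deg j → bracket x y ∈ deg (i + j)
  antisymm : ∀ (i j : ℤ) (x y : carrier), x ∈ deg i → y ∈ deg j →
    bracket x y = -(((-1 : ℤˣ) ^ (i * j)) • bracket y x)
  jacobi : ∀ (i j : ℤ) (x y z : carrier), x ∈ deg i → y ∈ deg j →
    bracket x (bracket y z) = bracket (bracket x y) z + ((-1 : ℤˣ) ^ (i * j)) • bracket y (bracket x z)
  leibniz : ∀ (i : ℤ) (x y : carrier), x ∈ deg i →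
    d (bracket x y) = bracket (d x) y + ((-1 : ℤˣ) ^ i) • bracket x (d y)

namespace DGLie

variable {k : Type u} [Field k]

instance : CoeSort (DGLie k) (Type u) := ⟨DGLie.carrier⟩

attribute [instance] DGLie.addCommGroup DGLie.module DGLie.decomposition

/-- A Lie algebra as a dg Lie algebra concentrated in degree zero. -/
def ofLie (L : Type u) [LieRing L] [LieAlgebra k L] : DGLie k where
  carrier := L
  deg := degZero
  d := 0
  bracket := (LieModule.toEnd k L L : L →ₗ[k] Module.End k L)
  d_mem i x _ := zero_mem _
  d_d x := rfl
  bracket_mem i j x y hx hy := by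
    rw [mem_degZero] at *
    rcases hx with rfl | rfl
    · rcases hy with rfl | rfl
      · exact Or.inl rfl
      · exact Or.inr (map_zero _)
    · exact Or.inr (by simp)
  antisymm i j x y hx hy := by
    rw [mem_degZero] at hx
    rcases hx with rfl | rfl
    · simp
    · simp
  jacobi i j x y z hx hy := by
    rw [mem_degZero] at hx
    rcases hx with rfl | rfl
    · simp
    · simp
  leibniz i x y _ := by simp

/-- The projection of a graded module onto its even part. -/
def evenPart {M : Type u} [AddCommGroup M] [Module k M] (deg : ℤ → Submodule k M)
    [Decomposition deg] : M →ₗ[k] M :=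
  DirectSum.toModule k ℤ M (fun i => if Even i then (deg i).subtype else 0) ∘ₗ
    (decomposeLinearEquiv deg).toLinearMap

theorem evenPart_apply {M : Type u} [AddCommGroup M] [Module k M] (deg : ℤ → Submodule k M)
    [Decomposition deg] {i : ℤ} {x : M} (hx : x ∈ deg i) :
    evenPart deg x = if Even i then x else 0 := by
  simp only [evenPart, LinearMap.comp_apply, LinearEquiv.coe_coe, decomposeLinearEquiv_apply,
    decompose_of_mem deg hx]
  rw [← DirectSum.lof_eq_of k, DirectSum.toModule_lof]
  split_ifs <;> rfl

section extension

variable (C C' : CDGA k) (L : DGLie k)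

/-- The differential `c ⊗ l ↦ dc ⊗ l + (-1)^{|c|} c ⊗ dl` of `C ⊗ L`. -/
def extD : C ⊗[k] L →ₗ[k] C ⊗[k] L :=
  TensorProduct.map C.d LinearMap.id + TensorProduct.map (signMap C.deg) L.d

/-- The bracket `[c ⊗ l, c' ⊗ l'] = (-1)^{|l||c'|} c c' ⊗ [l, l']` of `C ⊗ L`. -/
def extBracket : C ⊗[k] L →ₗ[k] C ⊗[k] L →ₗ[k] C ⊗[k] L :=
  TensorProduct.map₂ (LinearMap.mul k C) (L.bracket ∘ₗ evenPart L.deg) +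
    TensorProduct.map₂ ((LinearMap.mul k C).compl₂ (signMap C.deg))
      (L.bracket ∘ₗ (LinearMap.id - evenPart L.deg))

/-- The elements of degree `n` of `C ⊗ L`. -/
def extDeg (n : ℤ) : Submodule k (C ⊗[k] L) :=
  Submodule.span k {z | ∃ i j : ℤ, i + j = n ∧ ∃ c ∈ C.deg i, ∃ l ∈ L.deg j, z = c ⊗ₜ l}

variable {C C' L}

theorem extD_tmul {i : ℤ} {c : C} (hc : c ∈ C.deg i) (l : L) :
    extD C L (c ⊗ₜ l) = C.d c ⊗ₜ l + ((-1 : ℤˣ) ^ i) • (c ⊗ₜ[k] L.d l) := by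
  simp only [extD, LinearMap.add_apply, TensorProduct.map_tmul, signMap_apply _ hc,
    LinearMap.id_apply, Units.smul_def, TensorProduct.smul_tmul']

theorem extBracket_tmul {i j : ℤ} (c : C) {l : L} (hl : l ∈ L.deg i) {c' : C}
    (hc' : c' ∈ C.deg j) (l' : L) :
    extBracket C L (c ⊗ₜ l) (c' ⊗ₜ l') =
      ((-1 : ℤˣ) ^ (i * j)) • ((c * c') ⊗ₜ[k] L.bracket l l') := by
  simp only [extBracket, LinearMap.add_apply, TensorProduct.map₂_apply_tmul, LinearMap.comp_apply,
    LinearMap.sub_apply, LinearMap.id_apply, evenPart_apply _ hl]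
  rcases Int.even_or_odd i with h | h
  · have : (-1 : ℤˣ) ^ (i * j) = 1 := (h.mul_right j).neg_one_zpow
    simp [h, this]
  · have h' : ¬ Even i := Int.not_even_iff_odd.2 h
    have : (-1 : ℤˣ) ^ (i * j) = (-1) ^ j := by rw [zpow_mul, h.neg_one_zpow]
    rw [if_neg h', sub_zero, map_zero, TensorProduct.map_tmul, TensorProduct.map_tmul,
      LinearMap.zero_apply, TensorProduct.tmul_zero,
      zero_add, this, Units.smul_def, TensorProduct.smul_tmul', ← mul_smul_comm,
      ← Units.smul_def, ← signMap_apply C.deg hc']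
    rfl

theorem extD_map (f : C ⟶ C') (z : C ⊗[k] L) :
    extD C' L ((alg f).toLinearMap.rTensor L z) = (alg f).toLinearMap.rTensor L (extD C L z) := by
  induction z with
  | zero => simp
  | add x y hx hy => simp only [map_add, hx, hy]
  | tmul c l =>
    refine C.hom_induction (p := fun c => extD C' L ((alg f).toLinearMap.rTensor L (c ⊗ₜ l)) =
      (alg f).toLinearMap.rTensor L (extD C L (c ⊗ₜ l))) ?_ ?_ ?_ c
    · simp
    · intro x y hx hy
      simp only [TensorProduct.add_tmul, map_add, hx, hy]
    · intro i c hc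
      rw [extD_tmul hc, LinearMap.rTensor_tmul, AlgHom.toLinearMap_apply,
        extD_tmul (Hom.map_deg f i c hc)]
      simp only [map_add, Units.smul_def, map_zsmul, LinearMap.rTensor_tmul,
        AlgHom.toLinearMap_apply, Hom.map_d f]

theorem signMap_map (f : C ⟶ C') (c : C) :
    signMap C'.deg (alg f c) = alg f (signMap C.deg c) := by
  refine C.hom_induction (p := fun c => signMap C'.deg (alg f c) = alg f (signMap C.deg c))
    ?_ ?_ ?_ c
  · simp
  · intro x y hx hy
    simp only [map_add, hx, hy]
  · intro i c hc
    rw [signMap_apply _ hc, signMap_apply _ (Hom.map_deg f i c hc), Units.smul_def, Units.smul_def]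
    exact (map_zsmul (alg f) _ c).symm

theorem extBracket_map (f : C ⟶ C') (z w : C ⊗[k] L) :
    extBracket C' L ((alg f).toLinearMap.rTensor L z) ((alg f).toLinearMap.rTensor L w) =
      (alg f).toLinearMap.rTensor L (extBracket C L z w) := by
  induction z with
  | zero => simp
  | add x y hx hy => simp only [map_add, LinearMap.add_apply, hx, hy]
  | tmul c l =>
    induction w with
    | zero => simp
    | add x y hx hy => simp only [map_add, hx, hy]
    | tmul c' l' =>
      simp [extBracket, signMap_map]

theorem extDeg_map (f : C ⟶ C') {n : ℤ} {z : C ⊗[k] L} (hz : z ∈ extDeg C L n) :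
    (alg f).toLinearMap.rTensor L z ∈ extDeg C' L n := by
  refine Submodule.span_induction
    (p := fun z _ => (alg f).toLinearMap.rTensor L z ∈ extDeg C' L n) ?_ ?_ ?_ ?_ hz
  · rintro _ ⟨i, j, h, c, hc, l, hl, rfl⟩
    exact Submodule.subset_span ⟨i, j, h, _, Hom.map_deg f i c hc, l, hl, rfl⟩
  · rw [map_zero]; exact zero_mem _
  · intro x y _ _ hx hy
    rw [map_add]; exact add_mem hx hy
  · intro c x _ hx
    rw [map_smul]; exact Submodule.smul_mem _ _ hx

end extension

theorem rTensor_alg_comp {D C C' : CDGA k} (f : D ⟶ C) (g : C ⟶ C') (L : DGLie k) (z : D ⊗[k] L) :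
    (alg g).toLinearMap.rTensor L ((alg f).toLinearMap.rTensor L z) =
      (alg (f ≫ g)).toLinearMap.rTensor L z :=
  (LinearMap.rTensor_comp_apply L (alg g).toLinearMap (alg f).toLinearMap z).symm

/-- The subspace `m ⊗ W ⊗ L` of `A ⊗ W ⊗ L`, where `m` is the maximal ideal of `A`. -/
def maxPart (A : DGArt k) (W : CDGA k) (L : DGLie k) : Submodule k (tensor A.toCDGA W ⊗[k] L) :=
  Submodule.span k {z | ∃ a : A.toCDGA, alg A.aug a = 0 ∧
    ∃ (w : W) (l : L), z = (tmul a w : Tens A.toCDGA W) ⊗ₜ[k] l}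

/-- The Maurer-Cartan elements of `m ⊗ W ⊗ L`: the elements `z` of degree one such that
`dz + [z, z] / 2 = 0`. -/
def MC (A : DGArt k) (W : CDGA k) (L : DGLie k) : Set (tensor A.toCDGA W ⊗[k] L) :=
  {z | z ∈ maxPart A W L ∧ z ∈ extDeg (tensor A.toCDGA W) L 1 ∧
    extD (tensor A.toCDGA W) L z + (2⁻¹ : k) • extBracket (tensor A.toCDGA W) L z z = 0}

theorem MC_map {A A' : DGArt k} {W W' : CDGA k} (a : A ⟶ A') (w : W ⟶ W') (L : DGLie k)
    {z : tensor A.toCDGA W ⊗[k] L} (hz : z ∈ MC A W L) :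
    (alg (tmap (DGArt.hom a) w)).toLinearMap.rTensor L z ∈ MC A' W' L := by
  obtain ⟨h1, h2, h3⟩ := hz
  refine ⟨?_, extDeg_map _ h2, ?_⟩
  · refine Submodule.span_induction (p := fun z _ =>
      (alg (tmap (DGArt.hom a) w)).toLinearMap.rTensor L z ∈ maxPart A' W' L)
      ?_ ?_ ?_ ?_ h1
    · rintro _ ⟨b, hb, v, l, rfl⟩
      refine Submodule.subset_span ⟨alg (DGArt.hom a) b, ?_, alg w v, l, ?_⟩
      · have := congrArg (fun f => alg f b) (DGArt.map_aug a)
        exact this.trans hb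
      · exact congrArg (· ⊗ₜ[k] l) (alg_tmap (DGArt.hom a) w b v)
    · rw [map_zero]; exact zero_mem _
    · intro x y _ _ hx hy
      rw [map_add]; exact add_mem hx hy
    · intro c x _ hx
      rw [map_smul]; exact Submodule.smul_mem _ _ hx
  · rw [extD_map, extBracket_map, ← map_smul, ← map_add, h3, map_zero]

/-- The functor assigning to `A` and `W` the set of Maurer-Cartan elements of `m ⊗ W ⊗ L`. -/
def mcFunctor (L : DGLie k) : DGArt k ⥤ CDGA k ⥤ Type u where
  obj A :=
    { obj := fun W => MC A W L
      map := fun w => TypeCat.ofHom fun z => ⟨_, MC_map (𝟙 A) w L z.2⟩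
      map_id := fun W => by
        ext z
        change (alg (tmap (𝟙 A.toCDGA) (𝟙 W))).toLinearMap.rTensor L z.1 = z.1
        rw [tmap_id]
        exact LinearMap.congr_fun (LinearMap.rTensor_id L (tensor A.toCDGA W)) z.1
      map_comp := fun {W W' W''} w w' => by
        ext z
        change (alg (tmap (𝟙 A.toCDGA) (w ≫ w'))).toLinearMap.rTensor L z.1 =
          (alg (tmap (𝟙 A.toCDGA) w')).toLinearMap.rTensor L
            ((alg (tmap (𝟙 A.toCDGA) w)).toLinearMap.rTensor L z.1)
        rw [rTensor_alg_comp, ← tmap_comp, Category.id_comp] }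
  map {A A'} a :=
    { app := fun W => TypeCat.ofHom fun z => ⟨_, MC_map a (𝟙 W) L z.2⟩
      naturality := fun W W' w => by
        ext z
        change (alg (tmap (DGArt.hom a) (𝟙 W'))).toLinearMap.rTensor L
            ((alg (tmap (𝟙 A.toCDGA) w)).toLinearMap.rTensor L z.1) =
          (alg (tmap (𝟙 A'.toCDGA) w)).toLinearMap.rTensor L
            ((alg (tmap (DGArt.hom a) (𝟙 W))).toLinearMap.rTensor L z.1)
        rw [rTensor_alg_comp, rTensor_alg_comp, ← tmap_eq_comp', ← tmap_eq_comp] }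
  map_id A := by
    ext W z
    change (alg (tmap (𝟙 A.toCDGA) (𝟙 W))).toLinearMap.rTensor L z.1 = z.1
    rw [tmap_id]
    exact LinearMap.congr_fun (LinearMap.rTensor_id L (tensor A.toCDGA W)) z.1
  map_comp {A A' A''} a b := by
    ext W z
    change (alg (tmap (DGArt.hom a ≫ DGArt.hom b) (𝟙 W))).toLinearMap.rTensor L z.1 =
      (alg (tmap (DGArt.hom b) (𝟙 W))).toLinearMap.rTensor L
        ((alg (tmap (DGArt.hom a) (𝟙 W))).toLinearMap.rTensor L z.1)
    rw [rTensor_alg_comp, ← tmap_comp, Category.id_comp]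

/-- The nerve of a dg Lie algebra: the functor `A ↦ ([n] ↦ MC(m ⊗ Ω_n ⊗ L))`. -/
def nerve (L : DGLie k) : DGArt k ⥤ SSet.{u} :=
  mcFunctor L ⋙ (Functor.whiskeringLeft _ _ _).obj (omega k)

end DGLie

/-- The Lie algebra of the affine group scheme with algebra of functions `R`: the left invariant
derivations of `R`. -/
def lieAlgebra (k : Type u) [Field k] (R : Type u) [CommRing R] [HopfAlgebra k R] :
    LieSubalgebra k (Derivation k R R) where
  carrier := {D | Coalgebra.comul ∘ₗ (D : R →ₗ[k] R) =
    (D : R →ₗ[k] R).lTensor R ∘ₗ Coalgebra.comul}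
  zero_mem' := by simp
  add_mem' {D E} hD hE := by
    simp only [Set.mem_ofPred_eq, Derivation.coe_add_linearMap, LinearMap.comp_add,
      LinearMap.lTensor_add, LinearMap.add_comp] at *
    rw [hD, hE]
  smul_mem' c D hD := by
    simp only [Set.mem_ofPred_eq, Derivation.coe_smul_linearMap, LinearMap.comp_smul,
      LinearMap.lTensor_smul, LinearMap.smul_comp] at *
    rw [hD]
  lie_mem' {D E} hD hE := by
    simp only [Set.mem_ofPred_eq] at *
    have h (F : Derivation k R R) (hF : Coalgebra.comul ∘ₗ (F : R →ₗ[k] R) =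
      (F : R →ₗ[k] R).lTensor R ∘ₗ Coalgebra.comul) (x : R) :
      Coalgebra.comul (R := k) (F x) = (F : R →ₗ[k] R).lTensor R (Coalgebra.comul x) :=
        LinearMap.congr_fun hF x
    ext x
    have e : ((⁅D, E⁆ : Derivation k R R) : R →ₗ[k] R) =
      (D : R →ₗ[k] R) ∘ₗ (E : R →ₗ[k] R) - (E : R →ₗ[k] R) ∘ₗ (D : R →ₗ[k] R) := by
      ext y; exact Derivation.commutator_apply y
    rw [e]
    simp only [LinearMap.comp_sub, LinearMap.lTensor_sub, LinearMap.lTensor_comp,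
      LinearMap.sub_comp, LinearMap.sub_apply, LinearMap.comp_apply, Derivation.coeFn_coe, h D hD,
      h E hE]

end dgLie

/-- A map of simplicial sets is a homotopy equivalence if it has a homotopy inverse. -/
def IsHomotopyEquivalence {X Y : SSet.{u}} (f : X ⟶ Y) : Prop :=
  ∃ g : Y ⟶ X, Nonempty (SSet.Homotopy (f ≫ g) (𝟙 X)) ∧ Nonempty (SSet.Homotopy (g ≫ f) (𝟙 Y))

/-- Two functors to simplicial sets are naturally equivalent if they are connected by a chain of
natural transformations, in either direction, which are objectwise homotopy equivalences. -/
def NaturallyEquivalent {C : Type*} [Category C] (F G : C ⥤ SSet.{u}) : Prop :=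
  Relation.EqvGen (fun F G : C ⥤ SSet.{u} =>
    ∃ α : F ⟶ G, ∀ A : C, IsHomotopyEquivalence (α.app A)) F G

end DG

end

noncomputable section

namespace DG

/-! ### Coordinates at the identity of an affine algebraic group in characteristic zero -/

section coords

variable {k R : Type u} [Field k] [CommRing R] [HopfAlgebra k R]

/-! In characteristic zero an affine algebraic group is smooth at the identity (Cartier). With I the
augmentation ideal, `Coords.exists_aeval` and `Coords.mem_pow_of_aeval_mem` say that k[x]/(x)^N →
R/I^N is bijective for suitable functions x. So if C is a dg algebra with a nilpotent filtration F,
the group `Pt` of algebra maps from R to the degree zero part of C that are trivial modulo F 1 is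
parametrized by tuples of coordinates, and an equation on it which is the identity to first order
has exactly one solution (`Pt.exists_unique_of_approx`). This replaces exponentials and the
Campbell-Hausdorff series throughout.

Take C = Ω_n ⊗ A ⊗ B. The logarithmic derivative z = g⁻¹dg of a point, formed in the convolution
algebra Hom(R, C), satisfies dz + z * z = 0 (`Pt.form_isMC`). Such z are the same as the
Maurer-Cartan elements of m ⊗ Ω_n ⊗ (B ⊗ g) (`mcConv_isMC`, `mcConv_injective`, `exists_mcConv`).
Points g, h with the same logarithmic derivative differ by a closed point gh⁻¹
(`Pt.closed_of_form_eq`), and closed points are the automorphisms over Ω_n of the trivial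
deformation (`autPt_injective`, `autPt_ptOf`).

From Maurer-Cartan elements to deformations: the Poincaré contraction of the n-simplex to a vertex v
singles out one point g_v with logarithmic derivative z (`exists_unique_gauge`, `form_gauge`). The
closed points g_i g_j⁻¹ are the arrows of a chain of n automorphisms of the trivial object, an
n-simplex of the diagonal. The contraction to a vertex commutes with affine maps which respect the
vertex (`omegaRetract_omegaMap`), and the normalized point is unique, so the construction is
simplicial and natural in A. This is `mcToDeformation`.

For a homotopy inverse at a fixed A, every object must first be trivialized. A torsor over A ⊗ B
that reduces to the trivial one has a section reducing to the neutral section: Newton's method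
solves the equations of the torsor, and flatness shows that the solution respects all relations
(`exists_section`). After choosing trivializations, a chain of isomorphisms becomes a closed
cocycle. It is written as e_i e_j⁻¹ in exactly one way subject to the vanishing of the barycenter ∑
t_i x_l(e_i) (`exists_frame`). The e_i share one logarithmic derivative, and this is the
Maurer-Cartan element of the chain. The barycenter condition is preserved by all simplicial
operators (`frame_extend`), so the inverse is a simplicial map; it depends on choices and need not
be natural in A.

Both homotopies are explicit on an n-simplex τ of Δ[1], read as a labelling of the vertices by 0 and
1. On chains, the object and its point at a vertex are replaced by the trivial object and g_v
exactly where the label is 0 (`chainHomotopy`). On Maurer-Cartan elements, the families g_i and e_i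
attached to z differ by one common right factor h (`comparison_eq`), and the coordinates of h are
multiplied by the sum of the t_i with label 0 (`interpolation`). -/

variable (k R) in
/-- The augmentation ideal of a Hopf algebra. -/
def augIdeal : Ideal R := RingHom.ker (Bialgebra.counitAlgHom k R)

theorem mem_augIdeal {r : R} : r ∈ augIdeal k R ↔ Coalgebra.counit (R := k) r = 0 := Iff.rfl

theorem sub_counit_mem (r : R) :
    r - algebraMap k R (Coalgebra.counit r) ∈ augIdeal k R := by
  rw [mem_augIdeal, map_sub, Bialgebra.counit_algebraMap, sub_self]

/-- A derivation over the counit with values in a vector space. -/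
def IsEpsDer {V : Type u} [AddCommGroup V] [Module k V] (φ : R →ₗ[k] V) : Prop :=
  ∀ r s : R, φ (r * s) = (Coalgebra.counit (R := k) r) • φ s + (Coalgebra.counit (R := k) s) • φ r

namespace IsEpsDer

variable {V : Type u} [AddCommGroup V] [Module k V] {φ : R →ₗ[k] V}

theorem map_one (h : IsEpsDer φ) : φ 1 = 0 := by
  have := h 1 1
  simpa using this

theorem map_algebraMap (h : IsEpsDer φ) (c : k) : φ (algebraMap k R c) = 0 := by
  rw [Algebra.algebraMap_eq_smul_one, map_smul, h.map_one, smul_zero]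

theorem map_sq (h : IsEpsDer φ) {r : R} (hr : r ∈ augIdeal k R ^ 2) : φ r = 0 := by
  rw [pow_two] at hr
  refine Submodule.mul_induction_on hr (fun a ha b hb => ?_) (fun a b ha hb => ?_)
  · rw [mem_augIdeal] at ha hb
    rw [h, ha, hb, zero_smul, zero_smul, add_zero]
  · rw [map_add, ha, hb, add_zero]

end IsEpsDer

/-- The left invariant derivation `r ↦ r₁ φ(r₂)` given by a derivation over the counit. -/
def invDer (φ : R →ₗ[k] k) (h : IsEpsDer φ) : Derivation k R R :=
  Derivation.mk' (TensorProduct.lift ((LinearMap.lsmul k R).flip.compl₂ φ) ∘ₗ Coalgebra.comul)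
    (fun r s => by
      -- The map id ⊗ φ on R ⊗ R is a derivation along id ⊗ ε. Precomposing with the multiplicative
      -- map Δ and using the counit law turns this into the Leibniz rule on R.
      have h1 : ∀ z w : R ⊗[k] R, TensorProduct.lift ((LinearMap.lsmul k R).flip.compl₂ φ) (z * w) =
          TensorProduct.lift ((LinearMap.lsmul k R).flip.compl₂ (Coalgebra.counit (R := k))) z *
            TensorProduct.lift ((LinearMap.lsmul k R).flip.compl₂ φ) w +
          TensorProduct.lift ((LinearMap.lsmul k R).flip.compl₂ (Coalgebra.counit (R := k))) w *
            TensorProduct.lift ((LinearMap.lsmul k R).flip.compl₂ φ) z := by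
        intro z w
        induction z with
        | zero => simp
        | add x y hx hy => rw [add_mul, map_add, hx, hy, map_add, map_add]; ring
        | tmul a b =>
          induction w with
          | zero => simp
          | add x y hx hy => rw [mul_add, map_add, hx, hy, map_add, map_add]; ring
          | tmul a' b' =>
            simp only [Algebra.TensorProduct.tmul_mul_tmul, TensorProduct.lift.tmul,
              LinearMap.compl₂_apply, LinearMap.flip_apply, LinearMap.lsmul_apply, h b b',
              Algebra.smul_def, map_add, map_mul, Algebra.algebraMap_self, RingHom.id_apply]
            ring
      have h2 : ∀ r : R, TensorProduct.lift ((LinearMap.lsmul k R).flip.compl₂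
          (Coalgebra.counit (R := k))) (Coalgebra.comul r) = r := by
        intro r
        have e : TensorProduct.lift ((LinearMap.lsmul k R).flip.compl₂
            (Coalgebra.counit (R := k) (A := R))) =
            (TensorProduct.rid k R).toLinearMap ∘ₗ (Coalgebra.counit (R := k) (A := R)).lTensor R := by
          ext a b; simp
        rw [e, LinearMap.comp_apply, Coalgebra.lTensor_counit_comul]
        simp
      simp only [LinearMap.comp_apply, Bialgebra.comul_mul, h1, h2, smul_eq_mul])

theorem invDer_apply (φ : R →ₗ[k] k) (h : IsEpsDer φ) (r : R) :
    invDer φ h r = TensorProduct.rid k R (φ.lTensor R (Coalgebra.comul r)) := by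
  change (TensorProduct.lift ((LinearMap.lsmul k R).flip.compl₂ φ)) (Coalgebra.comul r) = _
  have e : TensorProduct.lift ((LinearMap.lsmul k R).flip.compl₂ φ) =
      (TensorProduct.rid k R).toLinearMap ∘ₗ φ.lTensor R := by
    ext a b; simp
  exact LinearMap.congr_fun e _

/-- By the counit law, ε(r₁)φ(r₂) = φ(ε(r₁)r₂) = φ(r). -/
theorem counit_invDer (φ : R →ₗ[k] k) (h : IsEpsDer φ) (r : R) :
    Coalgebra.counit (R := k) (invDer φ h r) = φ r := by
  rw [invDer_apply]
  have e : (Coalgebra.counit (R := k) (A := R)) ∘ₗ (TensorProduct.rid k R).toLinearMap ∘ₗ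
      φ.lTensor R = φ ∘ₗ (TensorProduct.lid k R).toLinearMap ∘ₗ
        (Coalgebra.counit (R := k) (A := R)).rTensor R := by
    ext a b; simp [mul_comm]
  refine (LinearMap.congr_fun e (Coalgebra.comul r)).trans ?_
  simp

/-- This is coassociativity: Δ(r₁)φ(r₂) = r₁ ⊗ r₂φ(r₃). -/
theorem invDer_mem (φ : R →ₗ[k] k) (h : IsEpsDer φ) : invDer φ h ∈ lieAlgebra k R := by
  change Coalgebra.comul ∘ₗ (invDer φ h : R →ₗ[k] R) =
    (invDer φ h : R →ₗ[k] R).lTensor R ∘ₗ Coalgebra.comul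
  have e0 : (invDer φ h : R →ₗ[k] R) =
      (TensorProduct.rid k R).toLinearMap ∘ₗ φ.lTensor R ∘ₗ Coalgebra.comul :=
    LinearMap.ext fun r => invDer_apply φ h r
  have e1 : Coalgebra.comul ∘ₗ (TensorProduct.rid k R).toLinearMap ∘ₗ φ.lTensor R =
      ((TensorProduct.rid k R).toLinearMap ∘ₗ φ.lTensor R).lTensor R ∘ₗ
        (TensorProduct.assoc k R R R).toLinearMap ∘ₗ (Coalgebra.comul (R := k) (A := R)).rTensor R := by
    refine TensorProduct.ext' fun a b => ?_
    simp only [LinearMap.comp_apply, LinearMap.lTensor_tmul, LinearMap.rTensor_tmul,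
      LinearEquiv.coe_coe, TensorProduct.rid_tmul, map_smul]
    induction Coalgebra.comul (R := k) a with
    | zero => simp
    | add x y hx hy => rw [smul_add, hx, hy, TensorProduct.add_tmul, map_add, map_add]
    | tmul c d => simp
  refine LinearMap.ext fun r => ?_
  rw [e0, LinearMap.comp_apply]
  have h1 := LinearMap.congr_fun e1 (Coalgebra.comul r)
  simp only [LinearMap.comp_apply] at h1 ⊢
  rw [h1]
  simp only [LinearEquiv.coe_coe, Coalgebra.coassoc_apply]
  rw [← LinearMap.lTensor_comp_apply]
  rfl

theorem lieAlgebra_comul (D : lieAlgebra k R) (r : R) :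
    Coalgebra.comul (R := k) (D.1 r) = (D.1 : R →ₗ[k] R).lTensor R (Coalgebra.comul r) :=
  LinearMap.congr_fun (show Coalgebra.comul ∘ₗ (D.1 : R →ₗ[k] R) =
    (D.1 : R →ₗ[k] R).lTensor R ∘ₗ Coalgebra.comul from D.2) r

/-- The derivation over the counit given by a left invariant derivation. -/
def epsDer (D : lieAlgebra k R) : R →ₗ[k] k := Coalgebra.counit ∘ₗ (D.1 : R →ₗ[k] R)

theorem epsDer_isEpsDer (D : lieAlgebra k R) : IsEpsDer (epsDer D) := by
  intro r s
  simp [epsDer, Derivation.leibniz]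

/-- Apply id ⊗ ε to the invariance equation. So an invariant derivation is determined by its
composite with the counit, which is what makes the Lie algebra finite dimensional and computable in
coordinates. -/
theorem lieAlgebra_apply (D : lieAlgebra k R) (r : R) :
    D.1 r = TensorProduct.rid k R ((epsDer D).lTensor R (Coalgebra.comul r)) := by
  have h := congrArg (fun z => TensorProduct.rid k R
    ((Coalgebra.counit (R := k) (A := R)).lTensor R z)) (lieAlgebra_comul D r)
  simp only [Coalgebra.lTensor_counit_comul, TensorProduct.rid_tmul, one_smul] at h
  rw [h, ← LinearMap.lTensor_comp_apply]
  rfl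

theorem epsDer_injective {D E : lieAlgebra k R} (h : epsDer D = epsDer E) : D = E := by
  apply Subtype.ext
  ext r
  rw [lieAlgebra_apply, lieAlgebra_apply, h]

/-- Composition of invariant derivations is convolution of the corresponding functionals. Hence the
Lie bracket becomes a commutator of convolution products, the form in which it is compared with the
term z * z of the Maurer-Cartan equation. -/
theorem epsDer_comp (D E : lieAlgebra k R) (r : R) :
    Coalgebra.counit (R := k) (D.1 (E.1 r)) =
      TensorProduct.lift ((LinearMap.mul k k).compl₁₂ (epsDer D) (epsDer E))
        (Coalgebra.comul r) := by
  rw [lieAlgebra_apply E]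
  have e : (Coalgebra.counit (R := k) (A := R)) ∘ₗ (D.1 : R →ₗ[k] R) ∘ₗ
      (TensorProduct.rid k R).toLinearMap ∘ₗ (epsDer E).lTensor R =
      TensorProduct.lift ((LinearMap.mul k k).compl₁₂ (epsDer D) (epsDer E)) := by
    ext a b; simp [epsDer, mul_comm]
  exact LinearMap.congr_fun e (Coalgebra.comul r)

theorem epsDer_lie (D E : lieAlgebra k R) (r : R) :
    epsDer ⁅D, E⁆ r =
      TensorProduct.lift ((LinearMap.mul k k).compl₁₂ (epsDer D) (epsDer E)) (Coalgebra.comul r) -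
      TensorProduct.lift ((LinearMap.mul k k).compl₁₂ (epsDer E) (epsDer D))
        (Coalgebra.comul r) := by
  rw [← epsDer_comp, ← epsDer_comp, ← map_sub]
  exact congrArg (Coalgebra.counit (R := k)) (Derivation.commutator_apply (D1 := D.1) (D2 := E.1) r)

variable (k R) in
/-- Functions on an affine group which form a coordinate system at the identity, together with the
dual basis of its Lie algebra. -/
structure Coords where
  n : ℕ
  x : Fin n → R
  D : Fin n → lieAlgebra k R
  counit_x : ∀ i, Coalgebra.counit (R := k) (x i) = 0
  dual : ∀ i j, epsDer (D i) (x j) = if i = j then 1 else 0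
  sq : ∀ r, Coalgebra.counit (R := k) r = 0 → ∃ a : Fin n → k,
    r - ∑ l, a l • x l ∈ augIdeal k R ^ 2

/-- The cotangent space I/I² is spanned by the classes of g - ε(g) for the finitely many generators
g. Lifting a basis gives the coordinates, and the dual basis composed with r ↦ r - ε(r) consists of
derivations along ε, that is, of invariant derivations. Subtracting from each g - ε(g) its linear
part leaves the elements of I² which complete the coordinates to a generating system. -/
theorem exists_coords [Algebra.FiniteType k R] : ∃ (c : Coords k R) (m : ℕ) (y : Fin m → R),
    (∀ j, y j ∈ augIdeal k R ^ 2) ∧ Algebra.adjoin k (Set.range c.x ∪ Set.range y) = ⊤ := by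
  obtain ⟨s, hs⟩ := Algebra.FiniteType.out (R := k) (A := R)
  let ε : R →ₗ[k] k := Coalgebra.counit
  let z : s → R := fun g => g.1 - algebraMap k R (ε g.1)
  have hz : ∀ g, z g ∈ augIdeal k R := fun g => sub_counit_mem _
  let q : R →ₗ[k] R ⧸ (augIdeal k R ^ 2) := (Ideal.Quotient.mkₐ k _).toLinearMap
  have hq : ∀ r, q r = 0 ↔ r ∈ augIdeal k R ^ 2 := fun r => Ideal.Quotient.eq_zero_iff_mem
  let U : Submodule k (R ⧸ (augIdeal k R ^ 2)) := Submodule.span k (Set.range (q ∘ z))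
  -- Modulo I², the map r ↦ r - ε(r) is a derivation along ε, so it is enough to know its values on
  -- generators.
  have hgen : ∀ r : R, q (r - algebraMap k R (ε r)) ∈ U := by
    intro r
    have hr : r ∈ Algebra.adjoin k (s : Set R) := by rw [hs]; trivial
    induction hr using Algebra.adjoin_induction with
    | mem x hx => exact Submodule.subset_span ⟨⟨x, hx⟩, rfl⟩
    | algebraMap c => simp [ε, Bialgebra.counit_algebraMap]
    | add a b _ _ ha hb =>
      have : a + b - algebraMap k R (ε (a + b)) =
        (a - algebraMap k R (ε a)) + (b - algebraMap k R (ε b)) := by rw [map_add, map_add]; ring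
      rw [this, map_add]; exact add_mem ha hb
    | mul a b _ _ ha hb =>
      have e1 : ε (a * b) = ε a * ε b := Bialgebra.counit_mul a b
      have : a * b - algebraMap k R (ε (a * b)) =
        (a - algebraMap k R (ε a)) * (b - algebraMap k R (ε b)) +
          (ε a • (b - algebraMap k R (ε b)) + ε b • (a - algebraMap k R (ε a))) := by
        rw [e1, map_mul, Algebra.smul_def, Algebra.smul_def]; ring
      rw [this, map_add, (hq _).2 (by
        rw [pow_two]; exact Ideal.mul_mem_mul (sub_counit_mem a) (sub_counit_mem b)), zero_add,
        map_add, map_smul, map_smul]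
      exact add_mem (Submodule.smul_mem _ _ hb) (Submodule.smul_mem _ _ ha)
  have : Module.Finite k U := Module.Finite.span_of_finite k (Set.finite_range _)
  let b := Module.finBasis k U
  have hlift : ∀ i, ∃ x ∈ augIdeal k R, q x = b i := by
    intro i
    have : ∀ u ∈ U, ∃ x ∈ augIdeal k R, q x = u := by
      intro u hu
      induction hu using Submodule.span_induction with
      | mem u hu => obtain ⟨g, rfl⟩ := hu; exact ⟨z g, hz g, rfl⟩
      | zero => exact ⟨0, zero_mem _, map_zero _⟩
      | add u v _ _ hu hv =>
        obtain ⟨x, hx, rfl⟩ := hu; obtain ⟨y, hy, rfl⟩ := hv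
        exact ⟨x + y, add_mem hx hy, map_add _ _ _⟩
      | smul c u _ hu =>
        obtain ⟨x, hx, rfl⟩ := hu
        exact ⟨c • x, Submodule.smul_of_tower_mem _ _ hx, map_smul _ _ _⟩
    exact this _ (b i).2
  choose x hx hxb using hlift
  let π : R →ₗ[k] U := LinearMap.codRestrict U
    (q ∘ₗ (LinearMap.id - Algebra.linearMap k R ∘ₗ ε)) (fun r => hgen r)
  have hπ : ∀ r, (π r : R ⧸ (augIdeal k R ^ 2)) = q (r - algebraMap k R (ε r)) := fun r => rfl
  have hπder : IsEpsDer π := by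
    intro r s
    apply Subtype.ext
    change q _ = ε r • q _ + ε s • q _
    rw [← map_smul q, ← map_smul q, ← map_add q, ← sub_eq_zero, ← map_sub q, hq]
    have e1 : ε (r * s) = ε r * ε s := Bialgebra.counit_mul r s
    have : (r * s - algebraMap k R (ε (r * s))) - (ε r • (s - algebraMap k R (ε s)) +
        ε s • (r - algebraMap k R (ε r))) =
        (r - algebraMap k R (ε r)) * (s - algebraMap k R (ε s)) := by
      rw [e1, map_mul, Algebra.smul_def, Algebra.smul_def]; ring
    change (r * s - algebraMap k R (ε (r * s))) - (ε r • (s - algebraMap k R (ε s)) +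
        ε s • (r - algebraMap k R (ε r))) ∈ _
    rw [this, pow_two]
    exact Ideal.mul_mem_mul (sub_counit_mem r) (sub_counit_mem s)
  have hder : ∀ i, IsEpsDer (b.coord i ∘ₗ π) := by
    intro i r s
    simp only [LinearMap.comp_apply, hπder r s, map_add, map_smul]
  have hπx : ∀ j, π (x j) = b j := by
    intro j
    apply Subtype.ext
    have : ε (x j) = 0 := hx j
    rw [hπ, this, map_zero, sub_zero, hxb]
  have hsq : ∀ r, ε r = 0 → r - ∑ l, b.repr (π r) l • x l ∈ augIdeal k R ^ 2 := by
    intro r hr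
    rw [← hq, map_sub, map_sum, sub_eq_zero]
    have h1 := congrArg Subtype.val (b.sum_repr (π r))
    rw [hπ, hr, map_zero, sub_zero] at h1
    rw [← h1]
    simp only [Submodule.coe_sum, Submodule.coe_smul, map_smul, hxb]
  let c : Coords k R :=
    { n := Module.finrank k U
      x := x
      D := fun i => ⟨invDer _ (hder i), invDer_mem _ _⟩
      counit_x := hx
      dual := fun i j => by
        refine (counit_invDer _ (hder i) (x j)).trans ?_
        simp [hπx, Finsupp.single_apply, eq_comm]
      sq := fun r hr => ⟨_, hsq r hr⟩ }
  let e := Fintype.equivFin s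
  refine ⟨c, _, fun j => z (e.symm j) - ∑ l, b.repr (π (z (e.symm j))) l • x l,
    fun j => hsq _ (hz _), ?_⟩
  rw [eq_top_iff, ← hs]
  refine Algebra.adjoin_le fun g hg => ?_
  set T : Subalgebra k R := Algebra.adjoin k (Set.range c.x ∪ Set.range
    (fun j : Fin (Fintype.card s) => z (e.symm j) - ∑ l, b.repr (π (z (e.symm j))) l • x l))
  have h1 : z ⟨g, hg⟩ - ∑ l, b.repr (π (z ⟨g, hg⟩)) l • x l ∈ T :=
    Algebra.subset_adjoin (Set.mem_union_right _ ⟨e ⟨g, hg⟩, by simp⟩)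
  have h2 : ∑ l, b.repr (π (z ⟨g, hg⟩)) l • x l ∈ T :=
    sum_mem fun l _ => T.smul_mem (Algebra.subset_adjoin (Set.mem_union_left _ ⟨l, rfl⟩)) _
  have h3 := add_mem (add_mem h1 h2) (Subalgebra.algebraMap_mem T (ε g))
  simpa [z] using h3

end coords

end DG

/-! ### The formal group as a formal affine space, and local equations at the identity. -/

namespace DG

section adic

variable {k T : Type u} [Field k] [CommRing T] [Algebra k T] {n : ℕ}

/-- If the images of the variables generate an ideal of residue field `k` up to its square, then the
polynomials are dense in the adic topology. -/
theorem exists_poly_sub_mem_pow (φ : MvPolynomial (Fin n) k →ₐ[k] T) (I : Ideal T)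
    (h0 : ∀ t : T, ∃ c : k, t - algebraMap k T c ∈ I) (hX : ∀ i, φ (MvPolynomial.X i) ∈ I)
    (h1 : ∀ t ∈ I, ∃ q ∈ MvPolynomial.idealOfVars (Fin n) k, t - φ q ∈ I ^ 2) (N : ℕ) (t : T) :
    ∃ p, t - φ p ∈ I ^ N := by
  have hφ : Ideal.map φ (MvPolynomial.idealOfVars (Fin n) k) ≤ I := by
    rw [Ideal.map_span, Ideal.span_le]
    rintro _ ⟨_, ⟨i, rfl⟩, rfl⟩
    exact hX i
  have hφN : ∀ N, ∀ p ∈ MvPolynomial.idealOfVars (Fin n) k ^ N, φ p ∈ I ^ N := fun N p hp =>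
    Ideal.pow_right_mono hφ N (by rw [← Ideal.map_pow]; exact Ideal.mem_map_of_mem φ hp)
  -- An element of I^N is approximated to one order more by a polynomial of order N: for a product,
  -- approximate both factors. Adding up such corrections gives the approximation of an arbitrary
  -- element.
  have key : ∀ N, ∀ t ∈ I ^ N, ∃ p ∈ MvPolynomial.idealOfVars (Fin n) k ^ N,
      t - φ p ∈ I ^ (N + 1) := by
    intro N
    induction N with
    | zero =>
      intro t _
      obtain ⟨c, hc⟩ := h0 t
      exact ⟨MvPolynomial.C c, by simp, by simpa [MvPolynomial.algHom_C] using hc⟩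
    | succ N ih =>
      intro t ht
      rw [pow_succ] at ht
      refine Submodule.mul_induction_on ht (fun a ha b hb => ?_) (fun a b ha hb => ?_)
      · obtain ⟨p, hp, hap⟩ := ih a ha
        obtain ⟨q, hq, hbq⟩ := h1 b hb
        refine ⟨p * q, by rw [pow_succ]; exact Ideal.mul_mem_mul hp hq, ?_⟩
        have e : a * b - φ (p * q) = a * (b - φ q) + (a - φ p) * φ q := by rw [map_mul]; ring
        rw [e]
        refine add_mem ?_ ?_
        · rw [show N + 1 + 1 = N + 2 by ring, pow_add]; exact Ideal.mul_mem_mul ha hbq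
        · rw [pow_succ]; exact Ideal.mul_mem_mul hap (by simpa using hφN 1 q (by simpa using hq))
      · obtain ⟨p, hp, hap⟩ := ha
        obtain ⟨q, hq, hbq⟩ := hb
        refine ⟨p + q, add_mem hp hq, ?_⟩
        have e : a + b - φ (p + q) = (a - φ p) + (b - φ q) := by rw [map_add]; ring
        rw [e]; exact add_mem hap hbq
  induction N with
  | zero => exact ⟨0, by simp⟩
  | succ N ih =>
    obtain ⟨p, hp⟩ := ih
    obtain ⟨q, _, hq⟩ := key N _ hp
    refine ⟨p + q, ?_⟩
    rwa [map_add, ← sub_sub]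

end adic

section coords

open MvPolynomial

variable {k R : Type u} [Field k] [CommRing R] [HopfAlgebra k R]

theorem pderiv_aeval {n : ℕ} (x : Fin n → R) (D : Derivation k R R) (p : MvPolynomial (Fin n) k) :
    D (aeval x p) = ∑ l, aeval x (pderiv l p) * D (x l) := by
  induction p using MvPolynomial.induction_on with
  | C a => simp [algHom_C]
  | add p q hp hq => simp only [map_add, hp, hq, add_mul, Finset.sum_add_distrib]
  | mul_X p i hp =>
    simp only [map_mul, Derivation.leibniz, hp, aeval_X, map_add, smul_eq_mul, add_mul,
      Finset.sum_add_distrib, pderiv_X, Pi.single_apply, Finset.mul_sum]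
    congr 1
    · rw [Finset.sum_eq_single i]
      · simp
      · intro b _ hb; simp [hb.symm]
      · simp
    · exact Finset.sum_congr rfl fun l _ => by ring

theorem derivation_mem_pow (D : Derivation k R R) (I : Ideal R) (N : ℕ) {r : R}
    (hr : r ∈ I ^ (N + 1)) : D r ∈ I ^ N := by
  induction N generalizing r with
  | zero => simp
  | succ N ih =>
    rw [pow_succ] at hr
    refine Submodule.mul_induction_on hr (fun a ha b hb => ?_) (fun a b ha hb => ?_)
    · rw [D.leibniz, smul_eq_mul, smul_eq_mul]
      refine add_mem (Ideal.mul_mem_right _ _ ha) ?_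
      rw [pow_succ, mul_comm b]
      exact Ideal.mul_mem_mul (ih ha) hb
    · rw [map_add]; exact add_mem ha hb

namespace Coords

variable (c : Coords k R)

theorem x_mem (i : Fin c.n) : c.x i ∈ augIdeal k R := c.counit_x i

theorem aeval_mem_pow {N : ℕ} {p : MvPolynomial (Fin c.n) k}
    (hp : p ∈ idealOfVars (Fin c.n) k ^ N) : aeval c.x p ∈ augIdeal k R ^ N := by
  have hφ : Ideal.map (aeval c.x) (idealOfVars (Fin c.n) k) ≤ augIdeal k R := by
    rw [Ideal.map_span, Ideal.span_le]
    rintro _ ⟨_, ⟨i, rfl⟩, rfl⟩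
    simpa using c.x_mem i
  exact Ideal.pow_right_mono hφ N (by rw [← Ideal.map_pow]; exact Ideal.mem_map_of_mem _ hp)

theorem exists_aeval (N : ℕ) (r : R) :
    ∃ p : MvPolynomial (Fin c.n) k, r - aeval c.x p ∈ augIdeal k R ^ N := by
  refine exists_poly_sub_mem_pow (aeval c.x) (augIdeal k R) (fun t => ⟨_, sub_counit_mem t⟩)
    (fun i => by simpa using c.x_mem i) (fun t ht => ?_) N r
  obtain ⟨a, ha⟩ := c.sq t ht
  refine ⟨∑ l, C (a l) * X l, sum_mem fun l _ => Ideal.mul_mem_left _ _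
    (Ideal.subset_span ⟨l, rfl⟩), ?_⟩
  simpa [Algebra.smul_def, algHom_C] using ha

theorem homogeneous_mem_pow {e : ℕ} {p : MvPolynomial (Fin c.n) k} (hp : p.IsHomogeneous e) :
    p ∈ idealOfVars (Fin c.n) k ^ e := by
  rw [mem_pow_idealOfVars_iff']
  intro x hx
  by_contra h
  have := hp h
  have h2 : (Finsupp.weight 1) x = Finsupp.degree x :=
    (DFunLike.congr_fun (Finsupp.degree_eq_weight_one (R := ℕ)) x).symm
  omega

/-- Since D_i x_l ≡ δ_il modulo I, the derivation D_i sends p(x) to (∂_i p)(x) up to an element one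
order deeper. By induction all ∂_i p vanish, and Euler's identity gives (deg p) · p = 0. Here
characteristic zero makes the group smooth. -/
theorem eq_zero_of_homogeneous [CharZero k] {e : ℕ} {p : MvPolynomial (Fin c.n) k}
    (hp : p.IsHomogeneous e) (h : aeval c.x p ∈ augIdeal k R ^ (e + 1)) : p = 0 := by
  induction e generalizing p with
  | zero =>
    have h1 := totalDegree_eq_zero_iff_eq_C.1 (Nat.le_zero.1 hp.totalDegree_le)
    rw [h1] at h ⊢
    rw [algHom_C, zero_add, pow_one, mem_augIdeal, Bialgebra.counit_algebraMap] at h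
    rw [h, C_0]
  | succ e ih =>
    have h0 : ∀ i, pderiv i p = 0 := by
      intro i
      refine ih (hp.pderiv) ?_
      have h1 := derivation_mem_pow (c.D i).1 _ _ h
      rw [pderiv_aeval] at h1
      -- The error made by replacing D_i x_l with δ_il.
      have h2 : ∑ l, aeval c.x (pderiv l p) * ((c.D i).1 (c.x l) - if i = l then 1 else 0) ∈
          augIdeal k R ^ (e + 1) := by
        refine sum_mem fun l _ => ?_
        rw [pow_succ]
        refine Ideal.mul_mem_mul (c.aeval_mem_pow (c.homogeneous_mem_pow hp.pderiv)) ?_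
        have := c.dual i l
        rw [mem_augIdeal, map_sub]
        change epsDer (c.D i) (c.x l) - _ = 0
        rw [this]
        split_ifs <;> simp
      have h3 := sub_mem h1 h2
      rw [← Finset.sum_sub_distrib] at h3
      simpa [← mul_sub] using h3
    have h1 := hp.sum_X_mul_pderiv
    simp only [h0, mul_zero, Finset.sum_const_zero] at h1
    rcases smul_eq_zero.1 h1.symm with h2 | h2
    · omega
    · exact h2

/-- The component of lowest degree has a value of one order more than its degree, so it vanishes and
can be peeled off. Together with `exists_aeval` this identifies R/I^N with truncated polynomials in
the coordinates. -/
theorem mem_pow_of_aeval_mem [CharZero k] {N : ℕ} {p : MvPolynomial (Fin c.n) k}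
    (h : aeval c.x p ∈ augIdeal k R ^ N) : p ∈ idealOfVars (Fin c.n) k ^ N := by
  induction N with
  | zero => simp
  | succ N ih =>
    have h1 := ih (Ideal.pow_le_pow_right (Nat.le_succ N) h)
    have h2 : p - homogeneousComponent N p ∈ idealOfVars (Fin c.n) k ^ (N + 1) := by
      rw [mem_pow_idealOfVars_iff'] at h1 ⊢
      intro x hx
      rw [coeff_sub, coeff_homogeneousComponent]
      split_ifs with h3
      · rw [sub_self]
      · rw [sub_zero]; exact h1 x (by omega)
    have h3 : homogeneousComponent N p = 0 := by
      refine c.eq_zero_of_homogeneous (homogeneousComponent_isHomogeneous N p) ?_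
      have := sub_mem h (c.aeval_mem_pow h2)
      rwa [map_sub, sub_sub_cancel] at this
    rwa [h3, sub_zero] at h2

section nilpotent

variable {Z : Type u} [CommRing Z] [Algebra k Z] {J : Ideal Z} {N : ℕ}

theorem map_augIdeal_pow {g : R →ₐ[k] Z}
    (hg : ∀ r, g r - algebraMap k Z (Coalgebra.counit r) ∈ J) {r : R}
    (hr : r ∈ augIdeal k R ^ N) : g r ∈ J ^ N := by
  have h : Ideal.map g (augIdeal k R) ≤ J := by
    rw [Ideal.map_le_iff_le_comap]
    intro r hr
    have := hg r
    rw [mem_augIdeal] at hr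
    rwa [hr, map_zero, sub_zero] at this
  exact Ideal.pow_right_mono h N (by rw [← Ideal.map_pow]; exact Ideal.mem_map_of_mem _ hr)

/-- A point of the formal group is determined by its coordinates, with control of
the adic distance. -/
theorem sub_mem_of_coords (hJ : J ^ N = ⊥) {g g' : R →ₐ[k] Z}
    (hg : ∀ r, g r - algebraMap k Z (Coalgebra.counit r) ∈ J)
    (hg' : ∀ r, g' r - algebraMap k Z (Coalgebra.counit r) ∈ J) (K : Ideal Z)
    (h : ∀ l, g (c.x l) - g' (c.x l) ∈ K) (r : R) : g r - g' r ∈ K := by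
  obtain ⟨p, hp⟩ := c.exists_aeval N r
  -- As J^N = 0, a point kills I^N, so on r it agrees with a polynomial approximating r to order N.
  have e : ∀ {f : R →ₐ[k] Z}, (∀ r, f r - algebraMap k Z (Coalgebra.counit r) ∈ J) →
      f r = aeval (fun l => f (c.x l)) p := by
    intro f hf
    have h1 := map_augIdeal_pow hf hp
    rw [hJ, Submodule.mem_bot, map_sub, sub_eq_zero] at h1
    rw [h1, ← comp_aeval_apply]
  rw [e hg, e hg', ← Ideal.Quotient.eq, ← Ideal.Quotient.mkₐ_eq_mk k, comp_aeval_apply,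
    comp_aeval_apply]
  congr 2
  ext l
  exact Ideal.Quotient.eq.2 (h l)

/-- Every tuple of nilpotent elements is the tuple of coordinates of a point of
the formal group. -/
theorem exists_of_coords [CharZero k] (hJ : J ^ N = ⊥) (a : Fin c.n → Z) (ha : ∀ l, a l ∈ J) :
    ∃ g : R →ₐ[k] Z, (∀ r, g r - algebraMap k Z (Coalgebra.counit r) ∈ J) ∧
      ∀ l, g (c.x l) = a l := by
  let f : MvPolynomial (Fin c.n) k →ₐ[k] R ⧸ (augIdeal k R ^ N) :=
    (Ideal.Quotient.mkₐ k _).comp (aeval c.x)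
  have hf : Function.Surjective f := by
    intro t
    obtain ⟨r, rfl⟩ := Ideal.Quotient.mk_surjective t
    obtain ⟨p, hp⟩ := c.exists_aeval N r
    exact ⟨p, (Ideal.Quotient.eq.2 hp).symm⟩
  have hle : Ideal.map (aeval a) (idealOfVars (Fin c.n) k) ≤ J := by
    rw [Ideal.map_span, Ideal.span_le]
    rintro _ ⟨_, ⟨i, rfl⟩, rfl⟩
    simpa using ha i
  -- Evaluation at `a` descends to R/I^N: a polynomial whose value lies in I^N already has order N,
  -- so its value at `a` lies in J^N = 0.
  have hker : RingHom.ker f.toRingHom ≤ RingHom.ker (aeval (R := k) a).toRingHom := by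
    intro p hp
    have h1 : aeval c.x p ∈ augIdeal k R ^ N := Ideal.Quotient.eq_zero_iff_mem.1 hp
    have h2 : aeval a p ∈ J ^ N := Ideal.pow_right_mono hle N (by
      rw [← Ideal.map_pow]; exact Ideal.mem_map_of_mem _ (c.mem_pow_of_aeval_mem h1))
    rwa [hJ] at h2
  let g' : R ⧸ (augIdeal k R ^ N) →ₐ[k] Z := AlgHom.liftOfSurjective f hf (aeval a) hker
  have hg' : ∀ p, g' (f p) = aeval a p := fun p =>
    AlgHom.congr_fun (AlgHom.liftOfSurjective_comp f hf (aeval a) hker) p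
  have hx : ∀ p, g' (Ideal.Quotient.mk _ (aeval c.x p)) = aeval a p := hg'
  refine ⟨g'.comp (Ideal.Quotient.mkₐ k _), fun r => ?_, fun l => ?_⟩
  -- The order N + 1 ensures an approximation at least modulo I, even if N = 0; this is needed to
  -- read off the counit.
  · obtain ⟨p, hp⟩ := c.exists_aeval (N + 1) r
    have e1 : Ideal.Quotient.mk (augIdeal k R ^ N) r = Ideal.Quotient.mk _ (aeval c.x p) :=
      Ideal.Quotient.eq.2 (Ideal.pow_le_pow_right (Nat.le_succ N) hp)
    have e2 : Coalgebra.counit (R := k) r = constantCoeff p := by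
      have h1 : (Bialgebra.counitAlgHom k R).comp (aeval c.x) =
          aeval (fun _ => (0 : k)) := by
        ext l; simpa using c.counit_x l
      have h2 := Ideal.pow_le_self (Nat.succ_ne_zero N) hp
      rw [mem_augIdeal, map_sub, sub_eq_zero] at h2
      rw [h2]
      refine (AlgHom.congr_fun h1 p).trans ?_
      exact (MvPolynomial.aeval_zero' p)
    change g' (Ideal.Quotient.mk _ r) - _ ∈ J
    rw [e1, hx, e2]
    have h3 : aeval a p - algebraMap k Z (constantCoeff p) = aeval a (p - C (constantCoeff p)) := by
      rw [map_sub, algHom_C]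
    rw [h3]
    refine hle (Ideal.mem_map_of_mem _ ?_)
    rw [← pow_one (idealOfVars _ _), mem_pow_idealOfVars_iff']
    intro x hx
    have : x = 0 := by rw [← Finsupp.degree_eq_zero_iff]; omega
    subst this
    simp [constantCoeff_eq]
  · have := hx (X l)
    simpa using this

end nilpotent

theorem constantCoeff_eq_counit {σ : Type} {z : σ → R}
    (hz : ∀ i, Coalgebra.counit (R := k) (z i) = 0) (p : MvPolynomial σ k) :
    Coalgebra.counit (R := k) (aeval z p) = constantCoeff p := by
  have h1 : (Bialgebra.counitAlgHom k R).comp (aeval z) = aeval (fun _ => (0 : k)) := by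
    ext l; simpa using hz l
  exact (AlgHom.congr_fun h1 p).trans (MvPolynomial.aeval_zero' p)

theorem map_aeval_idealOfVars {σ : Type} {z : σ → R}
    (hz : ∀ i, Coalgebra.counit (R := k) (z i) = 0)
    (hs : Function.Surjective (aeval (R := k) z)) :
    Ideal.map (aeval (R := k) z) (idealOfVars σ k) = augIdeal k R := by
  apply le_antisymm
  · rw [Ideal.map_span, Ideal.span_le]
    rintro _ ⟨_, ⟨i, rfl⟩, rfl⟩
    rw [aeval_X]
    exact hz i
  · intro r hr
    obtain ⟨p, rfl⟩ := hs r
    rw [mem_augIdeal, constantCoeff_eq_counit hz] at hr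
    refine Ideal.mem_map_of_mem _ ?_
    rw [← pow_one (idealOfVars _ _), mem_pow_idealOfVars_iff']
    intro x hx
    have : x = 0 := by rw [← Finsupp.degree_eq_zero_iff]; omega
    subst this
    rwa [← constantCoeff_eq]

variable (k R) in
/-- A presentation of the function algebra of an affine algebraic group by coordinates at the
identity and further generators which vanish to second order there, and equations which are
locally sufficient. -/
structure Presentation where
  c : Coords k R
  m : ℕ
  y : Fin m → R
  q : Fin m → MvPolynomial (Fin c.n ⊕ Fin m) k
  q_mem : ∀ j, q j ∈ idealOfVars (Fin c.n ⊕ Fin m) k ^ 2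
  aeval_q : ∀ j, aeval (Sum.elim c.x y) (q j) = y j
  surjective : Function.Surjective (aeval (R := k) (Sum.elim c.x y))
  counit_y : ∀ j, Coalgebra.counit (R := k) (y j) = 0
  locally : ∀ p, aeval (Sum.elim c.x y) p = 0 → ∃ h, constantCoeff h = 1 ∧
    h * p ∈ Ideal.span (Set.range fun j => X (Sum.inr j) - q j)

/-- Let T be the quotient of k[x, y] by the equations y_j = q_j. Its cotangent space at the origin
is spanned by the x alone, so polynomials in x are dense in T. If p vanishes in R and p'(x)
approximates p in T to order N, then p'(x) ∈ I^N in R, so p' has order N by `mem_pow_of_aeval_mem`.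
Thus p lies in every power of the ideal of the origin of T, and Krull's intersection theorem
provides a multiplier with constant term 1. -/
theorem exists_presentation [CharZero k] [Algebra.FiniteType k R] :
    Nonempty (Presentation k R) := by
  obtain ⟨c, m, y, hy, hgen⟩ := exists_coords (k := k) (R := R)
  have hyI : ∀ j, Coalgebra.counit (R := k) (y j) = 0 := fun j =>
    Ideal.pow_le_self two_ne_zero (hy j)
  let z : Fin c.n ⊕ Fin m → R := Sum.elim c.x y
  have hz : ∀ i, Coalgebra.counit (R := k) (z i) = 0 := by
    rintro (i | j)
    · exact c.counit_x i
    · exact hyI j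
  have hs : Function.Surjective (aeval (R := k) z) := by
    rw [← AlgHom.range_eq_top, ← Algebra.adjoin_range_eq_range_aeval, ← hgen]
    congr 1
    exact Set.Sum.elim_range c.x y
  have hq : ∀ j, ∃ q ∈ idealOfVars (Fin c.n ⊕ Fin m) k ^ 2, aeval z q = y j := by
    intro j
    have h1 := hy j
    rw [← map_aeval_idealOfVars hz hs, ← Ideal.map_pow] at h1
    exact (Ideal.mem_map_iff_of_surjective _ hs).1 h1
  choose q hq hqy using hq
  refine ⟨⟨c, m, y, q, hq, hqy, hs, hyI, fun p hp => ?_⟩⟩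
  set J : Ideal (MvPolynomial (Fin c.n ⊕ Fin m) k) :=
    Ideal.span (Set.range fun j => X (Sum.inr j) - q j)
  let M := idealOfVars (Fin c.n ⊕ Fin m) k
  let T := MvPolynomial (Fin c.n ⊕ Fin m) k ⧸ J
  let I : Ideal T := M.map (Ideal.Quotient.mk J)
  let φ : MvPolynomial (Fin c.n) k →ₐ[k] T := (Ideal.Quotient.mkₐ k J).comp (rename Sum.inl)
  have hφX : ∀ i, φ (X i) = Ideal.Quotient.mk J (X (Sum.inl i)) := fun i =>
    congrArg (Ideal.Quotient.mk J) (rename_X _ _)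
  have hsub : ∀ p : MvPolynomial (Fin c.n ⊕ Fin m) k, p - C (constantCoeff p) ∈ M := by
    intro p
    rw [← pow_one M, mem_pow_idealOfVars_iff']
    intro x hx
    have : x = 0 := by rw [← Finsupp.degree_eq_zero_iff]; omega
    subst this
    simp [constantCoeff_eq]
  -- Each y_j equals q_j in T and is therefore of second order, so linear terms involve only the x.
  have hT : ∀ t ∈ I, ∃ p' ∈ idealOfVars (Fin c.n) k, t - φ p' ∈ I ^ 2 := by
    intro t ht
    obtain ⟨p, hp, rfl⟩ := (Ideal.mem_map_iff_of_surjective _ Ideal.Quotient.mk_surjective).1 ht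
    refine Submodule.span_induction (p := fun p _ => ∃ p' ∈ idealOfVars (Fin c.n) k,
      Ideal.Quotient.mk J p - φ p' ∈ I ^ 2) ?_ ?_ ?_ ?_ hp
    · rintro _ ⟨i | j, rfl⟩
      · exact ⟨X i, Ideal.subset_span ⟨i, rfl⟩, by rw [hφX, sub_self]; exact zero_mem _⟩
      · refine ⟨0, zero_mem _, ?_⟩
        have h1 : Ideal.Quotient.mk J (X (Sum.inr j)) = Ideal.Quotient.mk J (q j) :=
          Ideal.Quotient.eq.2 (Ideal.subset_span ⟨j, rfl⟩)
        rw [h1, map_zero, sub_zero, ← Ideal.map_pow]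
        exact Ideal.mem_map_of_mem _ (hq j)
    · exact ⟨0, zero_mem _, by simp⟩
    · rintro a b _ _ ⟨p, hp, hap⟩ ⟨q, hq, hbq⟩
      refine ⟨p + q, add_mem hp hq, ?_⟩
      rw [map_add, map_add, add_sub_add_comm]
      exact add_mem hap hbq
    · rintro s b hb ⟨p, hp, hbp⟩
      refine ⟨C (constantCoeff s) * p, Ideal.mul_mem_left _ _ hp, ?_⟩
      have e : Ideal.Quotient.mk J (s • b) - φ (C (constantCoeff s) * p) =
          Ideal.Quotient.mk J (s - C (constantCoeff s)) * Ideal.Quotient.mk J b +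
          φ (C (constantCoeff s)) * (Ideal.Quotient.mk J b - φ p) := by
        have h1 : φ (C (constantCoeff s)) = Ideal.Quotient.mk J (C (constantCoeff s)) :=
          congrArg (Ideal.Quotient.mk J) (rename_C _ _)
        rw [smul_eq_mul, map_mul, map_mul, h1, map_sub]; ring
      rw [e]
      refine add_mem ?_ (Ideal.mul_mem_left _ _ hbp)
      rw [pow_two I]
      exact Ideal.mul_mem_mul (Ideal.mem_map_of_mem _ (hsub s)) (Ideal.mem_map_of_mem _ hb)
  have hdense := exists_poly_sub_mem_pow φ I (fun t => by
      obtain ⟨p, rfl⟩ := Ideal.Quotient.mk_surjective t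
      exact ⟨constantCoeff p, Ideal.mem_map_of_mem (Ideal.Quotient.mk J) (hsub p)⟩)
    (fun i => by rw [hφX]; exact Ideal.mem_map_of_mem _ (Ideal.subset_span ⟨_, rfl⟩)) hT
  let ψ : T →ₐ[k] R := Ideal.Quotient.liftₐ J (aeval z) (by
    intro a ha
    refine Submodule.span_induction (p := fun a _ => aeval z a = 0) ?_ (map_zero _) ?_ ?_ ha
    · rintro _ ⟨j, rfl⟩
      simp only [map_sub, aeval_X, hqy]
      exact sub_self _
    · intro a b _ _ ha hb; rw [map_add, ha, hb, add_zero]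
    · intro s b _ hb; rw [smul_eq_mul, map_mul, hb, mul_zero])
  have hψ : ∀ p, ψ (Ideal.Quotient.mk J p) = aeval z p := fun p => rfl
  have hψφ : ∀ p, ψ (φ p) = aeval c.x p := by
    intro p
    exact (hψ _).trans (aeval_rename Sum.inl z p)
  have hψI : Ideal.map ψ I ≤ augIdeal k R := by
    rw [Ideal.map_le_iff_le_comap]
    refine Ideal.map_le_iff_le_comap.2 ?_
    rw [← map_aeval_idealOfVars hz hs]
    exact fun p hp => Ideal.mem_map_of_mem (aeval z) hp
  have hall : ∀ N, Ideal.Quotient.mk J p ∈ I ^ N := by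
    intro N
    obtain ⟨p', hp'⟩ := hdense N (Ideal.Quotient.mk J p)
    have h1 : ψ (Ideal.Quotient.mk J p - φ p') ∈ augIdeal k R ^ N :=
      Ideal.pow_right_mono hψI N (by rw [← Ideal.map_pow]; exact Ideal.mem_map_of_mem ψ hp')
    rw [map_sub, hψ, hp, zero_sub, hψφ, neg_mem_iff] at h1
    have h2 := c.mem_pow_of_aeval_mem h1
    have h3 : φ p' ∈ I ^ N := by
      have hle : Ideal.map φ (idealOfVars (Fin c.n) k) ≤ I := by
        rw [Ideal.map_span, Ideal.span_le]
        rintro _ ⟨_, ⟨i, rfl⟩, rfl⟩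
        rw [hφX]
        exact Ideal.mem_map_of_mem _ (Ideal.subset_span ⟨_, rfl⟩)
      exact Ideal.pow_right_mono hle N (by rw [← Ideal.map_pow]; exact Ideal.mem_map_of_mem φ h2)
    simpa using add_mem hp' h3
  have hinf : Ideal.Quotient.mk J p ∈ (⨅ i : ℕ, I ^ i • ⊤ : Submodule T T) := by
    rw [Submodule.mem_iInf]
    intro N
    simpa using hall N
  -- Krull's intersection theorem in the noetherian ring T: r · p = p for some r in the ideal of the
  -- origin, so 1 - r kills p.
  obtain ⟨⟨r, hr⟩, hr'⟩ := (I.mem_iInf_smul_pow_eq_bot_iff _).1 hinf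
  obtain ⟨s, hsM, rfl⟩ := (Ideal.mem_map_iff_of_surjective _ Ideal.Quotient.mk_surjective).1 hr
  refine ⟨1 - s, ?_, ?_⟩
  · have : constantCoeff s = 0 := by
      rw [← pow_one M, mem_pow_idealOfVars_iff'] at hsM
      rw [constantCoeff_eq]
      exact hsM 0 (by simp)
    rw [map_sub, map_one, this, sub_zero]
  · rw [← Ideal.Quotient.eq_zero_iff_mem, map_mul, map_sub, map_one, sub_mul, one_mul, sub_eq_zero]
    exact hr'.symm

end Coords

end coords

end DG

/-! ### Nilpotent filtrations of dg algebras. -/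

namespace DG

open CDGA

namespace DGArt

variable {k : Type u} [Field k] (A : DGArt k)

/-- The maximal ideal of a local artinian dg algebra, as a subspace. -/
def max : Submodule k A.toCDGA := LinearMap.ker (alg A.aug).toLinearMap

variable {A}

theorem mem_max {a : A.toCDGA} : a ∈ A.max ↔ alg A.aug a = 0 := Iff.rfl

theorem sub_aug_mem (a : A.toCDGA) :
    a - algebraMap k A.toCDGA (alg A.aug a) ∈ A.max := by
  rw [mem_max, map_sub, AlgHom.commutes]
  exact sub_self _

variable (A) in
-- Only elementwise nilpotence is given. The kernel of the augmentation is contained in the Jacobson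
-- radical, since ya is nilpotent for every a in it, and the Jacobson radical of a finite
-- dimensional algebra is nilpotent.
theorem exists_max_pow : ∃ N, A.max ^ N = ⊥ := by
  have := A.finite
  have : IsArtinianRing A.toCDGA := IsArtinianRing.of_finite k A.toCDGA
  obtain ⟨N, hN⟩ := IsArtinianRing.isNilpotent_jacobson_bot (R := A.toCDGA)
  refine ⟨N, ?_⟩
  have h1 : ∀ a ∈ A.max, a ∈ Ideal.jacobson (⊥ : Ideal A.toCDGA) := by
    intro a ha
    rw [Ideal.mem_jacobson_iff]
    intro y
    have h2 : IsNilpotent (y * a) := A.nilpotent _ (by rw [map_mul, mem_max.1 ha, mul_zero])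
    obtain ⟨u, hu⟩ := h2.isUnit_add_one
    refine ⟨(u⁻¹ : (A.toCDGA.carrier)ˣ), ?_⟩
    have e := Units.inv_mul u
    rw [hu, mul_add, mul_one] at e
    rw [Ideal.mem_bot, mul_assoc, e, sub_self]
  have h2 : ∀ n, ∀ a ∈ A.max ^ n, a ∈ Ideal.jacobson (⊥ : Ideal A.toCDGA) ^ n := by
    intro n
    induction n with
    | zero => intro a _; rw [Submodule.pow_zero, Ideal.one_eq_top]; trivial
    | succ n ih =>
      intro a ha
      rw [pow_succ] at ha
      rw [Submodule.pow_succ]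
      refine Submodule.mul_induction_on ha (fun x hx y hy => ?_) (fun x y hx hy => add_mem hx hy)
      exact Submodule.mul_mem_mul (ih x hx) (h1 y hy)
  rw [eq_bot_iff]
  intro a ha
  have h3 := h2 N a ha
  rw [hN] at h3
  exact h3

/-- The homogeneous elements of a power of the maximal ideal. -/
def homMax (A : DGArt k) (n : ℕ) : Set A.toCDGA :=
  {a | a ∈ A.max ^ n ∧ ∃ i, a ∈ A.toCDGA.deg i}

/-- The maximal ideal is homogeneous because the augmentation preserves degrees: a homogeneous
element of nonzero degree is killed, and one of degree zero becomes an element of the kernel after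
subtracting a scalar. -/
theorem span_homMax (n : ℕ) : Submodule.span k (homMax A n) = A.max ^ n := by
  induction n with
  | zero =>
    apply le_antisymm (Submodule.span_le.2 fun a ha => ha.1)
    rw [pow_zero, Submodule.one_eq_span]
    refine Submodule.span_mono (Set.singleton_subset_iff.2 ⟨?_, 0, SetLike.one_mem_graded _⟩)
    exact Submodule.one_le.1 le_rfl
  | succ n ih =>
    apply le_antisymm (Submodule.span_le.2 fun a ha => ha.1)
    have h1 : A.max ≤ Submodule.span k {a | a ∈ A.max ∧ ∃ i, a ∈ A.toCDGA.deg i} := by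
      intro a ha
      have key : a - algebraMap k A.toCDGA (alg A.aug a) ∈
          Submodule.span k {a | a ∈ A.max ∧ ∃ i, a ∈ A.toCDGA.deg i} := by
        refine A.toCDGA.hom_induction (p := fun a => a - algebraMap k A.toCDGA (alg A.aug a) ∈
          Submodule.span k {a | a ∈ A.max ∧ ∃ i, a ∈ A.toCDGA.deg i}) ?_ ?_ ?_ a
        · simp
        · intro x y hx hy
          have e : x + y - algebraMap k A.toCDGA (alg A.aug (x + y)) =
              (x - algebraMap k A.toCDGA (alg A.aug x)) +
              (y - algebraMap k A.toCDGA (alg A.aug y)) := by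
            rw [map_add]
            erw [map_add]
            abel
          rw [e]; exact add_mem hx hy
        · intro i x hx
          refine Submodule.subset_span ⟨sub_aug_mem x, ?_⟩
          by_cases hi : i = 0
          · subst hi
            exact ⟨0, sub_mem hx (SetLike.algebraMap_mem_graded _ _)⟩
          · refine ⟨i, ?_⟩
            have := Hom.map_deg A.aug i x hx
            rcases (mem_degZero (k := k) (M := k) i _).1 this with h | h
            · exact absurd h hi
            · have h' : alg A.aug x = (0 : k) := h
              rw [h', map_zero, sub_zero]
              exact hx
      rw [mem_max] at ha
      rw [ha] at key
      erw [map_zero, sub_zero] at key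
      exact key
    calc A.max ^ (n + 1) = A.max ^ n * A.max := pow_succ _ _
      _ ≤ Submodule.span k (homMax A n) *
          Submodule.span k {a | a ∈ A.max ∧ ∃ i, a ∈ A.toCDGA.deg i} :=
        mul_le_mul' ih.ge h1
      _ ≤ _ := by
        rw [Submodule.span_mul_span]
        refine Submodule.span_mono ?_
        rintro _ ⟨a, ⟨ha, i, hi⟩, b, ⟨hb, j, hj⟩, rfl⟩
        refine ⟨?_, i + j, SetLike.mul_mem_graded hi hj⟩
        rw [pow_succ]
        exact Submodule.mul_mem_mul ha hb

theorem d_mem_max (a : A.toCDGA) : A.toCDGA.d a ∈ A.max := by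
  rw [mem_max]
  exact (Hom.map_d A.aug a).trans rfl

theorem max_mul_top : A.max * ⊤ ≤ A.max :=
  Submodule.mul_le.2 fun a ha b _ => by rw [mem_max] at ha ⊢; rw [map_mul, ha, zero_mul]

theorem top_mul_max : ⊤ * A.max ≤ A.max :=
  Submodule.mul_le.2 fun a _ b hb => by rw [mem_max] at hb ⊢; rw [map_mul, hb, mul_zero]

end DGArt

/-- A nilpotent multiplicative filtration of a commutative dg algebra by homogeneous dg ideals. -/
structure NilFil {k : Type u} [Field k] (C : CDGA k) where
  F : ℕ → Submodule k C
  zero : F 0 = ⊤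
  mul : ∀ {i j : ℕ} {x y : C}, x ∈ F i → y ∈ F j → x * y ∈ F (i + j)
  anti : ∀ i, F (i + 1) ≤ F i
  d_mem : ∀ {i : ℕ} {x : C}, x ∈ F i → C.d x ∈ F i
  hom : ∀ i, F i ≤ Submodule.span k {x | x ∈ F i ∧ ∃ p, x ∈ C.deg p}
  nil : ∃ N, F N = ⊥

namespace NilFil

variable {k : Type u} [Field k] {C C' C'' : CDGA k} (φ : NilFil C)

theorem mem_zero (x : C) : x ∈ φ.F 0 := φ.zero ▸ trivial

theorem mul_left {i : ℕ} (y : C) {x : C} (hx : x ∈ φ.F i) : y * x ∈ φ.F i := by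
  have := φ.mul (φ.mem_zero y) hx
  rwa [zero_add] at this

theorem mul_right {i : ℕ} (y : C) {x : C} (hx : x ∈ φ.F i) : x * y ∈ φ.F i :=
  φ.mul hx (φ.mem_zero y)

theorem le {i j : ℕ} (h : i ≤ j) : φ.F j ≤ φ.F i := antitone_nat_of_succ_le φ.anti h

/-- The filtration of `C'` generated by the image of a filtration of `C`. -/
def push (f : C ⟶ C') : NilFil C' where
  F i := Submodule.span k {z | ∃ x ∈ φ.F i, ∃ y : C', z = alg f x * y}
  zero := by
    rw [eq_top_iff]
    rintro y -
    exact Submodule.subset_span ⟨1, φ.mem_zero 1, y, by rw [map_one, one_mul]⟩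
  mul {i j x y} hx hy := by
    induction hx using Submodule.span_induction with
    | zero => rw [zero_mul]; exact zero_mem _
    | add x x' _ _ h h' => rw [add_mul]; exact add_mem h h'
    | smul c x _ h => rw [smul_mul_assoc]; exact Submodule.smul_mem _ _ h
    | mem x hx =>
      obtain ⟨a, ha, b, rfl⟩ := hx
      induction hy using Submodule.span_induction with
      | zero => rw [mul_zero]; exact zero_mem _
      | add x x' _ _ h h' => rw [mul_add]; exact add_mem h h'
      | smul c x _ h => rw [mul_smul_comm]; exact Submodule.smul_mem _ _ h
      | mem y hy =>
        obtain ⟨a', ha', b', rfl⟩ := hy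
        -- It is enough to treat homogeneous a', which moves past the homogeneous parts of b at the
        -- cost of a sign. This is why a filtration is required to be spanned by homogeneous
        -- elements.
        have ha'' := φ.hom j ha'
        clear ha'
        induction ha'' using Submodule.span_induction with
        | zero => rw [map_zero, zero_mul, mul_zero]; exact zero_mem _
        | add x x' _ _ h h' => rw [map_add, add_mul, mul_add]; exact add_mem h h'
        | smul c x _ h =>
          rw [map_smul, smul_mul_assoc, mul_smul_comm]; exact Submodule.smul_mem _ _ h
        | mem a' ha' =>
          obtain ⟨ha', p, hp⟩ := ha'
          refine C'.hom_induction (p := fun b => alg f a * b * (alg f a' * b') ∈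
            Submodule.span k {z | ∃ x ∈ φ.F (i + j), ∃ y : C', z = alg f x * y}) ?_ ?_ ?_ b
          · rw [mul_zero, zero_mul]; exact zero_mem _
          · intro x y h h'; rw [mul_add, add_mul]; exact add_mem h h'
          · intro q b hb
            have e : alg f a * b * (alg f a' * b') =
                ((-1 : ℤˣ) ^ (q * p)) • (alg f (a * a') * (b * b')) := by
              rw [mul_assoc, ← mul_assoc b, C'.comm q p b _ hb (Hom.map_deg f p _ hp), map_mul,
                smul_mul_assoc, mul_units_smul]
              simp only [mul_assoc]
            rw [e, Units.smul_def]
            exact Submodule.smul_of_tower_mem _ _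
              (Submodule.subset_span ⟨_, φ.mul ha ha', _, rfl⟩)
  anti i := Submodule.span_mono fun z ⟨x, hx, y, h⟩ => ⟨x, φ.anti i hx, y, h⟩
  d_mem {i x} hx := by
    induction hx using Submodule.span_induction with
    | zero => rw [map_zero]; exact zero_mem _
    | add x x' _ _ h h' => rw [map_add]; exact add_mem h h'
    | smul c x _ h => rw [map_smul]; exact Submodule.smul_mem _ _ h
    | mem x hx =>
      obtain ⟨a, ha, b, rfl⟩ := hx
      have ha'' := φ.hom i ha
      clear ha
      induction ha'' using Submodule.span_induction with
      | zero => rw [map_zero, zero_mul, map_zero]; exact zero_mem _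
      | add x x' _ _ h h' => rw [map_add, add_mul, map_add]; exact add_mem h h'
      | smul c x _ h => rw [map_smul, smul_mul_assoc, map_smul]; exact Submodule.smul_mem _ _ h
      | mem a ha =>
        obtain ⟨ha, p, hp⟩ := ha
        rw [C'.leibniz p _ _ (Hom.map_deg f p _ hp), Units.smul_def, ← Hom.map_d f]
        exact Submodule.add_mem _ (Submodule.subset_span ⟨_, φ.d_mem ha, _, rfl⟩)
          (Submodule.smul_of_tower_mem _ _ (Submodule.subset_span ⟨_, ha, _, rfl⟩))
  hom i := by
    refine Submodule.span_le.2 ?_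
    rintro _ ⟨a, ha, b, rfl⟩
    have ha'' := φ.hom i ha
    clear ha
    induction ha'' using Submodule.span_induction with
    | zero => rw [map_zero, zero_mul]; exact zero_mem _
    | add x x' _ _ h h' => rw [map_add, add_mul]; exact add_mem h h'
    | smul c x _ h => rw [map_smul, smul_mul_assoc]; exact Submodule.smul_mem _ _ h
    | mem a ha =>
      obtain ⟨ha, p, hp⟩ := ha
      refine C'.hom_induction (p := fun b => alg f a * b ∈ Submodule.span k {z | z ∈ Submodule.span k
        {z | ∃ x ∈ φ.F i, ∃ y : C', z = alg f x * y} ∧ ∃ p, z ∈ C'.deg p}) ?_ ?_ ?_ b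
      · rw [mul_zero]; exact zero_mem _
      · intro x y h h'; rw [mul_add]; exact add_mem h h'
      · intro q b hb
        exact Submodule.subset_span ⟨Submodule.subset_span ⟨a, ha, b, rfl⟩, p + q,
          SetLike.mul_mem_graded (Hom.map_deg f p _ hp) hb⟩
  nil := by
    obtain ⟨N, hN⟩ := φ.nil
    refine ⟨N, ?_⟩
    rw [Submodule.span_eq_bot]
    rintro _ ⟨a, ha, b, rfl⟩
    rw [hN, Submodule.mem_bot] at ha
    rw [ha, map_zero, zero_mul]

theorem mem_push (f : C ⟶ C') {i : ℕ} {x : C} (hx : x ∈ φ.F i) : alg f x ∈ (φ.push f).F i :=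
  Submodule.subset_span ⟨x, hx, 1, (mul_one _).symm⟩

theorem push_induction (f : C ⟶ C') {i : ℕ} (p : Submodule k C')
    (h : ∀ x ∈ φ.F i, ∀ y : C', alg f x * y ∈ p) : (φ.push f).F i ≤ p :=
  Submodule.span_le.2 (by rintro _ ⟨x, hx, y, rfl⟩; exact h x hx y)

theorem push_map {D D' : CDGA k} {φ : NilFil C} {ψ : NilFil D} {f : C ⟶ C'} {g : D ⟶ D'}
    {a : C ⟶ D} {b : C' ⟶ D'} (h : f ≫ b = a ≫ g) (ha : ∀ i, ∀ x ∈ φ.F i, alg a x ∈ ψ.F i)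
    {i : ℕ} {x : C'} (hx : x ∈ (φ.push f).F i) : alg b x ∈ (ψ.push g).F i := by
  refine φ.push_induction f (((ψ.push g).F i).comap (alg b).toLinearMap) ?_ hx
  intro x hx y
  have e : alg b (alg f x) = alg g (alg a x) := congrArg (fun f => alg f x) h
  change alg b (alg f x * y) ∈ (ψ.push g).F i
  rw [map_mul, e]
  exact (ψ.push g).mul_right _ (ψ.mem_push g (ha i x hx))

/-- A map which is the identity to first order along a nilpotent filtration is bijective. -/
theorem exists_unique_of_approx {V : Type*} [AddCommGroup V] (U : ℕ → AddSubgroup V)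
    (anti : ∀ i, U (i + 1) ≤ U i) (nil : ∃ N, U N = ⊥) (Φ : V → V)
    (h1 : ∀ x ∈ U 1, Φ x ∈ U 1)
    (h : ∀ i, 1 ≤ i → ∀ x ∈ U 1, ∀ y ∈ U 1, x - y ∈ U i → Φ x - Φ y - (x - y) ∈ U (i + 1))
    (a : V) (ha : a ∈ U 1) : ∃! x, x ∈ U 1 ∧ Φ x = a := by
  obtain ⟨N, hN⟩ := nil
  have le {i j : ℕ} (h : i ≤ j) : U j ≤ U i := antitone_nat_of_succ_le anti h
  -- Adding the error a - Φ x to x improves the approximation by one step.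
  have key : ∀ i, ∃ x ∈ U 1, a - Φ x ∈ U (i + 1) := by
    intro i
    induction i with
    | zero => exact ⟨0, zero_mem _, sub_mem ha (h1 0 (zero_mem _))⟩
    | succ i ih =>
      obtain ⟨x, hx, hx'⟩ := ih
      have hy : x + (a - Φ x) ∈ U 1 := add_mem hx (le (Nat.le_add_left 1 i) hx')
      refine ⟨x + (a - Φ x), hy, ?_⟩
      have := h (i + 1) (Nat.le_add_left 1 i) _ hy x hx (by rwa [add_sub_cancel_left])
      rw [add_sub_cancel_left] at this
      have e := neg_mem this
      rwa [show -(Φ (x + (a - Φ x)) - Φ x - (a - Φ x)) = a - Φ (x + (a - Φ x)) by abel] at e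
  refine existsUnique_of_exists_of_unique ?_ ?_
  · obtain ⟨x, hx, hx'⟩ := key N
    refine ⟨x, hx, ?_⟩
    have := le (Nat.le_succ N) hx'
    rw [hN, AddSubgroup.mem_bot] at this
    exact (sub_eq_zero.1 this).symm
  · rintro x y ⟨hx, hx'⟩ ⟨hy, hy'⟩
    have : ∀ i, x - y ∈ U (i + 1) := by
      intro i
      induction i with
      | zero => exact sub_mem hx hy
      | succ i ih =>
        have := neg_mem (h (i + 1) (Nat.le_add_left 1 i) x hx y hy ih)
        rwa [hx', hy', sub_self, zero_sub, neg_neg] at this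
    have := le (Nat.le_succ N) (this N)
    rw [hN, AddSubgroup.mem_bot] at this
    exact sub_eq_zero.1 this

end NilFil

namespace DGArt

variable {k : Type u} [Field k] (A : DGArt k)

/-- The filtration of a local artinian dg algebra by the powers of its maximal ideal. -/
def fil : NilFil A.toCDGA where
  -- The zeroth power of a subspace is the line spanned by 1, so step zero is set to the whole
  -- algebra separately.
  F i := if i = 0 then ⊤ else A.max ^ i
  zero := rfl
  mul {i j x y} hx hy := by
    have h1 : ∀ i, A.max ^ (i + 1) * ⊤ ≤ A.max ^ (i + 1) := fun i => by
      rw [pow_succ, mul_assoc]; exact mul_le_mul' le_rfl max_mul_top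
    have h2 : ∀ i, ⊤ * A.max ^ (i + 1) ≤ A.max ^ (i + 1) := fun i => by
      rw [pow_succ', ← mul_assoc]; exact mul_le_mul' top_mul_max le_rfl
    rcases i with _ | i
    · rcases j with _ | j
      · exact Submodule.mem_top
      · rw [zero_add]
        exact h2 j (Submodule.mul_mem_mul hx hy)
    · rcases j with _ | j
      · exact h1 i (Submodule.mul_mem_mul hx hy)
      · have := Submodule.mul_mem_mul hx hy
        simp only [Nat.add_eq_zero_iff, one_ne_zero, and_false, if_false] at this ⊢
        rwa [pow_add]
  anti i := by
    rcases i with _ | i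
    · exact le_top
    · simp only [Nat.add_eq_zero_iff, one_ne_zero, and_false, if_false]
      rw [pow_succ _ (i + 1), pow_succ, mul_assoc]
      exact mul_le_mul' le_rfl ((mul_le_mul' le_rfl le_top).trans max_mul_top)
  d_mem {i x} hx := by
    rcases i with _ | i
    · exact Submodule.mem_top
    simp only [Nat.add_eq_zero_iff, one_ne_zero, and_false, if_false] at hx ⊢
    have key : ∀ (n : ℕ) (x : A.toCDGA), x ∈ A.max ^ n → A.toCDGA.d x ∈ A.max ^ n := by
      intro n
      induction n with
      | zero =>
        intro x hx
        rw [pow_zero, Submodule.mem_one] at hx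
        obtain ⟨c, rfl⟩ := hx
        rw [Algebra.algebraMap_eq_smul_one, map_smul, d_one, smul_zero]
        exact zero_mem _
      | succ n ih =>
        intro x hx
        rw [pow_succ] at hx ⊢
        refine Submodule.mul_induction_on hx ?_ ?_
        · intro a ha b hb
          rw [← span_homMax] at ha
          induction ha using Submodule.span_induction with
          | zero => rw [zero_mul, map_zero]; exact zero_mem _
          | add x x' _ _ h h' => rw [add_mul, map_add]; exact add_mem h h'
          | smul c x _ h => rw [smul_mul_assoc, map_smul]; exact Submodule.smul_mem _ _ h
          | mem a ha =>
            obtain ⟨ha, p, hp⟩ := ha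
            rw [A.toCDGA.leibniz p a b hp, Units.smul_def]
            exact add_mem (Submodule.mul_mem_mul (ih a ha) hb)
              (zsmul_mem (Submodule.mul_mem_mul ha (d_mem_max _)) _)
        · intro x y hx hy; rw [map_add]; exact add_mem hx hy
    exact key _ x hx
  hom i := by
    rcases i with _ | i
    · rintro x -
      refine A.toCDGA.hom_induction (p := fun x => x ∈ Submodule.span k
        {x | x ∈ (⊤ : Submodule k A.toCDGA) ∧ ∃ p, x ∈ A.toCDGA.deg p}) (zero_mem _)
        (fun _ _ => add_mem) (fun p x hp => Submodule.subset_span ⟨trivial, p, hp⟩) x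
    · exact span_homMax (i + 1) |>.ge
  nil := by
    obtain ⟨N, hN⟩ := A.exists_max_pow
    -- One more than N, since N may be zero, where the step is not a power of the maximal ideal.
    refine ⟨N + 1, ?_⟩
    simp only [Nat.add_eq_zero_iff, one_ne_zero, and_false, if_false]
    rw [pow_succ, hN, Submodule.bot_mul]

variable {A}

theorem mem_fil_one {a : A.toCDGA} : a ∈ A.fil.F 1 ↔ alg A.aug a = 0 := by
  change a ∈ A.max ^ 1 ↔ _
  rw [pow_one, mem_max]

theorem fil_map {A' : DGArt k} (f : A ⟶ A') (i : ℕ) (x : A.toCDGA) (hx : x ∈ A.fil.F i) :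
    alg (hom f) x ∈ A'.fil.F i := by
  rcases i with _ | i
  · exact Submodule.mem_top
  have h1 : A.max.map (alg (hom f)).toLinearMap ≤ A'.max := by
    rintro _ ⟨a, ha, rfl⟩
    exact (congrArg (fun g => alg g a) (map_aug f)).trans ha
  have h2 : (A.max ^ (i + 1)).map (alg (hom f)).toLinearMap ≤ A'.max ^ (i + 1) := by
    rw [Submodule.map_pow]
    exact pow_le_pow_left' h1 _
  exact h2 (Submodule.mem_map_of_mem hx)

/-- The filtration of `W ⊗ A ⊗ B` by the powers of the maximal ideal of `A`. -/
def filExt (A : DGArt k) (W B : CDGA k) : NilFil (tensor W (tensor A.toCDGA B)) :=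
  A.fil.push (inl A.toCDGA B ≫ inr W _)

theorem filExt_map {A' : DGArt k} (f : A ⟶ A') {W W' B : CDGA k} (w : W ⟶ W') (i : ℕ)
    (x : Tens W (tensor A.toCDGA B)) (hx : x ∈ (A.filExt W B).F i) :
    alg (tmap w (tmap (hom f) (𝟙 B))) x ∈ (A'.filExt W' B).F i :=
  NilFil.push_map (a := hom f) (by rw [Category.assoc, inr_tmap, ← Category.assoc, inl_tmap,
    Category.assoc]) (fun i x hx => fil_map f i x hx) hx

theorem tmul_mem_filExt {W B : CDGA k} (w : W) {i : ℕ} {a : A.toCDGA} (ha : a ∈ A.fil.F i)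
    (b : B) : tmul w (tmul a b : Tens A.toCDGA B) ∈ (A.filExt W B).F i := by
  have h : (tmul 1 (tmul a 1 : Tens A.toCDGA B) : Tens W (tensor A.toCDGA B)) ∈
    (A.filExt W B).F i := NilFil.mem_push _ _ ha
  have e : (tmul w (tmul a b : Tens A.toCDGA B) : Tens W (tensor A.toCDGA B)) =
      tmul w (1 : Tens A.toCDGA B) * (tmul 1 (tmul a 1 : Tens A.toCDGA B) *
        tmul 1 (tmul 1 b : Tens A.toCDGA B)) := by
    have h2 : (tmul 1 (tmul a 1 : Tens A.toCDGA B) * tmul 1 (tmul 1 b : Tens A.toCDGA B) :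
        Tens W (tensor A.toCDGA B)) = tmul 1 (tmul a b : Tens A.toCDGA B) := by
      rw [← tmul_mul_tmul_one A.toCDGA B a b]
      exact (map_mul (alg (inr W (tensor A.toCDGA B))) _ _).symm
    rw [h2]
    exact (tmul_mul_tmul_one W (tensor A.toCDGA B) w _).symm
  rw [e]
  exact NilFil.mul_left _ _ (NilFil.mul_right _ _ h)

/-- The inclusion B → A ⊗ B splits the reduction. On a pure tensor, subtracting the image of the
reduction replaces a by a minus its augmentation. -/
theorem mem_span_of_aug {W B : CDGA k} {x : Tens W (tensor A.toCDGA B)}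
    (hx : alg (tmap (𝟙 W) (A.augBase B)) x = 0) :
    x ∈ Submodule.span k {z | ∃ (w : W) (a : A.toCDGA) (b : B), alg A.aug a = 0 ∧
      z = (tmul w (tmul a b : Tens A.toCDGA B) : Tens W (tensor A.toCDGA B))} := by
  have key : ∀ x : Tens W (tensor A.toCDGA B), x - alg (tmap (𝟙 W) (inr A.toCDGA B))
      (alg (tmap (𝟙 W) (A.augBase B)) x) ∈ Submodule.span k {z | ∃ (w : W) (a : A.toCDGA) (b : B), alg A.aug a = 0 ∧
      z = (tmul w (tmul a b : Tens A.toCDGA B) : Tens W (tensor A.toCDGA B))} := by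
    intro x
    refine tens_induction (p := fun x => x - alg (tmap (𝟙 W) (inr A.toCDGA B))
      (alg (tmap (𝟙 W) (A.augBase B)) x) ∈ Submodule.span k {z | ∃ (w : W) (a : A.toCDGA) (b : B), alg A.aug a = 0 ∧
      z = (tmul w (tmul a b : Tens A.toCDGA B) : Tens W (tensor A.toCDGA B))}) ?_ ?_ ?_ x
    · simp
    · intro x y hx hy
      rw [map_add, map_add, add_sub_add_comm]; exact Submodule.add_mem _ hx hy
    · intro i j w y _ _
      rw [alg_tmap, alg_tmap, alg_id, alg_id, ← tmulₗ_apply, ← tmulₗ_apply, ← map_sub]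
      refine tens_induction (p := fun y => tmulₗ W (tensor A.toCDGA B) w
        (y - alg (inr A.toCDGA B) (alg (A.augBase B) y)) ∈ Submodule.span k {z | ∃ (w : W) (a : A.toCDGA) (b : B), alg A.aug a = 0 ∧
      z = (tmul w (tmul a b : Tens A.toCDGA B) : Tens W (tensor A.toCDGA B))}) ?_ ?_ ?_ y
      · simp
      · intro x y hx hy
        rw [map_add, map_add, add_sub_add_comm, map_add]; exact Submodule.add_mem _ hx hy
      · intro i j a b _ _
        have e : (tmul a b : Tens A.toCDGA B) -
            alg (inr A.toCDGA B) (alg (A.augBase B) (tmul a b : Tens A.toCDGA B)) =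
            tmul (a - algebraMap k A.toCDGA (alg A.aug a)) b := by
          have e1 : alg (A.augBase B) (tmul a b : Tens A.toCDGA B) =
              (alg A.aug a : k) • b := by
            refine (alg_tlift _ _ a b).trans ?_
            rw [Algebra.smul_def]; rfl
          rw [e1, map_smul, alg_inr, Algebra.algebraMap_eq_smul_one]
          simp only [← tmulₗ_apply, map_sub, LinearMap.sub_apply, map_smul, LinearMap.smul_apply]
        rw [e]
        exact Submodule.subset_span ⟨w, _, b, mem_max.1 (sub_aug_mem a), rfl⟩
  have := key x
  rwa [hx, map_zero, sub_zero] at this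

/-- The first step is the kernel of the reduction W ⊗ A ⊗ B → W ⊗ B; this translates compatibility
with trivializations into membership in the filtration. -/
theorem mem_filExt_one {W B : CDGA k} {x : Tens W (tensor A.toCDGA B)} :
    x ∈ (A.filExt W B).F 1 ↔ alg (tmap (𝟙 W) (A.augBase B)) x = 0 := by
  constructor
  · intro hx
    refine NilFil.push_induction _ _
      (LinearMap.ker (alg (tmap (𝟙 W) (A.augBase B))).toLinearMap) ?_ hx
    intro a ha y
    rw [LinearMap.mem_ker, AlgHom.toLinearMap_apply, map_mul]
    have h1 : (inl A.toCDGA B ≫ inr W _) ≫ tmap (𝟙 W) (A.augBase B) =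
        A.aug ≫ unitMap _ := by
      rw [Category.assoc, inr_tmap, augBase, ← Category.assoc, inl_tlift, Category.assoc,
        unitMap_comp]
    have h2 := congrArg (fun f => alg f a) h1
    rw [alg_comp A.aug] at h2
    have h3 : alg (unitMap (tensor W B)) (0 : k) = 0 := map_zero _
    rw [mem_fil_one.1 ha] at h2
    refine (congrArg (· * _) h2).trans ?_
    exact (congrArg (· * _) h3).trans (zero_mul _)
  · intro hx
    refine Submodule.span_le.2 ?_ (mem_span_of_aug hx)
    rintro _ ⟨w, a, b, ha, rfl⟩
    exact tmul_mem_filExt w (mem_fil_one.2 ha) b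

end DGArt

end DG

/-! ### The convolution algebra, groups of infinitesimal points, and logarithmic derivatives. -/

namespace DG

open CDGA WithConv

variable {k : Type u} [Field k]

namespace CDGA

variable (C : CDGA k)

theorem comm_of_deg_zero {C : CDGA k} {x : C} (hx : x ∈ C.deg 0) (y : C) : x * y = y * x := by
  refine C.hom_induction (p := fun y => x * y = y * x) (by simp)
    (fun a b ha hb => by rw [mul_add, add_mul, ha, hb]) (fun i y hy => ?_) y
  have := C.comm 0 i x y hx hy
  rwa [zero_mul, zpow_zero, one_smul] at this

/-- The subalgebra of elements of degree zero. -/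
def zeroPart : Subalgebra k C where
  carrier := C.deg 0
  mul_mem' {a b} ha hb := by
    have := SetLike.mul_mem_graded (A := C.deg) ha hb
    rwa [add_zero] at this
  add_mem' ha hb := add_mem (S := Submodule k C) ha hb
  algebraMap_mem' c := SetLike.algebraMap_mem_graded C.deg c

instance : CommRing C.zeroPart :=
  { (inferInstance : Ring C.zeroPart) with
    mul_comm := fun a b => Subtype.ext (comm_of_deg_zero a.2 b) }

end CDGA

namespace NilFil

variable {C : CDGA k} (φ : NilFil C)

/-- The ideals of elements of degree zero in a step of a filtration. -/
def ideal (i : ℕ) : Ideal C.zeroPart where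
  carrier := {x | (x : C) ∈ φ.F i}
  add_mem' ha hb := add_mem (S := Submodule k C) ha hb
  zero_mem' := zero_mem (φ.F i)
  smul_mem' a _ hb := φ.mul_left (a : C) hb

theorem ideal_pow (n : ℕ) : φ.ideal 1 ^ n ≤ φ.ideal n := by
  induction n with
  | zero => exact fun x _ => φ.mem_zero _
  | succ n ih =>
    rw [pow_succ]
    exact Ideal.mul_le.2 fun a ha b hb => φ.mul (ih ha) hb

theorem exists_ideal_pow : ∃ N, φ.ideal 1 ^ N = ⊥ := by
  obtain ⟨N, hN⟩ := φ.nil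
  refine ⟨N, eq_bot_iff.2 fun x hx => ?_⟩
  have h : (x : C) ∈ φ.F N := φ.ideal_pow N hx
  rw [hN] at h
  exact Subtype.ext h

end NilFil

variable {R : Type u} [CommRing R] [HopfAlgebra k R] {C C' : CDGA k}

/-- The convolution algebra of linear maps from a Hopf algebra to a dg algebra. -/
abbrev Conv (R : Type u) [CommRing R] [HopfAlgebra k R] (C : CDGA k) : Type u :=
  WithConv (R →ₗ[k] C)

namespace Conv

theorem mul_mem {P Q S : Submodule k C} (h : ∀ x ∈ P, ∀ y ∈ Q, x * y ∈ S) {f g : Conv R C}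
    (hf : ∀ r, f r ∈ P) (hg : ∀ r, g r ∈ Q) (r : R) : (f * g) r ∈ S := by
  rw [(Coalgebra.Repr.arbitrary k r).convMul_apply]
  exact sum_mem fun i _ => h _ (hf _) _ (hg _)

/-- The differential of the convolution algebra. -/
def d (f : Conv R C) : Conv R C := toConv (C.d ∘ₗ f.ofConv)

@[simp] theorem d_apply (f : Conv R C) (r : R) : d f r = C.d (f r) := rfl

theorem d_d (f : Conv R C) : d (d f) = 0 := by ext r; exact C.d_d _

theorem d_sub (f g : Conv R C) : d (f - g) = d f - d g := by ext r; exact map_sub C.d _ _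

theorem d_one : d (1 : Conv R C) = 0 := by
  ext r
  change C.d (algebraMap k C _) = 0
  rw [Algebra.algebraMap_eq_smul_one, map_smul, CDGA.d_one, smul_zero]

theorem d_mul_of_zero {f : Conv R C} (hf : ∀ r, f r ∈ C.deg 0) (g : Conv R C) :
    d (f * g) = d f * g + f * d g := by
  ext r
  let p := Coalgebra.Repr.arbitrary k r
  change C.d ((f * g) r) = (d f * g) r + (f * d g) r
  rw [p.convMul_apply, p.convMul_apply, p.convMul_apply, map_sum, ← Finset.sum_add_distrib]
  refine Finset.sum_congr rfl fun i _ => ?_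
  rw [C.leibniz 0 _ _ (hf _), zpow_zero, one_smul, d_apply, d_apply]

/-- Composition with an algebra map. -/
def map (f : C →ₐ[k] C') : Conv R C →+* Conv R C' where
  toFun g := toConv (f.toLinearMap ∘ₗ g.ofConv)
  map_one' := by ext r; exact f.commutes _
  map_mul' g h := by
    have := LinearMap.algHom_comp_convMul_distrib f g h
    exact congrArg toConv this
  map_zero' := by ext r; exact map_zero f
  map_add' g h := by ext r; exact map_add f _ _

@[simp] theorem map_apply (f : C →ₐ[k] C') (g : Conv R C) (r : R) : map f g r = f (g r) := rfl

end Conv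

/-- A point of the group with values in the degree zero part of `C`, which is trivial modulo the
first step of a filtration. -/
structure Pt (R : Type u) [CommRing R] [HopfAlgebra k R] (φ : NilFil C) : Type u where
  toAlgHom : R →ₐ[k] C
  mem_deg : ∀ r, toAlgHom r ∈ C.deg 0
  near : ∀ r, toAlgHom r - algebraMap k C (Coalgebra.counit r) ∈ φ.F 1

namespace Pt

variable {φ : NilFil C} {ψ : NilFil C'}

/-- A point as an element of the convolution algebra. -/
def conv (g : Pt R φ) : Conv R C := toConv g.toAlgHom.toLinearMap

@[simp] theorem conv_apply (g : Pt R φ) (r : R) : g.conv r = g.toAlgHom r := rfl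

theorem conv_mem (g : Pt R φ) (r : R) : g.conv r ∈ C.deg 0 := g.mem_deg r

theorem conv_injective : Function.Injective (conv : Pt R φ → Conv R C) := by
  rintro ⟨f, _, _⟩ ⟨g, _, _⟩ h
  congr
  ext r
  exact congrArg (fun f : Conv R C => f r) h

theorem ext' {g h : Pt R φ} (H : ∀ r, g.toAlgHom r = h.toAlgHom r) : g = h :=
  conv_injective (by ext r; exact H r)

theorem conv_sub_one_mem (g : Pt R φ) (r : R) : (g.conv - 1) r ∈ φ.F 1 := g.near r

/-- The product of points through Δ is the convolution product, so the group laws are inherited from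
the convolution algebra. Values of degree zero commute, which makes the product multiplicative
again. -/
theorem mul_aux (f g : R →ₐ[k] C) (hf : ∀ r, f r ∈ C.deg 0) (r : R) :
    (((Algebra.TensorProduct.lift f g (fun a b => comm_of_deg_zero (hf a) (g b))).comp
      (Bialgebra.comulAlgHom k R)) r) = (toConv f.toLinearMap * toConv g.toLinearMap : Conv R C) r := by
  rw [LinearMap.convMul_apply]
  change Algebra.TensorProduct.lift f g (fun a b => comm_of_deg_zero (hf a) (g b))
    (Coalgebra.comul r) = _
  induction Coalgebra.comul (R := k) r with
  | zero => simp
  | add x y hx hy => rw [map_add, hx, hy, map_add, map_add]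
  | tmul a b => exact Algebra.TensorProduct.lift_tmul _ _ _ a b

instance : Mul (Pt R φ) where
  mul g h :=
    { toAlgHom := (Algebra.TensorProduct.lift g.toAlgHom h.toAlgHom
        (fun a b => comm_of_deg_zero (g.mem_deg a) _)).comp (Bialgebra.comulAlgHom k R)
      mem_deg := fun r => by
        rw [mul_aux _ _ g.mem_deg]
        exact Conv.mul_mem (f := g.conv) (g := h.conv) (fun x hx y hy => by
          have := SetLike.mul_mem_graded hx hy; rwa [add_zero] at this) g.mem_deg h.mem_deg r
      near := fun r => by
        rw [mul_aux _ _ g.mem_deg]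
        have e : g.conv * h.conv - 1 = (g.conv - 1) * h.conv + (h.conv - 1) := by noncomm_ring
        have e' := congrArg (fun f : Conv R C => f r) e
        change (g.conv * h.conv - 1) r ∈ _
        rw [e]
        exact add_mem (Conv.mul_mem (P := φ.F 1) (Q := ⊤) (fun x hx y _ => φ.mul_right y hx)
          g.conv_sub_one_mem (fun _ => trivial) r) (h.conv_sub_one_mem r) }

theorem conv_mul (g h : Pt R φ) : (g * h).conv = g.conv * h.conv := by
  ext r; exact mul_aux g.toAlgHom _ g.mem_deg r

instance : One (Pt R φ) where
  one :=
    { toAlgHom := (Algebra.ofId k C).comp (Bialgebra.counitAlgHom k R)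
      mem_deg := fun r => SetLike.algebraMap_mem_graded C.deg _
      near := fun r => by
        have : ((Algebra.ofId k C).comp (Bialgebra.counitAlgHom k R)) r =
          algebraMap k C (Coalgebra.counit r) := rfl
        rw [this, sub_self]; exact zero_mem _ }

theorem conv_one : (1 : Pt R φ).conv = 1 := rfl

instance : Inv (Pt R φ) where
  inv g :=
    { toAlgHom := g.toAlgHom.comp (HopfAlgebra.antipodeAlgHom k R)
      mem_deg := fun r => g.mem_deg _
      near := fun r => by
        have := g.near (HopfAlgebra.antipode k r)
        rwa [HopfAlgebra.counit_antipode] at this }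

theorem conv_inv_mul (g : Pt R φ) : (g⁻¹).conv * g.conv = 1 := by
  ext r
  let p := Coalgebra.Repr.arbitrary k r
  change ((g⁻¹).conv * g.conv) r = algebraMap k C (Coalgebra.counit r)
  rw [p.convMul_apply, ← g.toAlgHom.commutes,
    ← HopfAlgebra.sum_antipode_mul_eq_algebraMap_counit p, map_sum]
  exact Finset.sum_congr rfl fun i _ => (map_mul g.toAlgHom _ _).symm

instance : Group (Pt R φ) :=
  Group.ofLeftAxioms
    (fun a b c => conv_injective (by simp only [conv_mul, mul_assoc]))
    (fun a => conv_injective (by rw [conv_mul, conv_one, one_mul]))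
    (fun a => conv_injective (by rw [conv_mul, conv_inv_mul, conv_one]))

theorem conv_mul_inv (g : Pt R φ) : g.conv * (g⁻¹).conv = 1 := by
  rw [← conv_mul, mul_inv_cancel, conv_one]

/-- The image of a point under a filtered morphism. -/
def map (f : C ⟶ C') (h : ∀ i, ∀ x ∈ φ.F i, alg f x ∈ ψ.F i) : Pt R φ →* Pt R ψ where
  toFun g :=
    { toAlgHom := (alg f).comp g.toAlgHom
      mem_deg := fun r => Hom.map_deg f 0 _ (g.mem_deg r)
      near := fun r => by
        have := h 1 _ (g.near r)
        rwa [map_sub, AlgHom.commutes] at this }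
  map_one' := ext' fun r => (alg f).commutes _
  map_mul' g g' := conv_injective (by
    rw [conv_mul]
    change Conv.map (alg f) (g * g').conv = Conv.map (alg f) g.conv * Conv.map (alg f) g'.conv
    rw [conv_mul, map_mul])

@[simp] theorem map_apply (f : C ⟶ C') (h : ∀ i, ∀ x ∈ φ.F i, alg f x ∈ ψ.F i) (g : Pt R φ) (r : R) :
    (map f h g).toAlgHom r = alg f (g.toAlgHom r) := rfl

theorem conv_map (f : C ⟶ C') (h : ∀ i, ∀ x ∈ φ.F i, alg f x ∈ ψ.F i) (g : Pt R φ) :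
    (map f h g).conv = Conv.map (alg f) g.conv := rfl

end Pt

theorem Conv.map_d (f : C ⟶ C') (g : Conv R C) : Conv.map (alg f) g.d = (Conv.map (alg f) g).d := by
  ext r; exact Hom.map_d f _

theorem Conv.mul_apply_mul (f g : Conv R C) {r s : R} {ι κ : Type*} (p : Coalgebra.Repr k r ι)
    (q : Coalgebra.Repr k s κ) : (f * g) (r * s) = ∑ i ∈ p.index, ∑ j ∈ q.index,
      f (p.left i * q.left j) * g (p.right i * q.right j) := by
  rw [LinearMap.convMul_apply, Bialgebra.comul_mul, ← p.eq, ← q.eq, Finset.sum_mul_sum, map_sum,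
    map_sum]
  refine Finset.sum_congr rfl fun i _ => ?_
  rw [map_sum, map_sum]
  refine Finset.sum_congr rfl fun j _ => ?_
  simp

/-- The Maurer-Cartan elements of the convolution algebra: the derivations along the counit of
degree one, with values in the first step of the filtration, such that `dz + z * z = 0`. -/
structure IsMC (φ : NilFil C) (z : Conv R C) : Prop where
  der : IsEpsDer z.ofConv
  deg : ∀ r, z r ∈ C.deg 1
  mem : ∀ r, z r ∈ φ.F 1
  eq : z.d + z * z = 0

namespace Pt

variable {φ : NilFil C} {ψ : NilFil C'}

/-- The logarithmic derivative `g⁻¹ dg` of a point. -/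
def form (g : Pt R φ) : Conv R C := (g⁻¹).conv * g.conv.d

theorem mul_form (g : Pt R φ) : g.conv * g.form = g.conv.d := by
  rw [form, ← mul_assoc, conv_mul_inv, one_mul]

theorem d_inv (g : Pt R φ) : (g⁻¹).conv.d = -(g.form * (g⁻¹).conv) := by
  have h := congrArg Conv.d (conv_inv_mul g)
  rw [Conv.d_mul_of_zero (conv_mem _), Conv.d_one] at h
  have h2 := congrArg (· * (g⁻¹).conv) h
  simp only [add_mul, zero_mul, mul_assoc, conv_mul_inv, mul_one] at h2
  rw [form, mul_assoc]
  exact eq_neg_of_add_eq_zero_left h2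

/-- Right translation by h acts on logarithmic derivatives by gauge transformations. In particular
the result depends on g only through its logarithmic derivative. -/
theorem form_mul (g h : Pt R φ) : (g * h).form = (h⁻¹).conv * g.form * h.conv + h.form := by
  rw [form, conv_mul, Conv.d_mul_of_zero (conv_mem _), mul_inv_rev, conv_mul, form, form]
  simp only [mul_add, mul_assoc]
  rw [← mul_assoc (g⁻¹).conv g.conv, conv_inv_mul, one_mul]

theorem form_mul_congr {g g' : Pt R φ} (H : g.form = g'.form) (h : Pt R φ) :
    (g * h).form = (g' * h).form := by rw [form_mul, form_mul, H]

theorem form_eq_of_closed {g h : Pt R φ} (H : g.conv.d = 0) : (g * h).form = h.form := by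
  rw [form_mul, form, H, mul_zero, mul_zero, zero_mul, zero_add]

/-- By the product rule, d(gh⁻¹) = g(g⁻¹dg - h⁻¹dh)h⁻¹. -/
theorem closed_of_form_eq {g h : Pt R φ} (H : g.form = h.form) : (g * h⁻¹).conv.d = 0 := by
  rw [conv_mul, Conv.d_mul_of_zero (conv_mem _), d_inv, ← mul_form, ← H]
  noncomm_ring

theorem d_conv_mem_deg (g : Pt R φ) (r : R) : g.conv.d r ∈ C.deg 1 := by
  have := C.d_mem 0 _ (g.mem_deg r)
  rwa [zero_add] at this

theorem d_conv_mem (g : Pt R φ) (r : R) : g.conv.d r ∈ φ.F 1 := by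
  have h : g.conv.d = (g.conv - 1).d := by rw [Conv.d_sub, Conv.d_one, sub_zero]
  rw [h]
  exact φ.d_mem (g.conv_sub_one_mem r)

theorem form_mem_deg (g : Pt R φ) (r : R) : g.form r ∈ C.deg 1 :=
  Conv.mul_mem (fun x hx y hy => by
    have := SetLike.mul_mem_graded hx hy; rwa [zero_add] at this) (conv_mem _) g.d_conv_mem_deg r

theorem form_mem (g : Pt R φ) (r : R) : g.form r ∈ φ.F 1 :=
  Conv.mul_mem (P := ⊤) (fun x _ _ hy => φ.mul_left x hy) (fun _ => trivial) g.d_conv_mem r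

/-- The differential of the multiplicative map g is a derivation along g, and left translation by
g⁻¹ turns it into a derivation along g⁻¹g, the counit. The values of g⁻¹ have degree zero, so they
can be moved freely. -/
theorem form_isEpsDer (g : Pt R φ) : IsEpsDer g.form.ofConv := by
  intro r s
  let p := Coalgebra.Repr.arbitrary k r
  let q := Coalgebra.Repr.arbitrary k s
  have e1 (t : R) : ((g⁻¹).conv * g.conv) t = algebraMap k C (Coalgebra.counit t) := by
    rw [conv_inv_mul]; rfl
  have key : g.form (r * s) = ((g⁻¹).conv * g.conv) r * g.form s +
      g.form r * ((g⁻¹).conv * g.conv) s := by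
    rw [form, Conv.mul_apply_mul _ _ p q, p.convMul_apply, q.convMul_apply, p.convMul_apply,
      q.convMul_apply, Finset.sum_mul_sum, Finset.sum_mul_sum, ← Finset.sum_add_distrib]
    refine Finset.sum_congr rfl fun i _ => ?_
    rw [← Finset.sum_add_distrib]
    refine Finset.sum_congr rfl fun j _ => ?_
    simp only [Conv.d_apply, conv_apply, map_mul]
    rw [C.leibniz 0 _ _ (g.mem_deg _), zpow_zero, one_smul]
    have c1 := comm_of_deg_zero ((g⁻¹).mem_deg (q.left j)) (g.toAlgHom (p.right i))
    have c2 := comm_of_deg_zero ((g⁻¹).mem_deg (q.left j)) (C.d (g.toAlgHom (p.right i)))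
    generalize (g⁻¹).toAlgHom (q.left j) = a at *
    generalize g.toAlgHom (p.right i) = b at *
    simp only [mul_add, mul_assoc]
    rw [add_comm]
    congr 1
    · rw [← mul_assoc a b, c1, mul_assoc]
    · rw [← mul_assoc a, c2, mul_assoc]
  rw [e1, e1] at key
  refine key.trans ?_
  rw [← Algebra.commutes (Coalgebra.counit (R := k) s), ← Algebra.smul_def, ← Algebra.smul_def]

/-- The equation is obtained by differentiating gz = dg and cancelling g: 0 = dg · z + g · dz = g(z
* z + dz). -/
theorem form_isMC (g : Pt R φ) : IsMC φ g.form where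
  der := g.form_isEpsDer
  deg := g.form_mem_deg
  mem := g.form_mem
  eq := by
    have h := congrArg Conv.d g.mul_form
    rw [Conv.d_d, Conv.d_mul_of_zero g.conv_mem, ← mul_form] at h
    have h2 := congrArg ((g⁻¹).conv * ·) h
    simp only [mul_add, mul_zero, ← mul_assoc, conv_inv_mul, one_mul] at h2
    rw [add_comm, h2]

theorem form_map (f : C ⟶ C') (h : ∀ i, ∀ x ∈ φ.F i, alg f x ∈ ψ.F i) (g : Pt R φ) :
    (map f h g).form = Conv.map (alg f) g.form := by
  rw [form, form, map_mul, ← map_inv, conv_map, conv_map, Conv.map_d]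

/-- To first order the logarithmic derivative is d. Every remaining term contains, besides a
difference of points, a factor g⁻¹ - 1 or dh, which lies in the first step. -/
theorem form_sub_form_mem {i : ℕ} {g h : Pt R φ}
    (H : ∀ r, g.toAlgHom r - h.toAlgHom r ∈ φ.F i) (r : R) :
    g.form r - h.form r - C.d (g.toAlgHom r - h.toAlgHom r) ∈ φ.F (i + 1) := by
  have e : g.form - h.form - (g.conv - h.conv).d =
      ((g⁻¹).conv - 1) * (g.conv - h.conv).d + ((g⁻¹).conv - (h⁻¹).conv) * h.conv.d := by
    rw [form, form, Conv.d_sub]; noncomm_ring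
  change (g.form - h.form - (g.conv - h.conv).d) r ∈ φ.F (i + 1)
  rw [e]
  refine add_mem ?_ ?_
  · refine Conv.mul_mem (P := φ.F 1) (Q := φ.F i) (fun x hx y hy => ?_) (g⁻¹).conv_sub_one_mem
      (fun r => φ.d_mem (H r)) r
    rw [add_comm]; exact φ.mul hx hy
  · exact Conv.mul_mem (P := φ.F i) (Q := φ.F 1) (fun x hx y hy => φ.mul hx hy)
      (fun r => H _) h.d_conv_mem r

section coords

variable (c : Coords k R)

/-- A point as an algebra map to the degree zero part. -/
def toZero (g : Pt R φ) : R →ₐ[k] C.zeroPart := g.toAlgHom.codRestrict C.zeroPart g.mem_deg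

theorem sub_mem_of_coords {i : ℕ} {g h : Pt R φ}
    (H : ∀ l, g.toAlgHom (c.x l) - h.toAlgHom (c.x l) ∈ φ.F i) (r : R) :
    g.toAlgHom r - h.toAlgHom r ∈ φ.F i := by
  obtain ⟨N, hN⟩ := φ.exists_ideal_pow
  exact c.sub_mem_of_coords hN (g := g.toZero) (g' := h.toZero) g.near h.near (φ.ideal i) H r

theorem ext_coords {g h : Pt R φ} (H : ∀ l, g.toAlgHom (c.x l) = h.toAlgHom (c.x l)) : g = h := by
  obtain ⟨N, hN⟩ := φ.nil
  refine ext' fun r => ?_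
  have := sub_mem_of_coords (i := N) c (g := g) (h := h)
    (fun l => by rw [H, sub_self]; exact zero_mem _) r
  rwa [hN, Submodule.mem_bot, sub_eq_zero] at this

theorem coord_mem (g : Pt R φ) (l : Fin c.n) : g.toAlgHom (c.x l) ∈ φ.F 1 := by
  have := g.near (c.x l)
  rwa [c.counit_x, map_zero, sub_zero] at this

variable [CharZero k]

theorem exists_of_coords (φ : NilFil C) (a : Fin c.n → C) (ha : ∀ l, a l ∈ C.deg 0 ∧ a l ∈ φ.F 1) :
    ∃ g : Pt R φ, ∀ l, g.toAlgHom (c.x l) = a l := by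
  obtain ⟨N, hN⟩ := φ.exists_ideal_pow
  obtain ⟨g, h1, h2⟩ := c.exists_of_coords hN (fun l => ⟨a l, (ha l).1⟩) (fun l => (ha l).2)
  exact ⟨⟨C.zeroPart.val.comp g, fun r => (g r).2, h1⟩, fun l => congrArg Subtype.val (h2 l)⟩

/-- Points correspond to tuples of elements of degree zero in the first step, and differences of
points are controlled by differences of coordinates. So this is `NilFil.exists_unique_of_approx` for
tuples. -/
theorem exists_unique_of_approx (Φ : Pt R φ → Fin c.n → C)
    (h1 : ∀ g l, Φ g l ∈ C.deg 0 ∧ Φ g l ∈ φ.F 1)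
    (h : ∀ i, 1 ≤ i → ∀ g g' : Pt R φ, (∀ r, g.toAlgHom r - g'.toAlgHom r ∈ φ.F i) → ∀ l,
      Φ g l - Φ g' l - (g.toAlgHom (c.x l) - g'.toAlgHom (c.x l)) ∈ φ.F (i + 1))
    (a : Fin c.n → C) (ha : ∀ l, a l ∈ C.deg 0 ∧ a l ∈ φ.F 1) : ∃! g : Pt R φ, Φ g = a := by
  classical
  let U (i : ℕ) : AddSubgroup (Fin c.n → C) :=
    { carrier := {v | ∀ l, v l ∈ C.deg 0 ∧ v l ∈ φ.F i}
      add_mem' := fun h h' l => ⟨add_mem (h l).1 (h' l).1, add_mem (h l).2 (h' l).2⟩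
      zero_mem' := fun l => ⟨zero_mem _, zero_mem _⟩
      neg_mem' := fun h l => ⟨neg_mem (h l).1, neg_mem (h l).2⟩ }
  -- The point with coordinates v; the value 1 for other tuples only makes the function total.
  let G (v : Fin c.n → C) : Pt R φ :=
    if hv : v ∈ U 1 then (exists_of_coords c φ v hv).choose else 1
  have hG {v : Fin c.n → C} (hv : v ∈ U 1) (l : Fin c.n) : (G v).toAlgHom (c.x l) = v l := by
    simp only [G, dif_pos hv]
    exact (exists_of_coords c φ v hv).choose_spec l
  have hmem (g : Pt R φ) : (fun l => g.toAlgHom (c.x l)) ∈ U 1 :=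
    fun l => ⟨g.mem_deg _, g.coord_mem c l⟩
  have hG' (g : Pt R φ) : G (fun l => g.toAlgHom (c.x l)) = g := ext_coords c (hG (hmem g))
  obtain ⟨x, ⟨hx, hx'⟩, hu⟩ := NilFil.exists_unique_of_approx U
    (fun i v hv l => ⟨(hv l).1, φ.anti i (hv l).2⟩)
    (by
      obtain ⟨N, hN⟩ := φ.nil
      refine ⟨N, eq_bot_iff.2 fun v hv => funext fun l => ?_⟩
      have := (hv l).2
      rwa [hN] at this)
    (fun v => Φ (G v)) (fun v _ l => h1 _ l)
    (fun i hi v hv w hw hvw l => by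
      have hsub : ∀ r, (G v).toAlgHom r - (G w).toAlgHom r ∈ φ.F i :=
        sub_mem_of_coords c fun l => by rw [hG hv, hG hw]; exact (hvw l).2
      refine ⟨sub_mem (sub_mem (h1 _ l).1 (h1 _ l).1) (sub_mem (hv l).1 (hw l).1), ?_⟩
      have := h i hi (G v) (G w) hsub l
      rwa [hG hv, hG hw] at this) a ha
  refine ⟨G x, hx', fun g hg => ?_⟩
  have := hu _ ⟨hmem g, by rw [hG' g]; exact hg⟩
  rw [← this, hG']

end coords

end Pt

end DG

/-! ### Polynomial forms: integration and the contraction of a simplex to a vertex. -/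

namespace DG

open CDGA

variable {k : Type u} [Field k]

theorem CDGA.alg_congr {A B : CDGA k} {f g : A ⟶ B} (h : f = g) (x : A) : alg f x = alg g x := by
  rw [h]

theorem CDGA.alg_comp_congr {A B B' C : CDGA k} {f : A ⟶ B} {g : B ⟶ C} {f' : A ⟶ B'} {g' : B' ⟶ C}
    (h : f ≫ g = f' ≫ g') (x : A) : alg g (alg f x) = alg g' (alg f' x) :=
  alg_congr h x

namespace Forms

variable {n : ℕ}

/-- Induction on homogeneous forms. -/
theorem homInduction {p : ℤ → Forms k n → Prop} (zero : ∀ i, p i 0)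
    (add : ∀ i x y, p i x → p i y → p i (x + y)) (smul : ∀ i (c : k) x, p i x → p i (c • x))
    (one : p 0 1)
    (mul : ∀ i j x y, x ∈ deg k i → y ∈ deg k j → p i x → p j y → p (i + j) (x * y))
    (t : ∀ i, p 0 (t k i)) (dt : ∀ i, p 1 (dt k i)) {i : ℤ} {x : Forms k n} (hx : x ∈ deg k i) :
    p i x := by
  let N : ℤ → Submodule k (Forms k n) := fun i =>
    { carrier := {x | x ∈ deg k i ∧ p i x}
      add_mem' := fun h h' => ⟨add_mem h.1 h'.1, add i _ _ h.2 h'.2⟩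
      zero_mem' := ⟨zero_mem _, zero i⟩
      smul_mem' := fun c x h => ⟨Submodule.smul_mem _ _ h.1, smul i c x h.2⟩ }
  refine (deg_le N (fun i x h => h.1) ?_ ?_ ?_ ?_ i hx).2
  · exact ⟨SetLike.one_mem_graded _, one⟩
  · rintro i j x y ⟨h1, h2⟩ ⟨h3, h4⟩
    exact ⟨SetLike.mul_mem_graded h1 h3, mul i j x y h1 h3 h2 h4⟩
  · exact fun l => ⟨t_mem l, t l⟩
  · exact fun l => ⟨dt_mem l, dt l⟩

theorem algHom_ext {A : Type u} [Ring A] [Algebra k A] {f g : Forms k n →ₐ[k] A}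
    (h : ∀ i, f (t k i) = g (t k i)) (h' : ∀ i, f (dt k i) = g (dt k i)) : f = g := by
  ext x
  refine induction (p := fun x => f x = g x) (fun c => by simp) h h' ?_ ?_ x
  · intro x y hx hy; rw [map_mul, map_mul, hx, hy]
  · intro x y hx hy; rw [map_add, map_add, hx, hy]

end Forms

section omegaLift

variable {n : ℕ} {A : CDGA k} (x : Fin (n + 1) → A) (hx : ∀ i, x i ∈ A.deg 0) (hs : ∑ i, x i = 1)

/-- The algebra map underlying `omegaLift`. -/
def omegaLiftAlg : Forms k n →ₐ[k] A :=
  Forms.lift x (fun i => A.d (x i))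
    (fun i j => comm_of_deg_zero (hx i) _) (fun i j => comm_of_deg_zero (hx i) _)
    (fun i j => by
      have h (i) : A.d (x i) ∈ A.deg 1 := by
        have := A.d_mem 0 _ (hx i); rwa [zero_add] at this
      have := A.comm 1 1 _ _ (h i) (h j)
      rwa [mul_one, zpow_one, Units.neg_smul, one_smul] at this)
    hs (by rw [← map_sum, hs, d_one])

theorem omegaLiftAlg_t (i : Fin (n + 1)) : omegaLiftAlg x hx hs (Forms.t k i) = x i := by
  simp [omegaLiftAlg]

theorem omegaLiftAlg_dt (i : Fin (n + 1)) :
    omegaLiftAlg x hx hs (Forms.dt k i) = A.d (x i) := by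
  simp [omegaLiftAlg]

/-- The universal property of the dg algebra of forms: a morphism is determined by the images of
the barycentric coordinates, which are arbitrary elements of degree zero with sum one. -/
def omegaLift : Omega k n ⟶ A :=
  let f := omegaLiftAlg x hx hs
  have ft := omegaLiftAlg_t x hx hs
  have fdt := omegaLiftAlg_dt x hx hs
  have hdeg (i : ℤ) (y : Forms k n) (hy : y ∈ Forms.deg k i) : f y ∈ A.deg i := by
    refine Forms.homInduction (p := fun i y => f y ∈ A.deg i) ?_ ?_ ?_ ?_ ?_ ?_ ?_ hy
    · intro i; rw [map_zero]; exact zero_mem _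
    · intro i x y h h'; rw [map_add]; exact add_mem h h'
    · intro i c x h; rw [map_smul]; exact Submodule.smul_mem _ _ h
    · rw [map_one]; exact SetLike.one_mem_graded _
    · intro i j x y _ _ h h'; rw [map_mul]; exact SetLike.mul_mem_graded h h'
    · intro i; rw [ft]; exact hx i
    · intro i; rw [fdt]; have := A.d_mem 0 _ (hx i); rwa [zero_add] at this
  CDGA.Hom.mk (A := Omega k n) f hdeg (fun y => by
    refine (Omega k n).hom_induction (p := fun y => f (Forms.d k y) = A.d (f y)) (by simp)
      (fun x y h h' => by simp only [map_add, h, h']) (fun i y hy => ?_) y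
    refine Forms.homInduction (p := fun i y => f (Forms.d k y) = A.d (f y)) ?_ ?_ ?_ ?_ ?_ ?_ ?_ hy
    · intro i; simp
    · intro i x y h h'; simp only [map_add, h, h']
    · intro i c x h; simp only [map_smul, h]
    · have : Forms.d k (1 : Forms k n) = 0 := (Omega k n).d_one
      rw [this, map_zero, map_one, d_one]
    · intro i j x y hx hy h h'
      rw [Forms.d_mul y hx, map_mul, A.leibniz i _ _ (hdeg i x hx), Units.smul_def, Units.smul_def,
        map_add, map_zsmul, map_mul, map_mul, h, h']
    · intro i; rw [Forms.d_t, fdt, ft]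
    · intro i; rw [Forms.d_dt, fdt, map_zero, A.d_d])

@[simp] theorem omegaLift_t (i : Fin (n + 1)) : alg (omegaLift x hx hs) (Forms.t k i) = x i :=
  omegaLiftAlg_t x hx hs i

end omegaLift

/-- Evaluation of forms at a vertex. -/
def vertex {n : ℕ} (v : Fin (n + 1)) : Omega k n ⟶ ofComm k :=
  omegaLift (A := ofComm k) (fun i => if i = v then (1 : k) else 0)
    (fun _ => (mem_degZero (k := k) (M := k) 0 _).2 (Or.inl rfl)) (by simp)

theorem vertex_t {n : ℕ} (v i : Fin (n + 1)) :
    alg (vertex (k := k) v) (Forms.t k i) = (if i = v then (1 : k) else 0) :=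
  omegaLift_t (A := ofComm k) _ _ _ i

theorem vertex_of_ne {n : ℕ} (v : Fin (n + 1)) {i : ℤ} (hi : i ≠ 0) {x : Forms k n}
    (hx : x ∈ Forms.deg k i) : alg (vertex (k := k) v) x = (0 : k) :=
  ((mem_degZero (k := k) (M := k) i _).1 (Hom.map_deg (vertex v) i x hx)).resolve_left hi

namespace Forms

open Polynomial

/-- Forms on the interval in terms of polynomials. -/
def toDual (k : Type u) [Field k] : Forms k 1 →ₐ[k] DualNumber k[X] :=
  lift ![TrivSqZeroExt.inl (1 - X), TrivSqZeroExt.inl X] ![-TrivSqZeroExt.inr 1, TrivSqZeroExt.inr 1] (fun _ _ => mul_comm _ _) (fun _ _ => mul_comm _ _)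
    (fun i j => by fin_cases i <;> fin_cases j <;> simp)
    (by simp) (by simp)

theorem toDual_t_zero : toDual k (t k 0) = TrivSqZeroExt.inl (1 - X) := lift_t _ _ _ _ _ _ _ _ 0
theorem toDual_t_one : toDual k (t k 1) = TrivSqZeroExt.inl X := lift_t _ _ _ _ _ _ _ _ 1
theorem toDual_dt_zero : toDual k (dt k 0) = -TrivSqZeroExt.inr 1 := lift_dt _ _ _ _ _ _ _ _ 0
theorem toDual_dt_one : toDual k (dt k 1) = TrivSqZeroExt.inr 1 := lift_dt _ _ _ _ _ _ _ _ 1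

/-- Functions have no dual part and 1-forms consist of a dual part only; all other degrees map to
zero. -/
theorem toDual_deg {i : ℤ} {x : Forms k 1} (hx : x ∈ deg k i) :
    0 ≤ i ∧ (i ≠ 0 → TrivSqZeroExt.fst (toDual k x) = 0) ∧ (i ≠ 1 → TrivSqZeroExt.snd (toDual k x) = 0) ∨ x = 0 := by
  refine homInduction (p := fun i x => 0 ≤ i ∧ (i ≠ 0 → TrivSqZeroExt.fst (toDual k x) = 0) ∧
    (i ≠ 1 → TrivSqZeroExt.snd (toDual k x) = 0) ∨ x = 0) ?_ ?_ ?_ ?_ ?_ ?_ ?_ hx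
  · intro i; exact Or.inr rfl
  · rintro i x y (⟨h0, h1, h2⟩ | rfl) (⟨_, h3, h4⟩ | rfl)
    · refine Or.inl ⟨h0, fun h => ?_, fun h => ?_⟩
      · rw [map_add, TrivSqZeroExt.fst_add, h1 h, h3 h, add_zero]
      · rw [map_add, TrivSqZeroExt.snd_add, h2 h, h4 h, add_zero]
    · rw [add_zero]; exact Or.inl ⟨h0, h1, h2⟩
    · rw [zero_add]; exact Or.inl ⟨‹_›, h3, h4⟩
    · exact Or.inr (add_zero 0)
  · rintro i c x (⟨h0, h1, h2⟩ | rfl)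
    · refine Or.inl ⟨h0, fun h => ?_, fun h => ?_⟩
      · rw [map_smul, TrivSqZeroExt.fst_smul, h1 h, smul_zero]
      · rw [map_smul, TrivSqZeroExt.snd_smul, h2 h, smul_zero]
    · exact Or.inr (smul_zero c)
  · exact Or.inl ⟨le_rfl, fun h => absurd rfl h, fun _ => by rw [map_one, TrivSqZeroExt.snd_one]⟩
  · rintro i j x y _ _ (⟨h0, h1, h2⟩ | rfl) (⟨h0', h3, h4⟩ | rfl)
    · refine Or.inl ⟨add_nonneg h0 h0', fun h => ?_, fun h => ?_⟩
      · rw [map_mul, TrivSqZeroExt.fst_mul]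
        by_cases hi : i = 0
        · rw [h3 (by omega), mul_zero]
        · rw [h1 hi, zero_mul]
      · rw [map_mul, TrivSqZeroExt.snd_mul]
        by_cases hi : i = 0
        · rw [h4 (by omega), h2 (by omega), smul_zero, smul_zero, add_zero]
        · rw [h1 hi, zero_smul, zero_add]
          by_cases hj : j = 0
          · rw [h2 (by omega), smul_zero]
          · rw [h3 hj, MulOpposite.op_zero, zero_smul]
    · rw [mul_zero]; exact Or.inr rfl
    · rw [zero_mul]; exact Or.inr rfl
    · rw [zero_mul]; exact Or.inr rfl
  · intro i
    refine Or.inl ⟨le_rfl, fun h => absurd rfl h, fun _ => ?_⟩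
    fin_cases i
    · exact (congrArg TrivSqZeroExt.snd (toDual_t_zero (k := k))).trans (TrivSqZeroExt.snd_inl _ _)
    · exact (congrArg TrivSqZeroExt.snd (toDual_t_one (k := k))).trans (TrivSqZeroExt.snd_inl _ _)
  · intro i
    refine Or.inl ⟨zero_le_one, fun _ => ?_, fun h => absurd rfl h⟩
    fin_cases i
    · exact (congrArg TrivSqZeroExt.fst (toDual_dt_zero (k := k))).trans (by simp)
    · exact (congrArg TrivSqZeroExt.fst (toDual_dt_one (k := k))).trans (TrivSqZeroExt.fst_inr _ _)

theorem toDual_d (x : Forms k 1) : TrivSqZeroExt.fst (toDual k (d k x)) = 0 ∧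
    TrivSqZeroExt.snd (toDual k (d k x)) = derivative (TrivSqZeroExt.fst (toDual k x)) := by
  refine (Omega k 1).hom_induction (p := fun x => TrivSqZeroExt.fst (toDual k (d k x)) = 0 ∧
    TrivSqZeroExt.snd (toDual k (d k x)) = derivative (TrivSqZeroExt.fst (toDual k x))) (by simp)
    (fun x y h h' => by simp [map_add, h.1, h.2, h'.1, h'.2]) (fun i x hx => ?_) x
  refine homInduction (p := fun i x => TrivSqZeroExt.fst (toDual k (d k x)) = 0 ∧
    TrivSqZeroExt.snd (toDual k (d k x)) = derivative (TrivSqZeroExt.fst (toDual k x))) ?_ ?_ ?_ ?_ ?_ ?_ ?_ hx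
  · intro i; simp
  · intro i x y h h'; simp [map_add, h.1, h.2, h'.1, h'.2]
  · intro i c x h; simp [h.1, h.2]
  · have : d k (1 : Forms k 1) = 0 := (Omega k 1).d_one
    simp [this]
  · intro i j x y hx hy h h'
    rw [d_mul y hx, Units.smul_def]
    simp only [map_add, map_mul, map_zsmul, TrivSqZeroExt.fst_add, TrivSqZeroExt.fst_mul, h.1, h'.1, zero_mul, TrivSqZeroExt.snd_add, TrivSqZeroExt.snd_mul,
      h.2, h'.2, TrivSqZeroExt.fst_smul, mul_zero, smul_zero, add_zero, TrivSqZeroExt.snd_smul, zero_smul, zero_add,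
      derivative_mul, true_and, MulOpposite.op_zero]
    by_cases hi : i = 0
    · subst hi; simp [add_comm]
    · rcases toDual_deg hx with ⟨_, h1, _⟩ | rfl
      · simp [h1 hi]
      · simp
  · intro i
    rw [d_t]
    fin_cases i
    · simp only [Fin.zero_eta, toDual_dt_zero, toDual_t_zero]; simp
    · simp only [Fin.mk_one, toDual_dt_one, toDual_t_one]; simp
  · intro i
    rw [d_dt]
    fin_cases i
    · simp only [Fin.zero_eta, toDual_dt_zero]; simp
    · simp only [Fin.mk_one, toDual_dt_one]; simp

/-- The integral over the unit interval of a polynomial. -/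
def polyIntegral (k : Type u) [Field k] : k[X] →ₗ[k] k :=
  Polynomial.lsum fun m => ((m + 1 : k)⁻¹) • LinearMap.id

/-- Checked on monomials, where the factor m + 1 from differentiation cancels the denominator; this
requires characteristic zero. -/
theorem polyIntegral_derivative [CharZero k] (p : k[X]) :
    polyIntegral k (derivative p) = eval 1 p - eval 0 p := by
  induction p using Polynomial.induction_on' with
  | add p q hp hq => simp only [map_add, hp, hq, eval_add]; ring
  | monomial m a =>
    rw [derivative_monomial]
    rcases m with _ | m
    · simp
    · have : (m + 1 : k) ≠ 0 := Nat.cast_add_one_ne_zero m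
      simp [polyIntegral, Polynomial.lsum_apply, Polynomial.sum_monomial_index]
      field_simp

/-- The integral of a form over the interval. -/
def integral (k : Type u) [Field k] : Forms k 1 →ₗ[k] k :=
  polyIntegral k ∘ₗ (TrivSqZeroExt.sndHom k[X] k[X]).restrictScalars k ∘ₗ (toDual k).toLinearMap

theorem integral_of_ne {i : ℤ} (hi : i ≠ 1) {x : Forms k 1} (hx : x ∈ deg k i) :
    integral k x = 0 := by
  rcases toDual_deg hx with ⟨_, _, h⟩ | rfl
  · change polyIntegral k (TrivSqZeroExt.snd (toDual k x)) = 0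
    rw [h hi, map_zero]
  · exact map_zero _

theorem integral_d [CharZero k] (x : Forms k 1) :
    integral k (d k x) = (alg (vertex (k := k) 1) x : k) - (alg (vertex (k := k) 0) x : k) := by
  change polyIntegral k (TrivSqZeroExt.snd (toDual k (d k x))) = _
  rw [(toDual_d x).2, polyIntegral_derivative]
  have key (v : Fin 2) (c : k) (h0 : 1 - c = if 0 = v then 1 else 0) (h1 : c = if 1 = v then 1 else 0)
      (x : Forms k 1) : eval c (TrivSqZeroExt.fst (toDual k x)) = (alg (vertex (k := k) v) x : k) := by
    have e : ((Polynomial.aeval c).comp (((TrivSqZeroExt.fstHom k k[X] k[X])).comp (toDual k)) :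
        Forms k 1 →ₐ[k] k) = (alg (vertex (k := k) v) : Forms k 1 →ₐ[k] k) := by
      refine algHom_ext ?_ ?_
      · intro i
        refine Eq.trans ?_ (vertex_t (k := k) v i).symm
        fin_cases i
        · simp only [Fin.zero_eta, AlgHom.comp_apply, toDual_t_zero]; simpa using h0
        · simp only [Fin.mk_one, AlgHom.comp_apply, toDual_t_one]; simpa using h1
      · intro i
        refine Eq.trans ?_ (vertex_of_ne (k := k) v one_ne_zero (dt_mem i)).symm
        fin_cases i
        · simp only [Fin.zero_eta, AlgHom.comp_apply, toDual_dt_zero]; simp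
        · simp only [Fin.mk_one, AlgHom.comp_apply, toDual_dt_one]; simp
    have := congrArg (fun f : Forms k 1 →ₐ[k] k => f x) e
    rw [← this]
    simp [Polynomial.coe_aeval_eq_eval]
  rw [key 1 1 (by simp) (by simp), key 0 0 (by simp) (by simp)]

end Forms

/-- A homotopy between the identity and an idempotent endomorphism of a dg algebra, subject to a
side condition. -/
structure Retract (C : CDGA k) where
  s : C →ₗ[k] C
  e : C →ₗ[k] C
  s_mem : ∀ {i : ℤ} {x : C}, x ∈ C.deg (i + 1) → s x ∈ C.deg i
  d_s : ∀ x : C, C.d (s x) + s (C.d x) = x - e x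
  s_s : ∀ x : C, s (s x) = 0
  s_e : ∀ x : C, s (e x) = 0

/-- Applying s to the homotopy relation gives s d s = s, and the relation at s x reads s d s x = s x
- e s x. -/
theorem Retract.e_s {C : CDGA k} (H : Retract C) (x : C) : H.e (H.s x) = 0 := by
  have h1 := H.d_s (H.s x)
  have h2 := congrArg H.s (H.d_s x)
  rw [map_add, map_sub, H.s_s, add_zero, H.s_e, sub_zero] at h2
  rw [H.s_s, map_zero, zero_add, h2] at h1
  rwa [eq_comm, sub_eq_self] at h1

section poincare

variable (k) {n : ℕ} (v : Fin (n + 1))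

/-- The linear contraction of the simplex to the vertex `v`. -/
def contraction : Omega k n ⟶ tensor (Omega k 1) (Omega k n) :=
  omegaLift (A := tensor (Omega k 1) (Omega k n))
    -- The straight line homotopy from the vertex v to the identity with parameter t₁: for t₁ = 1
    -- the coordinates are unchanged, for t₀ = 1 all weight is on v.
    (fun i => tmul (Forms.t k 1) (Forms.t k i) + if i = v then tmul (Forms.t k 0) 1 else 0)
    (fun i => by
      have h1 (j : Fin 2) (x : Forms k n) (hx : x ∈ Forms.deg k 0) :
          (tmul (Forms.t k j) x : Tens (Omega k 1) (Omega k n)) ∈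
            (tensor (Omega k 1) (Omega k n)).deg 0 :=
        tmul_mem (Forms.t_mem j) hx (add_zero 0)
      refine add_mem (h1 1 _ (Forms.t_mem i)) ?_
      split_ifs
      · exact h1 0 1 (SetLike.one_mem_graded _)
      · exact zero_mem _)
    (by
      rw [Finset.sum_add_distrib, Finset.sum_ite_eq', if_pos (Finset.mem_univ v)]
      have h1 : ∑ i, (tmul (Forms.t k 1) (Forms.t k i) : Tens (Omega k 1) (Omega k n)) =
          tmul (Forms.t k 1) 1 := by
        simp only [← tmulₗ_apply]
        rw [← map_sum]
        exact congrArg _ (Forms.sum_t k)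
      have h2 : (tmul (Forms.t k 1) 1 + tmul (Forms.t k 0) 1 : Tens (Omega k 1) (Omega k n)) =
          tmul (1 : Forms k 1) 1 := by
        rw [← Forms.sum_t k (n := 1), Fin.sum_univ_two, add_comm]
        simp only [← tmulₗ_apply, map_add, LinearMap.add_apply]
      exact (congrArg (· + _) h1).trans h2)

/-- Evaluation at a vertex followed by the inclusion of the constants. -/
def constAt : Omega k n ⟶ Omega k n := vertex v ≫ unitMap _

theorem contraction_t (i : Fin (n + 1)) : alg (contraction k v) (Forms.t k i) =
    (tmul (Forms.t k 1) (Forms.t k i) + (if i = v then tmul (Forms.t k 0) 1 else 0) :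
      Tens (Omega k 1) (Omega k n)) := omegaLift_t _ _ _ i

theorem contraction_end (j : Fin 2) : contraction k v ≫
    tlift (vertex j ≫ unitMap (Omega k n)) (𝟙 _) = if j = 1 then 𝟙 _ else constAt k v := by
  refine omega_hom_ext k fun i => ?_
  rw [alg_comp, contraction_t]
  have h0 (l : Fin 2) (x : Forms k n) : alg (tlift (vertex j ≫ unitMap (Omega k n)) (𝟙 _))
      (tmul (Forms.t k l) x : Tens (Omega k 1) (Omega k n)) = (if l = j then (1 : k) else 0) • x := by
    rw [alg_tlift, alg_comp, Algebra.smul_def, ← vertex_t (k := k) j l]; rfl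
  rw [map_add, h0]
  have h1 : alg (tlift (vertex j ≫ unitMap (Omega k n)) (𝟙 _))
      (if i = v then tmul (Forms.t k 0) 1 else 0 : Tens (Omega k 1) (Omega k n)) =
      if i = v then (if 0 = j then (1 : k) else 0) • (1 : Forms k n) else 0 := by
    split_ifs with h1 h2
    · rw [h0, if_pos h2]
    · rw [h0, if_neg h2]
    · exact map_zero _
  rw [h1]
  fin_cases j
  · have : alg (constAt k v) (Forms.t k i) = algebraMap k (Forms k n) (if i = v then 1 else 0) := by
      rw [← vertex_t (k := k) v i]; rfl
    simp only [Fin.zero_eta, Fin.isValue, zero_ne_one, one_ne_zero, if_false, if_true]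
    rw [this]
    split_ifs <;> simp
  · simp
    rfl

/-- Integration over the interval of forms on a product. -/
def fiberIntegral (C : CDGA k) : Tens (Omega k 1) C →ₗ[k] C :=
  tensLift (Omega k 1) C (LinearMap.lsmul k C ∘ₗ Forms.integral k)

theorem fiberIntegral_tmul (C : CDGA k) (x : Forms k 1) (y : C) :
    fiberIntegral k C (tmul (A := Omega k 1) x y) = Forms.integral k x • y := rfl

theorem fiberIntegral_mem (C : CDGA k) {i : ℤ} {z : Tens (Omega k 1) C}
    (hz : z ∈ tensDeg (Omega k 1) C (i + 1)) : fiberIntegral k C z ∈ C.deg i := by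
  refine tensDeg_induction (p := fun z => fiberIntegral k C z ∈ C.deg i) ?_ ?_ ?_ z hz
  · rw [map_zero]; exact zero_mem _
  · intro x y hx hy; rw [map_add]; exact add_mem hx hy
  · intro p q a b ha hb h
    rw [fiberIntegral_tmul]
    by_cases hp : p = 1
    · have : q = i := by omega
      exact Submodule.smul_mem _ _ (this ▸ hb)
    · rw [Forms.integral_of_ne hp ha, zero_smul]; exact zero_mem _

theorem fiberIntegral_d [CharZero k] (C : CDGA k) (z : Tens (Omega k 1) C) :
    fiberIntegral k C (tensD (Omega k 1) C z) + C.d (fiberIntegral k C z) =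
      alg (tlift (vertex 1 ≫ unitMap C) (𝟙 C)) z - alg (tlift (vertex 0 ≫ unitMap C) (𝟙 C)) z := by
  refine tens_induction (p := fun z => fiberIntegral k C (tensD (Omega k 1) C z) +
    C.d (fiberIntegral k C z) = alg (tlift (vertex 1 ≫ unitMap C) (𝟙 C)) z -
      alg (tlift (vertex 0 ≫ unitMap C) (𝟙 C)) z) ?_ ?_ ?_ z
  · simp
  · intro x y hx hy
    simp only [map_add]
    rw [add_sub_add_comm, ← hx, ← hy]; abel
  · intro p q a b ha _
    have h (j : Fin 2) : alg (tlift (vertex j ≫ unitMap C) (𝟙 C)) (tmul a b : Tens (Omega k 1) C) =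
        (alg (vertex (k := k) j) a : k) • b := by
      rw [alg_tlift, Algebra.smul_def]; rfl
    rw [h, h, ← sub_smul, ← Forms.integral_d, tensD_tmul _ _ a b ha, Units.smul_def, map_add,
      map_zsmul, fiberIntegral_tmul, fiberIntegral_tmul, fiberIntegral_tmul, map_smul]
    by_cases hp : p = 1
    · subst hp; simp
    · rw [Forms.integral_of_ne hp ha, zero_smul, smul_zero, add_zero,
        add_zero]

/-- The homotopy given by the linear contraction to a vertex. -/
def coneHomotopy : Forms k n →ₗ[k] Forms k n :=
  fiberIntegral k (Omega k n) ∘ₗ (alg (contraction k v)).toLinearMap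

/-- Stokes' formula for integration along the interval, applied to the pullback along the
contraction, whose ends are the identity and the constant map to v. -/
theorem coneHomotopy_d [CharZero k] (x : Forms k n) :
    coneHomotopy k v (Forms.d k x) + Forms.d k (coneHomotopy k v x) = x - alg (constAt k v) x := by
  have h1 := fiberIntegral_d k (Omega k n) (alg (contraction k v) x)
  have h3 : alg (tlift (vertex 0 ≫ unitMap (Omega k n)) (𝟙 _)) (alg (contraction k v) x) =
      alg (constAt k v) x := alg_congr (contraction_end k v 0) x
  have h4 : alg (tlift (vertex 1 ≫ unitMap (Omega k n)) (𝟙 _)) (alg (contraction k v) x) = x :=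
    alg_congr (contraction_end k v 1) x
  rw [h3, h4] at h1
  refine Eq.trans ?_ h1
  exact congrArg (fun z => fiberIntegral k (Omega k n) z +
    Forms.d k (fiberIntegral k (Omega k n) (alg (contraction k v) x))) (Hom.map_d (contraction k v) x)

theorem coneHomotopy_const (x : Forms k n) : coneHomotopy k v (alg (constAt k v) x) = 0 := by
  have h1 : constAt k v ≫ contraction k v = vertex v ≫ unitMap _ := by
    rw [constAt, Category.assoc, unitMap_comp]
  have h2 : alg (contraction k v) (alg (constAt k v) x) =
      alg (unitMap (tensor (Omega k 1) (Omega k n))) (alg (vertex v) x) :=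
    congrArg (fun f => alg f x) h1
  change fiberIntegral k (Omega k n) (alg (contraction k v) (alg (constAt k v) x)) = 0
  rw [h2]
  have h3 : ∀ c : k, (alg (unitMap (tensor (Omega k 1) (Omega k n))) c) =
      c • (tmul (1 : Forms k 1) 1 : Tens (Omega k 1) (Omega k n)) := fun c =>
    Algebra.algebraMap_eq_smul_one c
  rw [h3, map_smul, fiberIntegral_tmul, Forms.integral_of_ne zero_ne_one
    (SetLike.one_mem_graded _), zero_smul, smul_zero]

theorem d_constAt (x : Forms k n) : Forms.d k (alg (constAt k v) x) = 0 :=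
  (Hom.map_d (constAt k v) x).symm.trans (by
    change alg (unitMap (Omega k n)) (alg (vertex v) (Forms.d k x)) = 0
    have : alg (vertex v) (Forms.d k x) = (0 : k) := Hom.map_d (vertex v) x
    rw [this]; exact map_zero _)

/-- An affine map carries straight lines ending at u to straight lines ending at θ u. This is the
source of the naturality of all later constructions. -/
theorem omegaMap_contraction {m : ℕ} (θ : Fin (m + 1) → Fin (n + 1)) (u : Fin (m + 1)) :
    omegaMap k θ ≫ contraction k u =
      contraction k (θ u) ≫ tmap (𝟙 _) (omegaMap k θ) := by
  refine omega_hom_ext k fun i => ?_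
  rw [alg_comp, alg_comp, omegaMap_t, contraction_t, map_sum]
  refine (Finset.sum_congr rfl fun j _ => contraction_t k u j).trans ?_
  rw [Finset.sum_add_distrib, map_add, alg_tmap, omegaMap_t]
  congr 1
  · simp only [← tmulₗ_apply]
    rw [alg_id, map_sum]
  · rw [Finset.sum_ite_eq']
    simp only [Finset.mem_filter, Finset.mem_univ, true_and]
    by_cases h : i = θ u
    · rw [if_pos h, if_pos h.symm, alg_tmap, map_one, alg_id]
    · rw [if_neg h, if_neg (Ne.symm h), map_zero]

theorem coneHomotopy_omegaMap {m : ℕ} (θ : Fin (m + 1) → Fin (n + 1)) (u : Fin (m + 1))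
    (x : Forms k n) : coneHomotopy k u (alg (omegaMap k θ) x) =
      alg (omegaMap k θ) (coneHomotopy k (θ u) x) := by
  have h1 := alg_comp_congr (omegaMap_contraction k θ u) x
  change fiberIntegral k (Omega k m) (alg (contraction k u) (alg (omegaMap k θ) x)) =
    alg (omegaMap k θ) (fiberIntegral k (Omega k n) (alg (contraction k (θ u)) x))
  rw [h1]
  refine LinearMap.congr_fun (tens_ext (f := fiberIntegral k (Omega k m) ∘ₗ
    (alg (tmap (𝟙 (Omega k 1)) (omegaMap k θ))).toLinearMap)
    (g := (alg (omegaMap k θ)).toLinearMap ∘ₗ fiberIntegral k (Omega k n)) fun a b => ?_)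
    (alg (contraction k (θ u)) x)
  change fiberIntegral k (Omega k m) (alg (tmap _ _) (tmul a b)) =
    alg (omegaMap k θ) (fiberIntegral k (Omega k n) (tmul a b))
  rw [alg_tmap, fiberIntegral_tmul]
  exact (map_smul (alg (omegaMap k θ)) _ _).symm

/-- The contraction of the forms on a simplex to a vertex. -/
def omegaRetract [CharZero k] : Retract (Omega k n) where
  -- For the cone homotopy h the relation dh + hd = 1 - e gives dhd = d, so hdh is again a homotopy
  -- from e to the identity; with he = 0 it also squares to zero. Being made of h and d, it keeps
  -- the naturality of h.
  s := coneHomotopy k v ∘ₗ Forms.d k ∘ₗ coneHomotopy k v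
  e := (alg (constAt k v)).toLinearMap
  s_mem {i x} hx := by
    have h (j : ℤ) (y : Forms k n) (hy : y ∈ Forms.deg k (j + 1)) :
        coneHomotopy k v y ∈ Forms.deg k j :=
      fiberIntegral_mem k (Omega k n) (Hom.map_deg (contraction k v) _ _ hy)
    exact h _ _ (Forms.d_mem (h _ _ hx))
  d_s x := by
    have H (y : Forms k n) : coneHomotopy k v (Forms.d k y) =
        y - alg (constAt k v) y - Forms.d k (coneHomotopy k v y) :=
      eq_sub_of_add_eq (coneHomotopy_d k v y)
    have hd (y : Forms k n) : Forms.d k (coneHomotopy k v (Forms.d k y)) = Forms.d k y := by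
      rw [H, map_sub, map_sub, d_constAt, Forms.d_d, sub_zero, sub_zero]
    change Forms.d k (coneHomotopy k v (Forms.d k (coneHomotopy k v x))) +
      coneHomotopy k v (Forms.d k (coneHomotopy k v (Forms.d k x))) = x - alg (constAt k v) x
    rw [hd, hd, H, add_sub_cancel]
  s_s x := by
    have H (y : Forms k n) : coneHomotopy k v (Forms.d k y) =
        y - alg (constAt k v) y - Forms.d k (coneHomotopy k v y) :=
      eq_sub_of_add_eq (coneHomotopy_d k v y)
    have hd (y : Forms k n) : Forms.d k (coneHomotopy k v (Forms.d k y)) = Forms.d k y := by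
      rw [H, map_sub, map_sub, d_constAt, Forms.d_d, sub_zero, sub_zero]
    change coneHomotopy k v (Forms.d k (coneHomotopy k v (coneHomotopy k v (Forms.d k
      (coneHomotopy k v x))))) = 0
    set y := coneHomotopy k v (Forms.d k (coneHomotopy k v x)) with hy
    have h1 : Forms.d k (coneHomotopy k v y) = y - alg (constAt k v) y - coneHomotopy k v (Forms.d k y) :=
      eq_sub_of_add_eq' (coneHomotopy_d k v y)
    rw [h1, hy, hd, sub_sub_cancel_left, map_neg, coneHomotopy_const, neg_zero]
  s_e x := by
    change coneHomotopy k v (Forms.d k (coneHomotopy k v (alg (constAt k v) x))) = 0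
    rw [coneHomotopy_const, map_zero, map_zero]

theorem omegaRetract_omegaMap [CharZero k] {m : ℕ} (θ : Fin (m + 1) → Fin (n + 1)) (u : Fin (m + 1))
    (x : Forms k n) : (omegaRetract k u).s (alg (omegaMap k θ) x) =
      alg (omegaMap k θ) ((omegaRetract k (θ u)).s x) := by
  change coneHomotopy k u (Forms.d k (coneHomotopy k u (alg (omegaMap k θ) x))) =
    alg (omegaMap k θ) (coneHomotopy k (θ u) (Forms.d k (coneHomotopy k (θ u) x)))
  have h : ∀ y : Forms k n, Forms.d k (alg (omegaMap k θ) y) = alg (omegaMap k θ) (Forms.d k y) :=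
    fun y => (Hom.map_d (omegaMap k θ) y).symm
  rw [coneHomotopy_omegaMap, h, coneHomotopy_omegaMap]

end poincare

/-- The tensor product of a homotopy with an algebra. -/
def Retract.tensor {W : CDGA k} (H : Retract W) (Y : CDGA k) : Retract (CDGA.tensor W Y) where
  s := tensLift W Y ((tmulₗ W Y).compl₁₂ H.s LinearMap.id)
  e := tensLift W Y ((tmulₗ W Y).compl₁₂ H.e LinearMap.id)
  s_mem {i x} hx := by
    refine tensDeg_induction (p := fun x => tensLift W Y _ x ∈ tensDeg W Y i) ?_ ?_ ?_ x hx
    · rw [map_zero]; exact zero_mem _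
    · intro x y hx hy; rw [map_add]; exact add_mem hx hy
    · intro p q a b ha hb h
      rw [tensLift_tmul]
      exact tmul_mem (i := p - 1) (H.s_mem (by rwa [sub_add_cancel])) hb (by omega)
  d_s x := by
    refine tens_induction (p := fun x => tensD W Y (tensLift W Y _ x) +
      tensLift W Y _ (tensD W Y x) = x - tensLift W Y _ x) ?_ ?_ ?_ x
    · simp
    · intro x y hx hy
      simp only [map_add]
      rw [add_sub_add_comm, ← hx, ← hy]; abel
    · intro i j a b ha hb
      have hs : H.s a ∈ W.deg (i - 1) := H.s_mem (by rwa [sub_add_cancel])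
      simp only [tensLift_tmul, LinearMap.compl₁₂_apply, LinearMap.id_apply, tmulₗ_apply]
      rw [tensD_tmul W Y _ _ hs, tensD_tmul W Y _ _ ha, Units.smul_def, Units.smul_def, map_add,
        map_zsmul]
      simp only [tensLift_tmul, LinearMap.compl₁₂_apply, LinearMap.id_apply, tmulₗ_apply]
      have e1 : (((-1 : ℤˣ) ^ (i - 1) : ℤˣ) : ℤ) = -(((-1 : ℤˣ) ^ i : ℤˣ) : ℤ) := by
        rw [zpow_sub_one]; simp
      have e2 := congrArg (fun z => tmul z b) (H.d_s a)
      simp only [← tmulₗ_apply, map_add, map_sub, LinearMap.add_apply, LinearMap.sub_apply] at e2 ⊢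
      rw [e1, ← e2, neg_smul]; abel
  s_s x := by
    refine tens_induction (p := fun x => tensLift W Y _ (tensLift W Y _ x) = 0) ?_ ?_ ?_ x
    · simp
    · intro x y hx hy; rw [map_add, map_add, hx, hy, add_zero]
    · intro i j a b _ _
      change tmul (H.s (H.s a)) b = 0
      rw [H.s_s]; simp [← tmulₗ_apply]
  s_e x := by
    refine tens_induction (p := fun x => tensLift W Y _ (tensLift W Y _ x) = 0) ?_ ?_ ?_ x
    · simp
    · intro x y hx hy; rw [map_add, map_add, hx, hy, add_zero]
    · intro i j a b _ _
      change tmul (H.s (H.e a)) b = 0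
      rw [H.s_e]; simp [← tmulₗ_apply]

theorem Retract.tensor_s_tmul {W : CDGA k} (H : Retract W) (Y : CDGA k) (w : W) (y : Y) :
    (H.tensor Y).s (tmul w y : Tens W Y) = (tmul (H.s w) y : Tens W Y) := rfl

theorem Retract.tensor_map {W W' Y Y' : CDGA k} (H : Retract W) (H' : Retract W') (f : W ⟶ W')
    (g : Y ⟶ Y') (h : ∀ x, H'.s (alg f x) = alg f (H.s x)) (x : Tens W Y) :
    (H'.tensor Y').s (alg (tmap f g) x) = alg (tmap f g) ((H.tensor Y).s x) := by
  refine LinearMap.congr_fun (tens_ext (f := (H'.tensor Y').s ∘ₗ (alg (tmap f g)).toLinearMap)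
    (g := (alg (tmap f g)).toLinearMap ∘ₗ (H.tensor Y).s) fun a b => ?_) x
  change (H'.tensor Y').s (alg (tmap f g) (tmul a b)) =
    alg (tmap f g) ((H.tensor Y).s (tmul a b : Tens W Y))
  rw [alg_tmap, Retract.tensor_s_tmul, Retract.tensor_s_tmul, alg_tmap, h]

end DG

/-! ### Gauge fixing, barycenters and scaling of points. -/

namespace DG

open CDGA WithConv

variable {k : Type u} [Field k] {R : Type u} [CommRing R] [HopfAlgebra k R] {C C' : CDGA k}
  {φ : NilFil C} {ψ : NilFil C'}

/-- A derivation along the counit is determined by its values on coordinates. -/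
theorem IsEpsDer.mem_of_coords {V : Type u} [AddCommGroup V] [Module k V] {f : R →ₗ[k] V}
    (hf : IsEpsDer f) (c : Coords k R) (p : Submodule k V) (h : ∀ l, f (c.x l) ∈ p) (r : R) :
    f r ∈ p := by
  have h0 : Coalgebra.counit (R := k) (r - algebraMap k R (Coalgebra.counit r)) = 0 :=
    sub_counit_mem r
  obtain ⟨a, ha⟩ := c.sq _ h0
  have := hf.map_sq ha
  rw [map_sub, map_sub, hf.map_algebraMap, sub_zero, sub_eq_zero, map_sum] at this
  rw [this]
  exact sum_mem fun l _ => by rw [map_smul]; exact Submodule.smul_mem _ _ (h l)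

theorem IsEpsDer.sub {V : Type u} [AddCommGroup V] [Module k V] {f g : R →ₗ[k] V}
    (hf : IsEpsDer f) (hg : IsEpsDer g) : IsEpsDer (f - g) := by
  intro r s
  simp only [LinearMap.sub_apply, hf r s, hg r s, smul_sub]
  abel

section gauge

variable (c : Coords k R) (H : Retract C)
  (hF : ∀ i, ∀ x ∈ φ.F i, H.s x ∈ φ.F i) (he : ∀ x ∈ C.deg 1, H.e x = 0)

include hF he in
-- Applying s and e to the hypothesis gives s g(x_l) = 0 and e g(x_l) = 0, hence g(x_l) = s d
-- g(x_l), and the hypothesis becomes s w(x_l) = 0 for w = z - g⁻¹dg. The Maurer-Cartan equations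
-- give dw = -(z w + w g⁻¹dg). As e vanishes in degree one, w(x_l) = s d w(x_l), so w moves one step
-- deeper each time this is used and is zero by nilpotence.
theorem form_eq_of_gauge {z : Conv R C} (hz : IsMC φ z) {g : Pt R φ} (hg : ∀ l,
    g.toAlgHom (c.x l) + H.s (g.form (c.x l) - C.d (g.toAlgHom (c.x l))) = H.s (z (c.x l))) :
    g.form = z := by
  have h1 (l : Fin c.n) : H.s (g.toAlgHom (c.x l)) = 0 := by
    have := congrArg H.s (hg l)
    rwa [map_add, H.s_s, H.s_s, add_zero] at this
  have h2 (l : Fin c.n) : H.e (g.toAlgHom (c.x l)) = 0 := by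
    have := congrArg H.e (hg l)
    rwa [map_add, H.e_s, H.e_s, add_zero] at this
  have h3 (l : Fin c.n) : H.s ((z - g.form) (c.x l)) = 0 := by
    have e := H.d_s (g.toAlgHom (c.x l))
    rw [h1, h2, map_zero, zero_add, sub_zero] at e
    have := hg l
    rw [map_sub, e, add_sub_cancel] at this
    change H.s (z (c.x l) - g.form (c.x l)) = 0
    rw [map_sub, this, sub_self]
  have h4 : (z - g.form).d = -(z * (z - g.form) + (z - g.form) * g.form) := by
    rw [Conv.d_sub, eq_neg_of_add_eq_zero_left hz.eq, eq_neg_of_add_eq_zero_left g.form_isMC.eq]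
    noncomm_ring
  have h5 (l : Fin c.n) : (z - g.form) (c.x l) = H.s ((z - g.form).d (c.x l)) := by
    have e := H.d_s ((z - g.form) (c.x l))
    have h0 : (z - g.form) (c.x l) ∈ C.deg 1 := sub_mem (hz.deg _) (g.form_mem_deg _)
    rw [h3, map_zero, zero_add, he _ h0, sub_zero] at e
    exact e.symm
  have hder : IsEpsDer (z - g.form).ofConv := hz.der.sub g.form_isEpsDer
  have h6 : ∀ i, ∀ r, (z - g.form) r ∈ φ.F (i + 1) := by
    intro i
    induction i with
    | zero => exact fun r => sub_mem (hz.mem r) (g.form_mem r)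
    | succ i ih =>
      refine hder.mem_of_coords c (φ.F (i + 1 + 1)) fun l => ?_
      change (z - g.form) (c.x l) ∈ _
      rw [h5, h4]
      refine hF _ _ (neg_mem (add_mem ?_ ?_))
      · refine Conv.mul_mem (P := φ.F 1) (Q := φ.F (i + 1)) (fun x hx y hy => ?_) hz.mem ih _
        rw [add_comm]; exact φ.mul hx hy
      · exact Conv.mul_mem (P := φ.F (i + 1)) (Q := φ.F 1) (fun x hx y hy => φ.mul hx hy) ih
          g.form_mem _
  obtain ⟨N, hN⟩ := φ.nil
  have h7 : z - g.form = 0 := by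
    ext r
    have := φ.le (Nat.le_succ N) (h6 N r)
    rw [hN] at this
    exact this
  exact (sub_eq_zero.1 h7).symm

variable [CharZero k]

include hF in
-- By `Pt.form_sub_form_mem` the left hand side is, to first order, the tuple of coordinates of g.
theorem exists_unique_gauge {z : Conv R C} (hz : IsMC φ z) : ∃! g : Pt R φ, ∀ l,
    g.toAlgHom (c.x l) + H.s (g.form (c.x l) - C.d (g.toAlgHom (c.x l))) = H.s (z (c.x l)) := by
  have hd (g : Pt R φ) (l : Fin c.n) : C.d (g.toAlgHom (c.x l)) ∈ C.deg (0 + 1) :=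
    C.d_mem 0 _ (g.mem_deg _)
  obtain ⟨g, hg, hu⟩ := Pt.exists_unique_of_approx c (φ := φ)
    (fun g l => g.toAlgHom (c.x l) + H.s (g.form (c.x l) - C.d (g.toAlgHom (c.x l))))
    (fun g l => ⟨add_mem (g.mem_deg _) (H.s_mem (sub_mem (g.form_mem_deg _) (hd g l))),
      add_mem (g.coord_mem c l) (hF _ _ (sub_mem (g.form_mem _) (φ.d_mem (g.coord_mem c l))))⟩)
    (fun i _ g g' h l => by
      have h1 := hF _ _ (Pt.form_sub_form_mem h (c.x l))
      have e : g.toAlgHom (c.x l) + H.s (g.form (c.x l) - C.d (g.toAlgHom (c.x l))) -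
          (g'.toAlgHom (c.x l) + H.s (g'.form (c.x l) - C.d (g'.toAlgHom (c.x l)))) -
          (g.toAlgHom (c.x l) - g'.toAlgHom (c.x l)) =
          H.s (g.form (c.x l) - g'.form (c.x l) -
            C.d (g.toAlgHom (c.x l) - g'.toAlgHom (c.x l))) := by
        simp only [map_sub]; abel
      rwa [e]) (fun l => H.s (z (c.x l)))
    (fun l => ⟨H.s_mem (by rw [zero_add]; exact hz.deg _), hF _ _ (hz.mem _)⟩)
  exact ⟨g, fun l => congrFun hg l, fun g' hg' => hu g' (funext hg')⟩

/-- The gauge transformation from the trivial to a given Maurer-Cartan element, normalized with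
respect to a contracting homotopy. -/
def gauge {z : Conv R C} (hz : IsMC φ z) : Pt R φ := (exists_unique_gauge c H hF hz).choose

theorem gauge_spec {z : Conv R C} (hz : IsMC φ z) (l : Fin c.n) :
    (gauge c H hF hz).toAlgHom (c.x l) + H.s ((gauge c H hF hz).form (c.x l) -
      C.d ((gauge c H hF hz).toAlgHom (c.x l))) = H.s (z (c.x l)) :=
  (exists_unique_gauge c H hF hz).choose_spec.1 l

include he in
theorem form_gauge {z : Conv R C} (hz : IsMC φ z) : (gauge c H hF hz).form = z :=
  form_eq_of_gauge c H hF he hz (gauge_spec c H hF hz)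

/-- The image of the normalized point satisfies the normalization in C', so uniqueness applies. -/
theorem map_gauge (H' : Retract C') (hF' : ∀ i, ∀ x ∈ ψ.F i, H'.s x ∈ ψ.F i) (f : C ⟶ C')
    (h : ∀ i, ∀ x ∈ φ.F i, alg f x ∈ ψ.F i) (hs : ∀ x, H'.s (alg f x) = alg f (H.s x))
    {z : Conv R C} (hz : IsMC φ z) {z' : Conv R C'} (hz' : IsMC ψ z')
    (e : Conv.map (alg f) z = z') :
    Pt.map f h (gauge c H hF hz) = gauge c H' hF' hz' := by
  subst e
  refine (exists_unique_gauge c H' hF' hz').choose_spec.2 _ fun l => ?_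
  rw [Pt.form_map, Pt.map_apply, Conv.map_apply, Conv.map_apply, ← Hom.map_d, ← map_sub, hs, hs,
    ← map_add, gauge_spec]

end gauge

section mean

variable [CharZero k] (c : Coords k R)

/-- Points can be simultaneously translated to have vanishing barycenter. -/
theorem exists_unique_mean {ι : Type*} [Fintype ι] (t : ι → C) (ht : ∀ i, t i ∈ C.deg 0)
    (hs : ∑ i, t i = 1) (g : ι → Pt R φ) :
    ∃! h : Pt R φ, ∀ l, ∑ i, t i * (g i * h).toAlgHom (c.x l) = 0 := by
  have hdeg {x y : C} (hx : x ∈ C.deg 0) (hy : y ∈ C.deg 0) : x * y ∈ C.deg 0 := by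
    have := SetLike.mul_mem_graded hx hy; rwa [add_zero] at this
  obtain ⟨g, hg, hu⟩ := Pt.exists_unique_of_approx c (φ := φ)
    (fun h l => ∑ i, t i * (g i * h).toAlgHom (c.x l))
    (fun h l => ⟨sum_mem fun i _ => hdeg (ht i) ((g i * h).mem_deg _),
      sum_mem fun i _ => φ.mul_left _ ((g i * h).coord_mem c l)⟩)
    (fun i _ h h' H l => by
      -- Since the t_i have sum 1, the deviation from the identity is a combination of the products
      -- (g_i - 1)(h - h'), which are one step deeper than h - h'.
      have e : ∑ i, t i * (g i * h).toAlgHom (c.x l) - ∑ i, t i * (g i * h').toAlgHom (c.x l) -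
          (h.toAlgHom (c.x l) - h'.toAlgHom (c.x l)) =
          ∑ i, t i * ((((g i).conv - 1) * (h.conv - h'.conv)) (c.x l)) := by
        have h1 (i) : (g i * h).toAlgHom (c.x l) - (g i * h').toAlgHom (c.x l) -
            (h.toAlgHom (c.x l) - h'.toAlgHom (c.x l)) =
            (((g i).conv - 1) * (h.conv - h'.conv)) (c.x l) := by
          have : ((g i).conv - 1) * (h.conv - h'.conv) =
              (g i * h).conv - (g i * h').conv - (h.conv - h'.conv) := by
            rw [Pt.conv_mul, Pt.conv_mul]; noncomm_ring
          rw [this]; rfl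
        simp only [← h1]
        simp only [mul_sub, Finset.sum_sub_distrib, ← Finset.sum_mul, hs, one_mul]
      rw [e]
      refine sum_mem fun j _ => φ.mul_left _ ?_
      refine Conv.mul_mem (P := φ.F 1) (Q := φ.F i) (fun x hx y hy => ?_)
        (Pt.conv_sub_one_mem _) H _
      rw [add_comm]; exact φ.mul hx hy) 0 (fun l => ⟨zero_mem _, zero_mem _⟩)
  exact ⟨g, fun l => congrFun hg l, fun g' hg' => hu g' (funext hg')⟩

theorem exists_scale (T : C) (hT : T ∈ C.deg 0) (g : Pt R φ) :
    ∃ h : Pt R φ, ∀ l, h.toAlgHom (c.x l) = T * g.toAlgHom (c.x l) :=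
  Pt.exists_of_coords c φ _ fun l => ⟨by
    have := SetLike.mul_mem_graded hT (g.mem_deg (c.x l)); rwa [add_zero] at this,
    φ.mul_left _ (g.coord_mem c l)⟩

/-- The point obtained by multiplying the coordinates of a point with an element of degree zero. -/
def scale (T : C) (hT : T ∈ C.deg 0) (g : Pt R φ) : Pt R φ := (exists_scale c T hT g).choose

theorem scale_apply (T : C) (hT : T ∈ C.deg 0) (g : Pt R φ) (l : Fin c.n) :
    (scale c T hT g).toAlgHom (c.x l) = T * g.toAlgHom (c.x l) :=
  (exists_scale c T hT g).choose_spec l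

theorem scale_one (hT : (1 : C) ∈ C.deg 0) (g : Pt R φ) : scale c 1 hT g = g :=
  Pt.ext_coords c fun l => by rw [scale_apply, one_mul]

theorem scale_zero (hT : (0 : C) ∈ C.deg 0) (g : Pt R φ) : scale c 0 hT g = 1 :=
  Pt.ext_coords c fun l => by
    rw [scale_apply, zero_mul]
    change 0 = algebraMap k C (Coalgebra.counit (c.x l))
    rw [c.counit_x, map_zero]

theorem map_scale (f : C ⟶ C') (h : ∀ i, ∀ x ∈ φ.F i, alg f x ∈ ψ.F i) (T : C) (hT : T ∈ C.deg 0)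
    (g : Pt R φ) {T' : C'} (hT' : T' ∈ C'.deg 0) (e : alg f T = T') :
    Pt.map f h (scale c T hT g) = scale c T' hT' (Pt.map f h g) :=
  Pt.ext_coords c fun l => by
    rw [Pt.map_apply, scale_apply, scale_apply, map_mul, e, Pt.map_apply]

end mean

end DG

/-! ### Maurer-Cartan elements of the dg Lie algebra as derivations along the counit. -/

namespace DG

open CDGA WithConv DGLie

variable {k : Type u} [Field k] {R : Type u} [CommRing R] [HopfAlgebra k R]
  {B : Type u} [CommRing B] [Algebra k B]

/-- The rearrangement of the factors of `(A ⊗ W) ⊗ B`. -/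
def rearrange (A W B : CDGA k) : tensor (tensor A W) B ⟶ tensor W (tensor A B) :=
  tlift (tlift (inl A B ≫ inr W _) (inl W _)) (inr A B ≫ inr W _)

/-- The inverse of `rearrange`. -/
def rearrangeInv (A W B : CDGA k) : tensor W (tensor A B) ⟶ tensor (tensor A W) B :=
  tlift (inr A W ≫ inl _ _) (tlift (inl A W ≫ inl _ _) (inr _ _))

theorem rearrange_inv (A W B : CDGA k) : rearrange A W B ≫ rearrangeInv A W B = 𝟙 _ := by
  refine tensor_hom_ext (tensor_hom_ext ?_ ?_) ?_ <;> simp [rearrange, rearrangeInv]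

theorem rearrangeInv_rearrange (A W B : CDGA k) :
    rearrangeInv A W B ≫ rearrange A W B = 𝟙 _ := by
  refine tensor_hom_ext ?_ (tensor_hom_ext ?_ ?_) <;> simp [rearrange, rearrangeInv]

theorem rearrange_tmap {A W B A' W' B' : CDGA k} (a : A ⟶ A') (w : W ⟶ W') (b : B ⟶ B') :
    tmap (tmap a w) b ≫ rearrange A' W' B' = rearrange A W B ≫ tmap w (tmap a b) := by
  refine tensor_hom_ext (tensor_hom_ext ?_ ?_) ?_ <;> simp [rearrange, tmap]

theorem rearrangeInv_aug (A : DGArt k) (W B : CDGA k) :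
    rearrangeInv A.toCDGA W B ≫ tmap (A.augBase W) (𝟙 B) = tmap (𝟙 W) (A.augBase B) := by
  refine tensor_hom_ext ?_ (tensor_hom_ext ?_ ?_) <;>
    simp [rearrangeInv, tmap, DGArt.augBase]
  rw [unitMap_comp, unitMap_comp]

theorem epsDer_add (D E : lieAlgebra k R) : epsDer (D + E) = epsDer D + epsDer E := by
  ext r; simp [epsDer]

theorem epsDer_smul (a : k) (D : lieAlgebra k R) : epsDer (a • D) = a • epsDer D := by
  ext r; simp [epsDer]

/-- The bilinear map sending an element `v` and an invariant derivation `D` to `r ↦ ε(D r) v`. -/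
def derSmul (V : Type u) [AddCommGroup V] [Module k V] :
    V →ₗ[k] lieAlgebra k R →ₗ[k] R →ₗ[k] V :=
  LinearMap.mk₂ k (fun v D => (epsDer D).smulRight v)
    (fun v w D => by ext r; simp)
    (fun c v D => by ext r; exact smul_comm _ _ _)
    (fun v D E => by ext r; simp [epsDer_add, add_smul])
    (fun c v D => by ext r; simp [epsDer_smul, mul_smul])

section

variable (R B) (Y : CDGA k)

/-- The dg Lie algebra `B ⊗ g`. -/
abbrev coeffLie : DGLie k := DGLie.ofLie (k := k) (B ⊗[k] lieAlgebra k R)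

variable {R B} in
/-- The pure tensors of the Lie algebra `B ⊗ g`. -/
def coeffLie.tmul (b : B) (D : lieAlgebra k R) : coeffLie (k := k) R B :=
  (b ⊗ₜ D : B ⊗[k] lieAlgebra k R)

/-- The linear map which identifies `Y ⊗ (B ⊗ g)` with the derivations along the counit. -/
def toDer : Y ⊗[k] coeffLie (k := k) R B →ₗ[k] R →ₗ[k] Tens Y (ofComm B) :=
  TensorProduct.lift (derSmul (Tens Y (ofComm (k := k) B)) ∘ₗ
    TensorProduct.lift (tmulₗ Y (ofComm B))) ∘ₗ
    (TensorProduct.assoc k Y B (lieAlgebra k R)).symm.toLinearMap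

variable {R B Y}

theorem toDer_tmul (y : Y) (b : B) (D : lieAlgebra k R) (r : R) :
    toDer R B Y (y ⊗ₜ coeffLie.tmul b D) r = epsDer D r • (tmul y b : Tens Y (ofComm B)) := rfl

theorem coeff_induction {p : Y ⊗[k] coeffLie (k := k) R B → Prop} (zero : p 0)
    (add : ∀ x y, p x → p y → p (x + y))
    (mem : ∀ (i : ℤ) (y : Y), y ∈ Y.deg i → ∀ (b : B) (D : lieAlgebra k R), p (y ⊗ₜ coeffLie.tmul b D))
    (z : Y ⊗[k] coeffLie (k := k) R B) : p z := by
  refine TensorProduct.induction_on z zero (fun y l => ?_) add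
  refine TensorProduct.induction_on (motive := fun l => p (y ⊗ₜ l)) l ?_ (fun b D => ?_) ?_
  · have : (y ⊗ₜ[k] (0 : coeffLie (k := k) R B)) = 0 := TensorProduct.tmul_zero _ y
    exact this ▸ zero
  · refine Y.hom_induction (p := fun y => p (y ⊗ₜ coeffLie.tmul b D)) ?_ ?_ ?_ y
    · rw [TensorProduct.zero_tmul]; exact zero
    · intro x y hx hy; rw [TensorProduct.add_tmul]; exact add _ _ hx hy
    · exact fun i y hy => mem i y hy b D
  · intro l l' hl hl'
    have : (y ⊗ₜ[k] (l + l' : coeffLie (k := k) R B)) = y ⊗ₜ l + y ⊗ₜ l' :=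
      TensorProduct.tmul_add y _ _
    exact this ▸ add _ _ hl hl'

theorem toDer_isEpsDer (z : Y ⊗[k] coeffLie (k := k) R B) : IsEpsDer (toDer R B Y z) := by
  refine coeff_induction (p := fun z => IsEpsDer (toDer R B Y z)) ?_ ?_ ?_ z
  · intro r s; simp
  · intro x y hx hy r s
    rw [map_add, LinearMap.add_apply, LinearMap.add_apply, LinearMap.add_apply, hx r s, hy r s,
      smul_add, smul_add]; abel
  · intro i y _ b D r s
    rw [toDer_tmul, toDer_tmul, toDer_tmul, epsDer_isEpsDer D r s, add_smul, smul_smul, smul_smul]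
    rfl

theorem toDer_d (z : Y ⊗[k] coeffLie (k := k) R B) (r : R) :
    toDer R B Y (extD Y (coeffLie R B) z) r = tensD Y (ofComm B) (toDer R B Y z r) := by
  refine coeff_induction (p := fun z => toDer R B Y (extD Y (coeffLie R B) z) r =
    tensD Y (ofComm B) (toDer R B Y z r)) ?_ ?_ ?_ z
  · simp
  · intro x y hx hy
    rw [map_add, map_add, map_add, LinearMap.add_apply, LinearMap.add_apply, hx, hy, map_add]
  · intro i y hy b D
    rw [extD_tmul hy]
    have h0 : (y ⊗ₜ[k] (coeffLie (k := k) R B).d (coeffLie.tmul b D)) = 0 := TensorProduct.tmul_zero _ y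
    rw [h0, smul_zero, add_zero, toDer_tmul, toDer_tmul, map_smul, tensD_tmul _ _ _ _ hy]
    have h1 : (tmul y ((ofComm (k := k) B).d b) : Tens Y (ofComm B)) = 0 :=
      map_zero (tmulₗ Y (ofComm (k := k) B) y)
    rw [h1, smul_zero, add_zero]

/-- The Lie algebra is concentrated in degree zero, so the coefficients carry the whole degree. -/
theorem extDeg_le {n : ℤ} : extDeg Y (coeffLie (k := k) R B) n ≤
    Submodule.span k {z | ∃ y ∈ Y.deg n, ∃ (b : B) (D : lieAlgebra k R), z = y ⊗ₜ coeffLie.tmul b D} := by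
  refine Submodule.span_le.2 ?_
  rintro _ ⟨i, j, hij, y, hy, l, hl, rfl⟩
  rcases (mem_degZero (k := k) (M := B ⊗[k] lieAlgebra k R) j l).1 hl with rfl | rfl
  · rw [add_zero] at hij
    subst hij
    refine TensorProduct.induction_on (motive := fun l => (y ⊗ₜ l : Y ⊗[k] coeffLie (k := k) R B) ∈
      Submodule.span k {z | ∃ y ∈ Y.deg i, ∃ (b : B) (D : lieAlgebra k R), z = y ⊗ₜ coeffLie.tmul b D})
      l ?_ (fun b D => ?_) ?_
    · have : (y ⊗ₜ[k] (0 : coeffLie (k := k) R B)) = 0 := TensorProduct.tmul_zero _ y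
      exact this ▸ zero_mem _
    · exact Submodule.subset_span ⟨y, hy, b, D, rfl⟩
    · intro l l' hl hl'
      have : (y ⊗ₜ[k] (l + l' : coeffLie (k := k) R B)) = y ⊗ₜ l + y ⊗ₜ l' :=
        TensorProduct.tmul_add y _ _
      exact this ▸ add_mem hl hl'
  · have : (y ⊗ₜ[k] (0 : coeffLie (k := k) R B)) = 0 := TensorProduct.tmul_zero _ y
    exact this ▸ zero_mem _

theorem toDer_mem_deg {n : ℤ} {z : Y ⊗[k] coeffLie (k := k) R B}
    (hz : z ∈ extDeg Y (coeffLie R B) n) (r : R) : toDer R B Y z r ∈ tensDeg Y (ofComm B) n := by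
  refine Submodule.span_induction (p := fun z _ => toDer R B Y z r ∈ tensDeg Y (ofComm B) n)
    ?_ ?_ ?_ ?_ (extDeg_le hz)
  · rintro _ ⟨y, hy, b, D, rfl⟩
    rw [toDer_tmul]
    exact Submodule.smul_mem _ _ (tmul_mem hy ((mem_degZero (k := k) (M := B) 0 b).2 (Or.inl rfl))
      (add_zero n))
  · rw [map_zero]; exact zero_mem _
  · intro x y _ _ hx hy; rw [map_add]; exact add_mem hx hy
  · intro c x _ hx; rw [map_smul]; exact Submodule.smul_mem _ _ hx

/-- `toDer` with values in the convolution algebra. -/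
def toConvDer : Y ⊗[k] coeffLie (k := k) R B →ₗ[k] Conv R (tensor Y (ofComm B)) where
  toFun z := toConv (toDer R B Y z)
  map_add' x y := by rw [map_add]; rfl
  map_smul' c x := by rw [map_smul]; rfl

/-- By `epsDer_lie` the bracket of invariant derivations is a commutator of convolution products.
The coefficients have degree one and anticommute, so exchanging them turns the difference into a
sum. For z = w this makes half the bracket equal to z * z. -/
theorem toConvDer_bracket {z w : Y ⊗[k] coeffLie (k := k) R B}
    (hz : z ∈ extDeg Y (coeffLie R B) 1) (hw : w ∈ extDeg Y (coeffLie R B) 1) :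
    toConvDer (extBracket Y (coeffLie R B) z w) =
      toConvDer z * toConvDer w + toConvDer w * toConvDer z := by
  have hz' := extDeg_le hz
  have hw' := extDeg_le hw
  clear hz hw
  induction hz' using Submodule.span_induction with
  | zero => rw [map_zero, LinearMap.zero_apply, map_zero, zero_mul, mul_zero, add_zero]
  | add x y _ _ hx hy =>
    rw [map_add, LinearMap.add_apply, map_add, hx, hy, map_add, add_mul, mul_add]; abel
  | smul c x _ hx =>
    rw [map_smul, LinearMap.smul_apply, map_smul, hx, map_smul, smul_mul_assoc, mul_smul_comm,
      smul_add]
  | mem z hz =>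
    induction hw' using Submodule.span_induction with
    | zero => rw [map_zero, map_zero, zero_mul, mul_zero, add_zero]
    | add x y _ _ hx hy => rw [map_add, map_add, hx, hy, map_add, add_mul, mul_add]; abel
    | smul c x _ hx =>
      rw [map_smul, map_smul, hx, map_smul, smul_mul_assoc, mul_smul_comm, smul_add]
    | mem w hw =>
      obtain ⟨y, hy, b, D, rfl⟩ := hz
      obtain ⟨y', hy', b', D', rfl⟩ := hw
      have hl : coeffLie.tmul b D ∈ (coeffLie (k := k) R B).deg 0 :=
        (mem_degZero (k := k) 0 _).2 (Or.inl rfl)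
      rw [extBracket_tmul y hl hy' (coeffLie.tmul b' D')]
      have hb : (coeffLie (k := k) R B).bracket (coeffLie.tmul b D) (coeffLie.tmul b' D') =
          coeffLie.tmul (b * b') ⁅D, D'⁆ :=
        LieAlgebra.ExtendScalars.bracket_tmul k B (lieAlgebra k R) (lieAlgebra k R) b b' D D'
      rw [hb, zero_mul, zpow_zero, one_smul]
      ext r
      let p := Coalgebra.Repr.arbitrary k r
      have hB (b : B) : b ∈ (ofComm (k := k) B).deg 0 :=
        (mem_degZero (k := k) (M := B) 0 b).2 (Or.inl rfl)
      have m1 : (tmul y b * tmul y' b' : Tens Y (ofComm (k := k) B)) = tmul (y * y') (b * b') := by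
        rw [tmul_mul_tmul Y (ofComm (k := k) B) y y' b b' (hB b) hy', zero_mul, zpow_zero, one_smul]
      have m2 : (tmul y' b' * tmul y b : Tens Y (ofComm (k := k) B)) =
          -tmul (y * y') (b * b') := by
        rw [tmul_mul_tmul Y (ofComm (k := k) B) y' y b' b (hB b') hy, zero_mul, zpow_zero, one_smul,
          Y.comm 1 1 y' y hy' hy, mul_one, zpow_one, Units.neg_smul, one_smul, mul_comm b' b]
        simp [← tmulₗ_apply]
      change epsDer ⁅D, D'⁆ r • (tmul (y * y') (b * b') : Tens Y (ofComm (k := k) B)) =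
        (toConvDer (y ⊗ₜ coeffLie.tmul b D) * toConvDer (y' ⊗ₜ coeffLie.tmul b' D')) r +
          (toConvDer (y' ⊗ₜ coeffLie.tmul b' D') * toConvDer (y ⊗ₜ coeffLie.tmul b D)) r
      have key (D D' : lieAlgebra k R) (y y' : Y) (b b' : B) :
          ((toConvDer (y ⊗ₜ coeffLie.tmul b D) * toConvDer (y' ⊗ₜ coeffLie.tmul b' D') :
            Conv R (tensor Y (ofComm (k := k) B))) r) =
          TensorProduct.lift ((LinearMap.mul k k).compl₁₂ (epsDer D) (epsDer D'))
            (Coalgebra.comul r) • (tmul y b * tmul y' b' : Tens Y (ofComm (k := k) B)) := by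
        rw [p.convMul_apply, ← p.eq, map_sum, Finset.sum_smul]
        refine Finset.sum_congr rfl fun i _ => ?_
        change (epsDer D (p.left i) • (tmul y b : Tens Y (ofComm (k := k) B))) *
          (epsDer D' (p.right i) • (tmul y' b' : Tens Y (ofComm (k := k) B))) = _
        rw [smul_mul_smul_comm]
        rfl
      rw [key, key, m1, m2, smul_neg, ← sub_eq_add_neg, ← sub_smul, epsDer_lie]

theorem toConvDer_map {Y' : CDGA k} (f : Y ⟶ Y') (z : Y ⊗[k] coeffLie (k := k) R B) :
    toConvDer ((alg f).toLinearMap.rTensor (coeffLie (k := k) R B) z) =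
      Conv.map (alg (tmap f (𝟙 (ofComm B)))) (toConvDer z) := by
  refine coeff_induction (p := fun z => toConvDer ((alg f).toLinearMap.rTensor
    (coeffLie (k := k) R B) z) = Conv.map (alg (tmap f (𝟙 (ofComm B)))) (toConvDer z)) ?_ ?_ ?_ z
  · simp
  · intro x y hx hy; simp only [map_add, hx, hy]
  · intro i y _ b D
    ext r
    change epsDer D r • (tmul (alg f y) b : Tens Y' (ofComm B)) =
      alg (tmap f (𝟙 (ofComm B))) (epsDer D r • (tmul y b : Tens Y (ofComm B)))
    rw [map_smul, alg_tmap]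
    rfl

/-- The part of `ofDer` corresponding to one basis element of the Lie algebra. -/
def ofDerPart (Y : CDGA k) (D : lieAlgebra k R) :
    Tens Y (ofComm (k := k) B) →ₗ[k] Y ⊗[k] coeffLie (k := k) R B :=
  tensLift Y (ofComm B) ((TensorProduct.mk k Y (coeffLie (k := k) R B)).compl₁₂ LinearMap.id
    ((TensorProduct.mk k B (lieAlgebra k R)).flip D))

theorem ofDerPart_tmul (Y : CDGA k) (D : lieAlgebra k R) (y : Y) (b : B) :
    ofDerPart Y D (tmul y b : Tens Y (ofComm (k := k) B)) = y ⊗ₜ coeffLie.tmul b D := rfl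

/-- The inverse of `toDer`. -/
def ofDer (c : Coords k R) (δ : R →ₗ[k] Tens Y (ofComm (k := k) B)) :
    Y ⊗[k] coeffLie (k := k) R B := ∑ l, ofDerPart Y (c.D l) (δ (c.x l))

theorem toDer_ofDerPart (D : lieAlgebra k R) (v : Tens Y (ofComm (k := k) B)) (r : R) :
    toDer R B Y (ofDerPart Y D v) r = epsDer D r • v := by
  refine tens_induction (p := fun v => toDer R B Y (ofDerPart Y D v) r = epsDer D r • v)
    ?_ ?_ ?_ v
  · simp
  · intro x y hx hy
    rw [map_add, map_add, LinearMap.add_apply, hx, hy, smul_add]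
  · intro i j y b _ _
    rw [ofDerPart_tmul, toDer_tmul]

theorem toDer_ofDer (c : Coords k R) {δ : R →ₗ[k] Tens Y (ofComm (k := k) B)} (hδ : IsEpsDer δ) :
    toDer R B Y (ofDer c δ) = δ := by
  ext r
  have := ((toDer_isEpsDer (ofDer c δ)).sub hδ).mem_of_coords c ⊥ (fun l => ?_) r
  · exact sub_eq_zero.1 this
  · rw [Submodule.mem_bot, LinearMap.sub_apply, ofDer, map_sum, LinearMap.sum_apply, sub_eq_zero]
    simp only [toDer_ofDerPart, c.dual]
    simp

/-- Both sides have the same values on coordinates by duality, and a derivation along the counit is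
determined by these values. -/
theorem Coords.sum_epsDer (c : Coords k R) (D : lieAlgebra k R) :
    ∑ l, epsDer D (c.x l) • c.D l = D := by
  refine epsDer_injective (LinearMap.ext fun r => ?_)
  have := ((epsDer_isEpsDer (∑ l, epsDer D (c.x l) • c.D l)).sub (epsDer_isEpsDer D)).mem_of_coords
    c ⊥ (fun m => ?_) r
  · exact sub_eq_zero.1 this
  · have h : epsDer (∑ l, epsDer D (c.x l) • c.D l) = ∑ l, epsDer D (c.x l) • epsDer (c.D l) := by
      exact (map_sum (⟨⟨epsDer, epsDer_add⟩, epsDer_smul⟩ : lieAlgebra k R →ₗ[k] R →ₗ[k] k) _ _).trans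
        (Finset.sum_congr rfl fun l _ => epsDer_smul _ _)
    rw [Submodule.mem_bot, LinearMap.sub_apply, sub_eq_zero, h, LinearMap.sum_apply]
    simp only [LinearMap.smul_apply, c.dual]
    simp

theorem ofDer_toDer (c : Coords k R) (z : Y ⊗[k] coeffLie (k := k) R B) :
    ofDer c (toDer R B Y z) = z := by
  refine coeff_induction (p := fun z => ofDer c (toDer R B Y z) = z) ?_ ?_ ?_ z
  · simp [ofDer]
  · intro x y hx hy
    refine Eq.trans ?_ (congrArg₂ (· + ·) hx hy)
    simp only [ofDer, map_add, LinearMap.add_apply, Finset.sum_add_distrib]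
  · intro i y _ b D
    simp only [ofDer, toDer_tmul, map_smul, ofDerPart_tmul]
    have h : ∑ l, epsDer D (c.x l) • coeffLie.tmul (k := k) b (c.D l) = coeffLie.tmul b D := by
      have h1 := congrArg (TensorProduct.mk k B (lieAlgebra k R) b) (c.sum_epsDer D)
      rw [map_sum] at h1
      simp only [map_smul] at h1
      exact h1
    rw [← h, TensorProduct.tmul_sum]
    exact Finset.sum_congr rfl fun l _ => (TensorProduct.tmul_smul _ _ _).symm

theorem toDer_injective [Algebra.FiniteType k R] :
    Function.Injective (toDer (k := k) R B Y) := by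
  obtain ⟨c, -⟩ := exists_coords (k := k) (R := R)
  intro z w h
  rw [← ofDer_toDer c z, h, ofDer_toDer]

theorem ofDerPart_mem {n : ℤ} (D : lieAlgebra k R) {v : Tens Y (ofComm (k := k) B)}
    (hv : v ∈ tensDeg Y (ofComm B) n) : ofDerPart Y D v ∈ extDeg Y (coeffLie R B) n := by
  refine tensDeg_induction (p := fun v => ofDerPart Y D v ∈ extDeg Y (coeffLie R B) n) ?_ ?_ ?_ v hv
  · rw [map_zero]; exact zero_mem _
  · intro x y hx hy; rw [map_add]; exact add_mem hx hy
  · intro i j y b hy hb h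
    rw [ofDerPart_tmul]
    refine Submodule.subset_span ⟨i, j, h, y, hy, coeffLie.tmul b D, ?_, rfl⟩
    rcases (mem_degZero (k := k) (M := B) j b).1 hb with rfl | rfl
    · exact (mem_degZero (k := k) 0 _).2 (Or.inl rfl)
    · exact (mem_degZero (k := k) j _).2 (Or.inr (TensorProduct.zero_tmul _ D))

end

section

variable (A : DGArt k) (W : CDGA k)

/-- As the reduction A ⊗ W → W is split, its kernel after tensoring with L is computed on pure
tensors. -/
theorem mem_maxPart {L : DGLie k} {z : tensor A.toCDGA W ⊗[k] L}
    (hz : (alg (A.augBase W)).toLinearMap.rTensor L z = 0) : z ∈ maxPart A W L := by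
  have key (z : tensor A.toCDGA W ⊗[k] L) : z - (alg (inr A.toCDGA W)).toLinearMap.rTensor L
      ((alg (A.augBase W)).toLinearMap.rTensor L z) ∈ maxPart A W L := by
    induction z with
    | zero => simp
    | add x y hx hy => rw [map_add, map_add, add_sub_add_comm]; exact add_mem hx hy
    | tmul y l =>
      rw [LinearMap.rTensor_tmul, LinearMap.rTensor_tmul, ← TensorProduct.sub_tmul]
      refine tens_induction (p := fun y => (y - alg (inr A.toCDGA W) (alg (A.augBase W) y)) ⊗ₜ l ∈
        maxPart A W L) ?_ ?_ ?_ y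
      · simp
      · intro x y hx hy
        rw [map_add, map_add, add_sub_add_comm, TensorProduct.add_tmul]; exact add_mem hx hy
      · intro i j a w _ _
        have e : (tmul a w : Tens A.toCDGA W) -
            alg (inr A.toCDGA W) (alg (A.augBase W) (tmul a w : Tens A.toCDGA W)) =
            tmul (a - algebraMap k A.toCDGA (alg A.aug a)) w := by
          have e1 : alg (A.augBase W) (tmul a w : Tens A.toCDGA W) = (alg A.aug a : k) • w := by
            refine (alg_tlift _ _ a w).trans ?_
            rw [Algebra.smul_def]; rfl
          rw [e1, map_smul, alg_inr, Algebra.algebraMap_eq_smul_one]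
          simp only [← tmulₗ_apply, map_sub, LinearMap.sub_apply, map_smul, LinearMap.smul_apply]
        rw [e]
        exact Submodule.subset_span ⟨_, DGArt.mem_max.1 (DGArt.sub_aug_mem a), w, l, rfl⟩
  have := key z
  rwa [hz, map_zero, sub_zero] at this

variable {A W}

/-- The convolution algebra element corresponding to an element of `A ⊗ W ⊗ (B ⊗ g)`. -/
def mcConv (z : tensor A.toCDGA W ⊗[k] coeffLie (k := k) R B) :
    Conv R (tensor W (tensor A.toCDGA (ofComm (k := k) B))) :=
  Conv.map (alg (rearrange A.toCDGA W (ofComm B))) (toConvDer z)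

theorem mcConv_map {A' : DGArt k} {W' : CDGA k} (a : A ⟶ A') (w : W ⟶ W')
    (z : tensor A.toCDGA W ⊗[k] coeffLie (k := k) R B) :
    mcConv (A := A') ((alg (tmap (DGArt.hom a) w)).toLinearMap.rTensor (coeffLie (k := k) R B) z) =
      Conv.map (alg (tmap w (tmap (DGArt.hom a) (𝟙 _)))) (mcConv z) := by
  rw [mcConv, toConvDer_map, mcConv]
  ext r
  exact alg_comp_congr (rearrange_tmap (DGArt.hom a) w (𝟙 (ofComm B))) _

theorem rearrange_injective (A W B : CDGA k) : Function.Injective (alg (rearrange A W B)) := by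
  intro x y h
  have e (x) : alg (rearrangeInv A W B) (alg (rearrange A W B) x) = x :=
    alg_congr (rearrange_inv A W B) x
  rw [← e x, h, e]

theorem conv_map_injective {C C' : CDGA k} {f : C →ₐ[k] C'} (hf : Function.Injective f) :
    Function.Injective (Conv.map (R := R) f) := by
  intro x y h
  ext r
  exact hf (congrArg (fun g : Conv R C' => g r) h)

theorem mcConv_injective [Algebra.FiniteType k R] : Function.Injective
    (mcConv : tensor A.toCDGA W ⊗[k] coeffLie (k := k) R B → _) := by
  intro z w h
  refine toDer_injective (R := R) ?_
  exact congrArg ofConv (conv_map_injective (rearrange_injective _ _ _) h)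

theorem mcConv_equation [CharZero k] {z : tensor A.toCDGA W ⊗[k] coeffLie (k := k) R B}
    (hz : z ∈ extDeg (tensor A.toCDGA W) (coeffLie R B) 1) :
    mcConv (extD (tensor A.toCDGA W) (coeffLie R B) z +
      (2⁻¹ : k) • extBracket (tensor A.toCDGA W) (coeffLie R B) z z) =
      (mcConv z).d + mcConv z * mcConv z := by
  rw [mcConv, map_add, map_smul, toConvDer_bracket hz hz, ← two_smul k (toConvDer z * toConvDer z),
    smul_smul, inv_mul_cancel₀ two_ne_zero, one_smul, map_add, map_mul, mcConv, ← Conv.map_d]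
  congr 2
  ext r
  exact toDer_d z r

theorem mcConv_isMC [CharZero k] {z : tensor A.toCDGA W ⊗[k] coeffLie (k := k) R B}
    (hz : z ∈ MC A W (coeffLie R B)) : IsMC (A.filExt W (ofComm B)) (mcConv z) := by
  obtain ⟨h1, h2, h3⟩ := hz
  refine ⟨fun r s => ?_, fun r => Hom.map_deg (rearrange _ _ _) 1 _ (toDer_mem_deg h2 r), ?_, ?_⟩
  · change alg (rearrange _ _ _) (toDer R B _ z (r * s)) = _
    rw [toDer_isEpsDer z r s, map_add, map_smul, map_smul]
    rfl
  · intro r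
    rw [DGArt.mem_filExt_one]
    have e : rearrange A.toCDGA W (ofComm (k := k) B) ≫ tmap (𝟙 W) (A.augBase (ofComm B)) =
        tmap (A.augBase W) (𝟙 (ofComm B)) := by
      rw [← rearrangeInv_aug, ← Category.assoc, rearrange_inv, Category.id_comp]
    refine (alg_congr e (toDer R B _ z r)).trans ?_
    have e2 : toConvDer ((alg (A.augBase W)).toLinearMap.rTensor (coeffLie (k := k) R B) z) = 0 := by
      have : (alg (A.augBase W)).toLinearMap.rTensor (coeffLie (k := k) R B) z = 0 := by
        refine Submodule.span_induction (p := fun z _ => (alg (A.augBase W)).toLinearMap.rTensor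
          (coeffLie (k := k) R B) z = 0) ?_ (map_zero _) ?_ ?_ h1
        · rintro _ ⟨a, ha, w, l, rfl⟩
          have e1 : alg (A.augBase W) (tmul a w : Tens A.toCDGA W) = 0 := by
            refine (alg_tlift _ _ a w).trans ?_
            rw [alg_comp, ha]
            exact (congrArg (· * _) (map_zero (alg (unitMap W)))).trans (zero_mul _)
          rw [LinearMap.rTensor_tmul, AlgHom.toLinearMap_apply, e1, TensorProduct.zero_tmul]
        · intro x y _ _ hx hy; rw [map_add, hx, hy, add_zero]
        · intro c x _ hx; rw [map_smul, hx, smul_zero]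
      rw [this, map_zero]
    rw [toConvDer_map] at e2
    exact congrArg (fun f : Conv R (tensor W (ofComm (k := k) B)) => f r) e2
  · rw [← mcConv_equation h2, h3, mcConv, map_zero, map_zero]

/-- The derivation is expanded in the basis dual to the coordinates. Membership in the maximal part
and the Maurer-Cartan equation can be checked after the injective maps to derivations, where they
are hypotheses. -/
theorem exists_mcConv [CharZero k] [Algebra.FiniteType k R]
    {δ : Conv R (tensor W (tensor A.toCDGA (ofComm (k := k) B)))}
    (hδ : IsMC (A.filExt W (ofComm B)) δ) :
    ∃ z ∈ MC A W (coeffLie (k := k) R B), mcConv z = δ := by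
  obtain ⟨c, -⟩ := exists_coords (k := k) (R := R)
  let δ' := Conv.map (alg (rearrangeInv A.toCDGA W (ofComm B))) δ
  have h0 : IsEpsDer δ'.ofConv := fun r s => by
    change alg (rearrangeInv _ _ _) (δ (r * s)) = _
    have : δ (r * s) = _ := hδ.der r s
    rw [this, map_add, map_smul, map_smul]
    rfl
  let z := ofDer c δ'.ofConv
  have hz : toConvDer z = δ' := congrArg toConv (toDer_ofDer c h0)
  have e : mcConv z = δ := by
    rw [mcConv, hz]
    ext r
    exact alg_congr (rearrangeInv_rearrange _ _ _) _
  have hdeg : z ∈ extDeg (tensor A.toCDGA W) (coeffLie (k := k) R B) 1 :=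
    sum_mem fun l _ => ofDerPart_mem _ (Hom.map_deg (rearrangeInv _ _ _) 1 _ (hδ.deg _))
  refine ⟨z, ⟨mem_maxPart A W ?_, hdeg, ?_⟩, e⟩
  · refine toDer_injective (R := R) (congrArg ofConv ?_ : _ = ofConv (toConvDer 0))
    change toConvDer ((alg (A.augBase W)).toLinearMap.rTensor (coeffLie (k := k) R B) z) = _
    rw [toConvDer_map, hz, map_zero]
    ext r
    exact (alg_congr (rearrangeInv_aug A W (ofComm B)) (δ r)).trans
      (DGArt.mem_filExt_one.1 (hδ.mem r))
  · refine mcConv_injective (R := R) ?_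
    rw [mcConv_equation hdeg, e, hδ.eq, mcConv, map_zero, map_zero]

end

end DG

/-! ### Relative tensor products and faithful flatness. -/

namespace DG

open CDGA

variable {k : Type u} [Field k]

namespace CDGA

theorem decompose_map {T X : CDGA k} (F : T ⟶ X) (t : T) (i : ℤ) :
    alg F (decompose T.deg t i : T) = (decompose X.deg (alg F t) i : X) := by
  refine T.hom_induction (p := fun t => alg F (decompose T.deg t i : T) =
    (decompose X.deg (alg F t) i : X)) ?_ ?_ ?_ t
  · simp
  · intro x y hx hy
    rw [decompose_add, map_add, decompose_add, DirectSum.add_apply, DirectSum.add_apply,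
      Submodule.coe_add, Submodule.coe_add, map_add, hx, hy]
  · intro j y hy
    by_cases hj : j = i
    · subst hj
      rw [decompose_of_mem_same _ hy, decompose_of_mem_same _ (Hom.map_deg F j y hy)]
    · rw [decompose_of_mem_ne _ hy hj, decompose_of_mem_ne _ (Hom.map_deg F j y hy) hj, map_zero]

/-- A surjective morphism is a quotient map: multiplication, grading and differential of X are all
visible on preimages in T. -/
theorem exists_factor {T X Z : CDGA k} (F : T ⟶ X) (G : T ⟶ Z) (hF : Function.Surjective (alg F))
    (h : ∀ t, alg F t = 0 → alg G t = 0) : ∃ H : X ⟶ Z, F ≫ H = G := by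
  obtain ⟨s, hs⟩ := hF.hasRightInverse
  have key {t t' : T} (e : alg F t = alg F t') : alg G t = alg G t' := by
    have := h (t - t') (by rw [map_sub, e, sub_self])
    rwa [map_sub, sub_eq_zero] at this
  let H : X →ₐ[k] Z :=
    { toFun := fun x => alg G (s x)
      map_one' := (key (by rw [hs, map_one])).trans (map_one _)
      map_zero' := (key (by rw [hs, map_zero])).trans (map_zero _)
      map_mul' := fun x y => (key (by rw [hs, map_mul, hs, hs])).trans (map_mul _ (s x) (s y))
      map_add' := fun x y => (key (by rw [hs, map_add, hs, hs])).trans (map_add _ (s x) (s y))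
      commutes' := fun c =>
        (key (by rw [hs, AlgHom.commutes])).trans ((alg G).commutes c) }
  have hH : ∀ t, H (alg F t) = alg G t := fun t => key (hs _)
  refine ⟨Hom.mk H (fun i x hx => ?_) (fun x => ?_), hom_ext hH⟩
  -- A homogeneous element may have been given an inhomogeneous preimage; the component of degree i
  -- of the preimage is a preimage too.
  · obtain ⟨t, rfl⟩ := hF x
    rw [← decompose_of_mem_same X.deg hx, ← decompose_map, hH]
    exact Hom.map_deg G i _ (SetLike.coe_mem _)
  · obtain ⟨t, rfl⟩ := hF x
    have e : X.d (alg F t) = alg F (T.d t) := (Hom.map_d F t).symm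
    rw [e, hH, hH]
    exact Hom.map_d G t

theorem isIso_of_bijective {X Y : CDGA k} (f : X ⟶ Y) (h : Function.Bijective (alg f)) :
    IsIso f := by
  obtain ⟨g, hg⟩ := exists_factor f (𝟙 X) h.2 (fun t ht => h.1 (ht.trans (map_zero _).symm))
  refine ⟨g, hg, hom_ext fun y => ?_⟩
  obtain ⟨x, rfl⟩ := h.2 y
  exact congrArg (alg f) (congrArg (fun e => alg e x) hg)

section square

variable {C C' X X' : CDGA k} {φ : C ⟶ C'} {x : C ⟶ X} {x' : C' ⟶ X'} {f : X ⟶ X'}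

/-- The universal property of the relative tensor product for balanced bilinear maps: the kernel of
C' ⊗ X → X' is spanned by relations, and a linear section of this surjection defines the descended
map. -/
theorem IsTensorSquare.exists_linear (h : IsTensorSquare φ x x' f) {M : Type u} [AddCommGroup M]
    [Module k M] (K : C' →ₗ[k] X →ₗ[k] M) (hK : ∀ c' c y, K (c' * alg φ c) y = K c' (alg x c * y)) :
    ∃ θ : X' →ₗ[k] M, ∀ c' y, θ (alg x' c' * alg f y) = K c' y := by
  obtain ⟨hs, hk⟩ := h
  set L := TensorProduct.lift ((LinearMap.mul k X').compl₁₂ (alg x').toLinearMap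
    (alg f).toLinearMap)
  obtain ⟨s, hs'⟩ := LinearMap.exists_rightInverse_of_surjective L (LinearMap.range_eq_top.2 hs)
  refine ⟨TensorProduct.lift K ∘ₗ s, fun c' y => ?_⟩
  have h1 : s (L (c' ⊗ₜ y)) - c' ⊗ₜ y ∈ LinearMap.ker L := by
    rw [LinearMap.mem_ker, map_sub, sub_eq_zero]
    exact LinearMap.congr_fun hs' _
  have h2 : LinearMap.ker L ≤ LinearMap.ker (TensorProduct.lift K) := by
    rw [hk, Submodule.span_le]
    rintro _ ⟨c', c, y, rfl⟩
    rw [SetLike.mem_coe, LinearMap.mem_ker, map_sub, TensorProduct.lift.tmul,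
      TensorProduct.lift.tmul, hK, sub_self]
  have h3 := h2 h1
  rw [LinearMap.mem_ker, map_sub, sub_eq_zero] at h3
  exact h3

theorem IsTensorSquare.surjective (h : IsTensorSquare φ x x' f) :
    Function.Surjective (alg (tlift x' f)) := by
  intro z
  obtain ⟨w, rfl⟩ := h.1 z
  induction w with
  | zero => exact ⟨0, by simp⟩
  | add a b ha hb =>
    obtain ⟨a', ha⟩ := ha
    obtain ⟨b', hb⟩ := hb
    exact ⟨a' + b', by rw [map_add, map_add, ha, hb]⟩
  | tmul a b => exact ⟨tmul a b, rfl⟩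

theorem IsTensorSquare.induction (h : IsTensorSquare φ x x' f) {p : X' → Prop}
    (zero : p 0) (add : ∀ y z, p y → p z → p (y + z)) (mul : ∀ c' y, p (alg x' c' * alg f y))
    (z : X') : p z := by
  obtain ⟨w, rfl⟩ := h.1 z
  induction w with
  | zero => simpa using zero
  | add a b ha hb => rw [map_add]; exact add _ _ ha hb
  | tmul a b => exact mul a b

theorem IsTensorSquare.hom_ext (h : IsTensorSquare φ x x' f) {Z : CDGA k} {a b : X' ⟶ Z}
    (h1 : x' ≫ a = x' ≫ b) (h2 : f ≫ a = f ≫ b) : a = b := by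
  refine CDGA.hom_ext fun z => ?_
  refine h.induction (p := fun z => alg a z = alg b z) (by simp) ?_ ?_ z
  · intro y z hy hz; rw [map_add, map_add, hy, hz]
  · intro c' y
    rw [map_mul, map_mul]
    exact congrArg₂ (· * ·) (congrArg (fun e => alg e c') h1) (congrArg (fun e => alg e y) h2)

/-- Tensor squares are pushouts of commutative dg algebras. The linear descent shows that the kernel
of C' ⊗ X → X' is killed, and `exists_factor` then gives a morphism. -/
theorem IsTensorSquare.exists_desc (h : IsTensorSquare φ x x' f) {Z : CDGA k} (a : C' ⟶ Z)
    (b : X ⟶ Z) (hab : φ ≫ a = x ≫ b) : ∃ c : X' ⟶ Z, x' ≫ c = a ∧ f ≫ c = b := by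
  obtain ⟨θ, hθ⟩ := h.exists_linear
    ((LinearMap.mul k Z).compl₁₂ (alg a).toLinearMap (alg b).toLinearMap) (fun c' c y => by
      have e : alg a (alg φ c) = alg b (alg x c) := congrArg (fun e => alg e c) hab
      change alg a (c' * alg φ c) * alg b y = alg a c' * alg b (alg x c * y)
      rw [map_mul, map_mul, e, mul_assoc])
  have hker : ∀ t, alg (tlift x' f) t = 0 → alg (tlift a b) t = 0 := by
    intro t ht
    have e : θ ∘ₗ (alg (tlift x' f)).toLinearMap = (alg (tlift a b)).toLinearMap :=
      tens_ext fun c' y => hθ c' y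
    rw [← AlgHom.toLinearMap_apply, ← e, LinearMap.comp_apply, AlgHom.toLinearMap_apply, ht,
      map_zero]
  obtain ⟨c, hc⟩ := exists_factor (tlift x' f) (tlift a b) h.surjective hker
  refine ⟨c, ?_, ?_⟩
  · rw [← inl_tlift x' f, Category.assoc, hc, inl_tlift]
  · rw [← inr_tlift x' f, Category.assoc, hc, inr_tlift]

/-- If every tensor agrees, up to relations, with ψ of its product, then a tensor with product zero
is itself a combination of relations. -/
theorem IsTensorSquare.of_section (hc : φ ≫ x' = x ≫ f) (ψ : X' →ₗ[k] C' ⊗[k] X)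
    (h1 : Function.Surjective (alg (tlift x' f)))
    (h2 : ∀ c' y, c' ⊗ₜ y - ψ (alg x' c' * alg f y) ∈
      Submodule.span k {z : C' ⊗[k] X | ∃ (c' : C') (c : C) (y : X),
        z = (c' * alg φ c) ⊗ₜ y - c' ⊗ₜ (alg x c * y)}) : IsTensorSquare φ x x' f := by
  refine ⟨fun z => ?_, le_antisymm (fun z hz => ?_) (Submodule.span_le.2 ?_)⟩
  · obtain ⟨w, rfl⟩ := h1 z
    refine tens_induction (p := fun w => ∃ v, TensorProduct.lift ((LinearMap.mul k X').compl₁₂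
      (alg x').toLinearMap (alg f).toLinearMap) v = alg (tlift x' f) w) ⟨0, by simp⟩ ?_ ?_ w
    · rintro a b ⟨v, hv⟩ ⟨w, hw⟩
      exact ⟨v + w, by rw [map_add, map_add, hv, hw]⟩
    · intro _ _ a b _ _
      exact ⟨a ⊗ₜ b, rfl⟩
  · have key : ∀ z : C' ⊗[k] X, z - ψ (TensorProduct.lift ((LinearMap.mul k X').compl₁₂
        (alg x').toLinearMap (alg f).toLinearMap) z) ∈
        Submodule.span k {z : C' ⊗[k] X | ∃ (c' : C') (c : C) (y : X),
        z = (c' * alg φ c) ⊗ₜ y - c' ⊗ₜ (alg x c * y)} := by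
      intro z
      induction z with
      | zero => simp
      | add a b ha hb =>
        rw [map_add, map_add, add_sub_add_comm]
        exact add_mem ha hb
      | tmul a b => exact h2 a b
    have := key z
    rwa [LinearMap.mem_ker.1 hz, map_zero, sub_zero] at this
  · rintro _ ⟨c', c, y, rfl⟩
    rw [SetLike.mem_coe, LinearMap.mem_ker, map_sub, sub_eq_zero]
    change alg x' (c' * alg φ c) * alg f y = alg x' c' * alg f (alg x c * y)
    have e : alg x' (alg φ c) = alg f (alg x c) := congrArg (fun e => alg e c) hc
    rw [map_mul, map_mul, e, mul_assoc]

theorem IsTensorSquare.comp_iso (h : IsTensorSquare φ x x' f) {Z : CDGA k} (e : X' ⟶ Z) [IsIso e] :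
    IsTensorSquare φ x (x' ≫ e) (f ≫ e) := by
  have he : TensorProduct.lift ((LinearMap.mul k Z).compl₁₂ (alg (x' ≫ e)).toLinearMap
      (alg (f ≫ e)).toLinearMap) = (alg e).toLinearMap ∘ₗ TensorProduct.lift
      ((LinearMap.mul k X').compl₁₂ (alg x').toLinearMap (alg f).toLinearMap) :=
    TensorProduct.ext' fun a b => (map_mul (alg e) _ _).symm
  have h1 : ∀ z, alg e (alg (inv e) z) = z := fun z => congrArg (fun e => alg e z) (IsIso.inv_hom_id e)
  have h2 : ∀ z, alg (inv e) (alg e z) = z := fun z => congrArg (fun e => alg e z) (IsIso.hom_inv_id e)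
  refine ⟨?_, ?_⟩
  · rw [he]
    exact (Function.RightInverse.surjective h1).comp h.1
  · rw [he, ← h.2]
    refine le_antisymm (fun z hz => ?_) (fun z hz => ?_)
    · have h3 : alg e _ = 0 := hz
      have h4 := congrArg (alg (inv e)) h3
      rw [h2, map_zero] at h4
      exact h4
    · exact (congrArg (alg e) (LinearMap.mem_ker.1 hz)).trans (map_zero _)

/-- The map `c' ⊗ r ↦ c' ⊗ (1 ⊗ r)`. -/
def tensSection (C C' R : CDGA k) : tensor C' R →ₗ[k] C' ⊗[k] tensor C R :=
  tensLift C' R ((TensorProduct.mk k C' (tensor C R)).compl₁₂ LinearMap.id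
    (alg (inr C R)).toLinearMap)

theorem tensSection_tmul {R : CDGA k} (c' : C') (r : R) :
    tensSection C C' R (tmul c' r : Tens C' R) = c' ⊗ₜ[k] (tmul 1 r : Tens C R) := rfl

theorem inl_mul_tmul (C R : CDGA k) (c c' : C) (r : R) :
    alg (inl C R) c * (tmul c' r : Tens C R) = tmul (c * c') r := by
  rw [← tmul_mul_tmul_one C R c', ← tmul_mul_tmul_one C R (c * c'), ← mul_assoc]
  exact congrArg (· * _) (map_mul (alg (inl C R)) _ _).symm

/-- Using the relations, the coefficient c of c ⊗ r can be moved into C', leaving 1 ⊗ r; thus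
`tensSection` inverts the product map modulo relations. -/
theorem isTensorSquare_tmap (φ : C ⟶ C') (R : CDGA k) :
    IsTensorSquare φ (inl C R) (inl C' R) (tmap φ (𝟙 R)) := by
  have := IsTensorSquare.of_section (inl_tmap φ (𝟙 R)).symm (tensSection C C' R)
  refine this ?_ ?_
  · intro z
    refine tens_induction (p := fun z => ∃ w, alg (tlift (inl C' R) (tmap φ (𝟙 R))) w = z)
      ⟨0, map_zero _⟩ ?_ ?_ z
    · rintro a b ⟨v, hv⟩ ⟨w, hw⟩
      exact ⟨v + w, by rw [map_add, hv, hw]⟩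
    · intro i j a b _ _
      refine ⟨tmul a (tmul 1 b : Tens C R), ?_⟩
      rw [alg_tlift, alg_tmap, map_one, inl_mul_tmul, mul_one]
      rfl
  · intro c' y
    refine tens_induction (p := fun y => c' ⊗ₜ y - tensSection C C' R
      (alg (inl C' R) c' * alg (tmap φ (𝟙 R)) y) ∈
      Submodule.span k {z : C' ⊗[k] tensor C R | ∃ (c' : C') (c : C) (y : tensor C R),
        z = (c' * alg φ c) ⊗ₜ y - c' ⊗ₜ (alg (inl C R) c * y)}) ?_ ?_ ?_ y
    · rw [TensorProduct.tmul_zero, map_zero, mul_zero, map_zero, sub_zero]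
      exact zero_mem _
    · intro a b ha hb
      rw [TensorProduct.tmul_add, map_add, mul_add, map_add, add_sub_add_comm]
      exact add_mem ha hb
    · intro i j c r hc hr
      have e1 : alg (inl C' R) c' * alg (tmap φ (𝟙 R)) (tmul c r) = tmul (c' * alg φ c) r := by
        rw [alg_tmap]
        exact inl_mul_tmul _ _ _ _ _
      have e2 : (tmul c r : Tens C R) = alg (inl C R) c * (tmul 1 r : Tens C R) := by
        rw [inl_mul_tmul, mul_one]
      rw [e1, tensSection_tmul, e2, ← neg_sub]
      exact neg_mem (Submodule.subset_span ⟨c', c, _, rfl⟩)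

end square

section flat

variable (C R : CDGA k) {ι : Type u} (b : Module.Basis ι k R)

/-- The coefficients of an element of `C ⊗ R` with respect to a basis of `R`. -/
def tensCoord : Tens C R →ₗ[k] ι →₀ C :=
  tensLift C R (LinearMap.mk₂ k
    (fun c r => Finsupp.mapRange.linearMap (LinearMap.toSpanSingleton k C c) (b.repr r))
    (fun c c' r => by ext i; exact smul_add (b.repr r i) c c')
    (fun a c r => by ext i; exact smul_comm (b.repr r i) a c)
    (fun c r r' => by rw [map_add, map_add]) (fun a c r => by rw [map_smul, map_smul]))

theorem tensCoord_tmul (c : C) (r : R) (i : ι) :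
    tensCoord C R b (tmul c r) i = b.repr r i • c := rfl

theorem tensCoord_mul (c : C) (y : Tens C R) (i : ι) :
    tensCoord C R b (alg (inl C R) c * y) i = c * tensCoord C R b y i := by
  refine tens_induction (p := fun y => tensCoord C R b (alg (inl C R) c * y) i =
    c * tensCoord C R b y i) (by simp) ?_ ?_ y
  · intro y z hy hz
    rw [mul_add, map_add, map_add, Finsupp.add_apply, Finsupp.add_apply, mul_add, hy, hz]
  · intro p q a r _ _
    rw [inl_mul_tmul, tensCoord_tmul, tensCoord_tmul, mul_smul_comm]

theorem sum_tensCoord (y : Tens C R) :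
    (tensCoord C R b y).sum (fun i c => (tmul c (b i) : Tens C R)) = y := by
  have h0 : ∀ i, (tmul (0 : C) (b i) : Tens C R) = 0 := fun i => by simp [← tmulₗ_apply]
  have ha : ∀ i (c c' : C), (tmul (c + c') (b i) : Tens C R) = tmul c (b i) + tmul c' (b i) :=
    fun i c c' => by simp [← tmulₗ_apply]
  refine tens_induction (p := fun y => (tensCoord C R b y).sum
    (fun i c => (tmul c (b i) : Tens C R)) = y) (by simp) ?_ ?_ y
  · intro y z hy hz
    rw [map_add, Finsupp.sum_add_index' h0 ha, hy, hz]
  · intro p q c r _ _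
    have e : tensCoord C R b (tmul c r) = (b.repr r).mapRange (fun a => a • c) (zero_smul k c) := rfl
    rw [e, Finsupp.sum_mapRange_index h0]
    conv_rhs => rw [← b.linearCombination_repr r, Finsupp.linearCombination_apply]
    rw [← tmulₗ_apply, Finsupp.sum, Finsupp.sum, map_sum]
    refine Finset.sum_congr rfl fun i _ => ?_
    simp only [← tmulₗ_apply, map_smul, LinearMap.smul_apply]

variable (M : Type u) [AddCommGroup M] [Module Cᵐᵒᵖ M]

/-- The coefficients of an element of `M ⊗ (C ⊗ R)` with respect to a basis of `R`. -/
def modCoord : M ⊗[ℤ] Tens C R →+ ι →₀ M :=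
  TensorProduct.liftAddHom
    (AddMonoidHom.mk' (fun m => (Finsupp.mapRange.addMonoidHom
        (AddMonoidHom.mk' (fun c : C => MulOpposite.op c • m)
          (fun c c' => by rw [MulOpposite.op_add, add_smul]))).comp
        (tensCoord C R b).toAddMonoidHom)
      (fun m m' => by ext y i; exact smul_add _ m m'))
    (fun a m y => by rw [map_zsmul, map_zsmul]; rfl)

theorem modCoord_tmul (m : M) (y : Tens C R) (i : ι) :
    modCoord C R b M (m ⊗ₜ y) i = MulOpposite.op (tensCoord C R b y i) • m := rfl

theorem modCoord_balanced {z : M ⊗[ℤ] Tens C R} (hz : z ∈ balanced (X := tensor C R) (inl C R) M) :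
    modCoord C R b M z = 0 := by
  refine (AddSubgroup.closure_le (K := (modCoord C R b M).ker)).2 ?_ hz
  rintro _ ⟨m, c, y, rfl⟩
  rw [SetLike.mem_coe, AddMonoidHom.mem_ker, map_sub, sub_eq_zero]
  ext i
  rw [modCoord_tmul, modCoord_tmul, tensCoord_mul, MulOpposite.op_mul, mul_smul]

/-- The map `(mᵢ) ↦ ∑ mᵢ ⊗ (1 ⊗ bᵢ)`. -/
def modSection : (ι →₀ M) →+ M ⊗[ℤ] Tens C R := Finsupp.liftAddHom fun i =>
  AddMonoidHom.mk' (fun m => m ⊗ₜ (tmul 1 (b i) : Tens C R))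
    (fun _ _ => TensorProduct.add_tmul _ _ _)

theorem modSection_modCoord (m : M) (y : Tens C R) :
    modSection C R b M (modCoord C R b M (m ⊗ₜ y)) = (tensCoord C R b y).sum
      fun i c => (MulOpposite.op c • m) ⊗ₜ (tmul 1 (b i) : Tens C R) := by
  have : modCoord C R b M (m ⊗ₜ y) = (tensCoord C R b y).mapRange
    (fun c : C => MulOpposite.op c • m) (by rw [MulOpposite.op_zero, zero_smul]) := rfl
  rw [this, modSection, Finsupp.liftAddHom_apply, Finsupp.sum_mapRange_index (fun i => map_zero _)]
  rfl

theorem mem_balanced {z : M ⊗[ℤ] Tens C R} (hz : modCoord C R b M z = 0) :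
    z ∈ balanced (X := tensor C R) (inl C R) M := by
  have key : ∀ z, z - modSection C R b M (modCoord C R b M z) ∈
      balanced (X := tensor C R) (inl C R) M := by
    intro z
    induction z with
    | zero => rw [map_zero, map_zero, sub_zero]; exact zero_mem _
    | add x y hx hy => rw [map_add, map_add, add_sub_add_comm]; exact add_mem hx hy
    | tmul m y =>
      rw [modSection_modCoord]
      nth_rw 1 [← sum_tensCoord C R b y]
      rw [Finsupp.sum, Finsupp.sum, TensorProduct.tmul_sum, ← Finset.sum_sub_distrib]
      refine sum_mem fun i _ => ?_
      have e : (tmul (tensCoord C R b y i) (b i) : Tens C R) =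
          alg (inl C R) (tensCoord C R b y i) * (tmul 1 (b i) : Tens C R) := by
        rw [inl_mul_tmul, mul_one]
      rw [← neg_sub, e]
      exact neg_mem (AddSubgroup.subset_closure ⟨m, _, _, rfl⟩)
  have := key z
  rwa [hz, map_zero, sub_zero] at this

variable {C} in
theorem modCoord_map {M N : Type u} [AddCommGroup M] [AddCommGroup N] [Module Cᵐᵒᵖ M]
    [Module Cᵐᵒᵖ N] (g : M →ₗ[Cᵐᵒᵖ] N) (z : M ⊗[ℤ] Tens C R) (i : ι) :
    modCoord C R b N ((g.toAddMonoidHom.toIntLinearMap.rTensor (Tens C R)) z) i =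
      g (modCoord C R b M z i) := by
  induction z with
  | zero => simp
  | add x y hx hy => simp only [map_add, Finsupp.add_apply, hx, hy]
  | tmul m y =>
    rw [LinearMap.rTensor_tmul, modCoord_tmul, modCoord_tmul, map_smul]
    rfl

/-- A basis of R makes C ⊗ R free over C, so M ⊗_C (C ⊗ R) consists of finitely supported families
in M: by `modCoord_balanced` and `mem_balanced`, the balanced tensors are those with vanishing
coefficients. Injectivity is then tested on coefficients, and a basis element exists because R is
nontrivial. -/
theorem faithfullyFlat_inl [Nontrivial R] : FaithfullyFlat (inl C R) := by
  let b := Module.Basis.ofVectorSpace k R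
  refine ⟨fun M N _ _ _ _ g hg z hz => ?_, fun M _ _ h => ?_⟩
  · refine mem_balanced C R b M (Finsupp.ext fun i => hg ?_)
    rw [← modCoord_map, modCoord_balanced C R b N hz]
    exact (map_zero g).symm
  · obtain ⟨i⟩ : Nonempty _ := b.index_nonempty
    refine subsingleton_of_forall_eq 0 fun m => ?_
    have h1 := modCoord_balanced C R b M (z := m ⊗ₜ (tmul 1 (b i) : Tens C R)) (h ▸ trivial)
    have h2 := DFunLike.congr_fun h1 i
    rwa [modCoord_tmul, tensCoord_tmul, b.repr_self, Finsupp.single_eq_same, one_smul,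
      MulOpposite.op_one, one_smul] at h2

end flat

end CDGA

end DG

/-! ### The trivial torsor and its automorphisms. -/

namespace DG

open CDGA WithConv

variable {k : Type u} [Field k] {R : Type u} [CommRing R] [HopfAlgebra k R]

namespace CDGA

variable {C D W W' X : CDGA k}

theorem tlift_comp {A B : CDGA k} (f : A ⟶ C) (g : B ⟶ C) (h : C ⟶ D) :
    tlift f g ≫ h = tlift (f ≫ h) (g ≫ h) :=
  tensor_hom_ext (by simp) (by simp)

theorem tmap_tlift {A B A' B' : CDGA k} (f : A ⟶ A') (g : B ⟶ B') (a : A' ⟶ C) (b : B' ⟶ C) :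
    tmap f g ≫ tlift a b = tlift (f ≫ a) (g ≫ b) := by
  rw [tmap, tlift_comp, Category.assoc, Category.assoc, inl_tlift, inr_tlift]

/-- The convolution product of two points of the group with values in a dg algebra. -/
def convHom (f g : ofComm R ⟶ C) : ofComm R ⟶ C := comul R ≫ tlift f g

variable (R C) in
/-- The neutral point. -/
def convUnit : ofComm R ⟶ C := counit R ≫ unitMap C

variable (R) in
/-- The antipode as a morphism of dg algebras. -/
def antipode : (ofComm R : CDGA k) ⟶ ofComm R := ofCommMap (HopfAlgebra.antipodeAlgHom k R)

theorem convHom_comp (f g : ofComm R ⟶ C) (h : C ⟶ D) :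
    convHom f g ≫ h = convHom (f ≫ h) (g ≫ h) := by
  rw [convHom, Category.assoc, tlift_comp]; rfl

theorem convUnit_comp (h : C ⟶ D) : convUnit R C ≫ h = convUnit R D := by
  rw [convUnit, Category.assoc, unitMap_comp]; rfl

/-- A morphism from `R` as an element of the convolution algebra. -/
def toConvHom (f : ofComm R ⟶ C) : Conv R C := toConv (alg f).toLinearMap

theorem toConvHom_injective : Function.Injective (toConvHom : (ofComm R ⟶ C) → Conv R C) :=
  fun _ _ h => hom_ext fun r => congrArg (fun f : Conv R C => f r) h

theorem toConvHom_convHom (f g : ofComm R ⟶ C) :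
    toConvHom (convHom f g) = toConvHom f * toConvHom g := by
  ext r
  rw [LinearMap.convMul_apply]
  change alg (tlift f g) (tensAlg R (Coalgebra.comul r)) = _
  induction Coalgebra.comul (R := k) r with
  | zero => simp
  | add x y hx hy => simp only [map_add, hx, hy]
  | tmul a b => rw [tensAlg_tmul]; rfl

theorem toConvHom_convUnit : toConvHom (convUnit R C) = 1 := rfl

theorem convHom_assoc (f g h : ofComm R ⟶ C) :
    convHom (convHom f g) h = convHom f (convHom g h) :=
  toConvHom_injective (by simp only [toConvHom_convHom, mul_assoc])

theorem convHom_unit (f : ofComm R ⟶ C) : convHom f (convUnit R C) = f :=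
  toConvHom_injective (by rw [toConvHom_convHom, toConvHom_convUnit, mul_one])

theorem unit_convHom (f : ofComm R ⟶ C) : convHom (convUnit R C) f = f :=
  toConvHom_injective (by rw [toConvHom_convHom, toConvHom_convUnit, one_mul])

theorem convHom_antipode (f : ofComm R ⟶ C) : convHom f (antipode R ≫ f) = convUnit R C :=
  toConvHom_injective (by
    ext r
    let p := Coalgebra.Repr.arbitrary k r
    rw [toConvHom_convHom, p.convMul_apply]
    change _ = algebraMap k C (Coalgebra.counit r)
    rw [← (alg f).commutes]
    change _ = alg f (algebraMap k R (Coalgebra.counit r))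
    rw [← HopfAlgebra.sum_mul_antipode_eq_algebraMap_counit p]
    refine Eq.trans ?_ (map_sum (alg f) _ _).symm
    exact Finset.sum_congr rfl fun i _ => (map_mul (alg f) _ _).symm)

theorem antipode_convHom (f : ofComm R ⟶ C) : convHom (antipode R ≫ f) f = convUnit R C :=
  toConvHom_injective (by
    ext r
    let p := Coalgebra.Repr.arbitrary k r
    rw [toConvHom_convHom, p.convMul_apply]
    change _ = algebraMap k C (Coalgebra.counit r)
    rw [← (alg f).commutes]
    change _ = alg f (algebraMap k R (Coalgebra.counit r))
    rw [← HopfAlgebra.sum_antipode_mul_eq_algebraMap_counit p]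
    refine Eq.trans ?_ (map_sum (alg f) _ _).symm
    exact Finset.sum_congr rfl fun i _ => (map_mul (alg f) _ _).symm)

theorem comul_tmap (f : ofComm R ⟶ C) :
    comul R ≫ tmap f (𝟙 _) = convHom (f ≫ inl C (ofComm R)) (inr C (ofComm R)) := by
  rw [convHom, tmap, Category.id_comp]

/-- The shear map `X ⊗ R ⟶ X ⊗ R` given by translation by an `X`-valued point. -/
def shear (f : ofComm R ⟶ X) : tensor X (ofComm R) ⟶ tensor X (ofComm R) :=
  tlift (inl X (ofComm R)) (convHom (f ≫ inl X (ofComm R)) (inr X (ofComm R)))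

theorem shear_comp (f g : ofComm R ⟶ X) : shear f ≫ shear g = shear (convHom f g) := by
  refine tensor_hom_ext ?_ ?_
  · simp [shear]
  · simp only [shear, inr_tlift_assoc, convHom_comp, inl_tlift, inr_tlift, Category.assoc,
      convHom_assoc]

theorem shear_unit : shear (convUnit R X) = 𝟙 _ := by
  refine tensor_hom_ext ?_ ?_
  · simp [shear]
  · rw [shear, inr_tlift, convUnit_comp, unit_convHom, Category.comp_id]

instance (f : ofComm R ⟶ X) : IsIso (shear f) :=
  ⟨shear (antipode R ≫ f), by rw [shear_comp, convHom_antipode, shear_unit],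
    by rw [shear_comp, antipode_convHom, shear_unit]⟩

end CDGA

variable (R) in
/-- The coaction of the trivial torsor `C ⊗ R`. -/
def trivialCoact (C : CDGA k) :
    tensor C (ofComm R) ⟶ tensor (tensor C (ofComm R)) (ofComm R) :=
  tmap (𝟙 C) (comul R) ≫ assocInv C (ofComm R) (ofComm R)

theorem inl_trivialCoact (C : CDGA k) : inl C (ofComm R) ≫ trivialCoact R C =
    inl C (ofComm R) ≫ inl (tensor C (ofComm R)) (ofComm R) := inl_coact C (ofComm R) (comul R)

theorem inr_trivialCoact (C : CDGA k) : inr C (ofComm R) ≫ trivialCoact R C =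
    convHom (inr C (ofComm R) ≫ inl (tensor C (ofComm R)) (ofComm R)) (inr _ (ofComm R)) := by
  rw [← comul_tmap]
  exact inr_coact C (ofComm R) (comul R)

/-- For X = C ⊗ R, the canonical map X ⊗_C X → X ⊗ R is the base change isomorphism followed by a
shear, and the antipode inverts shears. -/
theorem trivialTorsor_isTorsor (C : CDGA k) : (trivialTorsor R C).IsTorsor := by
  have : Nontrivial R := (Bialgebra.counitAlgHom k R).toRingHom.domain_nontrivial
  refine ⟨?_, ?_⟩
  · have h := (isTensorSquare_tmap (inl C (ofComm R)) (ofComm (k := k) R)).comp_iso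
      (shear (inr C (ofComm R)))
    have e1 : inl (tensor C (ofComm R)) (ofComm R) ≫ shear (inr C (ofComm (k := k) R)) =
      inl _ _ := inl_tlift _ _
    have e2 : tmap (inl C (ofComm R)) (𝟙 (ofComm R)) ≫ shear (inr C (ofComm (k := k) R)) =
        trivialCoact R C := by
      refine tensor_hom_ext ?_ ?_
      · rw [← Category.assoc, inl_tmap, Category.assoc, e1, inl_trivialCoact]
      · rw [inr_trivialCoact, ← Category.assoc, inr_tmap, Category.id_comp]
        exact inr_tlift _ _
    rw [e1, e2] at h
    exact h
  · have : Nontrivial (ofComm (k := k) R) := ‹Nontrivial R›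
    exact faithfullyFlat_inl C (ofComm R)

namespace CDGA

variable (R) (W C D : CDGA k)

/-- The inclusion of `W ⊗ C` in `W ⊗ (C ⊗ R)`. -/
def inclBase : tensor W C ⟶ tensor W (tensor C (ofComm R)) := tmap (𝟙 W) (inl C (ofComm R))

/-- The inclusion of `R` in `W ⊗ (C ⊗ R)`. -/
def inclGroup : ofComm R ⟶ tensor W (tensor C (ofComm R)) := inr C (ofComm R) ≫ inr W _

/-- The neutral section of `W ⊗ (C ⊗ R)` over `W ⊗ C`. -/
def neutral : tensor W (tensor C (ofComm R)) ⟶ tensor W C :=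
  tmap (𝟙 W) (tlift (𝟙 C) (convUnit R C))

variable {W C D}

theorem extended_hom_ext {f g : tensor W (tensor C (ofComm R)) ⟶ D}
    (h1 : inclBase R W C ≫ f = inclBase R W C ≫ g)
    (h2 : inclGroup R W C ≫ f = inclGroup R W C ≫ g) : f = g := by
  refine tensor_hom_ext ?_ (tensor_hom_ext ?_ ?_)
  · have := congrArg (inl W C ≫ ·) h1
    simp only [inclBase, ← Category.assoc, inl_tmap, Category.id_comp] at this
    exact this
  · have := congrArg (inr W C ≫ ·) h1
    simp only [inclBase, ← Category.assoc, inr_tmap] at this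
    simp only [Category.assoc] at this
    exact this
  · simp only [inclGroup, Category.assoc] at h2
    exact h2

variable (W C)

theorem inclBase_neutral : inclBase R W C ≫ neutral R W C = 𝟙 _ := by
  rw [inclBase, neutral, ← tmap_comp, inl_tlift, Category.id_comp, tmap_id]

theorem inclGroup_neutral : inclGroup R W C ≫ neutral R W C = convUnit R _ := by
  rw [inclGroup, neutral, Category.assoc, inr_tmap, ← Category.assoc, inr_tlift, convUnit_comp]

/-- The coaction of `W ⊗ (C ⊗ R)`. -/
def extendedCoact : tensor W (tensor C (ofComm R)) ⟶
    tensor (tensor W (tensor C (ofComm R))) (ofComm R) :=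
  tmap (𝟙 W) (trivialCoact R C) ≫ assocInv W (tensor C (ofComm R)) (ofComm R)

theorem inclBase_coact : inclBase R W C ≫ extendedCoact R W C = inclBase R W C ≫ inl _ _ :=
  ((trivialTorsor R C).extend W).base

theorem inclGroup_coact : inclGroup R W C ≫ extendedCoact R W C =
    convHom (inclGroup R W C ≫ inl _ _) (inr _ _) := by
  rw [inclGroup, Category.assoc, extendedCoact, inr_coact, ← Category.assoc, inr_trivialCoact,
    convHom_comp, Category.assoc, inl_tmap, inr_tmap, Category.id_comp, Category.assoc]

variable {R W C}

/-- The automorphism of the trivial torsor given by a point of the group. -/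
def autHom (γ : ofComm R ⟶ tensor W C) :
    tensor W (tensor C (ofComm R)) ⟶ tensor W (tensor C (ofComm R)) :=
  tlift (inl W _) (tlift (inl C (ofComm R) ≫ inr W _)
    (convHom (γ ≫ inclBase R W C) (inclGroup R W C)))

theorem inclBase_autHom (γ : ofComm R ⟶ tensor W C) :
    inclBase R W C ≫ autHom γ = inclBase R W C := by
  refine tensor_hom_ext ?_ ?_
  · simp only [inclBase, autHom, ← Category.assoc, inl_tmap, Category.id_comp, inl_tlift]
  · simp only [inclBase, autHom, ← Category.assoc, inr_tmap]
    simp only [Category.assoc, inr_tlift, inl_tlift]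

theorem inclGroup_autHom (γ : ofComm R ⟶ tensor W C) :
    inclGroup R W C ≫ autHom γ = convHom (γ ≫ inclBase R W C) (inclGroup R W C) := by
  rw [inclGroup, autHom, Category.assoc, inr_tlift, inr_tlift]; rfl

theorem autHom_comp (γ γ' : ofComm R ⟶ tensor W C) :
    autHom γ ≫ autHom γ' = autHom (convHom γ γ') := by
  refine extended_hom_ext R ?_ ?_
  · rw [← Category.assoc, inclBase_autHom, inclBase_autHom, inclBase_autHom]
  · rw [← Category.assoc, inclGroup_autHom, convHom_comp, Category.assoc, inclBase_autHom,
      inclGroup_autHom, inclGroup_autHom, ← convHom_assoc, ← convHom_comp]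

theorem autHom_unit : autHom (convUnit R (tensor W C)) = 𝟙 _ := by
  refine extended_hom_ext R ?_ ?_
  · rw [inclBase_autHom, Category.comp_id]
  · rw [inclGroup_autHom, convUnit_comp, unit_convHom, Category.comp_id]

instance (γ : ofComm R ⟶ tensor W C) : IsIso (autHom γ) :=
  ⟨autHom (antipode R ≫ γ), by rw [autHom_comp, convHom_antipode, autHom_unit],
    by rw [autHom_comp, antipode_convHom, autHom_unit]⟩

/-- The automorphism translates on the left, the coaction on the right; they commute by
associativity of convolution. -/
theorem autHom_equivariant (γ : ofComm R ⟶ tensor W C) :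
    extendedCoact R W C ≫ tmap (autHom γ) (𝟙 _) =
      autHom γ ≫ extendedCoact R W C := by
  refine extended_hom_ext R ?_ ?_
  · rw [← Category.assoc, inclBase_coact, Category.assoc, inl_tmap, ← Category.assoc,
      inclBase_autHom, ← Category.assoc, inclBase_autHom, inclBase_coact]
  · rw [← Category.assoc, inclGroup_coact, convHom_comp, Category.assoc, inl_tmap, inr_tmap,
      Category.id_comp, ← Category.assoc, inclGroup_autHom, ← Category.assoc, inclGroup_autHom,
      convHom_comp, convHom_comp, Category.assoc, Category.assoc, inclBase_coact, inclGroup_coact,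
      convHom_assoc]

theorem inclBase_tmap (w : W ⟶ W') (f : C ⟶ D) :
    inclBase R W C ≫ tmap w (tmap f (𝟙 _)) = tmap w f ≫ inclBase R W' D := by
  rw [inclBase, inclBase, ← tmap_comp, ← tmap_comp, inl_tmap, Category.id_comp, Category.comp_id]

theorem inclGroup_tmap (w : W ⟶ W') (f : C ⟶ D) :
    inclGroup R W C ≫ tmap w (tmap f (𝟙 _)) = inclGroup R W' D := by
  rw [inclGroup, inclGroup, Category.assoc, inr_tmap, ← Category.assoc, inr_tmap, Category.id_comp]

theorem autHom_tmap (γ : ofComm R ⟶ tensor W C) (w : W ⟶ W') (f : C ⟶ D) :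
    autHom γ ≫ tmap w (tmap f (𝟙 _)) = tmap w (tmap f (𝟙 _)) ≫ autHom (γ ≫ tmap w f) := by
  refine extended_hom_ext R ?_ ?_
  · rw [← Category.assoc, inclBase_autHom, ← Category.assoc, inclBase_tmap, Category.assoc,
      inclBase_autHom]
  · rw [← Category.assoc, inclGroup_autHom, convHom_comp, Category.assoc, inclBase_tmap,
      inclGroup_tmap, ← Category.assoc (inclGroup _ _ _), inclGroup_tmap, inclGroup_autHom,
      Category.assoc]

theorem extHom_autHom (γ : ofComm R ⟶ tensor W C) (w : W ⟶ W') :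
    extHom w (autHom γ) = autHom (γ ≫ tmap w (𝟙 C)) := by
  have h := autHom_tmap γ w (𝟙 C)
  rw [tmap_id] at h
  refine tensor_hom_ext ?_ ?_
  · rw [inl_extHom, autHom, inl_tlift]
  · rw [inr_extHom, h, ← Category.assoc, inr_tmap, Category.id_comp]

/-- The point of the group given by an equivariant endomorphism of the trivial torsor. -/
def autPoint (f : tensor W (tensor C (ofComm R)) ⟶ tensor W (tensor C (ofComm R))) :
    ofComm R ⟶ tensor W C := inclGroup R W C ≫ f ≫ neutral R W C

theorem autPoint_autHom (γ : ofComm R ⟶ tensor W C) : autPoint (autHom γ) = γ := by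
  rw [autPoint, ← Category.assoc, inclGroup_autHom, convHom_comp, Category.assoc,
    inclBase_neutral, inclGroup_neutral, Category.comp_id, convHom_unit]

/-- An equivariant map is determined by its effect on the neutral section. Formally, the coaction
followed by q, which restricts to the neutral section and then translates it back by the group
element, is the identity; inserting this after f and using equivariance expresses f by its point. -/
theorem autHom_autPoint (f : tensor W (tensor C (ofComm R)) ⟶ tensor W (tensor C (ofComm R)))
    (h1 : inclBase R W C ≫ f = inclBase R W C)
    (h2 : extendedCoact R W C ≫ tmap f (𝟙 _) =
      f ≫ extendedCoact R W C) : autHom (autPoint f) = f := by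
  let q : tensor (tensor W (tensor C (ofComm R))) (ofComm R) ⟶ tensor W (tensor C (ofComm R)) :=
    tlift (neutral R W C ≫ inclBase R W C) (inclGroup R W C)
  have hq : extendedCoact R W C ≫ q = 𝟙 _ := by
    refine extended_hom_ext R ?_ ?_
    · rw [← Category.assoc, inclBase_coact, Category.assoc, inl_tlift, ← Category.assoc,
        inclBase_neutral, Category.id_comp, Category.comp_id]
    · rw [← Category.assoc, inclGroup_coact, convHom_comp, Category.assoc, inl_tlift, inr_tlift,
        ← Category.assoc, inclGroup_neutral, convUnit_comp, unit_convHom, Category.comp_id]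
  refine extended_hom_ext R ?_ ?_
  · rw [inclBase_autHom, h1]
  · have h3 := congrArg (fun g => inclGroup R W C ≫ g ≫ q) h2
    simp only [Category.assoc, hq, Category.comp_id] at h3
    rw [← h3, ← Category.assoc, inclGroup_coact, convHom_comp, Category.assoc, inclGroup_autHom]
    simp only [q, tmap_tlift, inl_tlift, inr_tlift, Category.id_comp, autPoint, Category.assoc]

end CDGA

end DG

/-! ### Sections trivialize torsors and cartesian sections of deformations. -/

namespace DG

open CDGA

variable {k : Type u} [Field k] {R : Type u} [CommRing R] [HopfAlgebra k R]

namespace CDGA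

variable {A B C D : CDGA k}

theorem assoc_assocInv (A B C : CDGA k) : assoc A B C ≫ assocInv A B C = 𝟙 _ := by
  refine tensor_hom_ext (tensor_hom_ext ?_ ?_) ?_ <;> simp [assoc, assocInv]

theorem assocInv_tmap {A' B' C' : CDGA k} (f : A ⟶ A') (g : B ⟶ B') (h : C ⟶ C') :
    assocInv A B C ≫ tmap (tmap f g) h = tmap f (tmap g h) ≫ assocInv A' B' C' := by
  refine tensor_hom_ext ?_ (tensor_hom_ext ?_ ?_) <;> simp [assocInv, tmap]

end CDGA

theorem tmap_comp_id {A B C D : CDGA k} (f : A ⟶ B) (g : B ⟶ C) :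
    tmap (f ≫ g) (𝟙 D) = tmap f (𝟙 D) ≫ tmap g (𝟙 D) := by
  rw [← tmap_comp, Category.id_comp]

namespace CoactAlg

variable {C : CDGA k} (T : CoactAlg R C)

/-- The equivariant morphism to the trivial torsor given by a section of a torsor. -/
def ofSection (σ : T.X ⟶ C) : T.X ⟶ tensor C (ofComm R) := T.μ ≫ tmap σ (𝟙 (ofComm R))

variable {T} {σ : T.X ⟶ C}

theorem x_ofSection (hσ : T.x ≫ σ = 𝟙 C) : T.x ≫ T.ofSection σ = inl C (ofComm R) := by
  rw [ofSection, ← Category.assoc, T.base, Category.assoc, inl_tmap, ← Category.assoc, hσ,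
    Category.id_comp]

theorem ofSection_equivariant :
    T.μ ≫ tmap (T.ofSection σ) (𝟙 _) = T.ofSection σ ≫ trivialCoact R C := by
  have h1 : tmap σ (𝟙 (ofComm R)) ≫ tmap (𝟙 C) (comul R) =
      tmap (𝟙 _) (comul R) ≫ tmap σ (𝟙 _) := by rw [← tmap_eq_comp, ← tmap_eq_comp']
  rw [ofSection, trivialCoact, Category.assoc, ← Category.assoc (tmap σ _), h1]
  simp only [← Category.assoc]
  rw [← T.coassoc]
  have h2 := tmap_assoc σ (𝟙 (ofComm R)) (𝟙 (ofComm R))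
  rw [tmap_id] at h2
  simp only [Category.assoc]
  rw [← Category.assoc (assoc _ _ _) (tmap σ _), ← h2, Category.assoc, assoc_assocInv,
    Category.comp_id, ← tmap_comp, Category.id_comp]

/-- The torsor condition gives a linear map θ on X ⊗ R with θ((y ⊗ 1)μ(z)) = x(σ(y))z, so θ(μ z) =
z. It takes the same value after the first factor is replaced by its image under x ∘ σ, and that
image of μ z depends only on (σ ⊗ 1)μ(z). Hence z can be recovered from the latter. -/
theorem injective_ofSection (hT : IsTensorSquare T.x T.x (inl T.X (ofComm R)) T.μ)
    (hσ : T.x ≫ σ = 𝟙 C) : Function.Injective (alg (T.ofSection σ)) := by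
  have hσ' (c : C) : alg σ (alg T.x c) = c := congrArg (fun e => alg e c) hσ
  obtain ⟨θ, hθ⟩ := hT.exists_linear ((LinearMap.mul k T.X).compl₁₂
    (alg (σ ≫ T.x)).toLinearMap LinearMap.id) (fun y c z => by
      change alg T.x (alg σ (y * alg T.x c)) * z = alg T.x (alg σ y) * (alg T.x c * z)
      rw [map_mul, map_mul, hσ', mul_assoc])
  replace hθ : ∀ y z, θ (alg (inl T.X (ofComm R)) y * alg T.μ z) = alg T.x (alg σ y) * z := hθ
  have h1 (y w) : θ (alg (inl T.X (ofComm R)) y * w) = alg T.x (alg σ y) * θ w := by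
    refine hT.induction (p := fun w => θ (alg (inl T.X (ofComm R)) y * w) =
      alg T.x (alg σ y) * θ w) (by simp) ?_ ?_ w
    · intro a b ha hb; rw [mul_add, map_add, map_add, mul_add, ha, hb]
    · intro y' z
      rw [← mul_assoc, ← map_mul, hθ, hθ, map_mul, map_mul, mul_assoc]
  have h2 (w : Tens T.X (ofComm R)) : θ (alg (tmap (σ ≫ T.x) (𝟙 _)) w) = θ w := by
    refine tens_induction (p := fun w => θ (alg (tmap (σ ≫ T.x) (𝟙 _)) w) = θ w) (by simp) ?_ ?_ w
    · intro a b ha hb; rw [map_add, map_add, map_add, ha, hb]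
    · intro i j y r _ _
      have e1 : (tmul y r : Tens T.X (ofComm R)) = alg (inl T.X (ofComm R)) y * tmul 1 r := by
        rw [inl_mul_tmul, mul_one]
      have e2 : (alg (tmap (σ ≫ T.x) (𝟙 _)) (tmul y r) : Tens T.X (ofComm R)) =
          alg (inl T.X (ofComm R)) (alg T.x (alg σ y)) * tmul 1 r := by
        rw [inl_mul_tmul, mul_one, alg_tmap]; rfl
      rw [e1, h1, ← e1, e2, h1, hσ']
  have h3 (z) : z = θ (alg (tmap T.x (𝟙 _)) (alg (T.ofSection σ) z)) := by
    have e : alg (tmap T.x (𝟙 _)) (alg (T.ofSection σ) z) =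
        alg (tmap (σ ≫ T.x) (𝟙 (ofComm R))) (alg T.μ z) := by
      have : T.ofSection σ ≫ tmap T.x (𝟙 _) = T.μ ≫ tmap (σ ≫ T.x) (𝟙 _) := by
        rw [ofSection, Category.assoc, ← tmap_comp, Category.id_comp]
      exact congrArg (fun e => alg e z) this
    have := hθ 1 z
    rw [map_one, one_mul, map_one, map_one, one_mul] at this
    rw [e, h2, this]
  intro z z' h
  rw [h3 z, h3 z', h]

/-- Write (x ⊗ 1)v as a sum of elements (y ⊗ 1)μ(z) by the torsor condition. Applying σ ⊗ 1 exhibits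
v as the image of the sum of the elements x(σ(y))z. -/
theorem surjective_ofSection (hT : IsTensorSquare T.x T.x (inl T.X (ofComm R)) T.μ)
    (hσ : T.x ≫ σ = 𝟙 C) : Function.Surjective (alg (T.ofSection σ)) := by
  intro v
  obtain ⟨t, ht⟩ := hT.surjective (alg (tmap T.x (𝟙 _)) v)
  have hv : alg (tmap σ (𝟙 (ofComm R))) (alg (tmap T.x (𝟙 _)) v) = v := by
    have : tmap T.x (𝟙 _) ≫ tmap σ (𝟙 (ofComm R)) = 𝟙 _ := by
      rw [← tmap_comp, hσ, Category.id_comp, tmap_id]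
    exact congrArg (fun e => alg e v) this
  rw [← hv, ← ht]
  refine tens_induction (p := fun t => ∃ z, alg (T.ofSection σ) z =
    alg (tmap σ (𝟙 (ofComm R))) (alg (tlift (inl T.X (ofComm R)) T.μ) t)) ⟨0, by simp⟩ ?_ ?_ t
  · rintro a b ⟨y, hy⟩ ⟨z, hz⟩
    exact ⟨y + z, by rw [map_add, map_add, map_add, hy, hz]⟩
  · intro i j y z _ _
    refine ⟨alg T.x (alg σ y) * z, ?_⟩
    rw [alg_tlift, map_mul, map_mul]
    refine congrArg₂ (· * ·) ?_ rfl
    refine (congrArg (fun e => alg e (alg σ y)) (x_ofSection hσ)).trans ?_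
    exact (congrArg (fun e => alg e y) (inl_tmap σ (𝟙 (ofComm R)))).symm

theorem isIso_ofSection (hT : IsTensorSquare T.x T.x (inl T.X (ofComm R)) T.μ)
    (hσ : T.x ≫ σ = 𝟙 C) : IsIso (T.ofSection σ) :=
  isIso_of_bijective _ ⟨injective_ofSection hT hσ, surjective_ofSection hT hσ⟩

end CoactAlg

theorem trivialCoact_tmap {C D : CDGA k} (f : C ⟶ D) :
    trivialCoact R C ≫ tmap (tmap f (𝟙 _)) (𝟙 _) = tmap f (𝟙 _) ≫ trivialCoact R D := by
  rw [trivialCoact, Category.assoc, assocInv_tmap, trivialCoact, tmap_id, ← Category.assoc,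
    ← Category.assoc, ← tmap_eq_comp, ← tmap_eq_comp']

section trivial

variable (R) (B : CDGA k)

/-- The trivial deformation. -/
def trivialDeformation (A : DGArt k) : Deformation (trivialTorsor R B) A where
  T := trivialTorsor R (tensor A.toCDGA B)
  isTorsor := trivialTorsor_isTorsor _
  τ := tmap (A.augBase B) (𝟙 _)
  τ_base := inl_tmap _ _
  τ_equivariant := trivialCoact_tmap (A.augBase B)
  τ_iso := isTensorSquare_tmap (A.augBase B) (ofComm R)

theorem tmap_augBase {A A' : DGArt k} (f : A ⟶ A') :
    tmap (DGArt.hom f) (𝟙 B) ≫ A'.augBase B = A.augBase B := by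
  rw [DGArt.augBase, DGArt.augBase, tmap_tlift, ← Category.assoc, DGArt.map_aug, Category.id_comp]

/-- The trivial cartesian section. -/
def trivialSec (A : DGArt k) : Sec (trivialTorsor R B) A where
  obj U := trivialDeformation R B U.right
  map g := tmap (tmap (DGArt.hom g.right) (𝟙 B)) (𝟙 (ofComm R))
  base g := inl_tmap _ _
  equivariant g := trivialCoact_tmap (tmap (DGArt.hom g.right) (𝟙 B))
  triv {U V} g := by
    change tmap (tmap (DGArt.hom g.right) (𝟙 B)) (𝟙 (ofComm R)) ≫
      tmap (V.right.augBase B) (𝟙 _) = tmap (U.right.augBase B) (𝟙 _)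
    rw [← tmap_comp, tmap_augBase, Category.id_comp]
  cartesian g := isTensorSquare_tmap (tmap (DGArt.hom g.right) (𝟙 B)) (ofComm R)
  map_id U := by
    change tmap (tmap (𝟙 _) (𝟙 B)) (𝟙 (ofComm R)) = 𝟙 _
    rw [tmap_id, tmap_id]
  map_comp g h := by
    change tmap (tmap (DGArt.hom g.right ≫ DGArt.hom h.right) (𝟙 B)) (𝟙 (ofComm R)) =
      tmap (tmap (DGArt.hom g.right) (𝟙 B)) (𝟙 (ofComm R)) ≫
      tmap (tmap (DGArt.hom h.right) (𝟙 B)) (𝟙 (ofComm R))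
    rw [← tmap_comp, ← tmap_comp, Category.id_comp, Category.id_comp]

end trivial

namespace Sec

variable {B : CDGA k} {P : CoactAlg R B} {A : DGArt k} {W : CDGA k}

instance cart_isIso {S T : Cart W P A} (f : S ⟶ T) : IsIso f := by
  have h0 : ∀ U, IsIso (Hom.iso f U).hom := fun U => (Hom.iso f U).isIso
  let g : T ⟶ S := Hom.mk (fun U =>
    { hom := inv (Hom.iso f U).hom
      base := by
        rw [IsIso.comp_inv_eq]
        exact (Hom.iso f U).base.symm
      equivariant := by
        have h : tmap (Hom.iso f U).hom (𝟙 (ofComm (k := k) R)) ≫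
            tmap (inv (Hom.iso f U).hom) (𝟙 _) = 𝟙 _ := by
          rw [← tmap_comp, IsIso.hom_inv_id, Category.id_comp, tmap_id]
        rw [IsIso.eq_inv_comp, ← Category.assoc, ← (Hom.iso f U).equivariant, Category.assoc, h,
          Category.comp_id]
      triv := by
        rw [IsIso.inv_comp_eq]
        exact (Hom.iso f U).triv.symm
      isIso := inferInstance })
    (fun {U V} g => by
      change inv (Hom.iso f U).hom ≫ _ = _ ≫ inv (Hom.iso f V).hom
      rw [IsIso.inv_comp_eq, ← Category.assoc, IsIso.eq_comp_inv]
      exact (Hom.natural f g).symm)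
  exact ⟨g, cart_hom_ext fun U => IsIso.hom_inv_id (Hom.iso f U).hom,
    cart_hom_ext fun U => IsIso.inv_hom_id (Hom.iso f U).hom⟩

/-- The trivialization of a deformation of the trivial torsor. -/
def tau (D : Deformation (trivialTorsor R B) A) : D.T.X ⟶ tensor B (ofComm R) := D.τ

theorem base_tau (D : Deformation (trivialTorsor R B) A) :
    D.T.x ≫ tau D = A.augBase B ≫ inl B (ofComm R) := D.τ_base

theorem tau_equivariant (D : Deformation (trivialTorsor R B) A) :
    D.T.μ ≫ tmap (tau D) (𝟙 _) = tau D ≫ trivialCoact R B := D.τ_equivariant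

theorem map_tau (S : Sec (trivialTorsor R B) A) {U V : Under A} (g : U ⟶ V) :
    S.map g ≫ tau (S.obj V) = tau (S.obj U) := S.triv g

variable (R B) in
theorem trivialCoact_counit : trivialCoact R B ≫ tmap (tlift (𝟙 B) (convUnit R B)) (𝟙 _) = 𝟙 _ := by
  refine tensor_hom_ext ?_ ?_
  · rw [← Category.assoc, inl_trivialCoact, Category.assoc, inl_tmap, ← Category.assoc,
      inl_tlift, Category.id_comp, Category.comp_id]
  · rw [← Category.assoc, inr_trivialCoact, convHom_comp, Category.assoc, inl_tmap, inr_tmap,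
      ← Category.assoc, inr_tlift, convUnit_comp, unit_convHom, Category.id_comp,
      Category.comp_id]

/-- The isomorphism to the trivial deformation given by a section. -/
def isoOfSection (W : CDGA k) (D : Deformation (trivialTorsor R B) A)
    (s : D.T.X ⟶ tensor A.toCDGA B) (h1 : D.T.x ≫ s = 𝟙 _)
    (h2 : s ≫ A.augBase B = tau D ≫ tlift (𝟙 B) (convUnit R B)) :
    Deformation.Iso W D (trivialDeformation R B A) where
  hom := tmap (𝟙 W) (D.T.ofSection s)
  base := by
    have h : tmap (𝟙 W) D.T.x ≫ tmap (𝟙 W) (D.T.ofSection s) = tmap (𝟙 W) (inl _ (ofComm R)) := by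
      rw [← tmap_comp, CoactAlg.x_ofSection h1, Category.id_comp]
    exact h
  equivariant := by
    have h : (tmap (𝟙 W) D.T.μ ≫ assocInv W _ (ofComm R)) ≫
        tmap (tmap (𝟙 W) (D.T.ofSection s)) (𝟙 _) = tmap (𝟙 W) (D.T.ofSection s) ≫
        tmap (𝟙 W) (trivialCoact R _) ≫ assocInv W _ (ofComm R) := by
      rw [Category.assoc, assocInv_tmap, ← Category.assoc, ← Category.assoc, ← tmap_comp,
        CoactAlg.ofSection_equivariant, ← tmap_comp]
    exact h
  -- The section reduces to the neutral section of the trivial torsor over B, and translating by the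
  -- neutral section is the identity.
  triv := by
    have h : tmap (𝟙 W) (D.T.ofSection s) ≫ tmap (𝟙 W) (tmap (A.augBase B) (𝟙 (ofComm R))) =
        tmap (𝟙 W) (tau D) := by
      rw [← tmap_comp, Category.id_comp, CoactAlg.ofSection, Category.assoc,
        ← tmap_comp_id, h2, tmap_comp_id, ← Category.assoc, tau_equivariant, Category.assoc, trivialCoact_counit,
        Category.comp_id]
    exact h
  isIso := by
    have := CoactAlg.isIso_ofSection D.isTorsor.1 h1
    have h : IsIso (tmap (𝟙 W) (D.T.ofSection s)) := by
      refine ⟨tmap (𝟙 W) (inv (D.T.ofSection s)), ?_, ?_⟩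
      · rw [← tmap_comp, IsIso.hom_inv_id, Category.id_comp, tmap_id]
      · rw [← tmap_comp, IsIso.inv_hom_id, Category.id_comp, tmap_id]
    exact h

/-- A section over `A` of a cartesian section of deformations trivializes it. -/
theorem exists_hom_trivialSec (S : Sec (trivialTorsor R B) A)
    (σ : (S.obj (Under.mk (𝟙 A))).T.X ⟶ tensor A.toCDGA B)
    (h1 : (S.obj (Under.mk (𝟙 A))).T.x ≫ σ = 𝟙 _)
    (h2 : σ ≫ A.augBase B = tau (S.obj (Under.mk (𝟙 A))) ≫ tlift (𝟙 B) (convUnit R B)) :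
    Nonempty ((⟨S⟩ : Cart W (trivialTorsor R B) A) ⟶ ⟨trivialSec R B A⟩) := by
  let i (U : Under A) : Under.mk (𝟙 A) ⟶ U := Under.homMk U.hom (Category.id_comp _)
  have hi {U V : Under A} (g : U ⟶ V) : i U ≫ g = i V := by
    ext; exact Under.w g
  -- The identity of A is initial under A, and a cartesian arrow is a pushout; so the section over A
  -- extends to each base change, and uniqueness of maps out of a pushout makes the extensions
  -- compatible with one another.
  have hex (U : Under A) := (S.cartesian (i U)).exists_desc (𝟙 _)
    (σ ≫ tmap (DGArt.hom (i U).right) (𝟙 B)) (by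
      rw [Category.comp_id, ← Category.assoc, h1]; exact (Category.id_comp _).symm)
  choose s hs1 hs2 using hex
  have hnat {U V : Under A} (g : U ⟶ V) :
      S.map g ≫ s V = s U ≫ tmap (DGArt.hom g.right) (𝟙 B) := by
    refine (S.cartesian (i U)).hom_ext ?_ ?_
    · rw [← Category.assoc, S.base, Category.assoc, hs1, Category.comp_id, ← Category.assoc, hs1,
        Category.id_comp]
    · rw [← Category.assoc, ← S.map_comp, hi, hs2, ← Category.assoc, hs2, Category.assoc,
        ← tmap_comp, Category.id_comp, ← hi g]
      rfl
  have haug (U : Under A) : s U ≫ U.right.augBase B = tau (S.obj U) ≫ tlift (𝟙 B) (convUnit R B) := by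
    refine (S.cartesian (i U)).hom_ext ?_ ?_
    · rw [← Category.assoc, hs1, Category.id_comp, ← Category.assoc, base_tau,
        Category.assoc, inl_tlift, Category.comp_id]
    · rw [← Category.assoc, hs2, Category.assoc, tmap_augBase, ← Category.assoc, map_tau]
      exact h2
  refine ⟨⟨fun U => isoOfSection W (S.obj U) (s U) (hs1 U) (haug U), fun {U V} g => ?_⟩⟩
  have h : tmap (𝟙 W) ((S.obj U).T.ofSection (s U)) ≫
      tmap (𝟙 W) (tmap (tmap (DGArt.hom g.right) (𝟙 B)) (𝟙 (ofComm R))) =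
      tmap (𝟙 W) (S.map g) ≫ tmap (𝟙 W) ((S.obj V).T.ofSection (s V)) := by
    rw [← tmap_comp, ← tmap_comp, Category.id_comp, CoactAlg.ofSection, Category.assoc,
      ← tmap_comp_id, ← hnat, CoactAlg.ofSection, tmap_comp_id, ← Category.assoc, S.equivariant,
      Category.assoc]
  exact h

end Sec

end DG

/-! ### Nilpotence and flatness arguments for thickenings. -/

namespace DG

open CDGA

variable {k : Type u} [Field k]

theorem NilFil.decompose_mem {C : CDGA k} (φ : NilFil C) {i : ℕ} {x : C} (hx : x ∈ φ.F i) (n : ℤ) :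
    (decompose C.deg x n : C) ∈ φ.F i := by
  refine Submodule.closure_induction (p := fun x _ => (decompose C.deg x n : C) ∈ φ.F i)
    ?_ ?_ ?_ (φ.hom i hx)
  · rw [decompose_zero]; exact zero_mem _
  · intro x y _ _ hx hy
    rw [decompose_add, DirectSum.add_apply, Submodule.coe_add]
    exact add_mem hx hy
  · rintro a y ⟨hy, p, hp⟩
    rw [decompose_smul, DirectSum.smul_apply, Submodule.coe_smul]
    refine Submodule.smul_mem _ _ ?_
    by_cases h : p = n
    · subst h; rwa [decompose_of_mem_same _ hp]
    · rw [decompose_of_mem_ne _ hp h]; exact zero_mem _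

namespace CDGA

variable {C C' X X' Y : CDGA k} {ρ : C ⟶ C'} {x : C ⟶ X} {x' : C' ⟶ X'} {f : X ⟶ X'}

theorem IsTensorSquare.surjective_right (h : IsTensorSquare ρ x x' f)
    (hρ : Function.Surjective (alg ρ)) (hc : ρ ≫ x' = x ≫ f) : Function.Surjective (alg f) := by
  intro z
  refine h.induction (p := fun z => ∃ y, alg f y = z) ⟨0, map_zero _⟩ ?_ ?_ z
  · rintro _ _ ⟨y, rfl⟩ ⟨z, rfl⟩
    exact ⟨y + z, map_add _ _ _⟩
  · intro c' y
    obtain ⟨c, rfl⟩ := hρ c'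
    refine ⟨alg x c * y, ?_⟩
    rw [map_mul]
    exact congrArg (· * alg f y) (alg_congr hc c).symm

/-- The pushout X' of X along a surjection ρ is X modulo the multiples of the kernel of ρ. With a
linear section s of ρ, the map c' ⊗ y ↦ s(c')y modulo K is balanced, so it descends to X' and
recovers the class of y. -/
theorem IsTensorSquare.mem_of_apply_eq_zero (h : IsTensorSquare ρ x x' f)
    (hρ : Function.Surjective (alg ρ)) (K : Submodule k X)
    (hK : ∀ c, alg ρ c = 0 → ∀ y, alg x c * y ∈ K) {y : X} (hy : alg f y = 0) : y ∈ K := by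
  obtain ⟨s, hs⟩ := LinearMap.exists_rightInverse_of_surjective (alg ρ).toLinearMap
    (LinearMap.range_eq_top.2 hρ)
  replace hs : ∀ c', alg ρ (s c') = c' := fun c' => LinearMap.congr_fun hs c'
  obtain ⟨θ, hθ⟩ := h.exists_linear (((LinearMap.mul k X).compl₁₂
    ((alg x).toLinearMap ∘ₗ s) LinearMap.id).compr₂ K.mkQ) (fun b c z => by
      change K.mkQ (alg x (s (b * alg ρ c)) * z) = K.mkQ (alg x (s b) * (alg x c * z))
      rw [← sub_eq_zero, ← map_sub, ← mul_assoc, ← map_mul, ← sub_mul, ← map_sub]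
      exact (Submodule.Quotient.mk_eq_zero K).2
        (hK _ (by rw [map_sub, map_mul (alg ρ), hs, hs, sub_self]) z))
  replace hθ : ∀ c' y, θ (alg x' c' * alg f y) = K.mkQ (alg x (s c') * y) := hθ
  have h1 := hθ 1 y
  rw [hy, mul_zero, map_zero] at h1
  have h2 := (Submodule.Quotient.mk_eq_zero K).1 h1.symm
  -- The linear section need not preserve 1; the defect lies in the kernel of ρ.
  have h3 := hK (1 - s 1) (by rw [map_sub, hs, map_one, sub_self]) y
  have := add_mem h3 h2
  rwa [map_sub, map_one, sub_mul, one_mul, sub_add_cancel] at this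

/-- A graded form of Nakayama's lemma. In a sum of products c · z with c in the first step and of
positive total degree, either c has positive degree and is zero, or z has positive degree. So if the
part of positive degree lies in step j, it lies in step j + 1. -/
theorem eq_zero_of_pos (φ : NilFil C) (hC : ∀ i : ℤ, 0 < i → ∀ c ∈ C.deg i, c = 0)
    (hX : ∀ i : ℤ, 0 < i → ∀ y ∈ X.deg i, y ∈ (φ.push x).F 1) {i : ℤ} (hi : 0 < i) {y : X}
    (hy : y ∈ X.deg i) : y = 0 := by
  have key : ∀ j : ℕ, ∀ i : ℤ, 0 < i → ∀ y ∈ X.deg i, y ∈ (φ.push x).F j := by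
    intro j
    induction j with
    | zero => exact fun _ _ y _ => (φ.push x).mem_zero y
    | succ j ih =>
      intro i hi y hy
      have h1 : (φ.push x).F 1 ≤ ((φ.push x).F (j + 1)).comap
          ((X.deg i).subtype ∘ₗ DirectSum.component k ℤ (fun i => X.deg i) i ∘ₗ
            (decomposeLinearEquiv X.deg).toLinearMap) := by
        refine φ.push_induction x _ fun c hc z => ?_
        refine Submodule.closure_induction (p := fun c _ => alg x c * z ∈
          ((φ.push x).F (j + 1)).comap _) ?_ ?_ ?_ (φ.hom 1 hc)
        · rw [map_zero, zero_mul]; exact zero_mem _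
        · intro a b _ _ ha hb; rw [map_add, add_mul]; exact add_mem ha hb
        · rintro r c ⟨hc, a, ha⟩
          rw [map_smul, smul_mul_assoc]
          refine Submodule.smul_mem _ _ ?_
          refine X.hom_induction (p := fun z => alg x c * z ∈ ((φ.push x).F (j + 1)).comap _)
            ?_ ?_ ?_ z
          · rw [mul_zero]; exact zero_mem _
          · intro a b ha hb; rw [mul_add]; exact add_mem ha hb
          · intro b z hz
            change (decompose X.deg (alg x c * z) i : X) ∈ (φ.push x).F (j + 1)
            have hcz := SetLike.mul_mem_graded (Hom.map_deg x a c ha) hz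
            by_cases hab : a + b = i
            · subst hab
              rw [decompose_of_mem_same _ hcz]
              rcases lt_or_ge 0 a with h | h
              · rw [hC a h c ha, map_zero, zero_mul]; exact zero_mem _
              · have := (φ.push x).mul (φ.mem_push x hc) (ih b (by omega) z hz)
                rwa [add_comm] at this
            · rw [decompose_of_mem_ne _ hcz hab]; exact zero_mem _
      have h2 : (decompose X.deg y i : X) ∈ (φ.push x).F (j + 1) := h1 (hX i hi y hy)
      rwa [decompose_of_mem_same _ hy] at h2
  obtain ⟨N, hN⟩ := (φ.push x).nil
  have := key N i hi y hy
  rwa [hN, Submodule.mem_bot] at this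

/-- Nakayama's lemma for a nilpotent filtration: approximating the cofactor z in c · z modulo the
first step improves the approximation by one step. -/
theorem surjective_of_push (φ : NilFil C) {u : C ⟶ Y} {π : Y ⟶ X} (h : u ≫ π = x)
    (h1 : ∀ y, ∃ w, y - alg π w ∈ (φ.push x).F 1) : Function.Surjective (alg π) := by
  have hu (c) : alg π (alg u c) = alg x c := alg_congr h c
  have key : ∀ j : ℕ, ∀ y, ∃ w, y - alg π w ∈ (φ.push x).F j := by
    intro j
    induction j with
    | zero => exact fun y => ⟨0, (φ.push x).mem_zero _⟩
    | succ j ih =>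
      intro y
      obtain ⟨w, hw⟩ := ih y
      have h2 : (φ.push x).F j ≤ LinearMap.range (alg π).toLinearMap ⊔ (φ.push x).F (j + 1) := by
        refine φ.push_induction x _ fun c hc z => ?_
        obtain ⟨v, hv⟩ := h1 z
        have e : alg x c * z = alg π (alg u c * v) + alg x c * (z - alg π v) := by
          rw [map_mul, hu, mul_sub, add_sub_cancel]
        rw [e]
        exact Submodule.add_mem_sup ⟨_, rfl⟩ ((φ.push x).mul (φ.mem_push x hc) hv)
      obtain ⟨_, ⟨v, rfl⟩, r, hr, e⟩ := Submodule.mem_sup.1 (h2 hw)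
      refine ⟨w + v, ?_⟩
      rw [map_add, ← sub_sub, ← e, AlgHom.toLinearMap_apply, add_sub_cancel_left]
      exact hr
  obtain ⟨N, hN⟩ := (φ.push x).nil
  intro y
  obtain ⟨w, hw⟩ := key N y
  rw [hN, Submodule.mem_bot, sub_eq_zero] at hw
  exact ⟨w, hw.symm⟩

theorem exists_mem_push (φ : NilFil C) {u : C ⟶ Y} {π : Y ⟶ X} (h : u ≫ π = x)
    (hπ : Function.Surjective (alg π)) {i : ℕ} {y : X} (hy : y ∈ (φ.push x).F i) :
    ∃ w ∈ (φ.push u).F i, alg π w = y := by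
  have h2 : (φ.push x).F i ≤ ((φ.push u).F i).map (alg π).toLinearMap := by
    refine φ.push_induction x _ fun c hc z => ?_
    obtain ⟨w, rfl⟩ := hπ z
    refine ⟨alg u c * w, (φ.push u).mul_right _ (φ.mem_push u hc), ?_⟩
    rw [AlgHom.toLinearMap_apply, map_mul]
    exact congrArg (· * _) (alg_congr h c)
  exact h2 hy

/-- A step of a filtration as a right ideal. -/
def rightIdeal (φ : NilFil C) (i : ℕ) : Submodule Cᵐᵒᵖ C where
  carrier := φ.F i
  add_mem' ha hb := add_mem (S := Submodule k C) ha hb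
  zero_mem' := zero_mem (φ.F i)
  smul_mem' c _ hb := φ.mul_right c.unop hb

variable (x) in
/-- The action map `c ⊗ y ↦ x(c) y`. -/
def actMap : C ⊗[ℤ] X →+ X := TensorProduct.liftAddHom
  (AddMonoidHom.mk' (fun c => AddMonoidHom.mulLeft (alg x c))
    (fun c c' => by ext y; exact (congrArg (· * y) (map_add (alg x) c c')).trans (add_mul _ _ y)))
  (fun a c y => by rw [map_zsmul, map_zsmul]; rfl)

theorem actMap_tmul (c : C) (y : X) : actMap x (c ⊗ₜ y) = alg x c * y := rfl

theorem balanced_self {z : C ⊗[ℤ] X} (hz : actMap x z = 0) : z ∈ balanced x C := by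
  have key : ∀ z, z - (1 : C) ⊗ₜ actMap x z ∈ balanced x C := by
    intro z
    induction z with
    | zero => rw [map_zero, TensorProduct.tmul_zero, sub_zero]; exact zero_mem _
    | add a b ha hb => rw [map_add, TensorProduct.tmul_add, add_sub_add_comm]; exact add_mem ha hb
    | tmul c y =>
      refine AddSubgroup.subset_closure ⟨1, c, y, ?_⟩
      have : MulOpposite.op c • (1 : C) = c := one_mul c
      rw [this, actMap_tmul]
  have := key z
  rwa [hz, TensorProduct.tmul_zero, sub_zero] at this

/-- The elements of the first step times Y that lie in ker π are the first step times ker π, the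
usual consequence of the vanishing of Tor₁(C/F 1, X). The element y defines a tensor in F 1 ⊗ X with
image zero in X; by flatness it is balanced, and m ⊗ π(w) ↦ mw is well defined modulo F 1 · ker π.
-/
theorem mem_of_flat (hx : FaithfullyFlat x) (φ : NilFil C) {u : C ⟶ Y} {π : Y ⟶ X}
    (h : u ≫ π = x) (hπ : Function.Surjective (alg π)) {y : Y} (hy : y ∈ (φ.push u).F 1)
    (hy0 : alg π y = 0) :
    y ∈ Submodule.span k {z | ∃ c ∈ φ.F 1, ∃ w, alg π w = 0 ∧ z = alg u c * w} := by
  set K := Submodule.span k {z | ∃ c ∈ φ.F 1, ∃ w, alg π w = 0 ∧ z = alg u c * w}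
  have hK {c : C} (hc : c ∈ φ.F 1) {w w' : Y} (hw : alg π w = alg π w') :
      K.mkQ (alg u c * w) = K.mkQ (alg u c * w') := by
    rw [← sub_eq_zero, ← map_sub, ← mul_sub]
    exact (Submodule.Quotient.mk_eq_zero K).2 (Submodule.subset_span
      ⟨c, hc, _, by rw [map_sub, hw, sub_self], rfl⟩)
  obtain ⟨s, hs⟩ := hπ.hasRightInverse
  have hu (c) : alg π (alg u c) = alg x c := alg_congr h c
  let G : rightIdeal φ 1 ⊗[ℤ] X →+ Y ⧸ K := TensorProduct.liftAddHom
    (AddMonoidHom.mk' (fun m => AddMonoidHom.mk' (fun y => K.mkQ (alg u m.1 * s y))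
      (fun y z => by
        rw [← map_add, ← mul_add]
        exact hK m.2 (by rw [map_add, hs, hs, hs])))
      (fun m m' => by
        ext y
        change K.mkQ (alg u (m.1 + m'.1) * s y) = K.mkQ (alg u m.1 * s y) + K.mkQ (alg u m'.1 * s y)
        rw [map_add, add_mul, map_add]))
    (fun a m y => by rw [map_zsmul, map_zsmul]; rfl)
  have hG (m : rightIdeal φ 1) (y : X) : G (m ⊗ₜ y) = K.mkQ (alg u m.1 * s y) := rfl
  have hG0 : balanced x (rightIdeal φ 1) ≤ G.ker := by
    refine (AddSubgroup.closure_le _).2 ?_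
    rintro _ ⟨m, c, y, rfl⟩
    rw [SetLike.mem_coe, AddMonoidHom.mem_ker, map_sub, sub_eq_zero, hG, hG]
    have : ((MulOpposite.op c • m : rightIdeal φ 1) : C) = m.1 * c := rfl
    rw [this, map_mul (alg u), mul_assoc]
    exact hK m.2 (by rw [map_mul, hs, hs, hu])
  let g : rightIdeal φ 1 →ₗ[Cᵐᵒᵖ] C := (rightIdeal φ 1).subtype
  have hz : ∃ z, G z = K.mkQ y ∧ actMap x (g.toAddMonoidHom.toIntLinearMap.rTensor X z) = alg π y := by
    refine Submodule.closure_induction (p := fun y _ => ∃ z, G z = K.mkQ y ∧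
      actMap x (g.toAddMonoidHom.toIntLinearMap.rTensor X z) = alg π y) ?_ ?_ ?_ hy
    · exact ⟨0, by rw [map_zero, map_zero], by rw [map_zero, map_zero, map_zero]⟩
    · rintro a b _ _ ⟨z, h1, h2⟩ ⟨w, h3, h4⟩
      exact ⟨z + w, by rw [map_add, map_add, h1, h3], by rw [map_add, map_add, map_add, h2, h4]⟩
    · rintro r _ ⟨c, hc, w, rfl⟩
      refine ⟨(⟨c, hc⟩ : rightIdeal φ 1) ⊗ₜ alg π (r • w), ?_, ?_⟩
      · rw [hG, ← mul_smul_comm]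
        exact hK hc (hs _)
      · rw [← mul_smul_comm, map_mul (alg π), hu]
        rfl
  obtain ⟨z, hz1, hz2⟩ := hz
  have h1 := hx.1 _ _ g Subtype.val_injective z (balanced_self (hz2.trans hy0))
  exact (Submodule.Quotient.mk_eq_zero K).1 (hz1.symm.trans (hG0 h1))

end CDGA

end DG

/-! ### Newton's method for polynomial systems over a thickening. -/

namespace DG

open CDGA

theorem aeval_sub_aeval_mem {k Z σ : Type*} [CommRing k] [CommRing Z] [Algebra k Z] (I : Ideal Z)
    {a b : σ → Z} (h : ∀ s, a s - b s ∈ I) (p : MvPolynomial σ k) :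
    MvPolynomial.aeval a p - MvPolynomial.aeval b p ∈ I := by
  induction p using MvPolynomial.induction_on with
  | C c => simp
  | add p q hp hq => rw [map_add, map_add, add_sub_add_comm]; exact add_mem hp hq
  | mul_X p s hp =>
    rw [map_mul, map_mul, MvPolynomial.aeval_X, MvPolynomial.aeval_X,
      show MvPolynomial.aeval a p * a s - MvPolynomial.aeval b p * b s =
        MvPolynomial.aeval a p * (a s - b s) +
          (MvPolynomial.aeval a p - MvPolynomial.aeval b p) * b s by ring]
    exact add_mem (I.mul_mem_left _ (h s)) (I.mul_mem_right _ hp)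

theorem aeval_mem {k Z σ : Type*} [Field k] [CommRing Z] [Algebra k Z] (J : Ideal Z)
    {a : σ → Z} (ha : ∀ s, a s ∈ J) {p : MvPolynomial σ k}
    (hp : p ∈ MvPolynomial.idealOfVars σ k) : MvPolynomial.aeval a p ∈ J := by
  have : Ideal.map (MvPolynomial.aeval (R := k) a) (MvPolynomial.idealOfVars σ k) ≤ J := by
    rw [Ideal.map_span, Ideal.span_le]
    rintro _ ⟨_, ⟨i, rfl⟩, rfl⟩
    simpa using ha i
  exact this (Ideal.mem_map_of_mem _ hp)

/-- Factoring a polynomial of order two as a sum of products uv, in each term of the difference one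
factor is small by itself and the other contributes the difference of the arguments. -/
theorem aeval_sub_aeval_mem_mul {k Z σ : Type*} [Field k] [CommRing Z] [Algebra k Z]
    (I J : Ideal Z) {a b : σ → Z} (h : ∀ s, a s - b s ∈ I) (ha : ∀ s, a s ∈ J) (hb : ∀ s, b s ∈ J)
    {p : MvPolynomial σ k} (hp : p ∈ MvPolynomial.idealOfVars σ k ^ 2) :
    MvPolynomial.aeval a p - MvPolynomial.aeval b p ∈ J * I := by
  rw [pow_two] at hp
  refine Submodule.mul_induction_on hp (fun u hu v hv => ?_) (fun u v hu hv => ?_)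
  · rw [map_mul, map_mul,
      show MvPolynomial.aeval a u * MvPolynomial.aeval a v -
          MvPolynomial.aeval b u * MvPolynomial.aeval b v =
        MvPolynomial.aeval a u * (MvPolynomial.aeval a v - MvPolynomial.aeval b v) +
          (MvPolynomial.aeval a u - MvPolynomial.aeval b u) * MvPolynomial.aeval b v by ring]
    refine add_mem (Ideal.mul_mem_mul (aeval_mem J ha hu) (aeval_sub_aeval_mem I h v)) ?_
    rw [mul_comm (MvPolynomial.aeval a u - _)]
    exact Ideal.mul_mem_mul (aeval_mem J hb hv) (aeval_sub_aeval_mem I h u)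
  · rw [map_add, map_add, add_sub_add_comm]; exact add_mem hu hv

variable {k : Type u} [Field k]

namespace CDGA

variable {C D : CDGA k} {σ : Type}

/-- Evaluation of polynomials at elements of degree zero, if all such elements are closed. -/
def polyHom (hd : ∀ y ∈ C.deg 0, C.d y = 0) (ξ : σ → C.zeroPart) :
    ofComm (MvPolynomial σ k) ⟶ C :=
  ofCommHom (C.zeroPart.val.comp (MvPolynomial.aeval ξ)) (fun p => (MvPolynomial.aeval ξ p).2)
    (fun p => hd _ (MvPolynomial.aeval ξ p).2)

theorem polyHom_apply (hd : ∀ y ∈ C.deg 0, C.d y = 0) (ξ : σ → C.zeroPart)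
    (p : MvPolynomial σ k) :
    alg (polyHom hd ξ) p = (MvPolynomial.aeval ξ p : C.zeroPart).1 := rfl

theorem polyHom_ext {f g : ofComm (MvPolynomial σ k) ⟶ C}
    (h : ∀ s, alg f (MvPolynomial.X s : MvPolynomial σ k) = alg g (MvPolynomial.X s : MvPolynomial σ k)) :
    f = g := by
  refine hom_ext fun p => ?_
  have e : ((alg f : MvPolynomial σ k →ₐ[k] C)) = (alg g : MvPolynomial σ k →ₐ[k] C) := by
    ext s; exact h s
  exact AlgHom.congr_fun e p

/-- Evaluation of polynomials with coefficients in `C`. -/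
def evalAt (hd : ∀ y ∈ C.deg 0, C.d y = 0) (b : σ → C.zeroPart) :
    tensor C (ofComm (MvPolynomial σ k)) ⟶ C := tlift (𝟙 C) (polyHom hd b)

variable (hd : ∀ y ∈ C.deg 0, C.d y = 0) (φ : NilFil C)

theorem evalAt_tmul (b : σ → C.zeroPart) (c : C) (p : MvPolynomial σ k) :
    alg (evalAt hd b) (tmul (B := ofComm (MvPolynomial σ k)) c p) =
      c * (MvPolynomial.aeval b p : C.zeroPart).1 := rfl

theorem evalAt_inl_mul (b : σ → C.zeroPart) (c : C) (w : Tens C (ofComm (MvPolynomial σ k))) :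
    alg (evalAt hd b) (alg (inl C (ofComm (MvPolynomial σ k))) c * w) = c * alg (evalAt hd b) w := by
  rw [map_mul]
  exact congrArg (· * _) (alg_congr (inl_tlift (𝟙 C) (polyHom hd b)) c)

theorem evalAt_sub_mem {a b : σ → C.zeroPart} {i : ℕ} (h : ∀ s, a s - b s ∈ φ.ideal i)
    (w : Tens C (ofComm (MvPolynomial σ k))) :
    alg (evalAt hd a) w - alg (evalAt hd b) w ∈ φ.F i := by
  refine tens_induction (p := fun w => alg (evalAt hd a) w - alg (evalAt hd b) w ∈ φ.F i)
    (by rw [map_zero, map_zero, sub_zero]; exact zero_mem _) ?_ ?_ w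
  · intro x y hx hy; rw [map_add, map_add, add_sub_add_comm]; exact add_mem hx hy
  · intro _ _ c p _ _
    rw [evalAt_tmul, evalAt_tmul, ← mul_sub]
    exact φ.mul_left _ (aeval_sub_aeval_mem (φ.ideal i) h p)

theorem evalAt_sub_mem_succ {a b : σ → C.zeroPart} {i : ℕ} (h : ∀ s, a s - b s ∈ φ.ideal i)
    {w : Tens C (ofComm (MvPolynomial σ k))}
    (hw : w ∈ (φ.push (inl C (ofComm (MvPolynomial σ k)))).F 1) :
    alg (evalAt hd a) w - alg (evalAt hd b) w ∈ φ.F (i + 1) := by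
  refine φ.push_induction _ ((φ.F (i + 1)).comap
    ((alg (evalAt hd a)).toLinearMap - (alg (evalAt hd b)).toLinearMap)) (fun c hc y => ?_) hw
  change alg (evalAt hd a) (alg (inl C (ofComm (MvPolynomial σ k))) c * y) -
    alg (evalAt hd b) (alg (inl C (ofComm (MvPolynomial σ k))) c * y) ∈ φ.F (i + 1)
  rw [evalAt_inl_mul, evalAt_inl_mul, ← mul_sub, add_comm]
  exact φ.mul hc (evalAt_sub_mem hd φ h y)

theorem evalAt_mem {a : σ → C.zeroPart} {i : ℕ} {w : Tens C (ofComm (MvPolynomial σ k))}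
    (hw : w ∈ (φ.push (inl C (ofComm (MvPolynomial σ k)))).F i) :
    alg (evalAt hd a) w ∈ φ.F i := by
  refine φ.push_induction _ ((φ.F i).comap (alg (evalAt hd a)).toLinearMap) (fun c hc y => ?_) hw
  change alg (evalAt hd a) (alg (inl C (ofComm (MvPolynomial σ k))) c * y) ∈ φ.F i
  rw [evalAt_inl_mul]
  exact φ.mul_right _ hc

/-- Newton's method: a system of equations whose reduction has a nondegenerate root at the origin
has a root close to the origin. -/
theorem exists_root {n m : ℕ} (q : Fin m → MvPolynomial (Fin n ⊕ Fin m) k)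
    (hq : ∀ j, q j ∈ MvPolynomial.idealOfVars (Fin n ⊕ Fin m) k ^ 2)
    (f : Fin m → Tens C (ofComm (MvPolynomial (Fin n ⊕ Fin m) k)))
    (hf0 : ∀ j, f j ∈ tensDeg C (ofComm (MvPolynomial (Fin n ⊕ Fin m) k)) 0)
    (hf : ∀ j, f j - tmul (B := ofComm (MvPolynomial (Fin n ⊕ Fin m) k)) 1
      (MvPolynomial.X (Sum.inr j) - q j : MvPolynomial (Fin n ⊕ Fin m) k) ∈
      (φ.push (inl C (ofComm (MvPolynomial (Fin n ⊕ Fin m) k)))).F 1) :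
    ∃ b : Fin n ⊕ Fin m → C.zeroPart, (∀ s, b s ∈ φ.ideal 1) ∧
      ∀ j, alg (evalAt hd b) (f j) = 0 := by
  -- The coordinates x are put equal to zero, and the system is solved for the remaining variables
  -- y.
  let v (b : Fin m → C.zeroPart) : Fin n ⊕ Fin m → C.zeroPart := Sum.elim 0 b
  have hv1 {b : Fin m → C.zeroPart} {i : ℕ} (hb : ∀ j, b j ∈ φ.ideal i) (s) :
      v b s ∈ φ.ideal i := by
    rcases s with s | s
    · exact zero_mem _
    · exact hb s
  have hv2 {a b : Fin m → C.zeroPart} {i : ℕ} (hb : ∀ j, a j - b j ∈ φ.ideal i) (s) :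
      v a s - v b s ∈ φ.ideal i := by
    rcases s with s | s
    · change (0 - 0 : C.zeroPart) ∈ _
      rw [sub_zero]; exact zero_mem _
    · exact hb s
  have hone (b : Fin n ⊕ Fin m → C.zeroPart) (j) : alg (evalAt hd b)
      (tmul (B := ofComm (MvPolynomial (Fin n ⊕ Fin m) k)) 1
      (MvPolynomial.X (Sum.inr j) - q j : MvPolynomial (Fin n ⊕ Fin m) k)) =
      (b (Sum.inr j) - MvPolynomial.aeval b (q j) : C.zeroPart).1 := by
    rw [evalAt_tmul, one_mul, map_sub, MvPolynomial.aeval_X]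
  let Φ : (Fin m → C.zeroPart) → Fin m → C.zeroPart := fun b j =>
    ⟨alg (evalAt hd (v b)) (f j), Hom.map_deg (evalAt hd (v b)) 0 _ (hf0 j)⟩
  let U : ℕ → AddSubgroup (Fin m → C.zeroPart) := fun i =>
    { carrier := {b | ∀ j, b j ∈ φ.ideal i}
      add_mem' := fun ha hb j => add_mem (ha j) (hb j)
      zero_mem' := fun j => zero_mem _
      neg_mem' := fun ha j => neg_mem (ha j) }
  obtain ⟨b, ⟨hb1, hb2⟩, -⟩ := NilFil.exists_unique_of_approx U
    (fun i b hb j => φ.anti i (hb j)) (by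
      obtain ⟨N, hN⟩ := φ.nil
      refine ⟨N, eq_bot_iff.2 fun b hb => funext fun j => Subtype.ext ?_⟩
      have : (b j : C) ∈ φ.F N := hb j
      rwa [hN] at this) Φ
    (fun b hb j => by
      have h1 : alg (evalAt hd (v b)) (f j) - (v b (Sum.inr j) -
          MvPolynomial.aeval (v b) (q j) : C.zeroPart).1 ∈ φ.F 1 := by
        rw [← hone, ← map_sub]
        exact evalAt_mem hd φ (hf j)
      have h2 : v b (Sum.inr j) - MvPolynomial.aeval (v b) (q j) ∈ φ.ideal 1 :=
        sub_mem (hb j) (aeval_mem _ (hv1 hb) (Ideal.pow_le_self two_ne_zero (hq j)))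
      have h3 : (v b (Sum.inr j) - MvPolynomial.aeval (v b) (q j) : C.zeroPart).1 ∈ φ.F 1 := h2
      have := add_mem h1 h3
      rw [sub_add_cancel] at this
      exact this)
    (fun i hi a ha b hb hab j => by
      -- The equation f_j differs from y_j - q_j by a polynomial with coefficients in the first
      -- step, and q_j has order two. Changing y by an element of step i changes both corrections
      -- only in step i + 1, so the system is the identity to first order.
      have h1 : (alg (evalAt hd (v a)) (f j) - alg (evalAt hd (v b)) (f j)) -
          ((v a (Sum.inr j) - MvPolynomial.aeval (v a) (q j) : C.zeroPart).1 -
          (v b (Sum.inr j) - MvPolynomial.aeval (v b) (q j) : C.zeroPart).1) ∈ φ.F (i + 1) := by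
        rw [← hone, ← hone, sub_sub_sub_comm, ← map_sub, ← map_sub]
        exact evalAt_sub_mem_succ hd φ (hv2 hab) (hf j)
      have h2 : MvPolynomial.aeval (v a) (q j) - MvPolynomial.aeval (v b) (q j) ∈
          φ.ideal 1 * φ.ideal i :=
        aeval_sub_aeval_mem_mul _ _ (hv2 hab) (hv1 ha) (hv1 hb) (hq j)
      have h3 : φ.ideal 1 * φ.ideal i ≤ φ.ideal (i + 1) :=
        Ideal.mul_le.2 fun r hr s hs => by
          have := φ.mul hr hs
          rwa [add_comm] at this
      have h4 : (MvPolynomial.aeval (v a) (q j) - MvPolynomial.aeval (v b) (q j) : C.zeroPart).1 ∈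
        φ.F (i + 1) := h3 h2
      have h5 := sub_mem h1 h4
      change (alg (evalAt hd (v a)) (f j) - alg (evalAt hd (v b)) (f j)) -
        ((v a (Sum.inr j)).1 - (v b (Sum.inr j)).1) ∈ φ.F (i + 1)
      refine (congrArg (· ∈ φ.F (i + 1)) ?_).mp h5
      push_cast
      abel)
    0 (fun j => zero_mem _)
  exact ⟨v b, hv1 hb1, fun j => congrArg Subtype.val (congrFun hb2 j)⟩

end CDGA

end DG

/-! ### Smoothness: sections of torsors over a nilpotent thickening. -/

namespace DG

open CDGA

variable {k : Type u} [Field k]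

namespace CDGA

theorem tmap_surjective {C C' S S' : CDGA k} {f : C ⟶ C'} {g : S ⟶ S'}
    (hf : Function.Surjective (alg f)) (hg : Function.Surjective (alg g)) :
    Function.Surjective (alg (tmap f g)) := by
  intro z
  refine tens_induction (p := fun z => ∃ w, alg (tmap f g) w = z) ⟨0, map_zero _⟩ ?_ ?_ z
  · rintro _ _ ⟨v, rfl⟩ ⟨w, rfl⟩
    exact ⟨v + w, map_add _ _ _⟩
  · intro _ _ c s _ _
    obtain ⟨c, rfl⟩ := hf c
    obtain ⟨s, rfl⟩ := hg s
    exact ⟨tmul c s, alg_tmap f g c s⟩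

/-- The kernel of a tensor product of surjections is generated by the two kernels; linear sections
give the inverse modulo their span. -/
theorem mem_span_of_tmap_eq_zero {C C' S S' : CDGA k} {f : C ⟶ C'} {g : S ⟶ S'}
    (hf : Function.Surjective (alg f)) (hg : Function.Surjective (alg g)) {z : Tens C S}
    (hz : alg (tmap f g) z = 0) :
    z ∈ Submodule.span k {z : Tens C S | ∃ c s, (alg f c = 0 ∨ alg g s = 0) ∧ z = tmul c s} := by
  set K := Submodule.span k {z : Tens C S | ∃ c s, (alg f c = 0 ∨ alg g s = 0) ∧ z = tmul c s}
  obtain ⟨a, ha⟩ := LinearMap.exists_rightInverse_of_surjective (alg f).toLinearMap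
    (LinearMap.range_eq_top.2 hf)
  obtain ⟨b, hb⟩ := LinearMap.exists_rightInverse_of_surjective (alg g).toLinearMap
    (LinearMap.range_eq_top.2 hg)
  replace ha : ∀ c, alg f (a c) = c := fun c => LinearMap.congr_fun ha c
  replace hb : ∀ c, alg g (b c) = c := fun c => LinearMap.congr_fun hb c
  let ψ : Tens C' S' →ₗ[k] Tens C S ⧸ K :=
    tensLift C' S' (((tmulₗ C S).compl₁₂ a b).compr₂ K.mkQ)
  have key : ψ ∘ₗ (alg (tmap f g)).toLinearMap = K.mkQ := by
    refine tens_ext fun c s => ?_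
    rw [LinearMap.comp_apply, AlgHom.toLinearMap_apply, alg_tmap]
    change K.mkQ (tmulₗ C S (a (alg f c)) (b (alg g s))) = K.mkQ (tmulₗ C S c s)
    rw [← sub_eq_zero, ← map_sub]
    refine (Submodule.Quotient.mk_eq_zero K).2 ?_
    have e : tmulₗ C S (a (alg f c)) (b (alg g s)) - tmulₗ C S c s =
        tmulₗ C S (a (alg f c) - c) (b (alg g s)) + tmulₗ C S c (b (alg g s) - s) := by
      rw [map_sub, map_sub, LinearMap.sub_apply, sub_add_sub_cancel]
    rw [e]
    exact add_mem
      (Submodule.subset_span ⟨_, _, Or.inl (by rw [map_sub, ha, sub_self]), rfl⟩)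
      (Submodule.subset_span ⟨_, _, Or.inr (by rw [map_sub, hb, sub_self]), rfl⟩)
  have := LinearMap.congr_fun key z
  rw [LinearMap.comp_apply, AlgHom.toLinearMap_apply, hz, map_zero] at this
  exact (Submodule.Quotient.mk_eq_zero K).1 this.symm

theorem tens_mul_smul {A B : CDGA k} (r : k) (x y : Tens A B) : x * (r • y) = r • (x * y) :=
  mul_smul_comm r x y

/-- The homogeneous component of degree `i`. -/
def component (X : CDGA k) (i : ℤ) (x : X) : X := (decompose X.deg x i : X)

theorem component_mem {X : CDGA k} (i : ℤ) (x : X) : component X i x ∈ X.deg i := SetLike.coe_mem _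

theorem component_of_mem {X : CDGA k} {i : ℤ} {x : X} (hx : x ∈ X.deg i) : component X i x = x :=
  decompose_of_mem_same _ hx

theorem alg_component {X Y : CDGA k} (f : X ⟶ Y) (i : ℤ) (x : X) :
    alg f (component X i x) = component Y i (alg f x) := decompose_map f x i

theorem tens_ofComm_eq_zero {A B : Type u} [CommRing A] [Algebra k A] [CommRing B] [Algebra k B]
    {i : ℤ} (hi : i ≠ 0) {z : Tens (ofComm A : CDGA k) (ofComm B)}
    (hz : z ∈ tensDeg (ofComm A : CDGA k) (ofComm B) i) : z = 0 := by
  refine tensDeg_induction (p := fun z => z = 0) ?_ ?_ ?_ z hz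
  · trivial
  · intro x y hx hy
    rw [hx, hy, add_zero]
  · intro p q a b ha hb h
    rcases (mem_degZero (k := k) (M := A) p a).1 ha with hp | h0
    · rcases (mem_degZero (k := k) (M := B) q b).1 hb with hq | h0
      · omega
      · exact (congrArg (tmulₗ (ofComm A : CDGA k) (ofComm B) a) h0).trans (map_zero _)
    · exact (congrArg (fun a => tmulₗ (ofComm A : CDGA k) (ofComm B) a b) h0).trans
        (LinearMap.map_zero₂ _ b)

end CDGA

namespace Coords.Presentation

variable {R : Type u} [CommRing R] [HopfAlgebra k R] (p : Coords.Presentation k R)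

/-- The polynomial ring of a presentation. -/
abbrev Poly : Type u := MvPolynomial (Fin p.c.n ⊕ Fin p.m) k

/-- The surjection of a presentation. -/
def ev : (ofComm p.Poly : CDGA k) ⟶ ofComm R :=
  ofCommMap (MvPolynomial.aeval (Sum.elim p.c.x p.y))

theorem ev_apply (f : p.Poly) :
    alg p.ev f = (MvPolynomial.aeval (Sum.elim p.c.x p.y) f : R) := rfl

/-- The equations of a presentation. -/
def eqn (j : Fin p.m) : p.Poly := MvPolynomial.X (Sum.inr j) - p.q j

theorem ev_eqn (j : Fin p.m) : alg p.ev (p.eqn j) = 0 := by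
  rw [ev_apply, eqn, map_sub, MvPolynomial.aeval_X, p.aeval_q]
  exact sub_self _

theorem convUnit_ev_X (B : CDGA k) (s : Fin p.c.n ⊕ Fin p.m) :
    alg (convUnit R B) (alg p.ev (MvPolynomial.X s : p.Poly)) = 0 := by
  have h : Coalgebra.counit (R := k) (Sum.elim p.c.x p.y s) = 0 := by
    rcases s with i | j
    · exact p.c.counit_x i
    · exact p.counit_y j
  rw [ev_apply, MvPolynomial.aeval_X]
  refine Eq.trans (b := algebraMap k B (Coalgebra.counit (R := k) (Sum.elim p.c.x p.y s))) rfl ?_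
  rw [h, map_zero]

/-- An element which vanishes in the quotient lies, locally at the identity, in the ideal
of the equations. -/
theorem exists_mul_mem {C C' : CDGA k} (φ : NilFil C) (ρ : C ⟶ C')
    (hρ : Function.Surjective (alg ρ)) (hφ : ∀ c, alg ρ c = 0 → c ∈ φ.F 1)
    (J : Submodule k (Tens C (ofComm p.Poly)))
    (h1 : (φ.push (inl C (ofComm p.Poly))).F 1 ≤ J) (hmul : ∀ w, ∀ z ∈ J, w * z ∈ J)
    (heq : ∀ j, (tmul 1 (p.eqn j) : Tens C (ofComm p.Poly)) ∈ J)
    {κ : Tens C (ofComm p.Poly)} (hκ : alg (tmap ρ p.ev) κ = 0) :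
    ∃ h : p.Poly, MvPolynomial.constantCoeff h = 1 ∧
      (tmul 1 h : Tens C (ofComm p.Poly)) * κ ∈ J := by
  have hinr (f g : p.Poly) : (tmul 1 (f * g) : Tens C (ofComm p.Poly)) = tmul 1 f * tmul 1 g :=
    map_mul (alg (inr C (ofComm p.Poly))) f g
  have hone : (tmul 1 (1 : p.Poly) : Tens C (ofComm p.Poly)) = 1 :=
    map_one (alg (inr C (ofComm p.Poly)))
  have hideal : ∀ g ∈ Ideal.span (Set.range p.eqn), (tmul 1 g : Tens C (ofComm p.Poly)) ∈ J := by
    intro g hg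
    refine Submodule.span_induction
      (p := fun g _ => (tmul 1 g : Tens C (ofComm p.Poly)) ∈ J) ?_ ?_ ?_ ?_ hg
    · rintro _ ⟨j, rfl⟩
      exact heq j
    · exact (congrArg (· ∈ J) (map_zero (tmulₗ C (ofComm p.Poly) 1))).mpr (zero_mem J)
    · intro a b _ _ ha hb
      exact (congrArg (· ∈ J) (map_add (tmulₗ C (ofComm p.Poly) 1) a b)).mpr (add_mem ha hb)
    · intro a b _ hb
      rw [smul_eq_mul, hinr]
      exact hmul _ _ hb
  refine Submodule.closure_induction (p := fun κ _ => ∃ h : p.Poly,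
    MvPolynomial.constantCoeff h = 1 ∧ (tmul 1 h : Tens C (ofComm p.Poly)) * κ ∈ J) ?_ ?_ ?_
    (mem_span_of_tmap_eq_zero hρ p.surjective hκ)
  · exact ⟨1, map_one _, by rw [mul_zero]; exact zero_mem _⟩
  -- The product of the two multipliers works for both summands and still has constant term 1.
  · rintro a b _ _ ⟨h, e, hh⟩ ⟨g, e', hg⟩
    refine ⟨h * g, by rw [map_mul, e, e', one_mul], ?_⟩
    rw [mul_add]
    refine add_mem ?_ ?_
    · rw [mul_comm h g, hinr, mul_assoc]; exact hmul _ _ hh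
    · rw [hinr, mul_assoc]; exact hmul _ _ hg
  · rintro r _ ⟨c, f, hc | hf, rfl⟩
    · refine ⟨1, map_one _, ?_⟩
      rw [hone, one_mul]
      refine Submodule.smul_mem _ _ (h1 ?_)
      have e : (tmul c f : Tens C (ofComm p.Poly)) =
          alg (inl C (ofComm p.Poly)) c * tmul 1 f := by rw [inl_mul_tmul, mul_one]
      rw [e]
      exact (φ.push _).mul_right _ (φ.mem_push _ (hφ c hc))
    · obtain ⟨h, e, hh⟩ := p.locally f hf
      refine ⟨h, e, ?_⟩
      rw [tens_mul_smul]
      refine Submodule.smul_mem _ _ ?_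
      have e' : (tmul 1 h : Tens C (ofComm p.Poly)) * tmul c f =
          tmul c 1 * tmul 1 (h * f) := by
        rw [tmul_mul_tmul C (ofComm p.Poly) (i := 0) (j := 0) c 1 1 _
          (SetLike.one_mem_graded _) (SetLike.one_mem_graded _)]
        have : (tmul 1 h * tmul c f : Tens C (ofComm p.Poly)) =
            tmul c (h * f) := by
          refine C.hom_induction (p := fun c => (tmul 1 h * tmul c f : Tens C (ofComm p.Poly)) =
            tmul c (h * f)) ?_ ?_ ?_ c
          · simp [← tmulₗ_apply]
          · intro a b ha hb
            rw [← tmulₗ_apply C (ofComm p.Poly) (a + b), ← tmulₗ_apply C (ofComm p.Poly) (a + b), map_add, LinearMap.add_apply,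
              LinearMap.add_apply, mul_add]
            exact congrArg₂ (· + ·) ha hb
          · intro i c hc
            rw [tmul_mul_tmul C (ofComm p.Poly) (i := 0) 1 c h f
              ((mem_degZero (k := k) 0 h).2 (Or.inl rfl)) hc, zero_mul, zpow_zero, one_smul,
              one_mul]
        rw [this, zero_mul, zpow_zero, one_smul, mul_one]
        exact congrArg _ (one_mul (h * f)).symm
      rw [e']
      exact hmul _ _ (hideal _ hh)

end Coords.Presentation

namespace CDGA

variable {R B : Type u} [CommRing R] [HopfAlgebra k R] [CommRing B] [Algebra k B]

/-- Sections of a faithfully flat thickening of a smooth group scheme exist over a thickening. -/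
theorem exists_section (p : Coords.Presentation k R) {C X : CDGA k} (φ : NilFil C) {ρ : C ⟶ ofComm B}
    (hρ : Function.Surjective (alg ρ)) (hφ : ∀ c, alg ρ c = 0 ↔ c ∈ φ.F 1)
    (hC : ∀ i : ℤ, 0 < i → ∀ c ∈ C.deg i, c = 0) {x : C ⟶ X} (hx : FaithfullyFlat x)
    {τ : X ⟶ tensor (ofComm B) (ofComm R)} (hc : x ≫ τ = ρ ≫ inl (ofComm B) (ofComm R))
    (hτ : IsTensorSquare ρ x (inl (ofComm B) (ofComm R)) τ) :
    ∃ σ : X ⟶ C, x ≫ σ = 𝟙 C ∧ σ ≫ ρ = τ ≫ tlift (𝟙 _) (convUnit R (ofComm B)) := by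
  have hker {y : X} (hy : alg τ y = 0) : y ∈ (φ.push x).F 1 :=
    hτ.mem_of_apply_eq_zero hρ _ (fun c hc z =>
      (φ.push x).mul_right _ (φ.mem_push x ((hφ c).1 hc))) hy
  have hτs := hτ.surjective_right hρ hc.symm
  -- In positive degrees the target of τ is zero, so such elements lie in the first step, and
  -- Nakayama's lemma kills them. As a consequence all elements of degree zero are closed, which
  -- lets polynomials be evaluated at them by dg morphisms.
  have hX : ∀ i : ℤ, 0 < i → ∀ y ∈ X.deg i, y = 0 := fun i hi y hy =>
    eq_zero_of_pos φ hC (fun i hi y hy =>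
      hker (tens_ofComm_eq_zero hi.ne' (Hom.map_deg τ i y hy))) hi hy
  have hdX : ∀ y ∈ X.deg 0, X.d y = 0 := fun y hy => hX _ one_pos _ (X.d_mem 0 y hy)
  have hdC : ∀ y ∈ C.deg 0, C.d y = 0 := fun y hy => hC _ one_pos _ (C.d_mem 0 y hy)
  -- Lift the generators of R to X; passing to components of degree zero does not change their
  -- images.
  have hξ (s) : ∃ ξ : X.zeroPart, alg τ ξ.1 =
      (tmul 1 (Sum.elim p.c.x p.y s) : Tens (ofComm B : CDGA k) (ofComm R)) := by
    obtain ⟨y, hy⟩ := hτs (tmul 1 (Sum.elim p.c.x p.y s))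
    refine ⟨⟨component X 0 y, component_mem 0 y⟩, ?_⟩
    rw [alg_component, hy]
    exact component_of_mem (X := tensor (ofComm B) (ofComm R)) (tmul_mem (i := 0) (j := 0) (SetLike.one_mem_graded _)
      ((mem_degZero (k := k) 0 _).2 (Or.inl rfl)) (add_zero 0))
  choose ξ hξ using hξ
  let S : CDGA k := ofComm p.Poly
  let u : C ⟶ tensor C S := inl C S
  let π : tensor C S ⟶ X := tlift x (polyHom hdX ξ)
  have hu : u ≫ π = x := inl_tlift _ _
  have hπτ : π ≫ τ = tmap ρ p.ev := by
    refine tensor_hom_ext ?_ ?_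
    · rw [← Category.assoc, inl_tlift, inl_tmap, hc]
    · rw [← Category.assoc, inr_tlift, inr_tmap]
      refine polyHom_ext fun s => ?_
      rw [alg_comp, polyHom_apply, MvPolynomial.aeval_X, hξ, alg_comp, p.ev_apply,
        MvPolynomial.aeval_X]
      rfl
  have hπτ' (w) : alg τ (alg π w) = alg (tmap ρ p.ev) w := alg_congr hπτ w
  have hπ : Function.Surjective (alg π) := by
    refine surjective_of_push φ hu fun y => ?_
    obtain ⟨w, hw⟩ := tmap_surjective (g := p.ev) hρ p.surjective (alg τ y)
    refine ⟨w, hker ?_⟩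
    rw [map_sub, hπτ', sub_eq_zero]
    exact hw.symm
  -- The equation 1 ⊗ eqn_j maps into the first step of X, so subtracting an element of the first
  -- step of C ⊗ S turns it into a true relation of X. The homogeneous component keeps the degree
  -- zero.
  have hf (j) : ∃ f ∈ tensDeg C S 0, alg π f = 0 ∧
      f - (tmul 1 (p.eqn j) : Tens C S) ∈ (φ.push u).F 1 := by
    have hj : (tmul 1 (p.eqn j) : Tens C S) ∈ tensDeg C S 0 :=
      tmul_mem (i := 0) (j := 0) (SetLike.one_mem_graded _)
        ((mem_degZero (k := k) 0 _).2 (Or.inl rfl)) (add_zero 0)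
    have h1 : alg π (tmul 1 (p.eqn j) : Tens C S) ∈ (φ.push x).F 1 := by
      refine hker ?_
      rw [hπτ', alg_tmap, p.ev_eqn]
      exact map_zero (tmulₗ (ofComm B : CDGA k) (ofComm R) _)
    obtain ⟨w, hw, e⟩ := exists_mem_push φ hu hπ h1
    refine ⟨tmul 1 (p.eqn j) - component (tensor C S) 0 w,
      sub_mem hj (component_mem (X := tensor C S) 0 w), ?_, ?_⟩
    · rw [map_sub]
      have := alg_component π 0 w
      rw [e, component_of_mem (Hom.map_deg π 0 _ hj)] at this
      rw [← this]
      exact sub_self _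
    · rw [sub_sub_cancel_left]
      exact neg_mem ((φ.push u).decompose_mem hw 0)
  choose f hf0 hfπ hf1 using hf
  obtain ⟨b, hb, hbf⟩ := exists_root hdC φ p.q p.q_mem f hf0 hf1
  let e : tensor C S ⟶ C := evalAt hdC b
  let J : Submodule k (Tens C S) :=
    Submodule.span k {z | ∃ w j, z = w * f j} ⊔ (φ.push u).F 1
  have hJmul : ∀ w, ∀ z ∈ J, w * z ∈ J := by
    intro w z hz
    obtain ⟨a, ha, r, hr, rfl⟩ := Submodule.mem_sup.1 hz
    rw [mul_add]
    refine add_mem (Submodule.mem_sup_left ?_)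
      (Submodule.mem_sup_right ((φ.push u).mul_left _ hr))
    refine Submodule.span_induction (p := fun a _ => w * a ∈ Submodule.span k _)
      ?_ ?_ ?_ ?_ ha
    · rintro _ ⟨v, j, rfl⟩
      rw [← mul_assoc]
      exact Submodule.subset_span ⟨_, j, rfl⟩
    · rw [mul_zero]; exact zero_mem _
    · intro y z _ _ hy hz; rw [mul_add]; exact add_mem hy hz
    · intro r y _ hy; rw [tens_mul_smul]; exact Submodule.smul_mem _ _ hy
  have hJeq (j) : (tmul 1 (p.eqn j) : Tens C S) ∈ J := by
    have h1 : f j ∈ J := Submodule.mem_sup_left (Submodule.subset_span ⟨1, j, (one_mul _).symm⟩)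
    have := sub_mem h1 (Submodule.mem_sup_right (hf1 j))
    rwa [sub_sub_cancel] at this
  -- Newton's method solves only the chosen relations f_j; it has to be shown that the resulting
  -- evaluation e kills all of ker π. For κ in ker π, a multiple hκ with h(0) = 1 is a combination
  -- of the f_j plus a term r of the first step, and r lies in ker π as well. So e(hκ) = e(r), and
  -- this is pushed down the filtration inductively.
  have key : ∀ i : ℕ, ∀ κ, alg π κ = 0 → alg e κ ∈ φ.F i := by
    intro i
    induction i with
    | zero => exact fun κ _ => φ.mem_zero _
    | succ i ih =>
      intro κ hκ
      obtain ⟨h, h0, hh⟩ := p.exists_mul_mem φ ρ hρ (fun c => (hφ c).1) J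
        le_sup_right hJmul hJeq (κ := κ) (by rw [← hπτ', hκ, map_zero])
      obtain ⟨a, ha, r, hr, har⟩ := Submodule.mem_sup.1 hh
      have ha0 : alg π a = 0 ∧ alg e a = 0 := by
        refine Submodule.span_induction (p := fun a _ => alg π a = 0 ∧ alg e a = 0)
          ?_ ?_ ?_ ?_ ha
        · rintro _ ⟨v, j, rfl⟩
          exact ⟨by rw [map_mul, hfπ, mul_zero], by rw [map_mul]; exact (congrArg _ (hbf j)).trans (mul_zero _)⟩
        · exact ⟨map_zero _, map_zero _⟩
        · rintro y z _ _ ⟨h1, h2⟩ ⟨h3, h4⟩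
          exact ⟨by rw [map_add, h1, h3, add_zero], by rw [map_add, h2, h4, add_zero]⟩
        · rintro c y _ ⟨h1, h2⟩
          exact ⟨by rw [map_smul, h1, smul_zero], by rw [map_smul, h2, smul_zero]⟩
      have hr0 : alg π r = 0 := by
        have := congrArg (alg π) har
        rwa [map_add, ha0.1, zero_add, map_mul, hκ, mul_zero] at this
      -- Flatness puts r into the product of the first step and ker π, and the induction hypothesis
      -- applies to the second factor.
      have hr1 : alg e r ∈ φ.F (i + 1) := by
        refine Submodule.span_induction (p := fun r _ => alg e r ∈ φ.F (i + 1))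
          ?_ ?_ ?_ ?_ (mem_of_flat hx φ hu hπ hr hr0)
        · rintro _ ⟨c, hc, w, hw, rfl⟩
          have := φ.mul hc (ih w hw)
          rw [add_comm] at this
          exact (congrArg (· ∈ φ.F (i + 1)) (evalAt_inl_mul hdC b c w)).mpr this
        · rw [map_zero]; exact zero_mem _
        · intro y z _ _ hy hz; rw [map_add]; exact add_mem hy hz
        · intro c y _ hy; rw [map_smul]; exact Submodule.smul_mem _ _ hy
      have hb1 : (MvPolynomial.aeval b h - 1 : C.zeroPart).1 ∈ φ.F 1 := by
        have := aeval_sub_aeval_mem (φ.ideal 1) (a := b) (b := 0)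
          (fun s => by rw [Pi.zero_apply, sub_zero]; exact hb s) h
        rwa [MvPolynomial.aeval_zero, h0, map_one] at this
      -- Since b lies in the first step and h has constant term 1, the value h(b) is 1 modulo the
      -- first step and can be removed from h(b) e(κ).
      have h2 : (MvPolynomial.aeval b h : C.zeroPart).1 * alg e κ ∈ φ.F (i + 1) := by
        have := congrArg (alg e) har
        rw [map_add, ha0.2, zero_add, map_mul] at this
        have e1 : alg e (tmul 1 h : Tens C S) = (MvPolynomial.aeval b h : C.zeroPart).1 :=
          (evalAt_tmul hdC b 1 h).trans (one_mul _)
        rw [← e1, ← this]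
        exact hr1
      have h3 := φ.mul hb1 (ih κ hκ)
      rw [add_comm] at h3
      have h4 := sub_mem h2 h3
      have e2 : (MvPolynomial.aeval b h : C.zeroPart).1 * alg e κ -
          (MvPolynomial.aeval b h - 1 : C.zeroPart).1 * alg e κ = alg e κ := by
        have : (MvPolynomial.aeval b h - 1 : C.zeroPart).1 =
          (MvPolynomial.aeval b h : C.zeroPart).1 - 1 := rfl
        rw [this, sub_mul, one_mul, sub_sub_cancel]
      rwa [e2] at h4
  obtain ⟨σ, hσ⟩ := exists_factor π e hπ fun κ hκ => by
    obtain ⟨N, hN⟩ := φ.nil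
    have := key N κ hκ
    rwa [hN, Submodule.mem_bot] at this
  refine ⟨σ, ?_, ?_⟩
  · rw [← hu, Category.assoc, hσ]
    exact inl_tlift _ _
  -- The root b reduces to the origin, which is the neutral element in the coordinates x, y.
  · have h : π ≫ σ ≫ ρ = π ≫ τ ≫ tlift (𝟙 _) (convUnit R (ofComm B)) := by
      rw [← Category.assoc, hσ, ← Category.assoc, hπτ]
      refine tensor_hom_ext ?_ ?_
      · refine Eq.trans (b := ρ) ?_ (Eq.symm ?_)
        · exact (congrArg (· ≫ ρ) (inl_tlift (𝟙 C) (polyHom hdC b))).trans (Category.id_comp ρ)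
        · rw [← Category.assoc, inl_tmap, Category.assoc, inl_tlift, Category.comp_id]
      · refine Eq.trans (b := polyHom hdC b ≫ ρ) ?_ (Eq.trans (b := p.ev ≫ convUnit R _) ?_
          (Eq.symm ?_))
        · exact congrArg (· ≫ ρ) (inr_tlift (𝟙 C) (polyHom hdC b))
        rotate_left
        · rw [← Category.assoc, inr_tmap, Category.assoc, inr_tlift]
        refine polyHom_ext fun s => ?_
        rw [alg_comp, alg_comp, p.convUnit_ev_X, polyHom_apply, MvPolynomial.aeval_X]
        exact (hφ _).2 (hb s)
    refine hom_ext fun y => ?_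
    obtain ⟨w, rfl⟩ := hπ y
    exact alg_congr h w

end CDGA

namespace DGArt

variable (A : DGArt k) (B : CDGA k)

theorem augBase_surjective : Function.Surjective (alg (A.augBase B)) := fun b =>
  ⟨tmul 1 b, by
    refine (alg_tlift _ _ 1 b).trans ?_
    rw [map_one, one_mul, alg_id]⟩

theorem augBase_tmul (a : A.toCDGA) (b : B) :
    alg (A.augBase B) (tmul a b : Tens A.toCDGA B) = algebraMap k B (alg A.aug a) * b := rfl

theorem augBase_eq_zero_iff {z : Tens A.toCDGA B} :
    alg (A.augBase B) z = 0 ↔ z ∈ (A.fil.push (inl A.toCDGA B)).F 1 := by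
  constructor
  · intro hz
    have key : ∀ z : Tens A.toCDGA B, z - tmul 1 (alg (A.augBase B) z) ∈
        (A.fil.push (inl A.toCDGA B)).F 1 := by
      intro z
      refine tens_induction (p := fun z : Tens A.toCDGA B => z - tmul 1 (alg (A.augBase B) z) ∈
        (A.fil.push (inl A.toCDGA B)).F 1) ?_ ?_ ?_ z
      · rw [map_zero, zero_sub]
        exact neg_mem ((congrArg (· ∈ (A.fil.push (inl A.toCDGA B)).F 1)
          (map_zero (tmulₗ A.toCDGA B 1))).mpr (zero_mem _))
      · intro x y hx hy
        have : (tmul 1 (alg (A.augBase B) x + alg (A.augBase B) y) : Tens A.toCDGA B) =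
          tmul 1 (alg (A.augBase B) x) + tmul 1 (alg (A.augBase B) y) :=
          map_add (tmulₗ A.toCDGA B 1) _ _
        rw [map_add, this, add_sub_add_comm]
        exact add_mem hx hy
      · intro _ _ a b _ _
        have e : (tmul a b : Tens A.toCDGA B) - tmul 1 (alg (A.augBase B) (tmul a b)) =
            alg (inl A.toCDGA B) (a - algebraMap k _ (alg A.aug a)) * tmul 1 b := by
          rw [inl_mul_tmul, mul_one, augBase_tmul, ← Algebra.smul_def, Algebra.algebraMap_eq_smul_one]
          simp only [← tmulₗ_apply, map_sub, map_smul, LinearMap.sub_apply, LinearMap.smul_apply]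
        rw [e]
        exact NilFil.mul_right _ _ (NilFil.mem_push _ _ (mem_fil_one.2 (by
          rw [map_sub, AlgHom.commutes]; exact sub_self _)))
    have := key z
    rw [hz] at this
    have e : (tmul 1 (0 : B) : Tens A.toCDGA B) = 0 := map_zero (tmulₗ A.toCDGA B 1)
    rwa [e, sub_zero] at this
  · intro hz
    refine A.fil.push_induction _ (LinearMap.ker (alg (A.augBase B)).toLinearMap) ?_ hz
    intro a ha y
    rw [LinearMap.mem_ker, AlgHom.toLinearMap_apply, map_mul]
    have : alg (A.augBase B) (alg (inl A.toCDGA B) a) = 0 := by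
      refine (alg_congr (inl_tlift _ _) a).trans ?_
      refine Eq.trans (b := algebraMap k B (alg A.aug a)) rfl ?_
      rw [mem_fil_one.1 ha]
      exact map_zero (algebraMap k B)
    rw [this, zero_mul]

end DGArt

namespace Sec

variable {R B : Type u} [CommRing R] [HopfAlgebra k R] [CommRing B] [Algebra k B]

theorem tens_eq_zero_of_pos (A : DGArt k) {i : ℤ} (hi : 0 < i)
    {z : Tens A.toCDGA (ofComm (k := k) B)} (hz : z ∈ tensDeg A.toCDGA (ofComm (k := k) B) i) :
    z = 0 := by
  refine tensDeg_induction (p := fun z => z = 0) ?_ ?_ ?_ z hz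
  · trivial
  · intro x y hx hy
    rw [hx, hy, add_zero]
  · intro p q a b ha hb h
    rcases (mem_degZero (k := k) (M := B) q b).1 hb with hq | h0
    · have ha0 : a = 0 := by
        rw [A.nonpos p (by omega)] at ha
        exact ha
      rw [ha0]
      exact LinearMap.map_zero₂ (tmulₗ A.toCDGA (ofComm (k := k) B)) b
    · exact (congrArg (tmulₗ A.toCDGA (ofComm (k := k) B) a) h0).trans (map_zero _)

/-- Every cartesian section of deformations of the trivial torsor is trivial. -/
theorem nonempty_hom_trivialSec [CharZero k] [Algebra.FiniteType k R] (W : CDGA k) {A : DGArt k}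
    (S : Sec (trivialTorsor R (ofComm (k := k) B)) A) :
    Nonempty ((⟨S⟩ : Cart W (trivialTorsor R (ofComm (k := k) B)) A) ⟶
      ⟨trivialSec R (ofComm B) A⟩) := by
  obtain ⟨p⟩ := Coords.exists_presentation (k := k) (R := R)
  obtain ⟨σ, h1, h2⟩ := exists_section p (A.fil.push (inl A.toCDGA (ofComm B)))
    (A.augBase_surjective (ofComm B)) (fun c => A.augBase_eq_zero_iff (ofComm B))
    (fun i hi c hc => tens_eq_zero_of_pos A hi hc)
    (S.obj (Under.mk (𝟙 A))).isTorsor.2 (base_tau (S.obj (Under.mk (𝟙 A))))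
    (S.obj (Under.mk (𝟙 A))).τ_iso
  exact exists_hom_trivialSec S σ h1 h2

end Sec

end DG

/-! ### Closed points as automorphisms of the trivial cartesian section. -/

namespace DG

open CDGA

variable {k : Type u} [Field k] {R : Type u} [CommRing R] [HopfAlgebra k R] {B : CDGA k}
  {A A' A'' : DGArt k} {W W' W'' : CDGA k}

section points

theorem closed_mul {C : CDGA k} {φ : NilFil C} {g h : Pt R φ} (hg : g.conv.d = 0)
    (hh : h.conv.d = 0) : (g * h).conv.d = 0 := by
  rw [Pt.conv_mul, Conv.d_mul_of_zero (Pt.conv_mem _), hg, hh, zero_mul, mul_zero, add_zero]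

variable (R B A W) in
/-- The points of the group with values in `W ⊗ A ⊗ B` which reduce to the neutral element. -/
abbrev Gpt : Type u := Pt R (A.filExt W B)

/-- Functoriality of points. -/
def gmap (a : A ⟶ A') (w : W ⟶ W') : Gpt R B A W →* Gpt R B A' W' :=
  Pt.map (tmap w (tmap (DGArt.hom a) (𝟙 B))) (DGArt.filExt_map a w)

theorem form_gmap (a : A ⟶ A') (w : W ⟶ W') (g : Gpt R B A W) :
    (gmap a w g).form = Conv.map (alg (tmap w (tmap (DGArt.hom a) (𝟙 B)))) g.form :=
  Pt.form_map _ _ _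

theorem form_gmap_congr {g h : Gpt R B A W} (H : g.form = h.form) (a : A ⟶ A') (w : W ⟶ W') :
    (gmap a w g).form = (gmap a w h).form := by rw [form_gmap, form_gmap, H]

/-- A closed point as a morphism of dg algebras. -/
def ofClosed (g : Gpt R B A W) (hg : g.conv.d = 0) : ofComm R ⟶ tensor W (tensor A.toCDGA B) :=
  ofCommHom g.toAlgHom g.mem_deg (fun r => congrArg (fun f : Conv R _ => f r) hg)

theorem ofClosed_near (g : Gpt R B A W) (hg : g.conv.d = 0) :
    ofClosed g hg ≫ tmap (𝟙 W) (A.augBase B) = convUnit R _ := by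
  ext r
  have h := DGArt.mem_filExt_one.1 (g.near r)
  rw [map_sub, AlgHom.commutes, sub_eq_zero] at h
  exact h

theorem ofClosed_mul (g h : Gpt R B A W) (hg : g.conv.d = 0) (hh : h.conv.d = 0)
    (H : (g * h).conv.d = 0) : ofClosed (g * h) H = convHom (ofClosed g hg) (ofClosed h hh) :=
  toConvHom_injective (by rw [toConvHom_convHom]; exact Pt.conv_mul g h)

theorem ofClosed_one (H : (1 : Gpt R B A W).conv.d = 0) : ofClosed 1 H = convUnit R _ :=
  toConvHom_injective rfl

theorem closed_gmap {g : Gpt R B A W} (hg : g.conv.d = 0) (a : A ⟶ A') (w : W ⟶ W') :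
    (gmap a w g).conv.d = 0 := by
  rw [gmap, Pt.conv_map, ← Conv.map_d, hg, map_zero]

theorem ofClosed_gmap (g : Gpt R B A W) (hg : g.conv.d = 0) (a : A ⟶ A') (w : W ⟶ W') :
    ofClosed (gmap a w g) (closed_gmap hg a w) =
      ofClosed g hg ≫ tmap w (tmap (DGArt.hom a) (𝟙 B)) := rfl

/-- A morphism of dg algebras as a point. -/
def ofHom (γ : ofComm R ⟶ tensor W (tensor A.toCDGA B))
    (hγ : γ ≫ tmap (𝟙 W) (A.augBase B) = convUnit R _) : Gpt R B A W where
  toAlgHom := alg γ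
  mem_deg r := Hom.map_deg γ 0 r ((mem_degZero (k := k) (M := R) 0 r).2 (Or.inl rfl))
  near r := DGArt.mem_filExt_one.2 (by
    rw [map_sub, AlgHom.commutes, sub_eq_zero]
    exact congrArg (fun f => alg f r) hγ)

theorem closed_ofHom (γ : ofComm R ⟶ tensor W (tensor A.toCDGA B))
    (hγ : γ ≫ tmap (𝟙 W) (A.augBase B) = convUnit R _) : (ofHom γ hγ).conv.d = 0 := by
  ext r
  exact (Hom.map_d γ r).symm.trans (map_zero (alg γ))

end points

section automorphisms

/-- The automorphism of the trivial cartesian section given by a closed point. -/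
def autPt (g : Gpt R B A W) (hg : g.conv.d = 0) :
    (⟨trivialSec R B A⟩ : Sec.Cart W (trivialTorsor R B) A) ⟶ ⟨trivialSec R B A⟩ :=
  Sec.Hom.mk (fun U =>
    { hom := autHom (ofClosed g hg ≫ tmap (𝟙 W) (tmap (DGArt.hom U.hom) (𝟙 B)))
      base := inclBase_autHom _
      equivariant := autHom_equivariant _
      triv := by
        have h := autHom_tmap (ofClosed g hg ≫ tmap (𝟙 W) (tmap (DGArt.hom U.hom) (𝟙 B))) (𝟙 W)
          (U.right.augBase B)
        have e : (ofClosed g hg ≫ tmap (𝟙 W) (tmap (DGArt.hom U.hom) (𝟙 B))) ≫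
            tmap (𝟙 W) (U.right.augBase B) = convUnit R _ := by
          rw [Category.assoc, ← tmap_comp, Category.id_comp, tmap_augBase]
          exact ofClosed_near g hg
        rw [e, autHom_unit, Category.comp_id] at h
        exact h
      isIso := by
        have h : IsIso (autHom (ofClosed g hg ≫ tmap (𝟙 W) (tmap (DGArt.hom U.hom) (𝟙 B)))) :=
          inferInstance
        exact h })
    (fun {U V} f => by
      have h := autHom_tmap (ofClosed g hg ≫ tmap (𝟙 W) (tmap (DGArt.hom U.hom) (𝟙 B))) (𝟙 W)
          (tmap (DGArt.hom f.right) (𝟙 B))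
      have e : (ofClosed g hg ≫ tmap (𝟙 W) (tmap (DGArt.hom U.hom) (𝟙 B))) ≫
          tmap (𝟙 W) (tmap (DGArt.hom f.right) (𝟙 B)) =
          ofClosed g hg ≫ tmap (𝟙 W) (tmap (DGArt.hom V.hom) (𝟙 B)) := by
        rw [Category.assoc, ← tmap_comp, ← tmap_comp, Category.id_comp, Category.id_comp,
          ← DGArt.hom_comp, Under.w f]
      rw [e] at h
      exact h)

theorem autPt_hom (g : Gpt R B A W) (hg : g.conv.d = 0) (U : Under A) :
    (Sec.Hom.iso (autPt g hg) U).hom =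
      autHom (ofClosed g hg ≫ tmap (𝟙 W) (tmap (DGArt.hom U.hom) (𝟙 B))) := rfl

theorem autPt_congr {g g' : Gpt R B A W} (h : g = g') (hg : g.conv.d = 0) :
    autPt g hg = autPt g' (h ▸ hg) := by subst h; rfl

theorem autPt_comp {g h m : Gpt R B A W} (e : g * h = m) (hg : g.conv.d = 0) (hh : h.conv.d = 0)
    (hm : m.conv.d = 0) : autPt g hg ≫ autPt h hh = autPt m hm := by
  subst e
  refine Sec.cart_hom_ext fun U => ?_
  rw [autPt_hom, ofClosed_mul g h hg hh, convHom_comp]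
  exact autHom_comp _ _

theorem autPt_one (H : (1 : Gpt R B A W).conv.d = 0) : autPt 1 H = 𝟙 _ := by
  refine Sec.cart_hom_ext fun U => ?_
  rw [autPt_hom, ofClosed_one, convUnit_comp, autHom_unit]
  rfl

theorem extend_autPt (w : W ⟶ W') (g : Gpt R B A W) (hg : g.conv.d = 0) :
    (Sec.extend w (trivialTorsor R B) A).map (autPt g hg) =
      autPt (gmap (𝟙 A) w g) (closed_gmap hg _ _) := by
  refine Sec.cart_hom_ext fun U => ?_
  rw [autPt_hom, ofClosed_gmap]
  refine (extHom_autHom (ofClosed g hg ≫ tmap (𝟙 W) (tmap (DGArt.hom U.hom) (𝟙 B))) w).trans ?_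
  rw [Category.assoc, Category.assoc, ← tmap_comp, ← tmap_comp, DGArt.hom_id, tmap_id,
    Category.id_comp, Category.id_comp, Category.comp_id, Category.comp_id]

theorem pull_autPt (a : A ⟶ A') (g : Gpt R B A W) (hg : g.conv.d = 0) :
    (Sec.pullFunctor W (trivialTorsor R B) a).map (autPt g hg) =
      autPt (gmap a (𝟙 W) g) (closed_gmap hg _ _) := by
  refine Sec.cart_hom_ext fun U => ?_
  rw [autPt_hom, ofClosed_gmap, Category.assoc, ← tmap_comp, ← tmap_comp,
    Category.id_comp, Category.id_comp, ← DGArt.hom_comp]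
  rfl

/-- The component at the initial object of an automorphism of the trivial cartesian section. -/
def autComponent (f : (⟨trivialSec R B A⟩ : Sec.Cart W (trivialTorsor R B) A) ⟶ ⟨trivialSec R B A⟩) :
    tensor W (tensor (tensor A.toCDGA B) (ofComm R)) ⟶
      tensor W (tensor (tensor A.toCDGA B) (ofComm R)) :=
  (Sec.Hom.iso f (Under.mk (𝟙 A))).hom

theorem autHom_autComponent
    (f : (⟨trivialSec R B A⟩ : Sec.Cart W (trivialTorsor R B) A) ⟶ ⟨trivialSec R B A⟩) :
    autHom (autPoint (autComponent f)) = autComponent f :=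
  autHom_autPoint _ (Sec.Hom.iso f (Under.mk (𝟙 A))).base
    (Sec.Hom.iso f (Under.mk (𝟙 A))).equivariant

theorem autPoint_near
    (f : (⟨trivialSec R B A⟩ : Sec.Cart W (trivialTorsor R B) A) ⟶ ⟨trivialSec R B A⟩) :
    autPoint (autComponent f) ≫ tmap (𝟙 W) (A.augBase B) = convUnit R _ := by
  have h : autComponent f ≫ tmap (𝟙 W) (tmap (A.augBase B) (𝟙 (ofComm R))) =
      tmap (𝟙 W) (tmap (A.augBase B) (𝟙 _)) := (Sec.Hom.iso f (Under.mk (𝟙 A))).triv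
  have e : neutral R W (tensor A.toCDGA B) ≫ tmap (𝟙 W) (A.augBase B) =
      tmap (𝟙 W) (tmap (A.augBase B) (𝟙 (ofComm R))) ≫ neutral R W B := by
    rw [neutral, neutral, ← tmap_comp, ← tmap_comp, tlift_comp, tmap_tlift, convUnit_comp]
    rw [Category.id_comp, Category.id_comp, Category.comp_id, Category.id_comp]
  rw [autPoint, Category.assoc, Category.assoc, e, ← Category.assoc (autComponent f), h,
    ← Category.assoc, inclGroup_tmap, inclGroup_neutral]

/-- The point corresponding to an automorphism of the trivial cartesian section. -/
def ptOf (f : (⟨trivialSec R B A⟩ : Sec.Cart W (trivialTorsor R B) A) ⟶ ⟨trivialSec R B A⟩) :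
    Gpt R B A W := ofHom _ (autPoint_near f)

theorem closed_ptOf
    (f : (⟨trivialSec R B A⟩ : Sec.Cart W (trivialTorsor R B) A) ⟶ ⟨trivialSec R B A⟩) :
    (ptOf f).conv.d = 0 := closed_ofHom _ _

theorem autPt_injective {g h : Gpt R B A W} {hg : g.conv.d = 0} {hh : h.conv.d = 0}
    (H : autPt g hg = autPt h hh) : g = h := by
  have h1 := congrArg (fun f => autPoint (autComponent f)) H
  have h2 (g : Gpt R B A W) (hg : g.conv.d = 0) : autPoint (autComponent (autPt g hg)) =
      ofClosed g hg := by
    refine (autPoint_autHom _).trans ?_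
    have : DGArt.hom (Under.mk (𝟙 A)).hom = 𝟙 A.toCDGA := rfl
    rw [this, tmap_id, tmap_id, Category.comp_id]
  rw [h2, h2] at h1
  exact Pt.ext' fun r => congrArg (fun f => alg f r) h1

/-- At the initial object this is `autHom_autPoint`. At any other object the automorphism is fixed
on the base, and the group coordinates are base changed from the initial object, so naturality
determines the rest. -/
theorem autPt_ptOf
    (f : (⟨trivialSec R B A⟩ : Sec.Cart W (trivialTorsor R B) A) ⟶ ⟨trivialSec R B A⟩) :
    autPt (ptOf f) (closed_ptOf f) = f := by
  refine Sec.cart_hom_ext fun U => ?_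
  let i : Under.mk (𝟙 A) ⟶ U := Under.homMk U.hom (Category.id_comp _)
  have h1 : autComponent f ≫ tmap (𝟙 W) (tmap (tmap (DGArt.hom U.hom) (𝟙 B)) (𝟙 (ofComm R))) =
      tmap (𝟙 W) (tmap (tmap (DGArt.hom U.hom) (𝟙 B)) (𝟙 (ofComm R))) ≫ (Sec.Hom.iso f U).hom :=
    Sec.Hom.natural f i
  have h2 := autHom_tmap (autPoint (autComponent f)) (𝟙 W) (tmap (DGArt.hom U.hom) (𝟙 B))
  rw [autHom_autComponent, h1] at h2
  have h3 : inclBase R W _ ≫ (Sec.Hom.iso f U).hom = inclBase R W _ := (Sec.Hom.iso f U).base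
  refine extended_hom_ext R ((inclBase_autHom _).trans h3.symm) ?_
  have h4 (x y : tensor W (tensor (tensor U.right.toCDGA B) (ofComm R)) ⟶
      tensor W (tensor (tensor U.right.toCDGA B) (ofComm R)))
      (h : tmap (𝟙 W) (tmap (tmap (DGArt.hom U.hom) (𝟙 B)) (𝟙 (ofComm R))) ≫ x =
        tmap (𝟙 W) (tmap (tmap (DGArt.hom U.hom) (𝟙 B)) (𝟙 (ofComm R))) ≫ y) :
      inclGroup R W _ ≫ x = inclGroup R W _ ≫ y := by
    rw [← inclGroup_tmap (𝟙 W) (tmap (DGArt.hom U.hom) (𝟙 B)), Category.assoc]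
    exact (congrArg (_ ≫ ·) h).trans (Category.assoc _ _ _).symm
  exact (h4 _ _ h2).symm

end automorphisms

end DG

/-! ### Chains of sections described by points. -/

namespace DG

open CDGA

variable {k : Type u} [Field k] {R : Type u} [CommRing R] [HopfAlgebra k R] {B : CDGA k}
  {A A' A'' : DGArt k} {W W' W'' : CDGA k}

variable (R B A) in
/-- A cartesian section with an isomorphism to the trivial one. -/
structure Datum : Type (u + 1) where
  sec : Sec (trivialTorsor R B) A
  iso : (⟨sec⟩ : Sec.Cart (ofComm k) (trivialTorsor R B) A) ⟶ ⟨trivialSec R B A⟩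

namespace Datum

/-- The extension of scalars of the isomorphism to the trivial section. -/
def frame (D : Datum R B A) (W : CDGA k) :
    (⟨D.sec⟩ : Sec.Cart W (trivialTorsor R B) A) ⟶ ⟨trivialSec R B A⟩ :=
  (Sec.extend (unitMap W) (trivialTorsor R B) A).map D.iso

/-- The isomorphism is defined over k, so its extensions to all W are compatible. -/
theorem extend_frame (D : Datum R B A) (w : W ⟶ W') :
    (Sec.extend w (trivialTorsor R B) A).map (D.frame W) = D.frame W' := by
  refine Sec.cart_hom_ext fun U => ?_
  exact (extHom_comp' (unitMap W) w (Sec.Hom.iso D.iso U).hom).symm.trans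
    (congrArg (fun v => extHom v (Sec.Hom.iso D.iso U).hom) (unitMap_comp w))

variable (R B A) in
/-- The trivial section with the identity. -/
def triv : Datum R B A := ⟨trivialSec R B A, 𝟙 _⟩

theorem frame_triv : (triv R B A).frame W = 𝟙 _ :=
  (Sec.extend (unitMap W) (trivialTorsor R B) A).map_id _

end Datum

section chain

theorem mul_inv_mul_mul_inv {C : CDGA k} {φ : NilFil C} (a b c : Pt R φ) :
    a * b⁻¹ * (b * c⁻¹) = a * c⁻¹ := by group

theorem comp_inv_comp {C : Type*} [Category* C] {X Y Z T : C} (f : X ⟶ T) (g : Y ⟶ T) [IsIso g]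
    (h : Z ⟶ T) [IsIso h] {a b c : T ⟶ T} (H : a ≫ b = c) :
    (f ≫ a ≫ inv g) ≫ g ≫ b ≫ inv h = f ≫ c ≫ inv h := by subst H; simp

theorem comp_id_inv {C : Type*} [Category* C] {X T : C} (f : X ⟶ T) [IsIso f] {a : T ⟶ T}
    (H : a = 𝟙 T) : f ≫ a ≫ inv f = 𝟙 X := by subst H; simp

theorem comp_inv_eq {C : Type*} [Category* C] {T : C} {f : T ⟶ T} [IsIso f] {a : T ⟶ T}
    (H : f = 𝟙 T) : f ≫ a ≫ inv f = a := by subst H; simp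

theorem map_comp_inv {C D : Type*} [Category* C] [Category* D] (F : C ⥤ D) {X Y T : C} {f : X ⟶ T}
    {a : T ⟶ T} {g : Y ⟶ T} [IsIso g] {f' : F.obj X ⟶ F.obj T} {a' : F.obj T ⟶ F.obj T}
    {g' : F.obj Y ⟶ F.obj T} (_ : IsIso g') (hf : F.map f = f') (ha : F.map a = a')
    (hg : F.map g = g') : F.map (f ≫ a ≫ inv g) = f' ≫ a' ≫ inv g' := by
  subst hf ha hg; simp

/-- The transition isomorphism of two trivialized sections given by points with the same
logarithmic derivative. -/
def transition (D D' : Datum R B A) (g g' : Gpt R B A W) (h : g.form = g'.form) :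
    (⟨D.sec⟩ : Sec.Cart W (trivialTorsor R B) A) ⟶ ⟨D'.sec⟩ :=
  D.frame W ≫ autPt (g * g'⁻¹) (Pt.closed_of_form_eq h) ≫ inv (D'.frame W)

theorem transition_self (D : Datum R B A) (g : Gpt R B A W) : transition D D g g rfl = 𝟙 _ := by
  have H : autPt (g * g⁻¹) (Pt.closed_of_form_eq rfl) = 𝟙 _ :=
    (autPt_congr (mul_inv_cancel g) _).trans (autPt_one _)
  exact comp_id_inv (D.frame W) H

theorem transition_comp (D D' D'' : Datum R B A) (g g' g'' : Gpt R B A W) (h : g.form = g'.form)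
    (h' : g'.form = g''.form) :
    transition D D' g g' h ≫ transition D' D'' g' g'' h' =
      transition D D'' g g'' (h.trans h') := by
  exact comp_inv_comp (D.frame W) (D'.frame W) (D''.frame W) 
    (autPt_comp (mul_inv_mul_mul_inv g g' g'') _ _ _)

/-- A chain of trivialized sections given by points with the same logarithmic derivative. -/
def chain (D : Fin (n + 1) → Datum R B A) (e : Fin (n + 1) → Gpt R B A W)
    (he : ∀ i j, (e i).form = (e j).form) :
    Fin (n + 1) ⥤ Sec.Cart W (trivialTorsor R B) A where
  obj i := ⟨(D i).sec⟩
  map {i j} _ := transition (D i) (D j) (e i) (e j) (he i j)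
  map_id _ := transition_self _ _
  map_comp _ _ := (transition_comp _ _ _ _ _ _ _ _).symm

theorem chain_congr {D D' : Fin (n + 1) → Datum R B A} {e e' : Fin (n + 1) → Gpt R B A W}
    (hD : D = D') (h : e = e') (he : ∀ i j, (e i).form = (e j).form)
    (he' : ∀ i j, (e' i).form = (e' j).form) : chain D e he = chain D' e' he' := by
  subst hD h; rfl

theorem eq_chain (c : Fin (n + 1) ⥤ Sec.Cart W (trivialTorsor R B) A)
    (iso : ∀ i, (⟨(c.obj i).sec⟩ : Sec.Cart (ofComm k) (trivialTorsor R B) A) ⟶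
      ⟨trivialSec R B A⟩) (e : Fin (n + 1) → Gpt R B A W) (he : ∀ i j, (e i).form = (e j).form)
    (h : ∀ i j (f : i ⟶ j), c.map f =
      transition ⟨(c.obj i).sec, iso i⟩ ⟨(c.obj j).sec, iso j⟩ (e i) (e j) (he i j)) :
    c = chain (fun i => ⟨(c.obj i).sec, iso i⟩) e he :=
  CategoryTheory.Functor.ext (fun _ => rfl) fun i j f =>
    (h i j f).trans ((Category.id_comp _).trans (Category.comp_id _)).symm

theorem extend_transition (w : W ⟶ W') (D D' : Datum R B A) (g g' : Gpt R B A W)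
    (h : g.form = g'.form) :
    (Sec.extend w (trivialTorsor R B) A).map (transition D D' g g' h) =
      transition D D' (gmap (𝟙 A) w g) (gmap (𝟙 A) w g') (form_gmap_congr h _ _) := by
  have H := (extend_autPt w (g * g'⁻¹) (Pt.closed_of_form_eq h)).trans
    (autPt_congr (g' := gmap (𝟙 A) w g * (gmap (𝟙 A) w g')⁻¹) (by rw [map_mul, map_inv]) _)
  exact map_comp_inv (Sec.extend w (trivialTorsor R B) A) (Sec.cart_isIso _)
    (D.extend_frame w) H (D'.extend_frame w)

theorem chain_extend (φ : Fin (m + 1) ⥤ Fin (n + 1)) (w : W ⟶ W') (D : Fin (n + 1) → Datum R B A)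
    (e : Fin (n + 1) → Gpt R B A W) (he : ∀ i j, (e i).form = (e j).form) :
    φ ⋙ chain D e he ⋙ Sec.extend w (trivialTorsor R B) A =
      chain (fun i => D (φ.obj i)) (fun i => gmap (𝟙 A) w (e (φ.obj i)))
        (fun _ _ => form_gmap_congr (he _ _) _ _) :=
  CategoryTheory.Functor.ext (fun _ => rfl) fun _ _ _ => by
    exact (extend_transition w _ _ _ _ (he _ _)).trans ((Category.id_comp _).trans (Category.comp_id _)).symm

theorem transition_triv (g g' : Gpt R B A W) (h : g.form = g'.form) :
    transition (Datum.triv R B A) (Datum.triv R B A) g g' h =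
      autPt (g * g'⁻¹) (Pt.closed_of_form_eq h) :=  
  comp_inv_eq (C := Sec.Cart W (trivialTorsor R B) A) (T := ⟨trivialSec R B A⟩) Datum.frame_triv

theorem chain_pull (a : A ⟶ A') (e : Fin (n + 1) → Gpt R B A W)
    (he : ∀ i j, (e i).form = (e j).form) :
    chain (fun _ => Datum.triv R B A) e he ⋙ Sec.pullFunctor W (trivialTorsor R B) a =
      chain (fun _ => Datum.triv R B A') (fun i => gmap a (𝟙 W) (e i))
        (fun _ _ => form_gmap_congr (he _ _) _ _) := by
  refine CategoryTheory.Functor.ext (fun _ => rfl) fun i j f => ?_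
  refine Eq.trans ?_ ((Category.id_comp _).trans (Category.comp_id _)).symm
  change (Sec.pullFunctor W (trivialTorsor R B) a).map (transition (Datum.triv R B A)
    (Datum.triv R B A) (e i) (e j) (he i j)) = transition (Datum.triv R B A') (Datum.triv R B A')
      (gmap a (𝟙 W) (e i)) (gmap a (𝟙 W) (e j)) (form_gmap_congr (he i j) _ _)
  rw [transition_triv, transition_triv]
  refine (pull_autPt a _ _).trans ?_
  exact autPt_congr (by rw [map_mul, map_inv]) _

end chain

end DG

/-! ### Gauges normalized at the vertices of a simplex. -/

namespace DG

open CDGA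

variable {k : Type u} [Field k]

/-- Homogeneous generators commute with all homogeneous elements up to sign, so left multiples
generate as well as right multiples. -/
theorem NilFil.push_induction_left {C C' : CDGA k} (φ : NilFil C) (f : C ⟶ C') {i : ℕ}
    (p : Submodule k C') (h : ∀ x ∈ φ.F i, ∀ y : C', y * alg f x ∈ p) : (φ.push f).F i ≤ p := by
  refine φ.push_induction f p fun x hx y => ?_
  have hx' := φ.hom i hx
  clear hx
  induction hx' using Submodule.span_induction with
  | zero => rw [map_zero, zero_mul]; exact zero_mem _
  | add x x' _ _ h h' => rw [map_add, add_mul]; exact add_mem h h'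
  | smul c x _ h => rw [map_smul, smul_mul_assoc]; exact Submodule.smul_mem _ _ h
  | mem x hx =>
    obtain ⟨hx, q, hq⟩ := hx
    refine C'.hom_induction (p := fun y => alg f x * y ∈ p) ?_ ?_ ?_ y
    · rw [mul_zero]; exact zero_mem _
    · intro y y' h h'; rw [mul_add]; exact add_mem h h'
    · intro j y hy
      rw [C'.comm q j _ y (Hom.map_deg f q _ hq) hy, Units.smul_def]
      exact Submodule.smul_of_tower_mem _ _ (h x hx y)

section gauge

variable {W : CDGA k} {B : CDGA k} {A A' : DGArt k}

/-- The homotopy acts on the factor W only, hence commutes with right multiplication by elements of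
A. Generators are written as left multiples to avoid signs. -/
theorem tensor_s_mem_filExt (H : Retract W) (i : ℕ) (x : Tens W (tensor A.toCDGA B))
    (hx : x ∈ (A.filExt W B).F i) : (H.tensor (tensor A.toCDGA B)).s x ∈ (A.filExt W B).F i := by
  refine NilFil.push_induction_left _ _ (((A.filExt W B).F i).comap (H.tensor _).s) ?_ hx
  intro a ha y
  refine tens_induction (p := fun y => (H.tensor (tensor A.toCDGA B)).s
    (y * alg (inl A.toCDGA B ≫ inr W _) a) ∈ (A.filExt W B).F i) ?_ ?_ ?_ y
  · rw [zero_mul, map_zero]; exact zero_mem _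
  · intro y y' h h'; rw [add_mul, map_add]; exact add_mem h h'
  · intro p q w z hw hz
    have e (w : W) : (tmul w z : Tens W (tensor A.toCDGA B)) * alg (inl A.toCDGA B ≫ inr W _) a =
        tmul w (z * (tmul a 1 : Tens A.toCDGA B)) := by
      refine (tmul_mul_tmul W (tensor A.toCDGA B) w 1 z _ hz (SetLike.one_mem_graded W.deg)).trans ?_
      rw [mul_zero, zpow_zero, one_smul, mul_one]
      rfl
    rw [e, Retract.tensor_s_tmul, ← e]
    exact NilFil.mul_left _ _ (NilFil.mem_push _ _ ha)

theorem constAt_eq_zero {n : ℕ} (v : Fin (n + 1)) {i : ℤ} (hi : i ≠ 0) {x : Forms k n}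
    (hx : x ∈ Forms.deg k i) : alg (constAt k v) x = 0 := by
  have h : (alg (vertex (k := k) v) x : k) ∈ degZero (k := k) (M := k) i :=
    Hom.map_deg (vertex (k := k) v) i x hx
  rcases (mem_degZero (k := k) (M := k) i _).1 h with h | h
  · exact absurd h hi
  · exact (congrArg (alg (unitMap (Omega k n))) h).trans (map_zero _)

variable [CharZero k]

/-- As A has no positive degrees, an element of total degree one is a sum of products whose form
factor has positive degree, and evaluation at a vertex kills such forms. This supplies the
hypothesis on e in `form_gauge`. -/
theorem omegaRetract_tensor_e {n : ℕ} (v : Fin (n + 1)) (B : Type u) [CommRing B] [Algebra k B]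
    (x : Tens (Omega k n) (tensor A.toCDGA (ofComm (k := k) B)))
    (hx : x ∈ tensDeg (Omega k n) (tensor A.toCDGA (ofComm (k := k) B)) 1) :
    ((omegaRetract k v).tensor (tensor A.toCDGA (ofComm B))).e x = 0 := by
  refine tensDeg_induction (p := fun x =>
    ((omegaRetract k v).tensor (tensor A.toCDGA (ofComm B))).e x = 0) ?_ ?_ ?_ x hx
  · exact map_zero _
  · intro x y hx hy; rw [map_add, hx, hy, add_zero]
  · intro i j a b ha hb h
    change (tmul (alg (constAt k v) a) b :
      Tens (Omega k n) (tensor A.toCDGA (ofComm (k := k) B))) = 0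
    by_cases hi : i = 0
    · have hb0 : b = 0 := Sec.tens_eq_zero_of_pos A (by omega) hb
      rw [hb0, ← tmulₗ_apply, map_zero]
    · rw [constAt_eq_zero v hi ha, ← tmulₗ_apply, map_zero, LinearMap.zero_apply]

variable {R : Type u} [CommRing R] [HopfAlgebra k R] (c : Coords k R) {B : Type u} [CommRing B]
  [Algebra k B] {n m : ℕ}

/-- The gauge transformation from the trivial to a given Maurer-Cartan element which is normalized
at a vertex of the simplex. -/
def vertexGauge (v : Fin (n + 1)) {z : Conv R (tensor (Omega k n) (tensor A.toCDGA (ofComm B)))}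
    (hz : IsMC (A.filExt (Omega k n) (ofComm B)) z) : Gpt R (ofComm B) A (Omega k n) :=
  gauge c ((omegaRetract k v).tensor _) (tensor_s_mem_filExt _) hz

theorem form_vertexGauge (v : Fin (n + 1))
    {z : Conv R (tensor (Omega k n) (tensor A.toCDGA (ofComm B)))}
    (hz : IsMC (A.filExt (Omega k n) (ofComm B)) z) : (vertexGauge c v hz).form = z :=
  form_gauge c _ _ (omegaRetract_tensor_e v B) hz

/-- Instance of `map_gauge`: the normalization is respected whenever w intertwines the contractions
to v and u. -/
theorem gmap_vertexGauge (a : A ⟶ A') (w : Omega k n ⟶ Omega k m) (v : Fin (n + 1))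
    (u : Fin (m + 1)) (hw : ∀ x, (omegaRetract k u).s (alg w x) = alg w ((omegaRetract k v).s x))
    {z : Conv R (tensor (Omega k n) (tensor A.toCDGA (ofComm B)))}
    (hz : IsMC (A.filExt (Omega k n) (ofComm B)) z)
    {z' : Conv R (tensor (Omega k m) (tensor A'.toCDGA (ofComm B)))}
    (hz' : IsMC (A'.filExt (Omega k m) (ofComm B)) z')
    (e : Conv.map (alg (tmap w (tmap (DGArt.hom a) (𝟙 _)))) z = z') :
    gmap a w (vertexGauge c v hz) = vertexGauge c u hz' :=
  map_gauge c _ _ _ _ _ _ (Retract.tensor_map _ _ _ _ hw) hz hz' e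

end gauge

end DG

/-! ### The natural transformation from the nerve of the Lie algebra. -/

namespace DG

open CDGA

variable {k : Type u} [Field k] {R : Type u} [CommRing R] [HopfAlgebra k R]
  {B : Type u} [CommRing B] [Algebra k B] {A A' : DGArt k} {n m : ℕ}

variable [CharZero k] (c : Coords k R)

/-- The chain of automorphisms of the trivial section given by a Maurer-Cartan element. -/
def mcChain (z : DGLie.MC A (Omega k n) (coeffLie (k := k) R B)) :
    Fin (n + 1) ⥤ Sec.Cart (Omega k n) (trivialTorsor R (ofComm B)) A :=
  chain (fun _ => Datum.triv R (ofComm B) A)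
    (fun v => vertexGauge c v (mcConv_isMC z.2))
    (fun _ _ => (form_vertexGauge c _ _).trans (form_vertexGauge c _ _).symm)

/-- The gauge at the vertex φ(v) pulls back to the gauge at v, since the simplicial operator carries
the contraction to v to the contraction to φ(v). -/
theorem mcChain_extend (φ : Fin (m + 1) ⥤ Fin (n + 1))
    (z : DGLie.MC A (Omega k n) (coeffLie (k := k) R B))
    (z' : DGLie.MC A (Omega k m) (coeffLie (k := k) R B))
    (h : (alg (tmap (DGArt.hom (𝟙 A)) (omegaMap k φ.obj))).toLinearMap.rTensor
      (coeffLie (k := k) R B) z.1 = z'.1) :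
    φ ⋙ mcChain c z ⋙ Sec.extend (omegaMap k φ.obj) (trivialTorsor R (ofComm B)) A =
      mcChain c z' := by
  refine (chain_extend φ (omegaMap k φ.obj) _ _ _).trans ?_
  refine chain_congr rfl (funext fun v => ?_) _ _
  exact gmap_vertexGauge c (𝟙 A) (omegaMap k φ.obj) (φ.obj v) v
    (omegaRetract_omegaMap _ _ _) _ _ ((mcConv_map (𝟙 A) _ _).symm.trans (congrArg mcConv h))

/-- The natural transformation from the nerve of the Lie algebra to the deformation functor. -/
def mcToDeformation : DGLie.nerve (coeffLie (k := k) R B) ⋙ SSet.uliftFunctor.{u + 1} ⟶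
    deformationFunctor (trivialTorsor R (ofComm B)) where
  app A :=
    { app := fun X => TypeCat.ofHom fun z => mcChain c z.down
      naturality := fun X Y θ => by
        ext z
        exact (mcChain_extend c (SimplexCategory.toCat.map θ.unop).toFunctor z.down _ rfl).symm }
  naturality A A' a := by
    ext X z
    refine Eq.symm ?_
    refine (chain_pull a _ _).trans ?_
    refine chain_congr rfl (funext fun v => ?_) _ _
    exact gmap_vertexGauge c a (𝟙 _) v v (fun _ => rfl) _ _ (mcConv_map a (𝟙 _) _).symm

end DG

/-! ### Cocycles of chains with respect to chosen trivializations. -/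

namespace DG

open CDGA

variable {k : Type u} [Field k] [CharZero k] {R : Type u} [CommRing R] [HopfAlgebra k R]
  [Algebra.FiniteType k R] {B : Type u} [CommRing B] [Algebra k B] {A A' : DGArt k}
  {W W' : CDGA k} {n m : ℕ}

open Classical in
/-- A choice of an isomorphism to the trivial section, which is the identity for the trivial
section. -/
def trivialization (S : Sec (trivialTorsor R (ofComm (k := k) B)) A) :
    (⟨S⟩ : Sec.Cart (ofComm k) (trivialTorsor R (ofComm B)) A) ⟶ ⟨trivialSec R (ofComm B) A⟩ :=
  -- Normalized on the trivial section, so that the cocycle of the chain built from a Maurer-Cartan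
  -- element is read off as it was put in.
  if h : S = trivialSec R (ofComm B) A then eqToHom (congrArg Sec.Cart.mk h)
  else Classical.choice (Sec.nonempty_hom_trivialSec (ofComm k) S)

theorem trivialization_trivialSec :
    trivialization (trivialSec R (ofComm (k := k) B) A) = 𝟙 _ := by
  rw [trivialization, dif_pos rfl]; rfl

/-- A cartesian section with the chosen isomorphism to the trivial one. -/
def Datum.of (S : Sec (trivialTorsor R (ofComm (k := k) B)) A) : Datum R (ofComm B) A :=
  ⟨S, trivialization S⟩

section cocycle

/-- The automorphism of the trivial section given by a morphism between sections. -/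
def autOf {S T : Sec.Cart W (trivialTorsor R (ofComm (k := k) B)) A} (f : S ⟶ T) :
    (⟨trivialSec R (ofComm B) A⟩ : Sec.Cart W (trivialTorsor R (ofComm B)) A) ⟶
      ⟨trivialSec R (ofComm B) A⟩ :=
  inv ((Datum.of S.sec).frame W) ≫ f ≫ (Datum.of T.sec).frame W

/-- The point of the group given by a morphism between sections. -/
def pointOf {S T : Sec.Cart W (trivialTorsor R (ofComm (k := k) B)) A} (f : S ⟶ T) :
    Gpt R (ofComm B) A W := ptOf (autOf f)

theorem closed_pointOf {S T : Sec.Cart W (trivialTorsor R (ofComm (k := k) B)) A} (f : S ⟶ T) :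
    (pointOf f).conv.d = 0 := closed_ptOf _

theorem autPt_pointOf {S T : Sec.Cart W (trivialTorsor R (ofComm (k := k) B)) A} (f : S ⟶ T) :
    autPt (pointOf f) (closed_pointOf f) = autOf f := autPt_ptOf _

theorem inv_comp_comp {C : Type*} [Category* C] {X Y Z T : C} (f : X ⟶ T) [IsIso f] (g : Y ⟶ T)
    [IsIso g] (h : Z ⟶ T) (a : X ⟶ Y) (b : Y ⟶ Z) :
    (inv f ≫ a ≫ g) ≫ inv g ≫ b ≫ h = inv f ≫ (a ≫ b) ≫ h := by simp

theorem autOf_comp {S T U : Sec.Cart W (trivialTorsor R (ofComm (k := k) B)) A} (f : S ⟶ T)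
    (g : T ⟶ U) : autOf f ≫ autOf g = autOf (f ≫ g) :=
  inv_comp_comp ((Datum.of S.sec).frame W) ((Datum.of T.sec).frame W)
    ((Datum.of U.sec).frame W) f g

theorem pointOf_comp {S T U : Sec.Cart W (trivialTorsor R (ofComm (k := k) B)) A} (f : S ⟶ T)
    (g : T ⟶ U) : pointOf (f ≫ g) = pointOf f * pointOf g := by
  refine autPt_injective (hg := closed_pointOf _)
    (hh := closed_mul (closed_pointOf f) (closed_pointOf g)) ?_
  rw [autPt_pointOf, ← autPt_comp rfl (closed_pointOf f) (closed_pointOf g), autPt_pointOf,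
    autPt_pointOf, autOf_comp]

theorem map_inv_comp_comp {C D : Type*} [Category* C] [Category* D] (F : C ⥤ D) {X Y T : C}
    {f : X ⟶ T} [IsIso f] {a : X ⟶ Y} {g : Y ⟶ T} {f' : F.obj X ⟶ F.obj T} (_ : IsIso f')
    {g' : F.obj Y ⟶ F.obj T} (hf : F.map f = f') (hg : F.map g = g') :
    inv f' ≫ F.map a ≫ g' = F.map (inv f ≫ a ≫ g) := by
  subst hf hg; simp

theorem pointOf_extend {S T : Sec.Cart W (trivialTorsor R (ofComm (k := k) B)) A} (f : S ⟶ T)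
    (w : W ⟶ W') :
    pointOf ((Sec.extend w (trivialTorsor R (ofComm B)) A).map f) = gmap (𝟙 A) w (pointOf f) := by
  refine autPt_injective (hg := closed_pointOf _) (hh := closed_gmap (closed_pointOf f) _ _) ?_
  refine (autPt_pointOf _).trans (Eq.trans ?_ (extend_autPt w _ (closed_pointOf f)))
  refine Eq.trans ?_
    (congrArg (Sec.extend w (trivialTorsor R (ofComm B)) A).map (autPt_pointOf f).symm)
  exact map_inv_comp_comp (Sec.extend w (trivialTorsor R (ofComm B)) A) (Sec.cart_isIso _)
    ((Datum.of S.sec).extend_frame w) ((Datum.of T.sec).extend_frame w)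

theorem inv_comp_comp_inv {C : Type*} [Category* C] {X Y T : C} (f : X ⟶ T) [IsIso f] (g : Y ⟶ T)
    [IsIso g] {b : T ⟶ T} : inv f ≫ (f ≫ b ≫ inv g) ≫ g = b := by simp

theorem eq_comp_inv_comp {C : Type*} [Category* C] {X Y T : C} (f : X ⟶ T) [IsIso f] (g : Y ⟶ T)
    [IsIso g] {a : X ⟶ Y} {b : T ⟶ T} (h : b = inv f ≫ a ≫ g) : a = f ≫ b ≫ inv g := by
  subst h; simp

/-- A morphism is its cocycle conjugated back by the chosen trivializations, and gg'⁻¹ is this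
cocycle. -/
theorem eq_transition {S T : Sec.Cart W (trivialTorsor R (ofComm (k := k) B)) A} (f : S ⟶ T)
    (g g' : Gpt R (ofComm B) A W) (h : g.form = g'.form) (e : g = pointOf f * g') :
    f = transition (Datum.of S.sec) (Datum.of T.sec) g g' h :=
  eq_comp_inv_comp ((Datum.of S.sec).frame W) ((Datum.of T.sec).frame W)
    ((autPt_congr (mul_inv_eq_of_eq_mul e) _).trans (autPt_pointOf f))

theorem pointOf_transition (S T : Sec.Cart W (trivialTorsor R (ofComm (k := k) B)) A)
    (g g' : Gpt R (ofComm B) A W) (h : g.form = g'.form) :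
    pointOf (S := S) (T := T) (transition (Datum.of S.sec) (Datum.of T.sec) g g' h) =
      g * g'⁻¹ := by
  refine autPt_injective (hg := closed_pointOf _) (hh := Pt.closed_of_form_eq h) ?_
  refine (autPt_pointOf _).trans ?_
  exact inv_comp_comp_inv ((Datum.of S.sec).frame W) ((Datum.of T.sec).frame W)

end cocycle

end DG

/-! ### Frames of chains normalized by their barycenter. -/

namespace DG

open CDGA

variable {k : Type u} [Field k]

section bary

variable {n m : ℕ} {Y Y' : CDGA k}

variable (Y) in
/-- The barycentric coordinates in `Ω_n ⊗ Y`. -/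
def bary (i : Fin (n + 1)) : Tens (Omega k n) Y := alg (inl (Omega k n) Y) (Forms.t k i)

theorem bary_mem (i : Fin (n + 1)) : bary Y i ∈ tensDeg (Omega k n) Y 0 :=
  Hom.map_deg (inl (Omega k n) Y) 0 _ (Forms.t_mem i)

theorem sum_bary : ∑ i : Fin (n + 1), bary Y i = (1 : Tens (Omega k n) Y) := by
  refine (map_sum (alg (inl (Omega k n) Y)) _ _).symm.trans ?_
  exact (congrArg (alg (inl (Omega k n) Y)) (Forms.sum_t k)).trans (map_one _)

theorem map_bary (θ : Fin (m + 1) → Fin (n + 1)) (f : Y ⟶ Y') (i : Fin (n + 1)) :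
    alg (tmap (omegaMap k θ) f) (bary Y i) = ∑ j with θ j = i, bary Y' j := by
  have h : alg (tmap (omegaMap k θ) f) (bary Y i) =
      alg (inl (Omega k m) Y') (alg (omegaMap k θ) (Forms.t k i)) :=
    alg_comp_congr (inl_tmap (omegaMap k θ) f) _
  rw [h, omegaMap_t]
  exact map_sum (alg (inl (Omega k m) Y')) _ _

/-- The pullback of t_i is the sum of the t_j over the fibre of i, so weighted means are compatible
with all simplicial operators, degeneracies included. -/
theorem map_sum_bary (θ : Fin (m + 1) → Fin (n + 1)) (f : Y ⟶ Y')
    (u : Fin (n + 1) → Tens (Omega k n) Y) :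
    alg (tmap (omegaMap k θ) f) (∑ i, bary Y i * u i) =
      ∑ j, bary Y' j * alg (tmap (omegaMap k θ) f) (u (θ j)) := by
  refine (map_sum (alg (tmap (omegaMap k θ) f)) _ _).trans ?_
  refine (Finset.sum_congr rfl fun i _ => (map_mul (alg (tmap (omegaMap k θ) f)) _ _).trans
    ((congrArg (· * _) (map_bary θ f i)).trans (Finset.sum_mul _ _ _))).trans ?_
  refine (Finset.sum_comm' (t' := Finset.univ) (s' := fun j => {θ j}) ?_).trans ?_
  · intro i j; simp [eq_comm]
  · exact Finset.sum_congr rfl fun j _ => Finset.sum_singleton _ _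

/-- The weight of a simplex of the interval. -/
def weight (Y : CDGA k) (τ : Fin (n + 1) → Fin 2) : Tens (Omega k n) Y :=
  ∑ i with τ i = 0, bary Y i

theorem weight_mem (Y : CDGA k) (τ : Fin (n + 1) → Fin 2) :
    weight Y τ ∈ tensDeg (Omega k n) Y 0 := sum_mem fun i _ => bary_mem i

theorem map_weight {Y Y' : CDGA k} (θ : Fin (m + 1) → Fin (n + 1)) (f : Y ⟶ Y')
    (τ : Fin (n + 1) → Fin 2) :
    alg (tmap (omegaMap k θ) f) (weight Y τ) = weight Y' (fun j => τ (θ j)) := by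
  refine (map_sum (alg (tmap (omegaMap k θ) f)) _ _).trans ?_
  refine (Finset.sum_congr rfl fun i _ => map_bary θ f i).trans ?_
  refine (Finset.sum_comm' (t' := {j | τ (θ j) = 0}) (s' := fun j => {θ j}) ?_).trans ?_
  · intro i j; simp only [Finset.mem_filter, Finset.mem_univ, true_and, Finset.mem_singleton]
    constructor
    · rintro ⟨h, rfl⟩; exact ⟨rfl, h⟩
    · rintro ⟨rfl, h⟩; exact ⟨h, rfl⟩
  · exact Finset.sum_congr rfl fun j _ => Finset.sum_singleton _ _

end bary

variable [CharZero k] {R : Type u} [CommRing R] [HopfAlgebra k R]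
  [Algebra.FiniteType k R] {B : Type u} [CommRing B] [Algebra k B] {A A' : DGArt k}
  {n m : ℕ} (c : Coords k R)

/-- A frame of a chain of sections: points which solve the cocycle of the chain, with vanishing
barycenter. -/
structure IsFrame (F : Fin (n + 1) ⥤ Sec.Cart (Omega k n) (trivialTorsor R (ofComm (k := k) B)) A)
    (e : Fin (n + 1) → Gpt R (ofComm B) A (Omega k n)) : Prop where
  cocycle : ∀ {i j} (f : i ⟶ j), e i = pointOf (F.map f) * e j
  mean : ∀ l, ∑ i, bary (tensor A.toCDGA (ofComm B)) i * (e i).toAlgHom (c.x l) = 0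

/-- The cocycle determines all points from the one at the last vertex, which may be chosen freely:
solutions differ by a common right translation. `exists_unique_mean` says that exactly one
translation has vanishing barycenter. -/
theorem exists_frame
    (F : Fin (n + 1) ⥤ Sec.Cart (Omega k n) (trivialTorsor R (ofComm (k := k) B)) A) :
    ∃! e, IsFrame c F e := by
  have hl (i : Fin (n + 1)) : i ⟶ Fin.last n := homOfLE (Fin.le_last i)
  obtain ⟨h, h1, h2⟩ := exists_unique_mean c (φ := A.filExt (Omega k n) (ofComm B))
    (bary (tensor A.toCDGA (ofComm B))) bary_mem sum_bary (fun i => pointOf (F.map (hl i)))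
  refine ⟨fun i => pointOf (F.map (hl i)) * h, ⟨fun {i j} f => ?_, h1⟩, fun e he => ?_⟩
  · have : hl i = f ≫ hl j := Subsingleton.elim _ _
    rw [this, F.map_comp, pointOf_comp, mul_assoc]
  · have e1 : e (Fin.last n) = h := h2 _ fun l => by
      have := he.mean l
      simpa only [← he.cocycle] using this
    exact funext fun i => by rw [← e1, ← he.cocycle]

/-- The frame of a chain. -/
def frame (F : Fin (n + 1) ⥤ Sec.Cart (Omega k n) (trivialTorsor R (ofComm (k := k) B)) A) :
    Fin (n + 1) → Gpt R (ofComm B) A (Omega k n) := (exists_frame c F).choose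

section

variable (F : Fin (n + 1) ⥤ Sec.Cart (Omega k n) (trivialTorsor R (ofComm (k := k) B)) A)

theorem isFrame_frame : IsFrame c F (frame c F) := (exists_frame c F).choose_spec.1

variable {c F} in
theorem IsFrame.eq_frame {e : Fin (n + 1) → Gpt R (ofComm B) A (Omega k n)} (h : IsFrame c F e) :
    e = frame c F := (exists_frame c F).choose_spec.2 e h

/-- The points differ by closed left factors, which do not affect the logarithmic derivative. -/
theorem form_frame (i j : Fin (n + 1)) : (frame c F i).form = (frame c F j).form := by
  have key {i j : Fin (n + 1)} (h : i ≤ j) : (frame c F i).form = (frame c F j).form := by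
    rw [(isFrame_frame c F).cocycle (homOfLE h), Pt.form_eq_of_closed (closed_pointOf _)]
  rcases le_total i j with h | h
  · exact key h
  · exact (key h).symm

theorem eq_chain_frame : F = chain (fun i => Datum.of (F.obj i).sec) (frame c F)
    (form_frame c F) :=
  eq_chain F (fun i => trivialization (F.obj i).sec) _ _ fun _ _ f =>
    eq_transition (F.map f) _ _ _ ((isFrame_frame c F).cocycle f)

/-- The pulled back points solve the pulled back cocycle and, by `map_sum_bary`, still have
vanishing barycenter. A normalization at a fixed vertex would not be preserved by all simplicial
operators. -/
theorem frame_extend (φ : Fin (m + 1) ⥤ Fin (n + 1)) :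
    frame c (φ ⋙ F ⋙ Sec.extend (omegaMap k φ.obj) (trivialTorsor R (ofComm B)) A) =
      fun i => gmap (𝟙 A) (omegaMap k φ.obj) (frame c F (φ.obj i)) := by
  refine (IsFrame.eq_frame ⟨fun {i j} f => ?_, fun l => ?_⟩).symm
  · rw [(isFrame_frame c F).cocycle (φ.map f), map_mul]
    exact congrArg (· * _) (pointOf_extend (F.map (φ.map f)) (omegaMap k φ.obj)).symm
  · have h := map_sum_bary φ.obj (tmap (DGArt.hom (𝟙 A)) (𝟙 (ofComm (k := k) B)))
      (fun i => (frame c F i).toAlgHom (c.x l))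
    rw [(isFrame_frame c F).mean l, map_zero] at h
    exact h.symm

end

end DG

/-! ### The homotopy inverse and the two homotopies. -/

namespace DG

open CDGA

variable {k : Type u} [Field k] [CharZero k] {R : Type u} [CommRing R] [HopfAlgebra k R]
  [Algebra.FiniteType k R] {B : Type u} [CommRing B] [Algebra k B] {A A' : DGArt k}
  {W W' : CDGA k} {n m : ℕ}

/-- The Maurer-Cartan element given by the logarithmic derivative of a point. -/
def mcOf (g : Gpt R (ofComm B) A W) : DGLie.MC A W (coeffLie (k := k) R B) :=
  ⟨(exists_mcConv g.form_isMC).choose, (exists_mcConv g.form_isMC).choose_spec.1⟩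

theorem mcConv_mcOf (g : Gpt R (ofComm B) A W) : mcConv (mcOf g).1 = g.form :=
  (exists_mcConv g.form_isMC).choose_spec.2

theorem mcOf_eq {g : Gpt R (ofComm B) A W} {z : DGLie.MC A W (coeffLie (k := k) R B)}
    (h : g.form = mcConv z.1) : mcOf g = z :=
  Subtype.ext (mcConv_injective (R := R) ((mcConv_mcOf g).trans h))

theorem mcOf_congr {g g' : Gpt R (ofComm B) A W} (h : g.form = g'.form) : mcOf g = mcOf g' :=
  mcOf_eq (h.trans (mcConv_mcOf g').symm)

theorem map_mcOf (a : A ⟶ A') (w : W ⟶ W') (g : Gpt R (ofComm B) A W) :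
    (alg (tmap (DGArt.hom a) w)).toLinearMap.rTensor (coeffLie (k := k) R B) (mcOf g).1 =
      (mcOf (gmap a w g)).1 := by
  refine mcConv_injective (R := R) ?_
  rw [mcConv_map, mcConv_mcOf, mcConv_mcOf, form_gmap]

variable (c : Coords k R)

section

variable (F : Fin (n + 1) ⥤ Sec.Cart (Omega k n) (trivialTorsor R (ofComm (k := k) B)) A)

/-- The Maurer-Cartan element of a chain of sections. -/
def chainMC : DGLie.MC A (Omega k n) (coeffLie (k := k) R B) := mcOf (frame c F 0)

theorem mcConv_chainMC (i : Fin (n + 1)) : mcConv (chainMC c F).1 = (frame c F i).form :=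
  (mcConv_mcOf _).trans (form_frame c F 0 i)

/-- The operator need not preserve the vertex 0 used in the definition, but all points of a frame
have the same logarithmic derivative. -/
theorem chainMC_extend (φ : Fin (m + 1) ⥤ Fin (n + 1)) :
    (alg (tmap (DGArt.hom (𝟙 A)) (omegaMap k φ.obj))).toLinearMap.rTensor
      (coeffLie (k := k) R B) (chainMC c F).1 =
      (chainMC c (φ ⋙ F ⋙ Sec.extend (omegaMap k φ.obj) (trivialTorsor R (ofComm B)) A)).1 := by
  rw [chainMC, chainMC, frame_extend, map_mcOf]
  exact congrArg Subtype.val (mcOf_congr (form_gmap_congr (form_frame c F _ _) _ _))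

/-- A homotopy from a chain of sections to a chain of trivial sections, for a simplex of the
interval. -/
def chainHomotopy (τ : Fin (n + 1) → Fin 2) :
    Fin (n + 1) ⥤ Sec.Cart (Omega k n) (trivialTorsor R (ofComm (k := k) B)) A :=
  chain (fun i => if τ i = 0 then Datum.triv R (ofComm B) A else Datum.of (F.obj i).sec)
    (fun i => if τ i = 0 then vertexGauge c i (mcConv_isMC (chainMC c F).2) else frame c F i)
    (fun i j => by
      have h (i) : Pt.form (if τ i = 0 then vertexGauge c i (mcConv_isMC (chainMC c F).2)
          else frame c F i) = mcConv (chainMC c F).1 := by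
        split_ifs
        · exact form_vertexGauge c _ _
        · exact (mcConv_chainMC c F i).symm
      rw [h, h])

theorem chainHomotopy_zero {τ : Fin (n + 1) → Fin 2} (hτ : ∀ i, τ i = 0) :
    chainHomotopy c F τ = mcChain c (chainMC c F) :=
  chain_congr (funext fun i => if_pos (hτ i)) (funext fun i => if_pos (hτ i)) _ _

theorem chainHomotopy_one {τ : Fin (n + 1) → Fin 2} (hτ : ∀ i, τ i = 1) :
    chainHomotopy c F τ = F := by
  have h (i) : τ i ≠ 0 := by rw [hτ]; exact one_ne_zero
  refine Eq.trans ?_ (eq_chain_frame c F).symm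
  exact chain_congr (funext fun i => if_neg (h i)) (funext fun i => if_neg (h i)) _ _

theorem chainHomotopy_extend (φ : Fin (m + 1) ⥤ Fin (n + 1)) (τ : Fin (n + 1) → Fin 2) :
    φ ⋙ chainHomotopy c F τ ⋙ Sec.extend (omegaMap k φ.obj) (trivialTorsor R (ofComm B)) A =
      chainHomotopy c (φ ⋙ F ⋙ Sec.extend (omegaMap k φ.obj) (trivialTorsor R (ofComm B)) A)
        (fun i => τ (φ.obj i)) := by
  refine (chain_extend φ (omegaMap k φ.obj) _ _ _).trans ?_
  refine chain_congr rfl (funext fun v => ?_) _ _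
  rw [apply_ite (gmap (𝟙 A) (omegaMap k φ.obj)), frame_extend]
  refine if_congr Iff.rfl ?_ rfl
  exact gmap_vertexGauge c (𝟙 A) (omegaMap k φ.obj) (φ.obj v) v (omegaRetract_omegaMap _ _ _) _ _
    ((mcConv_map (𝟙 A) _ _).symm.trans (congrArg mcConv (chainMC_extend c F φ)))

end

section

variable (z : DGLie.MC A (Omega k n) (coeffLie (k := k) R B))

/-- The point relating the normalized gauges of a Maurer-Cartan element to the frame of its
chain. -/
def comparison (i : Fin (n + 1)) : Gpt R (ofComm B) A (Omega k n) :=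
  (vertexGauge c i (mcConv_isMC z.2))⁻¹ * frame c (mcChain c z) i

theorem transition_of_trivialSec (g g' : Gpt R (ofComm (k := k) B) A W) (h : g.form = g'.form) :
    transition (Datum.of (trivialSec R (ofComm B) A)) (Datum.of (trivialSec R (ofComm B) A)) g g' h =
      autPt (g * g'⁻¹) (Pt.closed_of_form_eq h) := by
  have H : (Datum.of (trivialSec R (ofComm (k := k) B) A)).frame W = 𝟙 _ :=
    (congrArg (Sec.extend (unitMap W) (trivialTorsor R (ofComm B)) A).map
      trivialization_trivialSec).trans ((Sec.extend (unitMap W) _ A).map_id _)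
  exact comp_inv_eq (C := Sec.Cart W (trivialTorsor R (ofComm B)) A)
    (T := ⟨trivialSec R (ofComm B) A⟩) H

/-- The chain of z has transitions g_i g_j⁻¹, and since the trivial section is trivialized by the
identity this is also its cocycle. So the gauges g_i and the frame e_i solve the same cocycle, and
g_i⁻¹e_i does not depend on i. -/
theorem comparison_eq (i j : Fin (n + 1)) : comparison c z i = comparison c z j := by
  have key {i j : Fin (n + 1)} (h : i ≤ j) : comparison c z i = comparison c z j := by
    have h1 := (isFrame_frame c (mcChain c z)).cocycle (homOfLE h)
    have h2 : pointOf ((mcChain c z).map (homOfLE h)) = vertexGauge c i (mcConv_isMC z.2) *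
        (vertexGauge c j (mcConv_isMC z.2))⁻¹ := by
      have hf := (form_vertexGauge c i (mcConv_isMC z.2)).trans
        (form_vertexGauge c j (mcConv_isMC z.2)).symm
      refine Eq.trans ?_ (pointOf_transition ⟨trivialSec R (ofComm B) A⟩
        ⟨trivialSec R (ofComm B) A⟩ _ _ hf)
      refine congrArg (pointOf (S := ⟨trivialSec R (ofComm B) A⟩) (T := ⟨trivialSec R (ofComm B) A⟩)) ?_
      exact (transition_triv _ _ hf).trans (transition_of_trivialSec _ _ hf).symm
    rw [comparison, comparison, h1, h2, mul_assoc, inv_mul_cancel_left]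
  rcases le_total i j with h | h
  · exact key h
  · exact (key h).symm

/-- A point interpolating between the gauge of a Maurer-Cartan element and the frame of its chain. -/
def interpolation (τ : Fin (n + 1) → Fin 2) (i : Fin (n + 1)) : Gpt R (ofComm B) A (Omega k n) :=
  vertexGauge c i (mcConv_isMC z.2) * scale c (weight _ τ) (weight_mem _ τ) (comparison c z i)

/-- The gauges have the common logarithmic derivative z, and all of them are translated on the right
by the same point. -/
theorem form_interpolation (τ : Fin (n + 1) → Fin 2) (i j : Fin (n + 1)) :
    (interpolation c z τ i).form = (interpolation c z τ j).form := by
  rw [interpolation, interpolation, comparison_eq c z i j]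
  exact Pt.form_mul_congr ((form_vertexGauge c _ _).trans (form_vertexGauge c _ _).symm) _

theorem interpolation_zero {τ : Fin (n + 1) → Fin 2} (hτ : ∀ i, τ i = 0) :
    mcOf (interpolation c z τ 0) = chainMC c (mcChain c z) := by
  have h : weight (tensor A.toCDGA (ofComm (k := k) B)) τ = 1 := by
    rw [weight, Finset.filter_true_of_mem fun i _ => hτ i]; exact sum_bary
  have h2 := scale_one c (SetLike.one_mem_graded _) (comparison c z 0)
  have h3 : interpolation c z τ 0 = frame c (mcChain c z) 0 := by
    rw [interpolation]
    simp only [h]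
    rw [h2, comparison, mul_inv_cancel_left]
  rw [h3]; rfl

theorem interpolation_one {τ : Fin (n + 1) → Fin 2} (hτ : ∀ i, τ i = 1) :
    mcOf (interpolation c z τ 0) = z := by
  have h : weight (tensor A.toCDGA (ofComm (k := k) B)) τ = 0 := by
    rw [weight, Finset.filter_false_of_mem fun i _ => by rw [hτ]; exact one_ne_zero]
    exact Finset.sum_empty
  have h2 := scale_zero c (zero_mem _) (comparison c z 0)
  have h3 : interpolation c z τ 0 = vertexGauge c 0 (mcConv_isMC z.2) := by
    rw [interpolation]
    simp only [h]
    rw [h2, mul_one]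
  exact mcOf_eq (by rw [h3, form_vertexGauge])

theorem interpolation_map (φ : Fin (m + 1) ⥤ Fin (n + 1))
    (z' : DGLie.MC A (Omega k m) (coeffLie (k := k) R B))
    (h : (alg (tmap (DGArt.hom (𝟙 A)) (omegaMap k φ.obj))).toLinearMap.rTensor
      (coeffLie (k := k) R B) z.1 = z'.1) (τ : Fin (n + 1) → Fin 2) :
    (alg (tmap (DGArt.hom (𝟙 A)) (omegaMap k φ.obj))).toLinearMap.rTensor
      (coeffLie (k := k) R B) (mcOf (interpolation c z τ 0)).1 =
      (mcOf (interpolation c z' (fun j => τ (φ.obj j)) 0)).1 := by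
  rw [map_mcOf]
  refine congrArg Subtype.val (mcOf_congr ?_)
  -- The logarithmic derivative does not depend on the vertex, so the vertex 0 is replaced by φ(0),
  -- which corresponds to the vertex 0 of the new simplex.
  rw [form_gmap_congr (form_interpolation c z τ 0 (φ.obj 0))]
  congr 1
  have hg (v) : gmap (𝟙 A) (omegaMap k φ.obj) (vertexGauge c (φ.obj v) (mcConv_isMC z.2)) =
      vertexGauge c v (mcConv_isMC z'.2) :=
    gmap_vertexGauge c (𝟙 A) (omegaMap k φ.obj) (φ.obj v) v
      (omegaRetract_omegaMap _ _ _) _ _ ((mcConv_map (𝟙 A) _ _).symm.trans (congrArg mcConv h))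
  have hk : gmap (𝟙 A) (omegaMap k φ.obj) (comparison c z (φ.obj 0)) = comparison c z' 0 := by
    rw [comparison, comparison, map_mul, map_inv, hg, ← mcChain_extend c φ z z' h, frame_extend]
  rw [interpolation, interpolation, map_mul, hg, ← hk]
  exact congrArg (_ * ·) (map_scale c _ _ _ _ _ (weight_mem _ _) (map_weight _ _ _))

end

/-- The simplicial map assigning to a chain of sections its Maurer-Cartan element. -/
def deformationToMC (A : DGArt k) :
    (deformationFunctor (trivialTorsor R (ofComm (k := k) B))).obj A ⟶
      (DGLie.nerve (coeffLie (k := k) R B) ⋙ SSet.uliftFunctor.{u + 1}).obj A where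
  app X := TypeCat.ofHom fun F => ⟨chainMC c F⟩
  naturality X Y θ := by
    ext F
    exact congrArg ULift.up (Subtype.ext
      (chainMC_extend c F (SimplexCategory.toCat.map θ.unop).toFunctor).symm)

open SSet MonoidalCategory
open scoped Simplicial

/-- The values of a simplex of the interval. -/
def intervalValue {X : SimplexCategoryᵒᵖ} (τ : (Δ[1] : SSet.{u}).obj X) (i : Fin (X.unop.len + 1)) :
    Fin 2 := (stdSimplex.objEquiv τ).toOrderHom i

/-- A homotopy given on simplices. -/
def homotopyOfSimplices {X Y : SSet.{u}} {f g : X ⟶ Y}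
    (h : ∀ n, X.obj n → (Δ[1] : SSet.{u}).obj n → Y.obj n)
    (hn : ∀ {n m} (θ : n ⟶ m) x τ, Y.map θ (h n x τ) = h m (X.map θ x) ((Δ[1] : SSet.{u}).map θ τ))
    (h0 : ∀ n x τ, (∀ i, intervalValue τ i = 0) → h n x τ = f.app n x)
    (h1 : ∀ n x τ, (∀ i, intervalValue τ i = 1) → h n x τ = g.app n x) : SSet.Homotopy f g where
  h :=
    { app := fun n => TypeCat.ofHom fun x => h n x.1 x.2
      naturality := fun n m θ => by
        ext x
        exact (hn θ x.1 x.2).symm }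
  h₀ := by
    refine SSet.hom_ext fun n => ?_
    ext x
    exact h0 _ _ _ fun i => rfl
  h₁ := by
    refine SSet.hom_ext fun n => ?_
    ext x
    exact h1 _ _ _ fun i => rfl
  -- The homotopy is relative to the empty subcomplex, so there is nothing to check.
  rel := by
    refine SSet.hom_ext fun n => ?_
    ext x
    exact x.1.2.elim

/-- Starting from a Maurer-Cartan element, label 0 everywhere gives the frame of its chain and label
1 everywhere gives its gauge; starting from a chain, label 0 everywhere gives the chain of its
Maurer-Cartan element and label 1 everywhere gives the chain itself. Compatibility with simplicial
operators holds because gauges, frames and weights are all natural. -/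
theorem isHomotopyEquivalence_mcToDeformation (A : DGArt k) :
    IsHomotopyEquivalence ((mcToDeformation (B := B) c).app A) := by
  refine ⟨deformationToMC c A, ⟨homotopyOfSimplices
    (fun n z τ => ⟨mcOf (interpolation c z.down (intervalValue τ) 0)⟩) ?_ ?_ ?_⟩,
    ⟨homotopyOfSimplices (fun n F τ => chainHomotopy c F (intervalValue τ)) ?_ ?_ ?_⟩⟩
  · intro n m θ z τ
    exact congrArg ULift.up (Subtype.ext (interpolation_map c z.down
      (SimplexCategory.toCat.map θ.unop).toFunctor _ rfl _))
  · intro n z τ hτ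
    exact congrArg ULift.up (interpolation_zero c z.down hτ)
  · intro n z τ hτ
    exact congrArg ULift.up (interpolation_one c z.down hτ)
  · intro n m θ F τ
    exact chainHomotopy_extend c F (SimplexCategory.toCat.map θ.unop).toFunctor _
  · intro n F τ hτ
    exact chainHomotopy_zero c F hτ
  · intro n F τ hτ
    exact chainHomotopy_one c F hτ

end DG

end

theorem proposition9 {k R B : Type u} [Field k] [CharZero k] [CommRing R] [HopfAlgebra k R]
    [Algebra.FiniteType k R] [CommRing B] [Algebra k B] :
    DG.NaturallyEquivalent
      (DG.deformationFunctor (DG.trivialTorsor R (DG.CDGA.ofComm (k := k) B)))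
      (DG.DGLie.nerve (DG.DGLie.ofLie (k := k) (B ⊗[k] DG.lieAlgebra k R)) ⋙
        SSet.uliftFunctor.{u + 1}) := by
  -- One choice of coordinates at the identity serves all A at once, so a single natural
  -- transformation suffices; it points from the nerve to the deformation functor.
  obtain ⟨c, -⟩ := DG.exists_coords (k := k) (R := R)
  exact Relation.EqvGen.symm _ _ (Relation.EqvGen.rel _ _
    ⟨DG.mcToDeformation c, DG.isHomotopyEquivalence_mcToDeformation c⟩)
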